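/- For arithmetic functions $f,g$ and an integer $n\ge 1$ with canonical factorization $n=p_1^{a_1}\cdots p_s^{a_s}$, the exponential convolution of $f$ and $g$ at $n$ is $$\sum_{b_1c_1=a_1}\cdots\sum_{b_sc_s=a_s} f\left(p_1^{b_1}\cdots p_s^{b_s}\right)g\left(p_1^{c_1}\cdots p_s^{c_s}\right)$$ (its value at $n=1$ is $f(1)g(1)$), and the e-unitary convolution is the same sum restricted to $\gcd(b_i,c_i)=1$ for all $i$. The identity of both convolutions is the indicator function of the squarefree numbers. Let $\mu^{(e)}$ and $\mu^{(e)*}$ be the inverses of the constant function $1$ under the exponential and the e-unitary convolution, respectively; thus $$\mu^{(e)}(n)=\mu(a_1)\cdots\mu(a_s),\qquad \mu^{(e)*}(n)=(-1)^{\omega(a_1)}\cdots(-1)^{\omega(a_s)},\qquad \mu^{(e)}(1)=\mu^{(e)*}(1)=1,$$ where $\mu$ is the Möbius function and $\omega(a)$ is the number of distinct prime factors of $a$. Put $$A_1=\prod_p\left(1+\sum_{n=2}^\infty\frac{\mu(n)-\mu(n-1)}{p^n}\right),\qquad A_2=\prod_p\left(1+\sum_{n=2}^\infty\frac{(-1)^{\omega(n)}-(-1)^{\omega(n-1)}}{p^n}\right),$$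 where $p$ runs over all primes. **Theorem 6.** Assume the Riemann hypothesis. Then the series in the definitions of $A_1$ and $A_2$ converge absolutely, the products converge unconditionally (to the same limit in every order), and for every $\varepsilon>0$, as $x\to\infty$, $$\sum_{n\le x}\mu^{(e)}(n)-A_1x=O_\varepsilon\left(x^{7/22+\varepsilon}\right)\qquad\text{and}\qquad\sum_{n\le x}\mu^{(e)*}(n)-A_2x=O_\varepsilon\left(x^{7/22+\varepsilon}\right).$$ -/

import Mathlib

open Filter Asymptotics

/-- Convolution through the exponents. Given, for every exponent `a`, the set `D a` of admissible
factorizations `a = b * c`, and `n = p₁ ^ a₁ ⋯ pₛ ^ aₛ`, the value at `n` is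
`∑ f (p₁ ^ b₁ ⋯ pₛ ^ bₛ) * g (p₁ ^ c₁ ⋯ pₛ ^ cₛ)` over all choices of `(bᵢ, cᵢ) ∈ D aᵢ`.
At `n = 1` it is `f 1 * g 1`; the value at `n = 0` has no meaning. -/
def exponentConv (D : ℕ → Finset (ℕ × ℕ)) (f g : ℕ → ℤ) (n : ℕ) : ℤ :=
  ∑ u ∈ n.primeFactors.pi (fun p => D (n.factorization p)),
    f (∏ p ∈ n.primeFactors.attach, p.1 ^ (u p.1 p.2).1) *
      g (∏ p ∈ n.primeFactors.attach, p.1 ^ (u p.1 p.2).2)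

/-- The exponential convolution (e-convolution): `bᵢ * cᵢ = aᵢ` for all `i`. -/
def eConv (f g : ℕ → ℤ) (n : ℕ) : ℤ :=
  exponentConv (fun a => a.divisorsAntidiagonal) f g n

/-- The e-unitary convolution: `bᵢ * cᵢ = aᵢ` and `gcd (bᵢ, cᵢ) = 1` for all `i`. -/
def eUnitaryConv (f g : ℕ → ℤ) (n : ℕ) : ℤ :=
  exponentConv (fun a => {c ∈ a.divisorsAntidiagonal | Nat.Coprime c.1 c.2}) f g n

/-- The neutral element of both convolutions: the indicator function `μ²` of the squarefree
numbers. -/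
def eUnit (n : ℕ) : ℤ := if Squarefree n then 1 else 0

/-- The exponential Möbius function: `μ(a₁) ⋯ μ(aₛ)` at `n = p₁ ^ a₁ ⋯ pₛ ^ aₛ`, and `1` at `1`.
That it is the inverse of `n ↦ 1` for the e-convolution is proved in `eConv_one_eq_eUnit_iff`. -/
def expMoebius (n : ℕ) : ℤ :=
  ∏ p ∈ n.primeFactors, ArithmeticFunction.moebius (n.factorization p)

/-- The e-unitary Möbius function: `(-1) ^ ω(a₁) ⋯ (-1) ^ ω(aₛ)` at `n = p₁ ^ a₁ ⋯ pₛ ^ aₛ`, and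
`1` at `1`. That it is the inverse of `n ↦ 1` for the e-unitary convolution is proved in
`eUnitaryConv_one_eq_eUnit_iff`. -/
def eUnitaryMoebius (n : ℕ) : ℤ :=
  ∏ p ∈ n.primeFactors, (-1) ^ ArithmeticFunction.cardDistinctFactors (n.factorization p)

/-- The term with index `n + 2` of the series in the Euler factor of `A₁` at `p`. -/
noncomputable def expMoebiusTerm (p n : ℕ) : ℝ :=
  ((ArithmeticFunction.moebius (n + 2) : ℝ) - (ArithmeticFunction.moebius (n + 1) : ℝ)) /
    (p : ℝ) ^ (n + 2)

/-- The term with index `n + 2` of the series in the Euler factor of `A₂` at `p`. -/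
noncomputable def eUnitaryMoebiusTerm (p n : ℕ) : ℝ :=
  ((-1 : ℝ) ^ ArithmeticFunction.cardDistinctFactors (n + 2) -
    (-1 : ℝ) ^ ArithmeticFunction.cardDistinctFactors (n + 1)) / (p : ℝ) ^ (n + 2)

/-- `A₁ = ∏ₚ (1 + ∑_{n ≥ 2} (μ(n) - μ(n - 1)) / p ^ n)`. -/
noncomputable def expMoebiusMean : ℝ :=
  ∏' p : Nat.Primes, (1 + ∑' n : ℕ, expMoebiusTerm p n)

/-- `A₂ = ∏ₚ (1 + ∑_{n ≥ 2} ((-1) ^ ω(n) - (-1) ^ ω(n - 1)) / p ^ n)`. -/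
noncomputable def eUnitaryMoebiusMean : ℝ :=
  ∏' p : Nat.Primes, (1 + ∑' n : ℕ, eUnitaryMoebiusTerm p n)

/-- `∑_{n ≤ x} μ^{(e)}(n) - A₁ x`. -/
noncomputable def expMoebiusError (x : ℝ) : ℝ :=
  (∑ n ∈ Finset.Icc 1 ⌊x⌋₊, (expMoebius n : ℝ)) - expMoebiusMean * x

/-- `∑_{n ≤ x} μ^{(e)*}(n) - A₂ x`. -/
noncomputable def eUnitaryMoebiusError (x : ℝ) : ℝ :=
  (∑ n ∈ Finset.Icc 1 ⌊x⌋₊, (eUnitaryMoebius n : ℝ)) - eUnitaryMoebiusMean * x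

theorem factorization_prod_primeFactors_attach {n : ℕ} (v : ∀ p, p ∈ n.primeFactors → ℕ)
    (q : ℕ) (hq : q ∈ n.primeFactors) :
    (∏ p ∈ n.primeFactors.attach, p.1 ^ v p.1 p.2).factorization q = v q hq := by
  rw [Nat.factorization_prod_apply
    (fun p _ => pow_ne_zero _ (Nat.prime_of_mem_primeFactors p.2).ne_zero)]
  rw [Finset.sum_eq_single ⟨q, hq⟩]
  · simp [(Nat.prime_of_mem_primeFactors hq).factorization_self]
  · intro p _ hp
    have hne : p.1 ≠ q := fun h => hp (Subtype.ext h)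
    simp [(Nat.prime_of_mem_primeFactors p.2).factorization, hne]
  · simp

theorem primeFactors_prod_primeFactors_attach {n : ℕ} (v : ∀ p, p ∈ n.primeFactors → ℕ)
    (hv : ∀ p hp, v p hp ≠ 0) :
    (∏ p ∈ n.primeFactors.attach, p.1 ^ v p.1 p.2).primeFactors = n.primeFactors := by
  ext q
  constructor
  · intro hq
    have hqp := Nat.prime_of_mem_primeFactors hq
    obtain ⟨p, -, hp⟩ := (hqp.prime.dvd_finsetProd_iff _).1 (Nat.dvd_of_mem_primeFactors hq)
    have h := (Nat.prime_dvd_prime_iff_eq hqp (Nat.prime_of_mem_primeFactors p.2)).1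
      (hqp.dvd_of_dvd_pow hp)
    rw [h]; exact p.2
  · intro hq
    rw [← Nat.support_factorization, Finsupp.mem_support_iff,
      factorization_prod_primeFactors_attach v q hq]
    exact hv q hq

theorem prod_primeFactors_attach_self {n : ℕ} (hn : n ≠ 0) :
    ∏ p ∈ n.primeFactors.attach, p.1 ^ n.factorization p.1 = n := by
  rw [Finset.prod_attach n.primeFactors (fun p => p ^ n.factorization p)]
  exact Nat.prod_factorization_pow_eq_self hn

theorem exponentConv_prod_one (D : ℕ → Finset (ℕ × ℕ)) (m : ℕ → ℤ)
    (hD : ∀ a, D a ⊆ a.divisorsAntidiagonal)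
    (hm : ∀ a, a ≠ 0 → ∑ c ∈ D a, m c.1 = if a = 1 then 1 else 0) (n : ℕ) (hn : n ≠ 0) :
    exponentConv D (fun k => ∏ p ∈ k.primeFactors, m (k.factorization p)) (fun _ => 1) n
      = eUnit n := by
  have hne : ∀ u ∈ n.primeFactors.pi (fun p => D (n.factorization p)),
      ∀ p hp, (u p hp).1 ≠ 0 := by
    intro u hu p hp h0
    have h1 := hD _ (Finset.mem_pi.1 hu p hp)
    rw [Nat.mem_divisorsAntidiagonal, h0] at h1
    exact h1.2 (by simpa using h1.1.symm)
  have h : exponentConv D (fun k => ∏ p ∈ k.primeFactors, m (k.factorization p)) (fun _ => 1) n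
      = ∑ u ∈ n.primeFactors.pi (fun p => D (n.factorization p)),
          ∏ p ∈ n.primeFactors.attach, m (u p.1 p.2).1 := by
    unfold exponentConv
    refine Finset.sum_congr rfl fun u hu => ?_
    simp only [mul_one]
    rw [primeFactors_prod_primeFactors_attach (fun p hp => (u p hp).1) (hne u hu),
      ← Finset.prod_attach]
    refine Finset.prod_congr rfl fun p _ => ?_
    rw [factorization_prod_primeFactors_attach (fun p hp => (u p hp).1) p.1 p.2]
  rw [h, ← Finset.prod_sum n.primeFactors (fun p => D (n.factorization p))
    (fun _ c => m c.1)]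
  have h2 : ∀ p ∈ n.primeFactors, ∑ c ∈ D (n.factorization p), m c.1 =
      if n.factorization p = 1 then 1 else 0 := by
    intro p hp
    apply hm
    rwa [← Nat.support_factorization, Finsupp.mem_support_iff] at hp
  rw [Finset.prod_congr rfl h2, eUnit]
  split_ifs with hs
  · refine Finset.prod_eq_one fun p hp => if_pos ?_
    have h3 := hs.natFactorization_le_one p
    rw [← Nat.support_factorization, Finsupp.mem_support_iff] at hp
    omega
  · rw [Nat.squarefree_iff_factorization_le_one hn] at hs
    push Not at hs
    obtain ⟨p, hp⟩ := hs
    refine Finset.prod_eq_zero (i := p) ?_ (if_neg (by omega))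
    rw [← Nat.support_factorization, Finsupp.mem_support_iff]
    omega

theorem exponentConv_one_injective (D : ℕ → Finset (ℕ × ℕ))
    (hD : ∀ a, D a ⊆ a.divisorsAntidiagonal) (hD1 : ∀ a, a ≠ 0 → (a, 1) ∈ D a)
    (f g : ℕ → ℤ)
    (h : ∀ n, n ≠ 0 → exponentConv D f (fun _ => 1) n = exponentConv D g (fun _ => 1) n)
    (n : ℕ) (hn : n ≠ 0) : f n = g n := by
  induction n using Nat.strong_induction_on with
  | _ n ih =>
    have hmem : (fun p (_ : p ∈ n.primeFactors) => (n.factorization p, 1)) ∈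
        n.primeFactors.pi (fun p => D (n.factorization p)) := by
      rw [Finset.mem_pi]
      intro p hp
      apply hD1
      rwa [← Nat.support_factorization, Finsupp.mem_support_iff] at hp
    have h1 := h n hn
    unfold exponentConv at h1
    simp only [mul_one] at h1
    rw [← Finset.add_sum_erase _ _ hmem, ← Finset.add_sum_erase _ _ hmem] at h1
    simp only [prod_primeFactors_attach_self hn] at h1
    have h2 : ∀ u ∈ (n.primeFactors.pi (fun p => D (n.factorization p))).erase
        (fun p (_ : p ∈ n.primeFactors) => (n.factorization p, 1)),
        f (∏ p ∈ n.primeFactors.attach, p.1 ^ (u p.1 p.2).1) =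
          g (∏ p ∈ n.primeFactors.attach, p.1 ^ (u p.1 p.2).1) := by
      intro u hu
      rw [Finset.mem_erase] at hu
      have hu2 : ∀ p hp, (u p hp).1 * (u p hp).2 = n.factorization p ∧ n.factorization p ≠ 0 :=
        fun p hp => Nat.mem_divisorsAntidiagonal.1 (hD _ (Finset.mem_pi.1 hu.2 p hp))
      have hd0 : ∏ p ∈ n.primeFactors.attach, p.1 ^ (u p.1 p.2).1 ≠ 0 :=
        Finset.prod_ne_zero_iff.2
          fun p _ => pow_ne_zero _ (Nat.prime_of_mem_primeFactors p.2).ne_zero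
      refine ih _ (lt_of_le_of_ne ?_ ?_) hd0
      · refine Nat.le_of_dvd (Nat.pos_of_ne_zero hn) ?_
        conv_rhs => rw [← prod_primeFactors_attach_self hn]
        refine Finset.prod_dvd_prod_of_dvd _ _ fun p _ => pow_dvd_pow _ ?_
        exact Nat.le_of_dvd (Nat.pos_of_ne_zero (hu2 p.1 p.2).2)
          (Dvd.intro _ (hu2 p.1 p.2).1)
      · intro he
        apply hu.1
        funext p hp
        have h3 := factorization_prod_primeFactors_attach (fun p hp => (u p hp).1) p hp
        rw [he] at h3
        have h4 := hu2 p hp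
        refine Prod.ext h3.symm ?_
        have h5 : (u p hp).1 * (u p hp).2 = (u p hp).1 * 1 := by
          rw [h4.1, mul_one, h3]
        exact Nat.eq_of_mul_eq_mul_left (Nat.pos_of_ne_zero (h3 ▸ h4.2)) h5
    rw [Finset.sum_congr rfl h2] at h1
    exact add_right_cancel h1

theorem sum_moebius_divisorsAntidiagonal_fst (a : ℕ) (_ha : a ≠ 0) :
    ∑ c ∈ a.divisorsAntidiagonal, ArithmeticFunction.moebius c.1 = if a = 1 then 1 else 0 := by
  have h := congrArg (fun F : ArithmeticFunction ℤ => F a)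
    ArithmeticFunction.moebius_mul_coe_zeta
  simp only [ArithmeticFunction.mul_apply, ArithmeticFunction.one_apply] at h
  rw [← h]
  refine Finset.sum_congr rfl fun c hc => ?_
  have hc2 : c.2 ≠ 0 := by
    rw [Nat.mem_divisorsAntidiagonal] at hc
    intro h0
    exact hc.2 (by rw [← hc.1, h0, mul_zero])
  simp [hc2]

theorem sum_neg_one_pow_coprime_fst (a : ℕ) (ha : a ≠ 0) :
    ∑ c ∈ a.divisorsAntidiagonal with Nat.Coprime c.1 c.2,
      (-1 : ℤ) ^ ArithmeticFunction.cardDistinctFactors c.1 = if a = 1 then 1 else 0 := by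
  have key : ∑ c ∈ a.divisorsAntidiagonal with Nat.Coprime c.1 c.2,
      (-1 : ℤ) ^ ArithmeticFunction.cardDistinctFactors c.1 =
      ∑ S ∈ a.primeFactors.powerset, (-1 : ℤ) ^ S.card := by
    refine Finset.sum_bij (fun c _ => c.1.primeFactors) ?_ ?_ ?_ ?_
    · intro c hc
      rw [Finset.mem_filter, Nat.mem_divisorsAntidiagonal] at hc
      rw [Finset.mem_powerset]
      exact Nat.primeFactors_mono (Dvd.intro _ hc.1.1) ha
    · intro c hc d hd hcd
      rw [Finset.mem_filter, Nat.mem_divisorsAntidiagonal] at hc hd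
      have aux : ∀ e : ℕ × ℕ, (e.1 * e.2 = a ∧ a ≠ 0) ∧ Nat.Coprime e.1 e.2 →
          e.1 = ∏ p ∈ e.1.primeFactors, p ^ a.factorization p := by
        intro e he
        have he1 : e.1 ≠ 0 := fun h => ha (by rw [← he.1.1, h, zero_mul])
        conv_lhs => rw [← Nat.prod_factorization_pow_eq_self he1]
        refine Finset.prod_congr rfl fun p hp => ?_
        rw [← he.1.1, Nat.factorization_eq_of_coprime_left he.2]
        simpa using hp
      have h1 : c.1 = d.1 := by
        rw [aux c hc, aux d hd]
        exact congrArg (fun T : Finset ℕ => ∏ p ∈ T, p ^ a.factorization p) hcd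
      have hc1 : 0 < c.1 := Nat.pos_of_ne_zero fun h => ha (by rw [← hc.1.1, h, zero_mul])
      refine Prod.ext h1 (Nat.eq_of_mul_eq_mul_left hc1 ?_)
      rw [hc.1.1, h1, hd.1.1]
    · intro S hS
      rw [Finset.mem_powerset] at hS
      have hprime : ∀ p ∈ a.primeFactors, p.Prime := fun p hp => Nat.prime_of_mem_primeFactors hp
      refine ⟨(∏ p ∈ S, p ^ a.factorization p,
        ∏ p ∈ a.primeFactors \ S, p ^ a.factorization p), ?_, ?_⟩
      · rw [Finset.mem_filter, Nat.mem_divisorsAntidiagonal]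
        refine ⟨⟨?_, ha⟩, ?_⟩
        · simp only
          rw [mul_comm, Finset.prod_sdiff hS]
          exact Nat.prod_factorization_pow_eq_self ha
        · refine Nat.Coprime.prod_left fun p hp => Nat.Coprime.prod_right fun q hq => ?_
          rw [Finset.mem_sdiff] at hq
          refine Nat.Coprime.pow _ _ ((Nat.coprime_primes (hprime p (hS hp)) (hprime q hq.1)).2 ?_)
          rintro rfl
          exact hq.2 hp
      · ext q
        simp only
        constructor
        · intro hq
          have hqp := Nat.prime_of_mem_primeFactors hq
          obtain ⟨p, hp, hqd⟩ :=
            (hqp.prime.dvd_finsetProd_iff _).1 (Nat.dvd_of_mem_primeFactors hq)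
          rw [(Nat.prime_dvd_prime_iff_eq hqp (hprime p (hS hp))).1 (hqp.dvd_of_dvd_pow hqd)]
          exact hp
        · intro hq
          have h0 := hS hq
          have hqa : a.factorization q ≠ 0 := by
            rwa [← Nat.support_factorization, Finsupp.mem_support_iff] at h0
          rw [Nat.mem_primeFactors]
          refine ⟨hprime q h0, (dvd_pow_self q hqa).trans
            (Finset.dvd_prod_of_mem (fun p => p ^ a.factorization p) hq), ?_⟩
          exact Finset.prod_ne_zero_iff.2 fun p hp => pow_ne_zero _ (hprime p (hS hp)).ne_zero
    · intro c _
      rfl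
  rw [key, Finset.sum_powerset_neg_one_pow_card]
  refine if_congr ?_ rfl rfl
  rw [Nat.primeFactors_eq_empty]
  omega

/-- The exponential Möbius function is the inverse of `n ↦ 1` for the e-convolution, and the
only one. -/
theorem eConv_one_eq_eUnit_iff (f : ℕ → ℤ) :
    (∀ n, n ≠ 0 → eConv f (fun _ => 1) n = eUnit n) ↔ ∀ n, n ≠ 0 → f n = expMoebius n := by
  have hinv := exponentConv_prod_one (fun a => a.divisorsAntidiagonal)
    (fun a => ArithmeticFunction.moebius a) (fun _ => subset_rfl)
    sum_moebius_divisorsAntidiagonal_fst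
  constructor
  · intro h
    exact exponentConv_one_injective (fun a => a.divisorsAntidiagonal) (fun _ => subset_rfl)
      (by simp) f expMoebius (fun n hn => (h n hn).trans (hinv n hn).symm)
  · intro h n hn
    rw [← hinv n hn]
    refine Finset.sum_congr rfl fun u _ => ?_
    rw [h]
    · rfl
    · exact Finset.prod_ne_zero_iff.2
        fun p _ => pow_ne_zero _ (Nat.prime_of_mem_primeFactors p.2).ne_zero

/-- The e-unitary Möbius function is the inverse of `n ↦ 1` for the e-unitary convolution, and
the only one. -/
theorem eUnitaryConv_one_eq_eUnit_iff (f : ℕ → ℤ) :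
    (∀ n, n ≠ 0 → eUnitaryConv f (fun _ => 1) n = eUnit n) ↔
      ∀ n, n ≠ 0 → f n = eUnitaryMoebius n := by
  have hinv := exponentConv_prod_one
    (fun a => {c ∈ a.divisorsAntidiagonal | Nat.Coprime c.1 c.2})
    (fun a => (-1) ^ ArithmeticFunction.cardDistinctFactors a)
    (fun _ => Finset.filter_subset _ _) sum_neg_one_pow_coprime_fst
  constructor
  · intro h
    exact exponentConv_one_injective
      (fun a => {c ∈ a.divisorsAntidiagonal | Nat.Coprime c.1 c.2})
      (fun _ => Finset.filter_subset _ _) (by simp) f eUnitaryMoebius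
      (fun n hn => (h n hn).trans (hinv n hn).symm)
  · intro h n hn
    rw [← hinv n hn]
    refine Finset.sum_congr rfl fun u _ => ?_
    rw [h]
    · rfl
    · exact Finset.prod_ne_zero_iff.2
        fun p _ => pow_ne_zero _ (Nat.prime_of_mem_primeFactors p.2).ne_zero

/-! ### Arithmetic functions of size `n ^ o(1)` -/

/-! Both functions are multiplicative with value v(k) at p^k, where v(1) = 1, v(2) = v(3) = -1 and
|v| ≤ 1; nothing else about μ or ω matters. If φ = 1 + ∑ v(k) X^k is the Euler factor in X = p^{-s},
then φ (1 - X) = (1 - X^2)^2 γ with γ = 1 + O(X^4) (`exists_eq_one_sub_X_sq_mul`). The Dirichlet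
series is therefore ζ(s) ζ(2s)^{-2} G(s) with G absolutely convergent for Re s > 1/4. As 1/4 < 7/22,
convolution with the coefficients of G only costs a constant
(`RiemannHypothesis.exists_abs_sum_ofEulerFactor_sub_le`), and everything reduces to ∑_d (μ*μ)(d)
⌊x/d^2⌋ = A x + O(x^{7/22+ε}), which is `RiemannHypothesis.exists_abs_sum_floor_sub_le`. The sum of
(μ*μ)(d) (⌊x/d^2⌋ - x/d^2) is cut at d ≈ y = x^{8/22} by piecewise linear weights.

Large d rest on the Riemann hypothesis. On Re s ≥ 1/2 + δ the function 1/ζ grows more slowly than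
any power of |t|, and so does ζ for Re s ≤ 3/4: this is the classical argument with log ζ, the
Borel-Carathéodory inequality and the three circles theorem. A shift of contour then bounds the
weighted tail of ∑ (μ*μ)(d) d^{-2s} on Re s = 1/2 + η by y^{-1/2+η} |t|^ε, and integration against
x^s ζ(s)/s yields x^{1/2} y^{-1/2} = x^{7/22} up to x^ε. Absolute convergence is obtained by
averaging over [x, x + h] with h = x^{7/22}; undoing the average costs O(h x^ε)
(`RiemannHypothesis.exists_abs_tsum_tail_le`).

For small d, write ⌊t⌋ - t = -({t} - 1/2) - 1/2. The constant -1/2 is again treated by a contour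
shift. The sawtooth is treated unconditionally (`exists_abs_sum_sawtooth_le`): put u = x^{1/22}; the
d up to a multiple of u^7 are estimated trivially, and on a dyadic block d ≈ D with u^7 ≤ D ≤ u^8
the sawtooth is replaced by Fourier polynomials with about (D/u^7)^2 frequencies. It remains to
bound ∑ (μ*μ)(d) e(hx/d^2), on average over h ≈ H, by u^7 x^ε
(`exists_norm_dyadicSum_moebiusSq_le`). A Vaughan identity with cut U ≈ D^{1/4} leaves two kinds of
sums. When one variable is at most U and the other carries no weight, the second derivative test
suffices. When both variables exceed U, Cauchy's inequality is applied after a partition of the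
points h/n^2 into short classes; the sum over m is bounded by the second derivative test, and the
pairs of close points h/n^2 are counted by `card_close_points_le`. -/

theorem exists_succ_le_mul_two_rpow {ε : ℝ} (hε : 0 < ε) :
    ∃ K : ℝ, 1 ≤ K ∧ ∀ a : ℕ, (a + 1 : ℝ) ≤ K * (2 : ℝ) ^ (a * ε : ℝ) := by
  have hl : 0 < Real.log 2 := Real.log_pos (by norm_num)
  refine ⟨1 + 1 / (ε * Real.log 2), by have := div_pos one_pos (mul_pos hε hl); linarith, fun a => ?_⟩
  have h1 : 1 + a * ε * Real.log 2 ≤ (2 : ℝ) ^ (a * ε : ℝ) := by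
    rw [Real.rpow_def_of_pos (by norm_num)]
    have := Real.add_one_le_exp (Real.log 2 * (a * ε))
    linarith
  have h2 : 0 < 1 / (ε * Real.log 2) := div_pos one_pos (mul_pos hε hl)
  have h3 : 1 / (ε * Real.log 2) * (a * ε * Real.log 2) = a := by field_simp
  have ha : (0 : ℝ) ≤ a * ε * Real.log 2 := by positivity
  nlinarith

/-- The divisor bound `d(n) ≪ n ^ ε`. -/
theorem exists_card_divisors_le_rpow {ε : ℝ} (hε : 0 < ε) :
    ∃ C : ℝ, 1 ≤ C ∧ ∀ n : ℕ, (n.divisors.card : ℝ) ≤ C * (n : ℝ) ^ ε := by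
  obtain ⟨K, hK1, hK⟩ := exists_succ_le_mul_two_rpow hε
  -- A prime p ≥ P has p^ε ≥ 2, so its factor a + 1 ≤ 2^a is already at most p^{aε}. Only the primes
  -- below P cost the constant K, and there are at most P of them.
  set P : ℕ := ⌈(2 : ℝ) ^ (1 / ε)⌉₊ with hP
  refine ⟨K ^ P, one_le_pow₀ hK1, fun n => ?_⟩
  rcases eq_or_ne n 0 with rfl | hn
  · simp [Real.zero_rpow hε.ne']
  have hprod : (n : ℝ) ^ ε = ∏ p ∈ n.primeFactors, ((p : ℝ) ^ (n.factorization p : ℕ)) ^ ε := by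
    rw [Real.finsetProd_rpow _ _ (fun p _ => by positivity)]
    congr 1
    conv_lhs => rw [← Nat.prod_factorization_pow_eq_self hn]
    rw [Finsupp.prod]
    push_cast
    rfl
  rw [Nat.card_divisors hn, hprod]
  push_cast
  calc ∏ p ∈ n.primeFactors, ((n.factorization p : ℝ) + 1)
      ≤ ∏ p ∈ n.primeFactors, ((if p < P then K else 1) * ((p : ℝ) ^ (n.factorization p : ℕ)) ^ ε) := by
        refine Finset.prod_le_prod (fun p _ => by positivity) fun p hp => ?_
        have hp2 : (2 : ℝ) ≤ p := by exact_mod_cast (Nat.prime_of_mem_primeFactors hp).two_le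
        have e1 : ((p : ℝ) ^ (n.factorization p : ℕ)) ^ ε = (p : ℝ) ^ ((n.factorization p : ℝ) * ε) := by
          rw [← Real.rpow_natCast, ← Real.rpow_mul (by positivity)]
        rw [e1]
        split_ifs with h
        · refine (hK _).trans ?_
          gcongr
        · rw [one_mul]
          have h2 : (2 : ℝ) ≤ (p : ℝ) ^ ε := by
            have : (2 : ℝ) ^ (1 / ε) ≤ p := (Nat.le_ceil _).trans (by exact_mod_cast not_lt.1 h)
            calc (2 : ℝ) = ((2 : ℝ) ^ (1 / ε)) ^ ε := by
                  rw [← Real.rpow_mul (by norm_num), one_div_mul_cancel hε.ne', Real.rpow_one]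
              _ ≤ _ := by gcongr
          have h3 : ((n.factorization p : ℝ) + 1) ≤ (2 : ℝ) ^ (n.factorization p) := by
            exact_mod_cast Nat.lt_two_pow_self
          refine h3.trans ?_
          rw [mul_comm, Real.rpow_mul (by positivity), Real.rpow_natCast]
          gcongr
    _ = (∏ p ∈ n.primeFactors, (if p < P then K else 1)) *
          ∏ p ∈ n.primeFactors, ((p : ℝ) ^ (n.factorization p : ℕ)) ^ ε := Finset.prod_mul_distrib
    _ ≤ _ := by
        refine mul_le_mul_of_nonneg_right ?_ (Finset.prod_nonneg fun p _ => by positivity)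
        rw [← Finset.prod_filter, Finset.prod_const]
        refine pow_le_pow_right₀ hK1 ?_
        calc _ ≤ (Finset.range P).card := Finset.card_le_card fun p hp => by
              simp only [Finset.mem_filter] at hp; simpa using hp.2
          _ = P := Finset.card_range P

/-- `f n ≪ n ^ ε` for every `ε > 0`. -/
def IsSubPoly (f : ArithmeticFunction ℝ) : Prop :=
  ∀ ε : ℝ, 0 < ε → ∃ C : ℝ, 1 ≤ C ∧ ∀ n : ℕ, |f n| ≤ C * (n : ℝ) ^ ε

theorem IsSubPoly.mul {f g : ArithmeticFunction ℝ} (hf : IsSubPoly f) (hg : IsSubPoly g) :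
    IsSubPoly (f * g) := by
  intro ε hε
  obtain ⟨C₁, h₁, H₁⟩ := hf (ε / 2) (by positivity)
  obtain ⟨C₂, h₂, H₂⟩ := hg (ε / 2) (by positivity)
  obtain ⟨C₃, h₃, H₃⟩ := exists_card_divisors_le_rpow (half_pos hε)
  refine ⟨C₁ * C₂ * C₃, one_le_mul_of_one_le_of_one_le (one_le_mul_of_one_le_of_one_le h₁ h₂) h₃,
    fun n => ?_⟩
  rw [ArithmeticFunction.mul_apply]
  calc |∑ p ∈ n.divisorsAntidiagonal, f p.1 * g p.2|
      ≤ ∑ p ∈ n.divisorsAntidiagonal, |f p.1 * g p.2| := Finset.abs_sum_le_sum_abs _ _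
    _ ≤ ∑ p ∈ n.divisorsAntidiagonal, C₁ * C₂ * (n : ℝ) ^ (ε / 2) := by
        refine Finset.sum_le_sum fun p hp => ?_
        rw [abs_mul]
        have h := (Nat.mem_divisorsAntidiagonal.1 hp).1
        calc |f p.1| * |g p.2| ≤ (C₁ * (p.1 : ℝ) ^ (ε / 2)) * (C₂ * (p.2 : ℝ) ^ (ε / 2)) := by
              gcongr
              · exact H₁ _
              · exact H₂ _
          _ = C₁ * C₂ * (n : ℝ) ^ (ε / 2) := by
              rw [← h]; push_cast
              rw [Real.mul_rpow (by positivity) (by positivity)]; ring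
    _ = (n.divisors.card : ℝ) * (C₁ * C₂ * (n : ℝ) ^ (ε / 2)) := by
        rw [Finset.sum_const, nsmul_eq_mul, ← Nat.map_div_right_divisors, Finset.card_map]
    _ ≤ (C₃ * (n : ℝ) ^ (ε / 2)) * (C₁ * C₂ * (n : ℝ) ^ (ε / 2)) := by
        gcongr
        exact H₃ n
    _ = C₁ * C₂ * C₃ * (n : ℝ) ^ ε := by
        have : (n : ℝ) ^ ε = (n : ℝ) ^ (ε / 2) * (n : ℝ) ^ (ε / 2) := by
          rcases eq_or_ne n 0 with rfl | hn
          · simp [Real.zero_rpow hε.ne', Real.zero_rpow (half_pos hε).ne']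
          · rw [← Real.rpow_add (by positivity)]; ring_nf
        rw [this]; ring

theorem isSubPoly_zeta : IsSubPoly ((ArithmeticFunction.zeta : ArithmeticFunction ℕ) : ArithmeticFunction ℝ) := by
  intro ε hε
  refine ⟨1, le_rfl, fun n => ?_⟩
  rcases eq_or_ne n 0 with rfl | hn
  · simp [Real.zero_rpow hε.ne']
  · have : (1 : ℝ) ≤ (n : ℝ) ^ ε :=
      Real.one_le_rpow (by exact_mod_cast Nat.one_le_iff_ne_zero.2 hn) hε.le
    simpa [ArithmeticFunction.natCoe_apply, hn] using this

/-- The generalized divisor function `d_k`, as a real arithmetic function. -/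
noncomputable def divisorK (k : ℕ) : ArithmeticFunction ℝ :=
  ((ArithmeticFunction.zeta : ArithmeticFunction ℕ) : ArithmeticFunction ℝ) ^ k

theorem isSubPoly_divisorK (k : ℕ) : IsSubPoly (divisorK k) := by
  induction k with
  | zero =>
    intro ε hε
    refine ⟨1, le_rfl, fun n => ?_⟩
    rw [divisorK, pow_zero, ArithmeticFunction.one_apply]
    split_ifs with h
    · simp [h]
    · simp only [abs_zero]; positivity
  | succ k ih =>
    rw [divisorK, pow_succ]
    exact IsSubPoly.mul ih isSubPoly_zeta

/-- Pointwise domination of a complex arithmetic function by a real one. -/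
def DominatedBy (f : ArithmeticFunction ℂ) (F : ArithmeticFunction ℝ) : Prop :=
  ∀ n, ‖f n‖ ≤ F n

theorem DominatedBy.mul {f g : ArithmeticFunction ℂ} {F G : ArithmeticFunction ℝ}
    (hf : DominatedBy f F) (hg : DominatedBy g G) : DominatedBy (f * g) (F * G) := by
  intro n
  rw [ArithmeticFunction.mul_apply, ArithmeticFunction.mul_apply]
  refine (norm_sum_le _ _).trans (Finset.sum_le_sum fun p _ => ?_)
  rw [norm_mul]
  exact mul_le_mul (hf _) (hg _) (norm_nonneg _) ((norm_nonneg _).trans (hf _))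

theorem divisorK_add (j k : ℕ) : divisorK (j + k) = divisorK j * divisorK k := pow_add _ _ _

theorem divisorK_nonneg (k n : ℕ) : 0 ≤ divisorK k n := by
  induction k generalizing n with
  | zero => rw [divisorK, pow_zero, ArithmeticFunction.one_apply]; split_ifs <;> norm_num
  | succ k ih =>
    rw [divisorK, pow_succ, ArithmeticFunction.mul_apply]
    refine Finset.sum_nonneg fun p _ => mul_nonneg (ih _) ?_
    rw [ArithmeticFunction.natCoe_apply]; positivity

theorem divisorK_one_apply {n : ℕ} (hn : n ≠ 0) : divisorK 1 n = 1 := by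
  rw [divisorK, pow_one, ArithmeticFunction.natCoe_apply, ArithmeticFunction.zeta_apply_ne hn]
  simp

theorem divisorK_mono {j k : ℕ} (h : j ≤ k) (n : ℕ) : divisorK j n ≤ divisorK k n := by
  induction k, h using Nat.le_induction with
  | base => exact le_rfl
  | succ k hk ih =>
    refine ih.trans ?_
    rcases eq_or_ne n 0 with rfl | hn
    · simp
    rw [divisorK_add, ArithmeticFunction.mul_apply]
    have hmem : (n, 1) ∈ n.divisorsAntidiagonal := by simp [hn]
    have := Finset.single_le_sum (f := fun p : ℕ × ℕ => divisorK k p.1 * divisorK 1 p.2)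
      (fun p _ => mul_nonneg (divisorK_nonneg _ _) (divisorK_nonneg _ _)) hmem
    simpa [divisorK_one_apply] using this

/-! ### The second derivative test of van der Corput -/

/-- `e(t) = exp (2 π i t)`. -/
noncomputable def expTwoPi (t : ℝ) : ℂ := Complex.exp (2 * Real.pi * t * Complex.I)

theorem expTwoPi_add (s t : ℝ) : expTwoPi (s + t) = expTwoPi s * expTwoPi t := by
  rw [expTwoPi, expTwoPi, expTwoPi, ← Complex.exp_add]; push_cast; ring_nf

theorem norm_expTwoPi (t : ℝ) : ‖expTwoPi t‖ = 1 := by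
  have : (2 * Real.pi * t * Complex.I : ℂ) = ((2 * Real.pi * t : ℝ) : ℂ) * Complex.I := by push_cast; ring
  rw [expTwoPi, this, Complex.norm_exp_ofReal_mul_I]

theorem expTwoPi_int (n : ℤ) : expTwoPi n = 1 := by
  rw [expTwoPi, Complex.exp_eq_one_iff]
  exact ⟨n, by push_cast; ring⟩

theorem expTwoPi_add_int (t : ℝ) (n : ℤ) : expTwoPi (t + n) = expTwoPi t := by
  rw [expTwoPi_add, expTwoPi_int, mul_one]

theorem conj_expTwoPi (t : ℝ) : (starRingEnd ℂ) (expTwoPi t) = expTwoPi (-t) := by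
  rw [expTwoPi, expTwoPi, ← Complex.exp_conj]
  congr 1
  simp [Complex.conj_ofReal, map_ofNat]

/-- `1 / (e(t) - 1) = (-1 - i cot (π t)) / 2`. -/
theorem inv_expTwoPi_sub_one {t : ℝ} (h0 : 0 < t) (h1 : t < 1) :
    (expTwoPi t - 1)⁻¹ = (-1 - Complex.I * ((Real.cos (Real.pi * t) / Real.sin (Real.pi * t) : ℝ) : ℂ)) / 2 := by
  have hs : Real.sin (Real.pi * t) ≠ 0 :=
    (Real.sin_pos_of_pos_of_lt_pi (by positivity) (by nlinarith [Real.pi_pos])).ne'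
  have he : expTwoPi t = ((Real.cos (Real.pi * t) : ℂ) + Real.sin (Real.pi * t) * Complex.I) ^ 2 := by
    rw [Complex.ofReal_cos, Complex.ofReal_sin, Complex.cos_add_sin_I, ← Complex.exp_nat_mul, expTwoPi]
    push_cast; ring_nf
  have hcs : (Real.sin (Real.pi * t) : ℂ) ^ 2 = 1 - (Real.cos (Real.pi * t) : ℂ) ^ 2 := by
    have := Real.sin_sq (Real.pi * t)
    exact_mod_cast this
  have hsC : (Real.sin (Real.pi * t) : ℂ) ≠ 0 := by exact_mod_cast hs
  apply inv_eq_of_mul_eq_one_right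
  rw [he]
  push_cast
  push_cast at hsC hcs
  set c := Complex.cos (Real.pi * t)
  set s := Complex.sin (Real.pi * t)
  field_simp
  linear_combination (s - c * Complex.I) * hcs + (-2 * c ^ 2 * s - c * s ^ 2 * Complex.I - s ^ 3) * Complex.I_sq

theorem cot_pi_antitone {s t : ℝ} (h0 : 0 < s) (hst : s ≤ t) (h1 : t < 1) :
    Real.cos (Real.pi * t) / Real.sin (Real.pi * t) ≤ Real.cos (Real.pi * s) / Real.sin (Real.pi * s) := by
  have hp := Real.pi_pos
  have hs : 0 < Real.sin (Real.pi * s) :=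
    Real.sin_pos_of_pos_of_lt_pi (by positivity) (by nlinarith)
  have ht : 0 < Real.sin (Real.pi * t) :=
    Real.sin_pos_of_pos_of_lt_pi (by nlinarith) (by nlinarith)
  rw [div_le_div_iff₀ ht hs]
  have : 0 ≤ Real.sin (Real.pi * t - Real.pi * s) :=
    Real.sin_nonneg_of_nonneg_of_le_pi (by nlinarith) (by nlinarith)
  rw [Real.sin_sub] at this
  linarith

theorem abs_cot_pi_le {t θ : ℝ} (hθ : 0 < θ) (h0 : θ ≤ t) (h1 : t ≤ 1 - θ) :
    |Real.cos (Real.pi * t) / Real.sin (Real.pi * t)| ≤ 1 / θ := by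
  have hp := Real.pi_pos
  have hs : 2 * θ ≤ Real.sin (Real.pi * t) := by
    rcases le_total t (1 / 2) with h | h
    · have := Real.mul_le_sin (x := Real.pi * t) (by nlinarith) (by nlinarith)
      have e : 2 / Real.pi * (Real.pi * t) = 2 * t := by field_simp
      linarith
    · have := Real.mul_le_sin (x := Real.pi * (1 - t)) (by nlinarith) (by nlinarith)
      have e : 2 / Real.pi * (Real.pi * (1 - t)) = 2 * (1 - t) := by field_simp
      have e2 : Real.sin (Real.pi * (1 - t)) = Real.sin (Real.pi * t) := by
        rw [mul_sub, mul_one, Real.sin_pi_sub]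
      linarith
  have hs0 : 0 < Real.sin (Real.pi * t) := by linarith
  rw [abs_div, abs_of_pos hs0, div_le_div_iff₀ hs0 hθ]
  have := Real.abs_cos_le_one (Real.pi * t)
  nlinarith

/-- The Kusmin-Landau inequality, for sequences with monotone differences in `[k + θ, k + 1 - θ]`. -/
theorem norm_sum_expTwoPi_le_of_monotone_sub {f : ℕ → ℝ} {a b : ℕ} {k : ℤ} {θ : ℝ} (hθ : 0 < θ)
    (hmono : ∀ n ∈ Finset.Ico a b, n + 1 < b → f (n + 1) - f n ≤ f (n + 2) - f (n + 1))
    (hg : ∀ n ∈ Finset.Ico a b, k + θ ≤ f (n + 1) - f n ∧ f (n + 1) - f n ≤ k + 1 - θ) :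
    ‖∑ n ∈ Finset.Ico a b, expTwoPi (f n)‖ ≤ 6 / θ := by
  rcases le_or_gt b a with hab | hab
  · rw [Finset.Ico_eq_empty (by omega)]; simp; positivity
  set c : ℕ → ℝ := fun n => Real.cos (Real.pi * (f (n + 1) - f n - k)) / Real.sin (Real.pi * (f (n + 1) - f n - k)) with hc
  -- With r n = 1/(e(g) - 1), g the n-th difference of f, each term is r n times a difference of
  -- consecutive exponentials. Partial summation then leaves the total variation of r; its real part
  -- is constant and `c` is monotone, so the variation telescopes to half a difference of values of
  -- `c`.
  set r : ℕ → ℂ := fun n => (-1 - Complex.I * (c n : ℂ)) / 2 with hr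
  have hθ1 : θ ≤ 1 / 2 := by have := hg a (by simp [hab]); linarith [this.1.trans this.2]
  have hterm : ∀ n ∈ Finset.Ico a b, expTwoPi (f n) = r n * (expTwoPi (f (n + 1)) - expTwoPi (f n)) := by
    intro n hn
    have h1 := hg n hn
    have e1 : expTwoPi (f (n + 1)) = expTwoPi (f n) * expTwoPi (f (n + 1) - f n - k) := by
      rw [← expTwoPi_add, ← expTwoPi_add_int _ (-k)]; congr 1; push_cast; ring
    have e2 := inv_expTwoPi_sub_one (t := f (n + 1) - f n - k) (by linarith) (by linarith)
    -- If this vanished, `e2` would equate 0 with a number of real part -1/2.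
    have h3 : expTwoPi (f (n + 1) - f n - k) - 1 ≠ 0 := by
      intro h0
      rw [h0, inv_zero] at e2
      generalize Real.cos _ / Real.sin _ = w at e2
      have := congrArg Complex.re e2
      norm_num [Complex.div_re, Complex.normSq] at this
    rw [e1, hr]
    simp only
    rw [← e2]
    field_simp
  have hnr : ∀ n ∈ Finset.Ico a b, |c n| ≤ 1 / θ := fun n hn =>
    abs_cot_pi_le hθ (by have := hg n hn; linarith) (by have := hg n hn; linarith)
  have hanti : ∀ n ∈ Finset.Ico a b, n + 1 < b → c (n + 1) ≤ c n := by
    intro n hn hb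
    have h1 := hg n hn
    have h2 := hg (n + 1) (by simp at hn ⊢; omega)
    exact cot_pi_antitone (by linarith) (by linarith [hmono n hn hb]) (by linarith)
  have hθ' : 1 ≤ 1 / θ := by rw [le_div_iff₀ hθ]; linarith
  have hr_le : ∀ n ∈ Finset.Ico a b, ‖r n‖ ≤ 1 / θ := by
    intro n hn
    rw [hr]; simp only
    rw [norm_div, Complex.norm_ofNat]
    have : ‖(-1 - Complex.I * (c n : ℂ) : ℂ)‖ ≤ 1 + |c n| := by
      refine (norm_sub_le _ _).trans ?_
      simp
    have := hnr n hn
    rw [div_le_iff₀ (by norm_num)]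
    linarith
  -- partial sums
  have key : ∀ m, a < m → m ≤ b →
      ‖∑ n ∈ Finset.Ico a m, expTwoPi (f n) - r (m - 1) * expTwoPi (f m)‖ ≤ 1 / θ + (c a - c (m - 1)) / 2 := by
    intro m hm
    induction m, hm using Nat.le_induction with
    | base =>
      intro hb
      have ha : a ∈ Finset.Ico a b := by simp; omega
      rw [Nat.succ_eq_add_one, Finset.sum_Ico_succ_top le_rfl, Finset.Ico_self, Finset.sum_empty, zero_add,
        hterm a ha, Nat.add_sub_cancel]
      have : r a * (expTwoPi (f (a + 1)) - expTwoPi (f a)) - r a * expTwoPi (f (a + 1)) = - (r a * expTwoPi (f a)) := by ring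
      rw [this, norm_neg, norm_mul, norm_expTwoPi, mul_one]
      simpa using hr_le a ha
    | succ m hm ih =>
      intro hb
      have hm' : a < m := hm
      have hmem : m ∈ Finset.Ico a b := by simp; omega
      have ih' := ih (by omega)
      have hmem' : m - 1 ∈ Finset.Ico a b := by simp; omega
      have han := hanti (m - 1) hmem' (by omega)
      rw [Nat.sub_add_cancel (by omega)] at han
      rw [Finset.sum_Ico_succ_top (by omega), Nat.add_sub_cancel]
      have e : ∑ n ∈ Finset.Ico a m, expTwoPi (f n) + expTwoPi (f m) - r m * expTwoPi (f (m + 1))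
          = (∑ n ∈ Finset.Ico a m, expTwoPi (f n) - r (m - 1) * expTwoPi (f m)) + (r (m - 1) - r m) * expTwoPi (f m) := by
        have := hterm m hmem
        linear_combination this
      rw [e]
      refine (norm_add_le _ _).trans ?_
      rw [norm_mul, norm_expTwoPi, mul_one]
      have e2 : r (m - 1) - r m = -(Complex.I * ((c (m - 1) - c m : ℝ) : ℂ)) / 2 := by
        rw [hr]; push_cast; ring
      rw [e2, norm_div, norm_neg, norm_mul, Complex.norm_I, one_mul, Complex.norm_real, Complex.norm_ofNat,
        Real.norm_eq_abs, abs_of_nonneg (by linarith)]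
      linarith
  have hb1 : b - 1 ∈ Finset.Ico a b := by simp; omega
  have h1 := key b hab le_rfl
  have h2 := hr_le (b - 1) hb1
  have h3 := (abs_le.1 (hnr a (by simp [hab]))).2
  have h4 := (abs_le.1 (hnr (b - 1) hb1)).1
  have h5 : ‖∑ n ∈ Finset.Ico a b, expTwoPi (f n)‖ ≤
      ‖∑ n ∈ Finset.Ico a b, expTwoPi (f n) - r (b - 1) * expTwoPi (f b)‖ + ‖r (b - 1) * expTwoPi (f b)‖ := by
    simpa using norm_add_le (∑ n ∈ Finset.Ico a b, expTwoPi (f n) - r (b - 1) * expTwoPi (f b)) (r (b - 1) * expTwoPi (f b))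
  rw [norm_mul, norm_expTwoPi, mul_one] at h5
  have : (6 : ℝ) / θ = 6 * (1 / θ) := by ring
  rw [this]
  linarith

theorem Finset.exists_eq_Ico_of_ordConnected (S : Finset ℕ)
    (hS : ∀ x ∈ S, ∀ z ∈ S, ∀ y, x ≤ y → y ≤ z → y ∈ S) :
    ∃ a b, S = Finset.Ico a b := by
  rcases S.eq_empty_or_nonempty with rfl | h
  · exact ⟨0, 0, by simp⟩
  · refine ⟨S.min' h, S.max' h + 1, ?_⟩
    ext y
    simp only [Finset.mem_Ico, Order.lt_add_one_iff]
    exact ⟨fun hy => ⟨S.min'_le y hy, S.le_max' y hy⟩,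
      fun hy => hS _ (S.min'_mem h) _ (S.max'_mem h) y hy.1 hy.2⟩

theorem sub_mul_le_sub_of_le_succ {g : ℕ → ℝ} {a b : ℕ} {l : ℝ}
    (hg : ∀ n, a ≤ n → n < b → l ≤ g (n + 1) - g n) {m n : ℕ} (ham : a ≤ m) (hmn : m ≤ n)
    (hnb : n ≤ b) : ((n : ℝ) - m) * l ≤ g n - g m := by
  induction n, hmn using Nat.le_induction with
  | base => simp
  | succ n hn ih =>
    have := ih (by omega)
    have := hg n (by omega) (by omega)
    push_cast
    linarith

/-- Each step raises g by at least l, so the extreme indices of S are at most (q - p)/l apart. -/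
theorem card_le_of_spaced {g : ℕ → ℝ} {a b : ℕ} {l p q : ℝ} (hl : 0 < l)
    (hg : ∀ n, a ≤ n → n < b → l ≤ g (n + 1) - g n) (hpq : p ≤ q) (S : Finset ℕ)
    (hS : S ⊆ Finset.Ico a b) (hp : ∀ n ∈ S, p ≤ g n ∧ g n ≤ q) :
    (S.card : ℝ) ≤ (q - p) / l + 1 := by
  rcases S.eq_empty_or_nonempty with rfl | h
  · have : 0 ≤ (q - p) / l := div_nonneg (by linarith) hl.le
    simp; linarith
  have h1 := S.min'_mem h
  have h2 := S.max'_mem h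
  have h3 := S.min'_le _ h2
  have hsub : S ⊆ Finset.Icc (S.min' h) (S.max' h) := fun y hy => by
    simp only [Finset.mem_Icc]; exact ⟨S.min'_le y hy, S.le_max' y hy⟩
  have hc := Finset.card_le_card hsub
  rw [Nat.card_Icc] at hc
  have hc' : (S.card : ℝ) ≤ (S.max' h : ℝ) - S.min' h + 1 := by
    have : S.card + S.min' h ≤ S.max' h + 1 := by omega
    have : (S.card : ℝ) + S.min' h ≤ S.max' h + 1 := by exact_mod_cast this
    linarith
  have m1 := Finset.mem_Ico.1 (hS h1)
  have m2 := Finset.mem_Ico.1 (hS h2)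
  have := sub_mul_le_sub_of_le_succ hg m1.1 h3 (by omega)
  have e1 := hp _ h1
  have e2 := hp _ h2
  have : (S.max' h : ℝ) - S.min' h ≤ (q - p) / l := by
    rw [le_div_iff₀ hl]; linarith
  linarith

/-- The second derivative test, for sequences with second differences in `[l, A * l]`. -/
theorem norm_sum_expTwoPi_le_of_second_difference {f : ℕ → ℝ} {a b : ℕ} {l A : ℝ} (hl : 0 < l)
    (hA : 1 ≤ A) (hab : a ≤ b)
    (h1 : ∀ n, a ≤ n → n < b → l ≤ f (n + 2) - 2 * f (n + 1) + f n)
    (h2 : ∀ n, a ≤ n → n < b → f (n + 2) - 2 * f (n + 1) + f n ≤ A * l) :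
    ‖∑ n ∈ Finset.Ico a b, expTwoPi (f n)‖ ≤ 20 * A * (((b : ℝ) - a) * √l + 1 / √l) := by
  have hs : 0 < √l := Real.sqrt_pos.2 hl
  have hss : √l * √l = l := Real.mul_self_sqrt hl.le
  have hL : (0 : ℝ) ≤ (b : ℝ) - a := by
    have : (a : ℝ) ≤ b := by exact_mod_cast hab
    linarith
  have h1s : 0 < 1 / √l := by positivity
  have htriv : ‖∑ n ∈ Finset.Ico a b, expTwoPi (f n)‖ ≤ (b : ℝ) - a := by
    refine (norm_sum_le _ _).trans ?_
    simp only [norm_expTwoPi, Finset.sum_const, Nat.card_Ico, nsmul_eq_mul, mul_one]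
    rw [Nat.cast_sub hab]
  rcases hab.eq_or_lt with rfl | hlt
  · refine htriv.trans ?_
    rw [sub_self]; positivity
  -- For l > 1/4 the trivial bound b - a is below 2 (b - a) √l.
  rcases lt_or_ge (1 / 4) l with hl4 | hl4
  · have : 1 / 2 ≤ √l := Real.le_sqrt_of_sq_le (by linarith)
    refine htriv.trans ?_
    have e : ((b : ℝ) - a) ≤ 2 * (((b : ℝ) - a) * √l) := by nlinarith
    have : 0 ≤ ((b : ℝ) - a) * √l := by positivity
    nlinarith
  have hs2 : √l ≤ 1 / 2 := Real.sqrt_le_iff.2 ⟨by norm_num, by linarith⟩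
  -- This balances the two losses in one class below: 1/θ from the Kusmin-Landau inequality, and θ/l
  -- for the indices whose difference lies within θ of an integer.
  set θ := √l with hθ
  set g : ℕ → ℝ := fun n => f (n + 1) - f n with hgdef
  have hg1 : ∀ n, a ≤ n → n < b → l ≤ g (n + 1) - g n := fun n hn hn' => by
    have := h1 n hn hn'; simp only [hgdef]; linarith
  have hg2 : ∀ n, a ≤ n → n < b → -(A * l) ≤ -g (n + 1) - -g n := fun n hn hn' => by
    have := h2 n hn hn'; simp only [hgdef]; linarith
  have hmono : ∀ m n, a ≤ m → m ≤ n → n < b → g m ≤ g n := fun m n hm hmn hn => by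
    have := sub_mul_le_sub_of_le_succ hg1 hm hmn hn.le
    have h0 : (0 : ℝ) ≤ (n : ℝ) - m := by
      have : (m : ℝ) ≤ n := by exact_mod_cast hmn
      linarith
    nlinarith
  -- The indices are grouped by ⌊g n⌋. Since g increases, the middle part of a class, where g stays
  -- θ away from k and k + 1, is an interval to which `norm_sum_expTwoPi_le_of_monotone_sub`
  -- applies; the two ends are bounded by their number of terms.
  have hfib : ∀ k : ℤ, ‖∑ n ∈ Finset.Ico a b with ⌊g n⌋ = k, expTwoPi (f n)‖ ≤ 10 / θ := by
    intro k
    set S := (Finset.Ico a b).filter (fun n => ⌊g n⌋ = k) with hS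
    have hSmem : ∀ n ∈ S, (a ≤ n ∧ n < b) ∧ (k : ℝ) ≤ g n ∧ g n < k + 1 := fun n hn => by
      rw [hS, Finset.mem_filter, Finset.mem_Ico, Int.floor_eq_iff] at hn
      exact hn
    rw [← Finset.sum_filter_add_sum_filter_not S (fun n => (k : ℝ) + θ ≤ g n),
      ← Finset.sum_filter_add_sum_filter_not (S.filter (fun n => (k : ℝ) + θ ≤ g n)) (fun n => g n ≤ k + 1 - θ)]
    have b1 : ‖∑ n ∈ (S.filter (fun n => (k : ℝ) + θ ≤ g n)).filter (fun n => g n ≤ k + 1 - θ), expTwoPi (f n)‖ ≤ 6 / θ := by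
      obtain ⟨a', b', h'⟩ := Finset.exists_eq_Ico_of_ordConnected
        ((S.filter (fun n => (k : ℝ) + θ ≤ g n)).filter (fun n => g n ≤ k + 1 - θ)) (by
          intro x hx z hz y hxy hyz
          simp only [Finset.mem_filter] at hx hz ⊢
          have ex := hSmem x hx.1.1
          have ez := hSmem z hz.1.1
          have m1 := hmono x y ex.1.1 hxy (by omega)
          have m2 := hmono y z (by omega) hyz ez.1.2
          refine ⟨⟨?_, by linarith⟩, by linarith⟩
          rw [hS, Finset.mem_filter, Finset.mem_Ico, Int.floor_eq_iff]
          exact ⟨⟨by omega, by omega⟩, by linarith, by linarith⟩)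
      have hmem : ∀ n ∈ Finset.Ico a' b', (a ≤ n ∧ n < b) ∧ (k : ℝ) + θ ≤ g n ∧ g n ≤ k + 1 - θ := fun n hn => by
        rw [← h', Finset.mem_filter, Finset.mem_filter] at hn
        exact ⟨(hSmem n hn.1.1).1, hn.1.2, hn.2⟩
      rw [h']
      refine norm_sum_expTwoPi_le_of_monotone_sub hs (k := k) ?_ fun n hn => (hmem n hn).2
      intro n hn hnb
      have e1 := hmem n hn
      have := hg1 n e1.1.1 e1.1.2
      simp only [hgdef] at this
      linarith
    have b2 : ‖∑ n ∈ (S.filter (fun n => (k : ℝ) + θ ≤ g n)).filter (fun n => ¬ g n ≤ k + 1 - θ), expTwoPi (f n)‖ ≤ θ / l + 1 := by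
      refine (norm_sum_le _ _).trans ?_
      simp only [norm_expTwoPi, Finset.sum_const, nsmul_eq_mul, mul_one]
      have := card_le_of_spaced (p := k + 1 - θ) (q := k + 1) hl hg1 (by linarith)
        ((S.filter (fun n => (k : ℝ) + θ ≤ g n)).filter (fun n => ¬ g n ≤ k + 1 - θ))
        (fun n hn => by
          simp only [Finset.mem_filter] at hn
          exact Finset.mem_Ico.2 (hSmem n hn.1.1).1)
        (fun n hn => by
          simp only [Finset.mem_filter] at hn
          have := hSmem n hn.1.1
          exact ⟨by linarith [not_le.1 hn.2], by linarith⟩)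
      rwa [show (k : ℝ) + 1 - (k + 1 - θ) = θ by ring] at this
    have b3 : ‖∑ n ∈ S.filter (fun n => ¬ (k : ℝ) + θ ≤ g n), expTwoPi (f n)‖ ≤ θ / l + 1 := by
      refine (norm_sum_le _ _).trans ?_
      simp only [norm_expTwoPi, Finset.sum_const, nsmul_eq_mul, mul_one]
      have := card_le_of_spaced (p := k) (q := k + θ) hl hg1 (by linarith)
        (S.filter (fun n => ¬ (k : ℝ) + θ ≤ g n))
        (fun n hn => by
          simp only [Finset.mem_filter] at hn
          exact Finset.mem_Ico.2 (hSmem n hn.1).1)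
        (fun n hn => by
          simp only [Finset.mem_filter] at hn
          have := hSmem n hn.1
          exact ⟨by linarith, by linarith [not_le.1 hn.2]⟩)
      rwa [show (k : ℝ) + θ - k = θ by ring] at this
    have e1 : θ / l = 1 / θ := by rw [div_eq_div_iff hl.ne' hs.ne']; linarith
    have e2 : 2 ≤ 1 / θ := by rw [le_div_iff₀ hs]; linarith
    have e3 : 6 / θ = 6 * (1 / θ) := by ring
    have e4 : 10 / θ = 10 * (1 / θ) := by ring
    refine (norm_add_le _ _).trans ?_
    have := norm_add_le (∑ n ∈ (S.filter (fun n => (k : ℝ) + θ ≤ g n)).filter (fun n => g n ≤ k + 1 - θ), expTwoPi (f n))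
      (∑ n ∈ (S.filter (fun n => (k : ℝ) + θ ≤ g n)).filter (fun n => ¬ g n ≤ k + 1 - θ), expTwoPi (f n))
    rw [e1] at b2 b3
    rw [e3] at b1
    rw [e4]
    linarith
  set T := Finset.Icc ⌊g a⌋ ⌊g (b - 1)⌋ with hT
  have hmaps : ∀ n ∈ Finset.Ico a b, ⌊g n⌋ ∈ T := by
    intro n hn
    rw [Finset.mem_Ico] at hn
    rw [hT, Finset.mem_Icc]
    exact ⟨Int.floor_mono (hmono a n le_rfl hn.1 hn.2), Int.floor_mono (hmono n (b - 1) hn.1 (by omega) (by omega))⟩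
  rw [← Finset.sum_fiberwise_of_maps_to hmaps]
  -- The first differences increase in total by at most A l (b - a), which bounds the number of
  -- integer parts met.
  have hTc : (T.card : ℝ) ≤ A * l * ((b : ℝ) - a) + 2 := by
    have hle : ⌊g a⌋ ≤ ⌊g (b - 1)⌋ := Int.floor_mono (hmono a (b - 1) le_rfl (by omega) (by omega))
    rw [hT, Int.card_Icc]
    have e : (((⌊g (b - 1)⌋ + 1 - ⌊g a⌋).toNat : ℤ) : ℝ) = (⌊g (b - 1)⌋ : ℝ) + 1 - ⌊g a⌋ := by
      rw [Int.toNat_of_nonneg (by omega)]; push_cast; ring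
    rw [Int.cast_natCast] at e
    rw [e]
    have f1 := Int.floor_le (g (b - 1))
    have f2 := Int.lt_floor_add_one (g a)
    have f3 := sub_mul_le_sub_of_le_succ (g := fun n => -g n) (b := b) hg2 (m := a) (n := b - 1) le_rfl (by omega) (by omega)
    have f4 : ((b - 1 : ℕ) : ℝ) = b - 1 := by rw [Nat.cast_sub (by omega)]; simp
    rw [f4] at f3
    have : 0 < A * l := by positivity
    nlinarith
  calc ‖∑ k ∈ T, ∑ n ∈ Finset.Ico a b with ⌊g n⌋ = k, expTwoPi (f n)‖
      ≤ ∑ k ∈ T, 10 / θ := (norm_sum_le _ _).trans (Finset.sum_le_sum fun k _ => hfib k)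
    _ = T.card * (10 / θ) := by rw [Finset.sum_const, nsmul_eq_mul]
    _ ≤ (A * l * ((b : ℝ) - a) + 2) * (10 / θ) := by gcongr
    _ = 10 * A * (((b : ℝ) - a) * θ) + 20 * (1 / θ) := by
        rw [← hss]; field_simp; ring
    _ ≤ _ := by
        have : 0 ≤ ((b : ℝ) - a) * θ := by positivity
        nlinarith

/-- The second derivative test for `∑ e(c / n ^ 2)`. -/
theorem norm_sum_expTwoPi_div_sq_le {c M : ℝ} (hc : c ≠ 0) (hM : 0 < M) {a b : ℕ}
    (ha : M ≤ a) (hb : (b : ℝ) ≤ 8 * M) :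
    ‖∑ n ∈ Finset.Ico a b, expTwoPi (c / (n : ℝ) ^ 2)‖ ≤
      (10 : ℝ) ^ 13 * (√|c| / M + M ^ 2 / √|c|) := by
  have hc0 : 0 < |c| := abs_pos.2 hc
  rcases le_or_gt b a with hab | hab
  · rw [Finset.Ico_eq_empty (by omega)]; simp; positivity
  wlog hcpos : 0 < c generalizing c
  · have hneg : 0 < -c := by
      rcases hc.lt_or_gt with h | h
      · linarith
      · exact absurd h hcpos
    have := this (c := -c) (by simpa using hc) (by simpa using hc0) hneg
    rw [abs_neg] at this
    refine le_trans (le_of_eq ?_) this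
    rw [← Complex.norm_conj, map_sum]
    congr 1
    refine Finset.sum_congr rfl fun n _ => ?_
    rw [conj_expTwoPi, neg_div]
  rw [abs_of_pos hcpos]
  have ha0 : (1 : ℝ) ≤ a := by
    have : (0 : ℝ) < a := by linarith
    exact_mod_cast this
  -- The second difference of c/n^2 is of order c/n^4. For M ≤ n ≤ 8 M it lies between l and 100
  -- c/M^4 = 10^8 l, whence the ratio `A` used below; the constants are generous.
  set l : ℝ := c / (10 ^ 6 * M ^ 4) with hl
  have hl0 : 0 < l := by positivity
  have hdiff : ∀ n : ℕ, a ≤ n → c / ((n + 2 : ℕ) : ℝ) ^ 2 - 2 * (c / ((n + 1 : ℕ) : ℝ) ^ 2) + c / (n : ℝ) ^ 2 =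
      c * ((6 * (n : ℝ) ^ 2 + 12 * n + 4) / ((n : ℝ) ^ 2 * (n + 1) ^ 2 * (n + 2) ^ 2)) := by
    intro n hn
    have : (0 : ℝ) < n := by
      have : (a : ℝ) ≤ n := by exact_mod_cast hn
      linarith
    push_cast
    field_simp
    ring
  have key := norm_sum_expTwoPi_le_of_second_difference (f := fun n : ℕ => c / (n : ℝ) ^ 2) (a := a) (b := b)
    (l := l) (A := 10 ^ 8) hl0 (by norm_num) hab.le ?_ ?_
  · refine key.trans ?_
    have hsq : √l = √c / (10 ^ 3 * M ^ 2) := by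
      rw [hl, Real.sqrt_div hcpos.le]
      congr 1
      rw [show (10 : ℝ) ^ 6 * M ^ 4 = (10 ^ 3 * M ^ 2) ^ 2 by ring, Real.sqrt_sq (by positivity)]
    rw [hsq]
    have hsc : 0 < √c := Real.sqrt_pos.2 hcpos
    have hba : (b : ℝ) - a ≤ 8 * M := by linarith
    have e1 : ((b : ℝ) - a) * (√c / (10 ^ 3 * M ^ 2)) ≤ 8 * M * (√c / (10 ^ 3 * M ^ 2)) := by gcongr
    have e2 : 8 * M * (√c / (10 ^ 3 * M ^ 2)) = 8 / 10 ^ 3 * (√c / M) := by field_simp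
    have e3 : 1 / (√c / (10 ^ 3 * M ^ 2)) = 10 ^ 3 * (M ^ 2 / √c) := by field_simp
    rw [e3]
    have p1 : 0 < √c / M := by positivity
    have p2 : 0 < M ^ 2 / √c := by positivity
    nlinarith
  · intro n hn hnb
    rw [hdiff n hn, hl, div_eq_mul_inv]
    have hnM : M ≤ n := by
      have : (a : ℝ) ≤ n := by exact_mod_cast hn
      linarith
    have hn1 : (n : ℝ) + 1 ≤ 8 * M := by
      have : (n : ℝ) + 1 ≤ b := by exact_mod_cast hnb
      linarith
    have hn0 : (1 : ℝ) ≤ n := by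
      have : (a : ℝ) ≤ n := by exact_mod_cast hn
      linarith
    refine mul_le_mul_of_nonneg_left ?_ hcpos.le
    rw [inv_eq_one_div, div_le_div_iff₀ (by positivity) (by positivity), one_mul]
    have f1 : (n : ℝ) + 2 ≤ 16 * M := by linarith
    calc (n : ℝ) ^ 2 * (n + 1) ^ 2 * (n + 2) ^ 2 ≤ (n : ℝ) ^ 2 * (8 * M) ^ 2 * (16 * M) ^ 2 := by gcongr
      _ = n ^ 2 * (16384 * M ^ 4) := by ring
      _ ≤ (6 * (n : ℝ) ^ 2 + 12 * n + 4) * (10 ^ 6 * M ^ 4) := by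
          have : (0 : ℝ) < M ^ 4 := by positivity
          gcongr
          · nlinarith
          · norm_num
  · intro n hn hnb
    rw [hdiff n hn, hl]
    have hnM : M ≤ n := by
      have : (a : ℝ) ≤ n := by exact_mod_cast hn
      linarith
    have hn0 : (1 : ℝ) ≤ n := by
      have : (a : ℝ) ≤ n := by exact_mod_cast hn
      linarith
    have : (10 : ℝ) ^ 8 * (c / (10 ^ 6 * M ^ 4)) = c * (100 / M ^ 4) := by field_simp; norm_num
    rw [this]
    refine mul_le_mul_of_nonneg_left ?_ hcpos.le
    rw [div_le_div_iff₀ (by positivity) (by positivity)]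
    have g1 : M ^ 4 ≤ (n : ℝ) ^ 2 * n ^ 2 := by
      calc M ^ 4 = M ^ 2 * M ^ 2 := by ring
        _ ≤ _ := by gcongr
    calc (6 * (n : ℝ) ^ 2 + 12 * n + 4) * M ^ 4 ≤ (100 * (n : ℝ) ^ 2) * (n ^ 2 * n ^ 2) := by
          gcongr
          nlinarith
      _ ≤ 100 * ((n : ℝ) ^ 2 * (n + 1) ^ 2 * (n + 2) ^ 2) := by
          rw [mul_assoc, ← mul_assoc ((n : ℝ) ^ 2)]
          gcongr <;> linarith

/-! ### Spacing of the points `h / n ^ 2` -/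

/-- Measured from the leftmost point in units of d, spaced points have distinct integer parts. -/
theorem card_le_of_pairwise_dist {ι : Type*} (S : Finset ι) (v : ι → ℝ) {d η : ℝ} (hd : 0 < d)
    (hη : 0 ≤ η) (hsp : ∀ x ∈ S, ∀ y ∈ S, x ≠ y → d ≤ |v x - v y|)
    (hdiam : ∀ x ∈ S, ∀ y ∈ S, |v x - v y| ≤ η) : (S.card : ℝ) ≤ η / d + 1 := by
  classical
  rcases S.eq_empty_or_nonempty with rfl | hne
  · have := div_nonneg hη hd.le
    simp; linarith
  obtain ⟨z, hz, hmin⟩ := S.exists_min_image v hne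
  have hinj : Set.InjOn (fun x => ⌊(v x - v z) / d⌋₊) S := by
    intro x hx y hy hxy
    by_contra hne
    have h1 := hsp x hx y hy hne
    have hx0 : 0 ≤ (v x - v z) / d := div_nonneg (by linarith [hmin x hx]) hd.le
    have hy0 : 0 ≤ (v y - v z) / d := div_nonneg (by linarith [hmin y hy]) hd.le
    simp only at hxy
    have a1 := Nat.floor_le hx0
    have a2 := Nat.lt_floor_add_one ((v x - v z) / d)
    have b1 := Nat.floor_le hy0
    have b2 := Nat.lt_floor_add_one ((v y - v z) / d)
    rw [hxy] at a1 a2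
    have : |(v x - v z) / d - (v y - v z) / d| < 1 := by rw [abs_lt]; constructor <;> linarith
    rw [← sub_div, abs_div, abs_of_pos hd, div_lt_one hd] at this
    rw [show v x - v z - (v y - v z) = v x - v y by ring] at this
    linarith
  have hmaps : Set.MapsTo (fun x => ⌊(v x - v z) / d⌋₊) S (Finset.range (⌊η / d⌋₊ + 1)) := by
    intro x hx
    simp only [Finset.coe_range, Set.mem_Iio, Order.lt_add_one_iff]
    refine Nat.floor_le_floor ?_
    gcongr
    exact (le_abs_self _).trans (hdiam x hx z hz)
  have := Finset.card_le_card_of_injOn _ hmaps hinj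
  rw [Finset.card_range] at this
  calc (S.card : ℝ) ≤ (⌊η / d⌋₊ + 1 : ℕ) := by exact_mod_cast this
    _ ≤ η / d + 1 := by push_cast; linarith [Nat.floor_le (div_nonneg hη hd.le)]

/-- Pairs with entries in `[N, 2 N)` and greatest common divisor `g`. -/
def dyadicPairsGcd (N g : ℕ) : Finset (ℕ × ℕ) :=
  (Finset.Ico N (2 * N) ×ˢ Finset.Ico N (2 * N)).filter fun p => Nat.gcd p.1 p.2 = g

theorem card_dyadicPairsGcd_le {N g : ℕ} :
    ((dyadicPairsGcd N g).card : ℝ) ≤ (2 * N / g : ℝ) ^ 2 := by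
  rcases Nat.eq_zero_or_pos N with rfl | hN
  · simp [dyadicPairsGcd]
  set M := (Finset.Ioc 0 (2 * N)).filter (fun n => g ∣ n) with hM
  have hsub : dyadicPairsGcd N g ⊆ M ×ˢ M := by
    rintro ⟨a, b⟩ hp
    simp only [dyadicPairsGcd, Finset.mem_filter, Finset.mem_product, Finset.mem_Ico] at hp
    simp only [hM, Finset.mem_product, Finset.mem_filter, Finset.mem_Ioc]
    refine ⟨⟨⟨by omega, by omega⟩, ?_⟩, ⟨by omega, by omega⟩, ?_⟩
    · rw [← hp.2]; exact Nat.gcd_dvd_left _ _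
    · rw [← hp.2]; exact Nat.gcd_dvd_right _ _
  have h1 := Finset.card_le_card hsub
  rw [Finset.card_product, hM, Nat.Ioc_filter_dvd_card_eq_div] at h1
  have h2 : ((2 * N / g : ℕ) : ℝ) ≤ 2 * N / g := by
    have := @Nat.cast_div_le ℝ _ _ _ (2 * N) g
    push_cast at this
    exact this
  calc ((dyadicPairsGcd N g).card : ℝ) ≤ ((2 * N / g : ℕ) * (2 * N / g : ℕ) : ℕ) := by exact_mod_cast h1
    _ = ((2 * N / g : ℕ) : ℝ) ^ 2 := by push_cast; ring
    _ ≤ _ := by gcongr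

/-- Dividing out g leaves coprime pairs with entries below 2N/g, so distinct pairs give distinct
fractions, and these differ by at least the inverse of the product of their denominators. -/
theorem ratio_spacing {N g : ℕ} (hg : 0 < g) {p q : ℕ × ℕ} (hp : p ∈ dyadicPairsGcd N g)
    (hq : q ∈ dyadicPairsGcd N g) (hpq : p ≠ q) :
    (g : ℝ) ^ 2 / (4 * N ^ 2) ≤ |(p.1 : ℝ) / p.2 - q.1 / q.2| := by
  obtain ⟨a, b⟩ := p
  obtain ⟨c, d⟩ := q
  simp only [dyadicPairsGcd, Finset.mem_filter, Finset.mem_product, Finset.mem_Ico] at hp hq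
  have hb : 0 < b := by omega
  have hd : 0 < d := by omega
  obtain ⟨⟨⟨ha1, ha2⟩, hb1, hb2⟩, hp⟩ := hp
  obtain ⟨⟨⟨hc1, hc2⟩, hd1, hd2⟩, hq⟩ := hq
  have hgcd : ∀ m n : ℕ, Nat.gcd m n = g → 0 < n → ∃ m' n', m = g * m' ∧ n = g * n' ∧ Nat.Coprime m' n' := by
    intro m n h hn
    have h0 : 0 < Nat.gcd m n := Nat.gcd_pos_of_pos_right _ hn
    refine ⟨m / g, n / g, ?_, ?_, ?_⟩
    · rw [← h]; exact (Nat.mul_div_cancel' (Nat.gcd_dvd_left _ _)).symm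
    · rw [← h]; exact (Nat.mul_div_cancel' (Nat.gcd_dvd_right _ _)).symm
    · rw [← h]; exact Nat.coprime_div_gcd_div_gcd h0
  obtain ⟨a', b', rfl, rfl, hab⟩ := hgcd a b hp hb
  obtain ⟨c', d', rfl, rfl, hcd⟩ := hgcd c d hq hd
  have hb' : 0 < b' := Nat.pos_of_mul_pos_left hb
  have hd' : 0 < d' := Nat.pos_of_mul_pos_left hd
  have hne : (a' : ℤ) * d' - c' * b' ≠ 0 := by
    intro h
    have h' : a' * d' = c' * b' := by
      have : (a' : ℤ) * d' = c' * b' := by linarith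
      exact_mod_cast this
    have e1 : b' ∣ d' := by
      have : b' ∣ a' * d' := ⟨c', by rw [h']; ring⟩
      exact hab.symm.dvd_of_dvd_mul_left this
    have e2 : d' ∣ b' := by
      have : d' ∣ c' * b' := ⟨a', by rw [← h']; ring⟩
      exact hcd.symm.dvd_of_dvd_mul_left this
    have e3 := Nat.dvd_antisymm e1 e2
    subst e3
    have := Nat.eq_of_mul_eq_mul_right hb' h'
    subst this
    exact hpq rfl
  have h1 : (1 : ℝ) ≤ |(a' : ℝ) * d' - c' * b'| := by
    have := Int.one_le_abs hne
    exact_mod_cast this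
  have hgr : (0 : ℝ) < g := by exact_mod_cast hg
  have hbr : (0 : ℝ) < b' := by exact_mod_cast hb'
  have hdr : (0 : ℝ) < d' := by exact_mod_cast hd'
  have e : (((g * a' : ℕ) : ℝ) / (g * b' : ℕ) - ((g * c' : ℕ) : ℝ) / (g * d' : ℕ)) = (a' * d' - c' * b') / (b' * d') := by
    push_cast; field_simp
  simp only
  rw [e, abs_div, abs_of_pos (by positivity : (0 : ℝ) < b' * d')]
  have hb2r : (g : ℝ) * b' ≤ 2 * N := by exact_mod_cast hb2.le
  have hd2r : (g : ℝ) * d' ≤ 2 * N := by exact_mod_cast hd2.le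
  have hN : (0 : ℝ) < N := by
    have : (0 : ℝ) < g * b' := by positivity
    linarith
  rw [div_le_div_iff₀ (by positivity) (by positivity)]
  calc (g : ℝ) ^ 2 * (b' * d') = (g * b') * (g * d') := by ring
    _ ≤ (2 * N) * (2 * N) := by gcongr
    _ = 1 * (4 * N ^ 2) := by ring
    _ ≤ _ := by gcongr

/-- Quadruples with `h / h'` close to `(n / n') ^ 2`, with prescribed greatest common divisors. -/
theorem card_close_ratios_gcd_le {H N k g : ℕ} (hk : 0 < k) (hg : 0 < g) (hH : 0 < H) (hN : 0 < N) {ρ : ℝ} (hρ : 0 ≤ ρ) :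
    (((dyadicPairsGcd H k ×ˢ dyadicPairsGcd N g).filter fun z : (ℕ × ℕ) × (ℕ × ℕ) =>
      |(z.1.1 : ℝ) / z.1.2 - (z.2.1 / z.2.2) ^ 2| ≤ ρ).card : ℝ) ≤
      4 * H * N / (k * g) + 32 * ρ * H ^ 2 * N ^ 2 / (k ^ 2 * g ^ 2) := by
  have hkr : (0 : ℝ) < k := by exact_mod_cast hk
  have hgr : (0 : ℝ) < g := by exact_mod_cast hg
  have hHr : (0 : ℝ) < H := by exact_mod_cast hH
  have hNr : (0 : ℝ) < N := by exact_mod_cast hN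
  have hcard : ∀ (A B : Finset (ℕ × ℕ)) (P : (ℕ × ℕ) → (ℕ × ℕ) → Prop) [∀ a b, Decidable (P a b)] (c : ℝ),
      (∀ a ∈ A, ((B.filter (P a)).card : ℝ) ≤ c) →
      (((A ×ˢ B).filter fun z => P z.1 z.2).card : ℝ) ≤ A.card * c := by
    intro A B P _ c h
    rw [Finset.card_filter, Finset.sum_product]
    push_cast
    calc ∑ a ∈ A, ∑ b ∈ B, (if P a b then (1 : ℝ) else 0) ≤ ∑ a ∈ A, c := by
          refine Finset.sum_le_sum fun a ha => ?_
          refine le_trans (le_of_eq ?_) (h a ha)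
          rw [Finset.card_filter]; push_cast; rfl
      _ = A.card * c := by rw [Finset.sum_const, nsmul_eq_mul]
  -- The pair with the smaller range is fixed and the other one is counted by spacing. The term `+
  -- 1` in the spacing bound then contributes the square of the smaller of 2H/k and 2N/g, which is
  -- at most their product.
  rcases le_total ((2 * H / k : ℝ)) (2 * N / g) with hle | hle
  · have h1 := hcard (dyadicPairsGcd H k) (dyadicPairsGcd N g)
      (fun a b => |(a.1 : ℝ) / a.2 - (b.1 / b.2) ^ 2| ≤ ρ) (2 * ρ / (g ^ 2 / (4 * N ^ 2)) + 1) (by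
        intro a _
        refine card_le_of_pairwise_dist _ (fun b => (b.1 : ℝ) / b.2) (by positivity) (by positivity) ?_ ?_
        · intro x hx y hy hxy
          exact ratio_spacing hg (Finset.mem_filter.1 hx).1 (Finset.mem_filter.1 hy).1 hxy
        · intro x hx y hy
          -- Ratios are at least 1/2, so two of them add up to at least 1, and passing from the
          -- difference of squares to the difference of ratios does not enlarge distances.
          have half : ∀ w ∈ dyadicPairsGcd N g, (1 / 2 : ℝ) ≤ (w.1 : ℝ) / w.2 := by
            intro w hw
            simp only [dyadicPairsGcd, Finset.mem_filter, Finset.mem_product, Finset.mem_Ico] at hw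
            have : 0 < w.2 := by omega
            rw [div_le_div_iff₀ (by norm_num) (by exact_mod_cast this)]
            have : w.2 ≤ w.1 * 2 := by omega
            rw [one_mul]
            exact_mod_cast this
          rw [Finset.mem_filter] at hx hy
          have ex := half x hx.1
          have ey := half y hy.1
          have h2 : |((x.1 : ℝ) / x.2) ^ 2 - (y.1 / y.2) ^ 2| ≤ 2 * ρ := by
            have a1 := abs_le.1 hx.2
            have a2 := abs_le.1 hy.2
            rw [abs_le]; constructor <;> linarith
          rw [sq_sub_sq, abs_mul, abs_of_nonneg (by linarith)] at h2
          have := abs_nonneg ((x.1 : ℝ) / x.2 - y.1 / y.2)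
          nlinarith)
    refine h1.trans ?_
    have hA := card_dyadicPairsGcd_le (N := H) (g := k)
    calc ((dyadicPairsGcd H k).card : ℝ) * (2 * ρ / (g ^ 2 / (4 * N ^ 2)) + 1)
        ≤ (2 * H / k : ℝ) ^ 2 * (2 * ρ / (g ^ 2 / (4 * N ^ 2)) + 1) := by gcongr
      _ = (2 * H / k : ℝ) * (2 * H / k) + 32 * ρ * H ^ 2 * N ^ 2 / (k ^ 2 * g ^ 2) := by field_simp; ring
      _ ≤ (2 * H / k : ℝ) * (2 * N / g) + 32 * ρ * H ^ 2 * N ^ 2 / (k ^ 2 * g ^ 2) := by gcongr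
      _ = _ := by field_simp; ring
  · have h1 := hcard (dyadicPairsGcd N g) (dyadicPairsGcd H k)
      (fun b a => |(a.1 : ℝ) / a.2 - (b.1 / b.2) ^ 2| ≤ ρ) (2 * ρ / (k ^ 2 / (4 * H ^ 2)) + 1) (by
        intro b _
        refine card_le_of_pairwise_dist _ (fun b => (b.1 : ℝ) / b.2) (by positivity) (by positivity) ?_ ?_
        · intro x hx y hy hxy
          exact ratio_spacing hk (Finset.mem_filter.1 hx).1 (Finset.mem_filter.1 hy).1 hxy
        · intro x hx y hy
          rw [Finset.mem_filter] at hx hy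
          have a1 := abs_le.1 hx.2
          have a2 := abs_le.1 hy.2
          rw [abs_le]; constructor <;> linarith)
    have hswap : (((dyadicPairsGcd H k ×ˢ dyadicPairsGcd N g).filter fun z : (ℕ × ℕ) × (ℕ × ℕ) =>
      |(z.1.1 : ℝ) / z.1.2 - (z.2.1 / z.2.2) ^ 2| ≤ ρ).card) = (((dyadicPairsGcd N g ×ˢ dyadicPairsGcd H k).filter fun z : (ℕ × ℕ) × (ℕ × ℕ) =>
      |(z.2.1 : ℝ) / z.2.2 - (z.1.1 / z.1.2) ^ 2| ≤ ρ).card) := by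
      refine Finset.card_bij' (fun z _ => z.swap) (fun z _ => z.swap) ?_ ?_ ?_ ?_ <;>
        simp +contextual [and_comm]
    rw [hswap]
    refine h1.trans ?_
    have hA := card_dyadicPairsGcd_le (N := N) (g := g)
    calc ((dyadicPairsGcd N g).card : ℝ) * (2 * ρ / (k ^ 2 / (4 * H ^ 2)) + 1)
        ≤ (2 * N / g : ℝ) ^ 2 * (2 * ρ / (k ^ 2 / (4 * H ^ 2)) + 1) := by gcongr
      _ = (2 * N / g : ℝ) * (2 * N / g) + 32 * ρ * H ^ 2 * N ^ 2 / (k ^ 2 * g ^ 2) := by field_simp; ring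
      _ ≤ (2 * H / k : ℝ) * (2 * N / g) + 32 * ρ * H ^ 2 * N ^ 2 / (k ^ 2 * g ^ 2) := by gcongr
      _ = _ := by field_simp; ring

theorem sum_inv_Icc_le {n : ℕ} : ∑ k ∈ Finset.Icc 1 n, (1 : ℝ) / k ≤ 1 + Real.log n := by
  have := harmonic_le_one_add_log n
  rw [harmonic_eq_sum_Icc] at this
  push_cast at this
  simpa using this

/-- Number of quadruples with `|h / n ^ 2 - h' / n' ^ 2| ≤ ρ H / N ^ 2`. -/
theorem card_close_points_le {H N : ℕ} (hH : 0 < H) (hN : 0 < N) {ρ : ℝ} (hρ : 0 ≤ ρ) :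
    ((((Finset.Ico H (2 * H) ×ˢ Finset.Ico N (2 * N)) ×ˢ (Finset.Ico H (2 * H) ×ˢ Finset.Ico N (2 * N))).filter
      fun z : (ℕ × ℕ) × (ℕ × ℕ) => |(z.1.1 : ℝ) / z.1.2 ^ 2 - z.2.1 / z.2.2 ^ 2| ≤ ρ * (H / N ^ 2)).card : ℝ) ≤
      128 * (H * N + ρ * H ^ 2 * N ^ 2) * ((1 + Real.log (2 * H)) * (1 + Real.log (2 * N))) := by
  classical
  have hHr : (0 : ℝ) < H := by exact_mod_cast hH
  have hNr : (0 : ℝ) < N := by exact_mod_cast hN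
  -- The quadruples are sorted by gcd(h, h') and gcd(n, n'). The distance of h/n^2 and h'/n'^2 is
  -- multiplied by n^2/h' ≤ 4 N^2/H to become that of h/h' and (n/n')^2, whence 4ρ. The logarithms
  -- come from summing 1/(kg) over the two gcds.
  set T := ((Finset.Icc 1 (2 * H)) ×ˢ (Finset.Icc 1 (2 * N))).biUnion (fun kg =>
    (dyadicPairsGcd H kg.1 ×ˢ dyadicPairsGcd N kg.2).filter fun z : (ℕ × ℕ) × (ℕ × ℕ) =>
      |(z.1.1 : ℝ) / z.1.2 - (z.2.1 / z.2.2) ^ 2| ≤ 4 * ρ) with hT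
  have h1 : (((Finset.Ico H (2 * H) ×ˢ Finset.Ico N (2 * N)) ×ˢ (Finset.Ico H (2 * H) ×ˢ Finset.Ico N (2 * N))).filter
      fun z : (ℕ × ℕ) × (ℕ × ℕ) => |(z.1.1 : ℝ) / z.1.2 ^ 2 - z.2.1 / z.2.2 ^ 2| ≤ ρ * (H / N ^ 2)).card ≤ T.card := by
    refine Finset.card_le_card_of_injOn (fun z => ((z.1.1, z.2.1), (z.1.2, z.2.2))) ?_ ?_
    · rintro ⟨⟨h, n⟩, h', n'⟩ hz
      simp only [Finset.coe_filter, Finset.mem_product, Finset.mem_Ico, Set.mem_ofPred_eq] at hz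
      obtain ⟨⟨⟨⟨a1, a2⟩, a3, a4⟩, ⟨a5, a6⟩, a7, a8⟩, hz⟩ := hz
      simp only [hT, Finset.coe_biUnion, Set.mem_iUnion, Finset.mem_coe, Finset.mem_filter, Finset.mem_product,
        dyadicPairsGcd, Finset.mem_Ico, Finset.mem_Icc]
      refine ⟨(Nat.gcd h h', Nat.gcd n n'), ⟨⟨?_, ?_⟩, ?_, ?_⟩, ⟨⟨⟨⟨a1, a2⟩, a5, a6⟩, rfl⟩, ⟨⟨a3, a4⟩, a7, a8⟩, rfl⟩, ?_⟩
      · exact Nat.gcd_pos_of_pos_left _ (by omega)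
      · exact (Nat.gcd_le_left _ (by omega)).trans a2.le
      · exact Nat.gcd_pos_of_pos_left _ (by omega)
      · exact (Nat.gcd_le_left _ (by omega)).trans a4.le
      · have hh' : (0 : ℝ) < h' := by
          have : 0 < h' := by omega
          exact_mod_cast this
        have hn : (0 : ℝ) < n := by
          have : 0 < n := by omega
          exact_mod_cast this
        have hn' : (0 : ℝ) < n' := by
          have : 0 < n' := by omega
          exact_mod_cast this
        have e : (h : ℝ) / h' - (n / n') ^ 2 = (h / n ^ 2 - h' / n' ^ 2) * (n ^ 2 / h') := by field_simp
        rw [e, abs_mul, abs_of_pos (by positivity : (0 : ℝ) < n ^ 2 / h')]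
        have a4r : (n : ℝ) ≤ 2 * N := by exact_mod_cast a4.le
        have a5r : (H : ℝ) ≤ h' := by exact_mod_cast a5
        calc _ ≤ ρ * (H / N ^ 2) * ((2 * N) ^ 2 / H) := by gcongr
          _ = 4 * ρ := by field_simp; ring
    · rintro ⟨⟨h, n⟩, h', n'⟩ _ ⟨⟨k, m⟩, k', m'⟩ _ he
      simp only [Prod.mk.injEq] at he
      obtain ⟨⟨rfl, rfl⟩, rfl, rfl⟩ := he
      rfl
  have h2 : (T.card : ℝ) ≤ ∑ kg ∈ (Finset.Icc 1 (2 * H)) ×ˢ (Finset.Icc 1 (2 * N)),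
      (128 * (H * N + ρ * H ^ 2 * N ^ 2)) * ((1 / kg.1) * (1 / kg.2)) := by
    refine (Nat.cast_le.2 Finset.card_biUnion_le).trans ?_
    push_cast
    refine Finset.sum_le_sum fun kg hkg => ?_
    rw [Finset.mem_product, Finset.mem_Icc, Finset.mem_Icc] at hkg
    refine (card_close_ratios_gcd_le (by omega) (by omega) hH hN (by positivity)).trans ?_
    have hk : (1 : ℝ) ≤ kg.1 := by exact_mod_cast hkg.1.1
    have hg : (1 : ℝ) ≤ kg.2 := by exact_mod_cast hkg.2.1
    have e1 : 32 * (4 * ρ) * (H : ℝ) ^ 2 * N ^ 2 / (kg.1 ^ 2 * kg.2 ^ 2) ≤ 32 * (4 * ρ) * (H : ℝ) ^ 2 * N ^ 2 / (kg.1 * kg.2) := by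
      have f1 : (kg.1 : ℝ) ≤ kg.1 ^ 2 := by nlinarith
      have f2 : (kg.2 : ℝ) ≤ kg.2 ^ 2 := by nlinarith
      gcongr
    have e2 : (4 : ℝ) * H * N / (kg.1 * kg.2) ≤ 128 * H * N / (kg.1 * kg.2) := by
      gcongr; norm_num
    refine (add_le_add e2 e1).trans (le_of_eq ?_)
    field_simp
    ring
  refine (Nat.cast_le.2 h1).trans (h2.trans ?_)
  rw [← Finset.mul_sum, Finset.sum_product' _ _ (fun a b : ℕ => (1 / (a : ℝ)) * (1 / (b : ℝ))), ← Finset.sum_mul_sum]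
  have l1 := sum_inv_Icc_le (n := 2 * H)
  have l2 := sum_inv_Icc_le (n := 2 * N)
  push_cast at l1 l2
  gcongr
  exact le_trans (Finset.sum_nonneg (s := Finset.Icc 1 (2 * H)) (f := fun k : ℕ => (1 : ℝ) / k)
    fun k _ => by positivity) l1

/-! ### Bilinear sums -/

/-- Cauchy's inequality, after a partition of the inner variable into classes. -/
theorem norm_sq_bilinear_le {ι : Type*} (P : Finset ι) (J : Finset ℕ) (a : ℕ → ℂ)
    (ha : ∀ m, ‖a m‖ ≤ 1) (z : ι → ℕ → ℂ) (κ : ι → ℕ) (Q : ℕ) (hκ : ∀ p ∈ P, κ p < Q) :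
    ‖∑ m ∈ J, a m * ∑ p ∈ P, z p m‖ ^ 2 ≤ J.card * (Q * ∑ w ∈ (P ×ˢ P).filter fun w => κ w.1 = κ w.2,
      ‖∑ m ∈ J, z w.1 m * (starRingEnd ℂ) (z w.2 m)‖) := by
  have h1 : ‖∑ m ∈ J, a m * ∑ p ∈ P, z p m‖ ≤ ∑ m ∈ J, ‖∑ p ∈ P, z p m‖ := by
    refine (norm_sum_le _ _).trans (Finset.sum_le_sum fun m _ => ?_)
    rw [norm_mul]
    exact mul_le_of_le_one_left (norm_nonneg _) (ha m)
  have h2 : ‖∑ m ∈ J, a m * ∑ p ∈ P, z p m‖ ^ 2 ≤ J.card * ∑ m ∈ J, ‖∑ p ∈ P, z p m‖ ^ 2 :=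
    (pow_le_pow_left₀ (norm_nonneg _) h1 2).trans sq_sum_le_card_mul_sum_sq
  refine h2.trans (mul_le_mul_of_nonneg_left ?_ (Nat.cast_nonneg _))
  -- This second use of Cauchy's inequality, over the Q classes, costs a factor Q; in exchange,
  -- expanding the square only produces pairs belonging to the same class.
  have h3 : ∀ m, ‖∑ p ∈ P, z p m‖ ^ 2 ≤ Q * ∑ k ∈ Finset.range Q, ‖∑ p ∈ P with κ p = k, z p m‖ ^ 2 := by
    intro m
    rw [← Finset.sum_fiberwise_of_maps_to (t := Finset.range Q) (g := κ) (fun p hp => Finset.mem_range.2 (hκ p hp))]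
    refine (pow_le_pow_left₀ (norm_nonneg _) (norm_sum_le _ _) 2).trans ?_
    have := sq_sum_le_card_mul_sum_sq (s := Finset.range Q) (f := fun k => ‖∑ p ∈ P with κ p = k, z p m‖)
    rwa [Finset.card_range] at this
  have h4 : ∀ k, ∑ m ∈ J, ‖∑ p ∈ P with κ p = k, z p m‖ ^ 2 ≤
      ∑ p ∈ P with κ p = k, ∑ q ∈ P with κ q = k, ‖∑ m ∈ J, z p m * (starRingEnd ℂ) (z q m)‖ := by
    intro k
    have e : ((∑ m ∈ J, ‖∑ p ∈ P with κ p = k, z p m‖ ^ 2 : ℝ) : ℂ) =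
        ∑ p ∈ P with κ p = k, ∑ q ∈ P with κ q = k, ∑ m ∈ J, z p m * (starRingEnd ℂ) (z q m) := by
      push_cast
      simp_rw [← Complex.mul_conj', map_sum, Finset.sum_mul_sum]
      rw [Finset.sum_comm]
      refine Finset.sum_congr rfl fun p _ => ?_
      rw [Finset.sum_comm]
    have h0 : 0 ≤ ∑ m ∈ J, ‖∑ p ∈ P with κ p = k, z p m‖ ^ 2 := Finset.sum_nonneg fun m _ => by positivity
    rw [← abs_of_nonneg h0, ← Real.norm_eq_abs, ← Complex.norm_real, e]
    exact (norm_sum_le _ _).trans (Finset.sum_le_sum fun p _ => norm_sum_le _ _)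
  calc ∑ m ∈ J, ‖∑ p ∈ P, z p m‖ ^ 2
      ≤ ∑ m ∈ J, Q * ∑ k ∈ Finset.range Q, ‖∑ p ∈ P with κ p = k, z p m‖ ^ 2 := Finset.sum_le_sum fun m _ => h3 m
    _ = Q * ∑ k ∈ Finset.range Q, ∑ m ∈ J, ‖∑ p ∈ P with κ p = k, z p m‖ ^ 2 := by
        rw [← Finset.mul_sum, Finset.sum_comm]
    _ ≤ Q * ∑ k ∈ Finset.range Q, ∑ p ∈ P with κ p = k, ∑ q ∈ P with κ q = k,
          ‖∑ m ∈ J, z p m * (starRingEnd ℂ) (z q m)‖ := by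
        gcongr with k _
        exact h4 k
    _ = _ := by
        congr 1
        rw [Finset.sum_filter, Finset.sum_product,
          ← Finset.sum_fiberwise_of_maps_to (s := P) (t := Finset.range Q) (g := κ) (fun p hp => Finset.mem_range.2 (hκ p hp))]
        refine Finset.sum_congr rfl fun k _ => Finset.sum_congr rfl fun p hp => ?_
        rw [Finset.sum_filter]
        refine Finset.sum_congr rfl fun q _ => ?_
        have := (Finset.mem_filter.1 hp).2
        simp only [this, eq_comm]

/-- A dyadic majorant of min(1, t^{-1/2}): the least j with t ≤ 4^j contributes 2^{-j}, and √t >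
2^{j-1} as soon as j > 0. It turns the bound 1/√t, summed over pairs of points, into counts of pairs
with t ≤ 4^j. -/
theorem one_inv_sqrt_le_sum {t : ℝ} (L : ℕ) (hL : t ≤ 4 ^ L) :
    (t ≤ 1 → 1 ≤ 2 * ∑ j ∈ Finset.range (L + 1), (1 / 2 : ℝ) ^ j * (if t ≤ 4 ^ j then 1 else 0)) ∧
    (1 < t → 1 / √t ≤ 2 * ∑ j ∈ Finset.range (L + 1), (1 / 2 : ℝ) ^ j * (if t ≤ 4 ^ j then 1 else 0)) := by
  have hge : ∀ j ≤ L, t ≤ 4 ^ j → (1 / 2 : ℝ) ^ j ≤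
      ∑ j ∈ Finset.range (L + 1), (1 / 2 : ℝ) ^ j * (if t ≤ 4 ^ j then 1 else 0) := by
    intro j hj hj1
    have := Finset.single_le_sum (s := Finset.range (L + 1)) (f := fun j => (1 / 2 : ℝ) ^ j * (if t ≤ 4 ^ j then 1 else 0))
      (fun i _ => by split_ifs <;> positivity) (Finset.mem_range.2 (by omega : j < L + 1))
    simpa only [if_pos hj1, mul_one] using this
  constructor
  · intro h1
    have := hge 0 (Nat.zero_le _) (by simpa using h1)
    rw [pow_zero] at this
    linarith
  intro h1
  have hex : ∃ j, t ≤ 4 ^ j := ⟨L, hL⟩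
  set j := Nat.find hex with hj
  have hj1 : t ≤ 4 ^ j := Nat.find_spec hex
  have hjL : j ≤ L := Nat.find_min' hex hL
  refine le_trans ?_ (mul_le_mul_of_nonneg_left (hge j hjL hj1) (by norm_num))
  have hpos : 0 < j := by
    rcases Nat.eq_zero_or_pos j with h0 | hpos
    · rw [h0, pow_zero] at hj1; linarith
    · exact hpos
  have hlt : (4 : ℝ) ^ (j - 1) < t := not_le.1 (Nat.find_min hex (by omega))
  have hs : (2 : ℝ) ^ (j - 1) ≤ √t := by
    refine Real.le_sqrt_of_sq_le ?_
    rw [← pow_mul, mul_comm, pow_mul]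
    norm_num
    exact hlt.le
  have e : 2 * (1 / 2 : ℝ) ^ j = 1 / 2 ^ (j - 1) := by
    obtain ⟨i, hi⟩ : ∃ i, j = i + 1 := ⟨j - 1, by omega⟩
    rw [hi, Nat.add_sub_cancel, pow_succ, one_div_pow]; ring
  rw [e]
  gcongr

/-- The bilinear sum over `D < m n ≤ 2 D`, with `D = 2 M N`. -/
theorem norm_sq_typeII_le {H N K : ℕ} (hH : 0 < H) (hN : 0 < N) (hK : 0 < K) {x M : ℝ} (hx : 0 < x)
    (hM : 1 ≤ M) (a : ℕ → ℂ) (ha : ∀ m, ‖a m‖ ≤ 1) (c : ℕ × ℕ → ℂ) (hc : ∀ p, ‖c p‖ ≤ 1) {F : ℝ}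
    (hF : F = x * H / (N ^ 2 * M ^ 2)) (L : ℕ) (hL : F / K ≤ 4 ^ L) :
    ‖∑ p ∈ Finset.Ico H (2 * H) ×ˢ Finset.Ico N (2 * N),
      ∑ m ∈ Finset.Ioc ⌊2 * M * N / p.2⌋₊ ⌊2 * (2 * M * N) / p.2⌋₊,
        c p * a m * expTwoPi (p.1 * x / (m * p.2 : ℝ) ^ 2)‖ ^ 2 ≤
      (10 : ℝ) ^ 20 * (L + 1) * ((1 + Real.log (2 * H)) * (1 + Real.log (2 * N))) * (H * N * M) ^ 2 *
        (√(F * K) / (H * N * M) + √(F / K) / M + K / (H * N) + √(K / F)) := by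
  have hHr : (0 : ℝ) < H := by exact_mod_cast hH
  have hNr : (0 : ℝ) < N := by exact_mod_cast hN
  have hKr : (0 : ℝ) < K := by exact_mod_cast hK
  have hM0 : 0 < M := by linarith
  have hF0 : 0 < F := by rw [hF]; positivity
  set P := Finset.Ico H (2 * H) ×ˢ Finset.Ico N (2 * N) with hP
  set J := Finset.Icc 1 ⌊4 * M⌋₊ with hJ
  set I : ℕ × ℕ → Finset ℕ := fun p => Finset.Ioc ⌊2 * M * N / p.2⌋₊ ⌊2 * (2 * M * N) / p.2⌋₊ with hI
  set ν : ℕ × ℕ → ℝ := fun p => (p.1 : ℝ) / p.2 ^ 2 with hν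
  -- The condition D < mn ≤ 2D is put inside z, so that the range of m no longer depends on n. After
  -- the square is opened it reappears as an intersection of two intervals, again an interval.
  set z : ℕ × ℕ → ℕ → ℂ := fun p m => if m ∈ I p then c p * expTwoPi (x * ν p / m ^ 2) else 0 with hz
  -- The values ν = h/n^2 lie below 2H/N^2. They are cut into 2K classes of length H/(K N^2).
  set κ : ℕ × ℕ → ℕ := fun p => ⌊ν p * (K * N ^ 2 / H)⌋₊ with hκ
  have hPmem : ∀ p ∈ P, (H ≤ p.1 ∧ p.1 < 2 * H) ∧ N ≤ p.2 ∧ p.2 < 2 * N := by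
    intro p hp; simpa [hP] using hp
  have hn0 : ∀ p ∈ P, (0 : ℝ) < p.2 := fun p hp => by
    have := (hPmem p hp).2.1
    exact_mod_cast (by omega : 0 < p.2)
  have hJcard : (J.card : ℝ) ≤ 4 * M := by
    rw [hJ, Nat.card_Icc, Nat.add_sub_cancel]
    exact Nat.floor_le (by positivity)
  have hIJ : ∀ p ∈ P, I p ⊆ J := by
    intro p hp m hm
    simp only [hI, Finset.mem_Ioc] at hm
    rw [hJ, Finset.mem_Icc]
    refine ⟨by omega, hm.2.trans (Nat.floor_le_floor ?_)⟩
    rw [div_le_iff₀ (hn0 p hp)]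
    have : (N : ℝ) ≤ p.2 := by exact_mod_cast (hPmem p hp).2.1
    nlinarith
  have hS : ∑ p ∈ P, ∑ m ∈ I p, c p * a m * expTwoPi (p.1 * x / (m * p.2 : ℝ) ^ 2) =
      ∑ m ∈ J, a m * ∑ p ∈ P, z p m := by
    simp_rw [Finset.mul_sum]
    rw [Finset.sum_comm (s := J)]
    refine Finset.sum_congr rfl fun p hp => ?_
    rw [← Finset.inter_eq_right.2 (hIJ p hp), ← Finset.filter_mem_eq_inter, Finset.sum_filter]
    refine Finset.sum_congr rfl fun m _ => ?_
    simp only [hz]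
    split_ifs with h
    · have e : (p.1 : ℝ) * x / (m * p.2 : ℝ) ^ 2 = x * ν p / m ^ 2 := by
        rw [hν]; simp only [mul_pow]; rw [mul_div_assoc', div_div]; ring
      rw [e]; ring
    · simp
  rw [hS]
  have hκlt : ∀ p ∈ P, κ p < 2 * K := by
    intro p hp
    have h1 := hPmem p hp
    have hp0 := hn0 p hp
    simp only [hκ, hν]
    rw [Nat.floor_lt (by positivity)]
    push_cast
    have e1 : (p.1 : ℝ) < 2 * H := by exact_mod_cast h1.1.2
    have e2 : (N : ℝ) ^ 2 ≤ p.2 ^ 2 := by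
      have : (N : ℝ) ≤ p.2 := by exact_mod_cast h1.2.1
      gcongr
    rw [div_mul_div_comm, div_lt_iff₀ (by positivity)]
    calc (p.1 : ℝ) * ((K : ℝ) * (N : ℝ) ^ 2) < 2 * H * ((K : ℝ) * (N : ℝ) ^ 2) := by gcongr
      _ ≤ 2 * H * ((K : ℝ) * (p.2 : ℝ) ^ 2) := by gcongr
      _ = _ := by ring
  have hκν : ∀ w ∈ (P ×ˢ P).filter (fun w => κ w.1 = κ w.2), |ν w.1 - ν w.2| ≤ 1 / K * (H / N ^ 2) := by
    intro w hw
    rw [Finset.mem_filter] at hw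
    have h0 := hw.2
    simp only [hκ] at h0
    have q1 : 0 ≤ ν w.1 * (K * N ^ 2 / H) := by simp only [hν]; positivity
    have q2 : 0 ≤ ν w.2 * (K * N ^ 2 / H) := by simp only [hν]; positivity
    have a1 := Nat.floor_le q1
    have a2 := Nat.lt_floor_add_one (ν w.1 * (K * N ^ 2 / H))
    have b1 := Nat.floor_le q2
    have b2 := Nat.lt_floor_add_one (ν w.2 * (K * N ^ 2 / H))
    rw [h0] at a1 a2
    have h3 : |(ν w.1 - ν w.2) * (K * N ^ 2 / H)| ≤ 1 := by rw [abs_le]; constructor <;> linarith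
    rw [abs_mul, abs_of_pos (by positivity : (0 : ℝ) < K * N ^ 2 / H)] at h3
    have e : 1 / (K : ℝ) * (H / N ^ 2) = 1 / (K * N ^ 2 / H) := by field_simp
    rw [e, le_div_iff₀ (by positivity)]
    exact h3
  set τ : (ℕ × ℕ) × (ℕ × ℕ) → ℝ := fun w => |ν w.1 - ν w.2| * (N ^ 2 / H) with hτ
  -- F τ is the size of the phase difference at m ≈ M. If it is at most 1 the sum over m is
  -- estimated trivially by O(M); otherwise the second derivative test gives √(F τ) + M/√(F τ), and
  -- F τ ≤ F/K within a class.
  have hT : ∀ w ∈ (P ×ˢ P).filter (fun w => κ w.1 = κ w.2),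
      ‖∑ m ∈ J, z w.1 m * (starRingEnd ℂ) (z w.2 m)‖ ≤ 10 ^ 13 * (√(F / K) + M * (2 * ∑ j ∈ Finset.range (L + 1),
        (1 / 2 : ℝ) ^ j * (if F * τ w ≤ 4 ^ j then 1 else 0))) := by
    intro w hw
    have hτK : F * τ w ≤ F / K := by
      have := hκν w hw
      rw [div_eq_mul_one_div]
      refine mul_le_mul_of_nonneg_left ?_ hF0.le
      simp only [hτ]
      calc |ν w.1 - ν w.2| * ((N : ℝ) ^ 2 / H) ≤ 1 / (K : ℝ) * ((H : ℝ) / (N : ℝ) ^ 2) * ((N : ℝ) ^ 2 / H) := by gcongr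
        _ = 1 / (K : ℝ) := by field_simp
    have hw' := Finset.mem_product.1 (Finset.mem_filter.1 hw).1
    have hbd : ‖∑ m ∈ J, z w.1 m * (starRingEnd ℂ) (z w.2 m)‖ ≤
        ‖∑ m ∈ I w.1 ∩ I w.2, expTwoPi (x * (ν w.1 - ν w.2) / m ^ 2)‖ := by
      have e : ∑ m ∈ J, z w.1 m * (starRingEnd ℂ) (z w.2 m) =
          c w.1 * (starRingEnd ℂ) (c w.2) * ∑ m ∈ I w.1 ∩ I w.2, expTwoPi (x * (ν w.1 - ν w.2) / m ^ 2) := by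
        rw [Finset.mul_sum]
        have hsub : I w.1 ∩ I w.2 ⊆ J := Finset.inter_subset_left.trans (hIJ _ hw'.1)
        rw [← Finset.inter_eq_right.2 hsub, ← Finset.filter_mem_eq_inter, Finset.sum_filter]
        refine Finset.sum_congr rfl fun m _ => ?_
        simp only [hz, Finset.mem_inter]
        by_cases h1 : m ∈ I w.1 <;> by_cases h2 : m ∈ I w.2 <;> simp only [h1, h2, if_true, if_false, and_true, and_false,
          map_zero, mul_zero, zero_mul]
        rw [map_mul, conj_expTwoPi]
        have : x * (ν w.1 - ν w.2) / (m : ℝ) ^ 2 = x * ν w.1 / m ^ 2 + -(x * ν w.2 / m ^ 2) := by ring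
        rw [this, expTwoPi_add]; ring
      rw [e, norm_mul, norm_mul, RCLike.norm_conj]
      have := mul_le_one₀ (hc w.1) (norm_nonneg _) (hc w.2)
      exact mul_le_of_le_one_left (norm_nonneg _) this
    refine hbd.trans ?_
    obtain ⟨s1, s2⟩ := one_inv_sqrt_le_sum L (hτK.trans hL)
    set X := 2 * ∑ j ∈ Finset.range (L + 1), (1 / 2 : ℝ) ^ j * (if F * τ w ≤ 4 ^ j then 1 else 0) with hX
    rcases le_or_gt (F * τ w) 1 with h1 | h1
    · have htriv : ‖∑ m ∈ I w.1 ∩ I w.2, expTwoPi (x * (ν w.1 - ν w.2) / m ^ 2)‖ ≤ 4 * M := by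
        refine (norm_sum_le _ _).trans ?_
        simp only [norm_expTwoPi, Finset.sum_const, nsmul_eq_mul, mul_one]
        refine le_trans ?_ hJcard
        exact_mod_cast Finset.card_le_card (Finset.inter_subset_left.trans (hIJ _ hw'.1))
      have := s1 h1
      have : 0 ≤ √(F / K) := Real.sqrt_nonneg _
      nlinarith
    · have := s2 h1
      have hτ0 : 0 < τ w := by
        by_contra hneg
        have := mul_nonneg hF0.le (sub_nonneg.2 (not_lt.1 hneg))
        nlinarith
      have hne : x * (ν w.1 - ν w.2) ≠ 0 := by
        intro h0
        rcases mul_eq_zero.1 h0 with h | h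
        · linarith
        · simp [hτ, h] at hτ0
      have hIeq : I w.1 ∩ I w.2 = Finset.Ico (max ⌊2 * M * N / w.1.2⌋₊ ⌊2 * M * N / w.2.2⌋₊ + 1)
          (min ⌊2 * (2 * M * N) / w.1.2⌋₊ ⌊2 * (2 * M * N) / w.2.2⌋₊ + 1) := by
        ext m
        simp only [hI, Finset.mem_inter, Finset.mem_Ioc, Finset.mem_Ico]
        omega
      have hv := norm_sum_expTwoPi_div_sq_le (c := x * (ν w.1 - ν w.2)) hne hM0
        (a := max ⌊2 * M * N / w.1.2⌋₊ ⌊2 * M * N / w.2.2⌋₊ + 1)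
        (b := min ⌊2 * (2 * M * N) / w.1.2⌋₊ ⌊2 * (2 * M * N) / w.2.2⌋₊ + 1) (by
          have hp0 := hn0 _ hw'.1
          have e1 : M ≤ 2 * M * N / w.1.2 := by
            rw [le_div_iff₀ hp0]
            have : (w.1.2 : ℝ) ≤ 2 * N := by exact_mod_cast (hPmem _ hw'.1).2.2.le
            nlinarith
          have e2 := Nat.lt_floor_add_one (2 * M * N / (w.1.2 : ℝ))
          have e3 : (⌊2 * M * N / (w.1.2 : ℝ)⌋₊ : ℝ) ≤ (max ⌊2 * M * N / (w.1.2 : ℝ)⌋₊ ⌊2 * M * N / (w.2.2 : ℝ)⌋₊ : ℕ) := by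
            exact_mod_cast le_max_left _ _
          rw [Nat.cast_add, Nat.cast_one]
          linarith) (by
          have hp0 := hn0 _ hw'.1
          have e1 : 2 * (2 * M * N) / w.1.2 ≤ 4 * M := by
            rw [div_le_iff₀ hp0]
            have : (N : ℝ) ≤ w.1.2 := by exact_mod_cast (hPmem _ hw'.1).2.1
            nlinarith
          have e2 := Nat.floor_le (by positivity : 0 ≤ 2 * (2 * M * N) / (w.1.2 : ℝ))
          have e3 : (min ⌊2 * (2 * M * N) / (w.1.2 : ℝ)⌋₊ ⌊2 * (2 * M * N) / (w.2.2 : ℝ)⌋₊ : ℕ) ≤ (⌊2 * (2 * M * N) / (w.1.2 : ℝ)⌋₊ : ℝ) := by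
            exact_mod_cast min_le_left _ _
          rw [Nat.cast_add, Nat.cast_one]
          linarith)
      rw [hIeq]
      refine hv.trans ?_
      have hc1 : |x * (ν w.1 - ν w.2)| = F * τ w * M ^ 2 := by
        rw [abs_mul, abs_of_pos hx, hF]
        simp only [hτ]
        field_simp
      have hsq : √|x * (ν w.1 - ν w.2)| = √(F * τ w) * M := by
        rw [hc1, Real.sqrt_mul (by positivity), Real.sqrt_sq hM0.le]
      rw [hsq]
      have h5 : 0 < √(F * τ w) := Real.sqrt_pos.2 (by linarith)
      have h6 : √(F * τ w) ≤ √(F / K) := Real.sqrt_le_sqrt hτK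
      have e1 : √(F * τ w) * M / M = √(F * τ w) := by field_simp
      have e2 : M ^ 2 / (√(F * τ w) * M) = M * (1 / √(F * τ w)) := by field_simp
      rw [e1, e2]
      gcongr
  have hcount : ∀ ρ : ℝ, 0 ≤ ρ → (((P ×ˢ P).filter fun w => |ν w.1 - ν w.2| ≤ ρ * (H / N ^ 2)).card : ℝ) ≤
      128 * (H * N + ρ * H ^ 2 * N ^ 2) * ((1 + Real.log (2 * H)) * (1 + Real.log (2 * N))) := fun ρ hρ =>
    card_close_points_le hH hN hρ
  set Λ := (1 + Real.log (2 * H)) * (1 + Real.log (2 * N)) with hΛ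
  have hΛ0 : 0 ≤ Λ := by
    have h1 : 0 ≤ Real.log (2 * H) := Real.log_nonneg (by
      have : (1 : ℝ) ≤ H := by exact_mod_cast hH
      linarith)
    have h2 : 0 ≤ Real.log (2 * N) := Real.log_nonneg (by
      have : (1 : ℝ) ≤ N := by exact_mod_cast hN
      linarith)
    positivity
  set r := √(F / K) with hr
  have hr0 : 0 < r := Real.sqrt_pos.2 (by positivity)
  have hFr : F = r ^ 2 * K := by rw [hr, Real.sq_sqrt (by positivity)]; field_simp
  set W := (P ×ˢ P).filter (fun w => κ w.1 = κ w.2) with hW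
  have hW1 : (W.card : ℝ) ≤ 128 * (H * N + 1 / K * H ^ 2 * N ^ 2) * Λ := by
    refine le_trans ?_ (hcount (1 / K) (by positivity))
    refine Nat.cast_le.2 (Finset.card_le_card fun w hw => ?_)
    rw [Finset.mem_filter]
    exact ⟨(Finset.mem_filter.1 hw).1, hκν w hw⟩
  have hWj : ∀ j : ℕ, (1 / 2 : ℝ) ^ j * ∑ w ∈ W, (if F * τ w ≤ 4 ^ j then (1 : ℝ) else 0) ≤
      128 * (H * N + 1 / (r * K) * H ^ 2 * N ^ 2) * Λ := by
    intro j
    have h1 : ∑ w ∈ W, (if F * τ w ≤ 4 ^ j then (1 : ℝ) else 0) ≤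
        128 * (H * N + min (1 / (K : ℝ)) (4 ^ j / F) * H ^ 2 * N ^ 2) * Λ := by
      refine le_trans ?_ (hcount (min (1 / (K : ℝ)) (4 ^ j / F)) (by positivity))
      rw [← Finset.sum_filter, Finset.sum_const, nsmul_eq_mul, mul_one]
      refine Nat.cast_le.2 (Finset.card_le_card fun w hw => ?_)
      rw [Finset.mem_filter] at hw ⊢
      refine ⟨(Finset.mem_filter.1 hw.1).1, ?_⟩
      rw [min_mul_of_nonneg _ _ (by positivity), le_min_iff]
      refine ⟨hκν w hw.1, ?_⟩
      have h2 := hw.2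
      simp only [hτ] at h2
      have e : |ν w.1 - ν w.2| = F * (|ν w.1 - ν w.2| * (N ^ 2 / H)) * (1 / F * (H / N ^ 2)) := by field_simp
      rw [e]
      calc F * (|ν w.1 - ν w.2| * (N ^ 2 / H)) * (1 / F * (H / N ^ 2)) ≤ 4 ^ j * (1 / F * (H / N ^ 2)) := by gcongr
        _ = _ := by ring
    have hj1 : (1 / 2 : ℝ) ^ j ≤ 1 := pow_le_one₀ (by norm_num) (by norm_num)
    have h2 : (1 / 2 : ℝ) ^ j * min (1 / (K : ℝ)) (4 ^ j / F) ≤ 1 / (r * K) := by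
      -- The minimum of two numbers is at most their geometric mean. The resulting factor 2^j is
      -- cancelled by the weight 2^{-j}, which makes the bound uniform in j.
      have hm : min (1 / (K : ℝ)) (4 ^ j / F) ≤ 2 ^ j / (r * K) := by
        have hA : (0 : ℝ) ≤ 1 / K := by positivity
        have hB : (0 : ℝ) ≤ 4 ^ j / F := by positivity
        have hAB : (1 / (K : ℝ)) * (4 ^ j / F) = (2 ^ j / (r * K)) ^ 2 := by
          rw [hFr, div_pow, ← pow_mul, mul_comm j 2, pow_mul]
          norm_num
          field_simp
        have hmm : min (1 / (K : ℝ)) (4 ^ j / F) ^ 2 ≤ (2 ^ j / (r * K)) ^ 2 := by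
          rw [← hAB, sq]
          exact mul_le_mul (min_le_left _ _) (min_le_right _ _) (le_min hA hB) hA
        exact (sq_le_sq₀ (le_min hA hB) (by positivity)).1 hmm
      calc (1 / 2 : ℝ) ^ j * min (1 / (K : ℝ)) (4 ^ j / F) ≤ (1 / 2 : ℝ) ^ j * (2 ^ j / (r * K)) := by gcongr
        _ = _ := by rw [one_div_pow]; field_simp
    calc (1 / 2 : ℝ) ^ j * ∑ w ∈ W, (if F * τ w ≤ 4 ^ j then (1 : ℝ) else 0)
        ≤ (1 / 2 : ℝ) ^ j * (128 * (H * N + min (1 / (K : ℝ)) (4 ^ j / F) * H ^ 2 * N ^ 2) * Λ) := by gcongr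
      _ = 128 * ((1 / 2 : ℝ) ^ j * (H * N) + ((1 / 2 : ℝ) ^ j * min (1 / (K : ℝ)) (4 ^ j / F)) * H ^ 2 * N ^ 2) * Λ := by ring
      _ ≤ 128 * (1 * (H * N) + 1 / (r * K) * H ^ 2 * N ^ 2) * Λ := by gcongr
      _ = _ := by ring
  have hsumT : ∑ w ∈ W, ‖∑ m ∈ J, z w.1 m * (starRingEnd ℂ) (z w.2 m)‖ ≤
      10 ^ 13 * (r * (128 * (H * N + 1 / K * H ^ 2 * N ^ 2) * Λ) +
        M * (2 * ((L + 1) * (128 * (H * N + 1 / (r * K) * H ^ 2 * N ^ 2) * Λ)))) := by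
    refine (Finset.sum_le_sum hT).trans ?_
    rw [← Finset.mul_sum, Finset.sum_add_distrib, Finset.sum_const, nsmul_eq_mul, ← Finset.mul_sum, ← Finset.mul_sum,
      Finset.sum_comm]
    have h3 : ∑ j ∈ Finset.range (L + 1), ∑ w ∈ W, (1 / 2 : ℝ) ^ j * (if F * τ w ≤ 4 ^ j then (1 : ℝ) else 0) ≤
        (L + 1) * (128 * (H * N + 1 / (r * K) * H ^ 2 * N ^ 2) * Λ) := by
      calc _ ≤ ∑ j ∈ Finset.range (L + 1), 128 * (H * N + 1 / (r * K) * H ^ 2 * N ^ 2) * Λ := by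
            refine Finset.sum_le_sum fun j _ => ?_
            rw [← Finset.mul_sum]
            exact hWj j
        _ = _ := by rw [Finset.sum_const, Finset.card_range, nsmul_eq_mul]; push_cast; ring
    rw [mul_comm (W.card : ℝ) r]
    gcongr
  have hmain := norm_sq_bilinear_le P J a ha z κ (2 * K) hκlt
  refine hmain.trans ?_
  have e1 : √(F * K) = r * K := by
    rw [hFr, show r ^ 2 * K * K = (r * K) ^ 2 by ring, Real.sqrt_sq (by positivity)]
  have e2 : √(K / F) = 1 / r := by
    rw [hFr, show (K : ℝ) / (r ^ 2 * K) = (1 / r) ^ 2 by field_simp, Real.sqrt_sq (by positivity)]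
  rw [e1, e2]
  calc (J.card : ℝ) * ((2 * K : ℕ) * ∑ w ∈ W, ‖∑ m ∈ J, z w.1 m * (starRingEnd ℂ) (z w.2 m)‖)
      ≤ (4 * M) * ((2 * K : ℕ) * (10 ^ 13 * (r * (128 * (H * N + 1 / K * H ^ 2 * N ^ 2) * Λ) +
        M * (2 * ((L + 1) * (128 * (H * N + 1 / (r * K) * H ^ 2 * N ^ 2) * Λ)))))) := by gcongr
    _ ≤ (4 * M) * ((2 * K : ℕ) * (10 ^ 13 * ((L + 1) * 2 * (r * (128 * (H * N + 1 / K * H ^ 2 * N ^ 2) * Λ)) +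
        M * (2 * ((L + 1) * (128 * (H * N + 1 / (r * K) * H ^ 2 * N ^ 2) * Λ)))))) := by
        have h1L : (1 : ℝ) ≤ (L + 1) * 2 := by
          have : (0 : ℝ) ≤ L := Nat.cast_nonneg _
          linarith
        have h0 : 0 ≤ r * (128 * (H * N + 1 / K * H ^ 2 * N ^ 2) * Λ) := by positivity
        have h2 := le_mul_of_one_le_left h0 h1L
        refine mul_le_mul_of_nonneg_left ?_ (by positivity)
        refine mul_le_mul_of_nonneg_left ?_ (by positivity)
        refine mul_le_mul_of_nonneg_left ?_ (by positivity)
        linarith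
    _ = 2048 * 10 ^ 13 * ((L + 1) * Λ * (H * N * M) ^ 2 * (r * K / (H * N * M) + r / M + K / (H * N) + 1 / r)) := by
        push_cast
        field_simp
        ring
    _ ≤ 10 ^ 20 * ((L + 1) * Λ * (H * N * M) ^ 2 * (r * K / (H * N * M) + r / M + K / (H * N) + 1 / r)) := by
        gcongr
        norm_num
    _ = _ := by ring

theorem exists_two_add_log_le_rpow {ε : ℝ} (hε : 0 < ε) :
    ∃ C : ℝ, 1 ≤ C ∧ ∀ x : ℝ, 1 ≤ x → 2 + Real.log (4 * x) ≤ C * x ^ ε := by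
  refine ⟨2 + Real.log 4 + 1 / ε, ?_, fun x hx => ?_⟩
  · have : 0 ≤ Real.log 4 := Real.log_nonneg (by norm_num)
    have : 0 < 1 / ε := by positivity
    linarith
  · have h4 : 0 ≤ Real.log 4 := Real.log_nonneg (by norm_num)
    have h1 : Real.log x ≤ x ^ ε / ε := Real.log_le_rpow_div (by linarith) hε
    have h2 : 1 ≤ x ^ ε := Real.one_le_rpow hx hε.le
    rw [Real.log_mul (by norm_num) (by linarith)]
    have e : (2 + Real.log 4 + 1 / ε) * x ^ ε = (2 + Real.log 4) * x ^ ε + x ^ ε / ε := by ring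
    rw [e]
    nlinarith

set_option maxHeartbeats 1000000 in
/-- The bilinear sum with `x = u ^ 22`, `u ^ 7 ≤ D ≤ u ^ 8` and `D ^ (1 / 4) ≪ N ≪ D ^ (1 / 2)`. -/
theorem exists_norm_typeII_le {ε : ℝ} (hε : 0 < ε) : ∃ C : ℝ, 1 ≤ C ∧
    ∀ u D : ℝ, 1 ≤ u → u ^ 7 ≤ D → D ≤ u ^ 8 → 8 ≤ D →
    ∀ H N : ℕ, 0 < H → 0 < N → (H : ℝ) * u ^ 14 ≤ D ^ 2 → D ≤ 16 * N ^ 4 → (N : ℝ) ^ 2 ≤ 2 * D →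
    ∀ (a : ℕ → ℂ) (_ : ∀ m, ‖a m‖ ≤ 1) (c : ℕ × ℕ → ℂ) (_ : ∀ p, ‖c p‖ ≤ 1),
    ‖∑ p ∈ Finset.Ico H (2 * H) ×ˢ Finset.Ico N (2 * N),
      ∑ m ∈ Finset.Ioc ⌊D / p.2⌋₊ ⌊2 * D / p.2⌋₊,
        c p * a m * expTwoPi (p.1 * u ^ 22 / (m * p.2 : ℝ) ^ 2)‖ ≤ C * (u ^ 22) ^ ε * (H * u ^ 7) := by
  obtain ⟨C₀, hC₀, hlog⟩ := exists_two_add_log_le_rpow (ε := ε / 2) (by positivity)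
  refine ⟨10 ^ 12 * C₀ ^ 2, by nlinarith [one_le_pow₀ (n := 2) hC₀], ?_⟩
  intro u D hu hD1 hD2 hD8 H N hH hN hHD hDN hND a ha c hc
  have hu0 : 0 < u := by linarith
  have hD0 : 0 < D := by linarith
  have hHr : (1 : ℝ) ≤ H := by exact_mod_cast hH
  have hNr : (1 : ℝ) ≤ N := by exact_mod_cast hN
  set x : ℝ := u ^ 22 with hx
  have hx1 : 1 ≤ x := one_le_pow₀ hu
  have hx0 : 0 < x := by linarith
  -- elementary inequalities between the parameters
  have hDx : D ≤ x := hD2.trans (pow_le_pow_right₀ hu (by norm_num))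
  have hNx : (N : ℝ) ≤ 2 * x := by nlinarith
  have hHx : (H : ℝ) ≤ 2 * x := by
    have h1 : (H : ℝ) * u ^ 14 ≤ u ^ 2 * u ^ 14 := by
      calc (H : ℝ) * u ^ 14 ≤ D ^ 2 := hHD
        _ ≤ (u ^ 8) ^ 2 := by gcongr
        _ = u ^ 2 * u ^ 14 := by ring
    have h2 : (H : ℝ) ≤ u ^ 2 := le_of_mul_le_mul_right h1 (by positivity)
    have : u ^ 2 ≤ x := pow_le_pow_right₀ hu (by norm_num)
    linarith
  -- Here N ≫ D^{1/4} and D ≤ u^8 are both used to the full: equality, up to constants, holds at D =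
  -- u^8 and N = D^{1/4}.
  have hΔN : D ^ 2 ≤ 2 * N * u ^ 14 := by
    have h1 : D ^ 7 ≤ u ^ 56 := by
      calc D ^ 7 ≤ (u ^ 8) ^ 7 := by gcongr
        _ = u ^ 56 := by ring
    have h2 : (D ^ 2) ^ 4 ≤ (2 * N * u ^ 14) ^ 4 := by
      calc (D ^ 2) ^ 4 = D * D ^ 7 := by ring
        _ ≤ (16 * N ^ 4) * u ^ 56 := by gcongr
        _ = _ := by ring
    exact (pow_le_pow_iff_left₀ (by positivity) (by positivity) (by norm_num)).1 h2
  set M : ℝ := D / (2 * N) with hM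
  have hM1 : 1 ≤ M := by
    rw [hM, le_div_iff₀ (by positivity), one_mul]
    have : (2 * (N : ℝ)) ^ 2 ≤ D ^ 2 := by nlinarith
    exact (pow_le_pow_iff_left₀ (by positivity) (by positivity) (by norm_num)).1 this
  have hMN : 2 * M * N = D := by rw [hM]; field_simp
  -- The number of classes is chosen to make K/(HN) of size q = u^14/D^2. This is the largest
  -- admissible value of the bracket in `norm_sq_typeII_le`, since (H N M)^2 q = (H u^7)^2/4. By
  -- `hΔN`, κ ≥ 1/2, so rounding up loses at most a factor 3.
  set κ : ℝ := H * N * u ^ 14 / D ^ 2 with hκ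
  have hκ0 : 0 < κ := by positivity
  have hκ2 : 1 / 2 ≤ κ := by
    rw [hκ, div_le_div_iff₀ (by norm_num) (by positivity)]
    have : (N : ℝ) * u ^ 14 ≤ H * (N * u ^ 14) := le_mul_of_one_le_left (by positivity) hHr
    nlinarith
  set K : ℕ := ⌈κ⌉₊ with hK
  have hK0 : 0 < K := Nat.ceil_pos.2 hκ0
  have hK1 : κ ≤ K := Nat.le_ceil κ
  have hK3 : (K : ℝ) ≤ 3 * κ := by
    have := (Nat.ceil_lt_add_one hκ0.le).le
    linarith
  have hKr : (0 : ℝ) < K := by exact_mod_cast hK0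
  set F : ℝ := x * H / (N ^ 2 * M ^ 2) with hF
  have hF' : F = 4 * x * H / D ^ 2 := by
    rw [hF, hM]; field_simp; ring
  have hF0 : 0 < F := by rw [hF']; positivity
  have hFK : F / K ≤ 4 * u ^ 8 / N := by
    calc F / K ≤ F / κ := by gcongr
      _ = _ := by rw [hF', hκ, hx]; field_simp
  set L : ℕ := ⌈Real.log (4 * x)⌉₊ with hL
  have hlog0 : 0 ≤ Real.log (4 * x) := Real.log_nonneg (by linarith)
  have hL1 : (L : ℝ) + 1 ≤ 2 + Real.log (4 * x) := by
    have := (Nat.ceil_lt_add_one hlog0).le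
    linarith
  have hL4 : F / K ≤ 4 ^ L := by
    have h1 : 4 * u ^ 8 / N ≤ 4 * x := by
      rw [div_le_iff₀ (by positivity)]
      have : u ^ 8 ≤ x := pow_le_pow_right₀ hu (by norm_num)
      nlinarith
    refine (hFK.trans h1).trans ?_
    calc 4 * x = Real.exp (Real.log (4 * x)) := (Real.exp_log (by positivity)).symm
      _ ≤ Real.exp L := Real.exp_le_exp.2 (Nat.le_ceil _)
      _ = Real.exp 1 ^ L := by rw [← Real.exp_nat_mul, mul_one]
      _ ≤ 4 ^ L := by
        gcongr
        linarith [Real.exp_one_lt_three]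
  have key := norm_sq_typeII_le hH hN hK0 hx0 hM1 a ha c hc hF L hL4
  rw [hMN] at key
  set S := ∑ p ∈ Finset.Ico H (2 * H) ×ˢ Finset.Ico N (2 * N),
      ∑ m ∈ Finset.Ioc ⌊D / p.2⌋₊ ⌊2 * D / p.2⌋₊,
        c p * a m * expTwoPi (p.1 * x / (m * p.2 : ℝ) ^ 2) with hS
  have hHNM : (H : ℝ) * N * M = H * D / 2 := by rw [← hMN]; ring
  set q : ℝ := u ^ 14 / D ^ 2 with hq
  have hq0 : 0 < q := by positivity
  have t1 : √(F * K) / (H * N * M) ≤ 20 * q := by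
    rw [hHNM, div_le_iff₀ (by positivity)]
    refine Real.sqrt_le_iff.2 ⟨by positivity, ?_⟩
    have h1 : F * K ≤ F * (3 * κ) := by gcongr
    refine h1.trans ?_
    have h2 : u ^ 8 * N ≤ 2 * D ^ 2 := by
      have h3 : u ^ 16 ≤ D ^ 3 := by
        calc u ^ 16 ≤ u ^ 21 := pow_le_pow_right₀ hu (by norm_num)
          _ = (u ^ 7) ^ 3 := by ring
          _ ≤ D ^ 3 := by gcongr
      have h4 : (u ^ 8 * N) ^ 2 ≤ (2 * D ^ 2) ^ 2 := by
        calc (u ^ 8 * N) ^ 2 = u ^ 16 * N ^ 2 := by ring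
          _ ≤ D ^ 3 * (2 * D) := by gcongr
          _ ≤ (2 * D ^ 2) ^ 2 := by linarith [pow_pos hD0 4]
      exact (pow_le_pow_iff_left₀ (by positivity) (by positivity) (by norm_num)).1 h4
    have e1 : F * (3 * κ) = 12 * H ^ 2 * u ^ 28 / D ^ 4 * (u ^ 8 * N) := by
      rw [hF', hκ, hx]; field_simp; ring
    have e2 : (20 * q * (H * D / 2)) ^ 2 = 12 * H ^ 2 * u ^ 28 / D ^ 4 * (100 / 12 * D ^ 2) := by
      rw [hq]; field_simp; ring
    rw [e1, e2]
    exact mul_le_mul_of_nonneg_left (by linarith [pow_pos hD0 2]) (by positivity)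
  have t2 : √(F / K) / M ≤ 20 * q := by
    rw [div_le_iff₀ (by positivity)]
    refine Real.sqrt_le_iff.2 ⟨by positivity, hFK.trans ?_⟩
    -- The opposite extreme N ≈ D^{1/2}, D = u^8 is sharp here, and again in the estimate of the
    -- last term.
    have h2 : N * D ^ 2 ≤ 2 * u ^ 20 := by
      have h4 : (N * D ^ 2) ^ 2 ≤ (2 * u ^ 20) ^ 2 := by
        calc (N * D ^ 2) ^ 2 = N ^ 2 * D ^ 4 := by ring
          _ ≤ (2 * D) * D ^ 4 := by gcongr
          _ = 2 * D ^ 5 := by ring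
          _ ≤ 2 * (u ^ 8) ^ 5 := by gcongr
          _ ≤ (2 * u ^ 20) ^ 2 := by linarith [pow_pos hu0 40]
      exact (pow_le_pow_iff_left₀ (by positivity) (by positivity) (by norm_num)).1 h4
    have e1 : (20 * q * M) ^ 2 = u ^ 8 / (N ^ 2 * D ^ 2) * (100 * u ^ 20) := by
      rw [hq, hM]; field_simp; ring
    have e2 : 4 * u ^ 8 / N = u ^ 8 / (N ^ 2 * D ^ 2) * (4 * (N * D ^ 2)) := by field_simp
    rw [e1, e2]
    exact mul_le_mul_of_nonneg_left (by linarith [pow_pos hu0 20]) (by positivity)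
  have t3 : K / (H * N) ≤ 3 * q := by
    rw [div_le_iff₀ (by positivity)]
    refine hK3.trans (le_of_eq ?_)
    rw [hκ, hq]; ring
  have t4 : √(K / F) ≤ 2 * q := by
    refine Real.sqrt_le_iff.2 ⟨by positivity, ?_⟩
    have h1 : K / F ≤ (3 * κ) / F := by gcongr
    refine h1.trans ?_
    have h2 : N * D ^ 4 ≤ 2 * u ^ 36 := by
      have h4 : (N * D ^ 4) ^ 2 ≤ (2 * u ^ 36) ^ 2 := by
        calc (N * D ^ 4) ^ 2 = N ^ 2 * D ^ 8 := by ring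
          _ ≤ (2 * D) * D ^ 8 := by gcongr
          _ = 2 * D ^ 9 := by ring
          _ ≤ 2 * (u ^ 8) ^ 9 := by gcongr
          _ ≤ (2 * u ^ 36) ^ 2 := by linarith [pow_pos hu0 72]
      exact (pow_le_pow_iff_left₀ (by positivity) (by positivity) (by norm_num)).1 h4
    have e1 : (3 * κ) / F = 1 / (u ^ 8 * D ^ 4) * (3 / 4 * (N * D ^ 4)) := by
      rw [hκ, hF', hx]; field_simp
    have e2 : (2 * q) ^ 2 = 1 / (u ^ 8 * D ^ 4) * (4 * u ^ 36) := by
      rw [hq]; field_simp; ring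
    rw [e1, e2]
    exact mul_le_mul_of_nonneg_left (by linarith [pow_pos hu0 36]) (by positivity)
  have hX : 2 + Real.log (4 * x) ≤ C₀ * x ^ (ε / 2) := hlog x hx1
  have hX1 : 1 ≤ C₀ * x ^ (ε / 2) := by linarith
  have hlH : 1 + Real.log (2 * H) ≤ C₀ * x ^ (ε / 2) := by
    have : Real.log (2 * H) ≤ Real.log (4 * x) := Real.log_le_log (by positivity) (by linarith)
    linarith
  have hlN : 1 + Real.log (2 * N) ≤ C₀ * x ^ (ε / 2) := by
    have : Real.log (2 * N) ≤ Real.log (4 * x) := Real.log_le_log (by positivity) (by linarith)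
    linarith
  have hlH0 : 0 ≤ Real.log (2 * H) := Real.log_nonneg (by linarith)
  have hlN0 : 0 ≤ Real.log (2 * N) := Real.log_nonneg (by linarith)
  set B := C₀ * x ^ (ε / 2) with hB
  have hfin : ‖S‖ ^ 2 ≤ (10 ^ 12 * B ^ 2 * (H * u ^ 7)) ^ 2 := by
    calc ‖S‖ ^ 2 ≤ (10 : ℝ) ^ 20 * (L + 1) * ((1 + Real.log (2 * H)) * (1 + Real.log (2 * N))) * (H * N * M) ^ 2 *
        (√(F * K) / (H * N * M) + √(F / K) / M + K / (H * N) + √(K / F)) := key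
      _ ≤ (10 : ℝ) ^ 20 * B * (B * B) * (H * N * M) ^ 2 * (20 * q + 20 * q + 3 * q + 2 * q) := by
          gcongr
          linarith
      _ = 45 / 4 * 10 ^ 20 * B ^ 3 * (H * u ^ 7) ^ 2 := by
          rw [hHNM, hq]; field_simp; ring
      _ ≤ 10 ^ 24 * B ^ 4 * (H * u ^ 7) ^ 2 := by
          have : B ^ 3 ≤ B ^ 4 := pow_le_pow_right₀ hX1 (by norm_num)
          gcongr
          norm_num
      _ = _ := by ring
  have hB0 : 0 < B := by linarith
  have := (pow_le_pow_iff_left₀ (norm_nonneg _) (by positivity) (by norm_num)).1 hfin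
  refine this.trans (le_of_eq ?_)
  rw [hB, mul_pow, ← Real.rpow_natCast (x ^ (ε / 2)), ← Real.rpow_mul hx0.le]
  push_cast
  rw [show ε / 2 * 2 = ε by ring]
  ring

/-- The sum over a smooth variable `l`, with `x = u ^ 22`, `u ^ 7 ≤ D ≤ u ^ 8` and `m ^ 4 ≤ D`. -/
theorem norm_sum_expTwoPi_smooth_le {u D : ℝ} (hu : 1 ≤ u) (hD1 : u ^ 7 ≤ D) (hD2 : D ≤ u ^ 8)
    {m h : ℕ} (hm : 0 < m) (hmD : (m : ℝ) ^ 4 ≤ D) (hh : 0 < h) (hhD : (h : ℝ) * u ^ 14 ≤ 2 * D ^ 2) :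
    ‖∑ l ∈ Finset.Ioc ⌊D / m⌋₊ ⌊2 * D / m⌋₊, expTwoPi (h * u ^ 22 / (m * l : ℝ) ^ 2)‖ ≤
      10 ^ 14 * u ^ 5 := by
  have hu0 : 0 < u := by linarith
  have hD0 : 0 < D := lt_of_lt_of_le (by positivity) hD1
  have hm1 : (1 : ℝ) ≤ m := by exact_mod_cast hm
  have hh1 : (1 : ℝ) ≤ h := by exact_mod_cast hh
  have hmD' : (m : ℝ) ≤ D := by
    calc (m : ℝ) = m ^ 1 := (pow_one _).symm
      _ ≤ m ^ 4 := pow_le_pow_right₀ hm1 (by norm_num)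
      _ ≤ D := hmD
  have hDm : 1 ≤ D / m := by rw [le_div_iff₀ (by positivity)]; linarith
  have e : Finset.Ioc ⌊D / m⌋₊ ⌊2 * D / m⌋₊ = Finset.Ico (⌊D / m⌋₊ + 1) (⌊2 * D / m⌋₊ + 1) := by
    ext l; simp only [Finset.mem_Ioc, Finset.mem_Ico]; omega
  have e' : ∀ l : ℕ, (h : ℝ) * u ^ 22 / (m * l : ℝ) ^ 2 = (h * u ^ 22 / m ^ 2) / (l : ℝ) ^ 2 := by
    intro l; rw [div_div, mul_pow]
  simp_rw [e']
  rw [e]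
  have hc0 : 0 < (h : ℝ) * u ^ 22 / m ^ 2 := by positivity
  refine (norm_sum_expTwoPi_div_sq_le hc0.ne' (M := D / m) (by linarith) ?_ ?_).trans ?_
  · push_cast
    exact (Nat.lt_floor_add_one _).le
  · push_cast
    have := Nat.floor_le (by positivity : 0 ≤ 2 * D / (m : ℝ))
    have e2 : 2 * D / (m : ℝ) = 2 * (D / m) := by ring
    linarith
  -- After simplification the two terms of the second derivative test are s/D ≤ 2 u^4 and D^2/(m s)
  -- ≤ u^5; the second needs only h, m ≥ 1 and D ≤ u^8.
  · rw [abs_of_pos hc0, Real.sqrt_div (by positivity), Real.sqrt_sq (by linarith)]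
    set s := √((h : ℝ) * u ^ 22) with hs
    have hs1 : s ≤ 2 * (D * u ^ 4) := by
      refine Real.sqrt_le_iff.2 ⟨by positivity, ?_⟩
      calc (h : ℝ) * u ^ 22 = h * u ^ 14 * u ^ 8 := by ring
        _ ≤ 2 * D ^ 2 * u ^ 8 := by gcongr
        _ ≤ (2 * (D * u ^ 4)) ^ 2 := by linarith [mul_pos (pow_pos hD0 2) (pow_pos hu0 8)]
    have hs2 : u ^ 11 ≤ s := by
      refine Real.le_sqrt_of_sq_le ?_
      calc (u ^ 11) ^ 2 = 1 * u ^ 22 := by ring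
        _ ≤ h * u ^ 22 := by gcongr
    have hs0 : 0 < s := lt_of_lt_of_le (by positivity) hs2
    have a1 : s / m / (D / m) ≤ 2 * u ^ 5 := by
      have : s / m / (D / m) = s / D := by field_simp
      rw [this, div_le_iff₀ hD0]
      have : u ^ 4 ≤ u ^ 5 := pow_le_pow_right₀ hu (by norm_num)
      nlinarith
    have a2 : (D / m) ^ 2 / (s / m) ≤ u ^ 5 := by
      have : (D / m) ^ 2 / (s / m) = D ^ 2 / (m * s) := by field_simp
      rw [this, div_le_iff₀ (by positivity)]
      calc D ^ 2 ≤ (u ^ 8) ^ 2 := by gcongr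
        _ = u ^ 5 * (1 * u ^ 11) := by ring
        _ ≤ u ^ 5 * (m * s) := by gcongr
    nlinarith [pow_pos hu0 5]

/-! ### Vaughan's identity for `μ * μ` -/

/-- The restriction of an arithmetic function to the integers satisfying `p`. -/
def arithRestrict (f : ArithmeticFunction ℂ) (p : ℕ → Prop) [DecidablePred p] : ArithmeticFunction ℂ :=
  ⟨fun n => if p n then f n else 0, by simp⟩

theorem arithRestrict_apply (f : ArithmeticFunction ℂ) (p : ℕ → Prop) [DecidablePred p] (n : ℕ) :
    arithRestrict f p n = if p n then f n else 0 := rfl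

theorem arithRestrict_add_not (f : ArithmeticFunction ℂ) (p : ℕ → Prop) [DecidablePred p] :
    arithRestrict f p + arithRestrict f (fun n => ¬ p n) = f := by
  ext n
  rw [ArithmeticFunction.add_apply, arithRestrict_apply, arithRestrict_apply]
  by_cases h : p n <;> simp [h]

theorem norm_arithRestrict_le (f : ArithmeticFunction ℂ) (p : ℕ → Prop) [DecidablePred p] (n : ℕ) :
    ‖arithRestrict f p n‖ ≤ ‖f n‖ := by
  rw [arithRestrict_apply]
  split_ifs <;> simp

/-- `∑_{D < d ≤ 2 D} f(d) φ(d)`. -/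
noncomputable def dyadicSum (D : ℝ) (φ : ℕ → ℂ) (f : ArithmeticFunction ℂ) : ℂ :=
  ∑ d ∈ Finset.Ioc ⌊D⌋₊ ⌊2 * D⌋₊, f d * φ d

theorem dyadicSum_add (D : ℝ) (φ : ℕ → ℂ) (f g : ArithmeticFunction ℂ) :
    dyadicSum D φ (f + g) = dyadicSum D φ f + dyadicSum D φ g := by
  simp [dyadicSum, add_mul, Finset.sum_add_distrib]

theorem dyadicSum_sub (D : ℝ) (φ : ℕ → ℂ) (f g : ArithmeticFunction ℂ) :
    dyadicSum D φ (f - g) = dyadicSum D φ f - dyadicSum D φ g := by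
  rw [eq_sub_iff_add_eq, ← dyadicSum_add, sub_add_cancel]

theorem dyadicSum_eq_zero {D : ℝ} (hD : 0 ≤ D) (φ : ℕ → ℂ) {f : ArithmeticFunction ℂ}
    (hf : ∀ n : ℕ, D < n → f n = 0) : dyadicSum D φ f = 0 := by
  refine Finset.sum_eq_zero fun d hd => ?_
  rw [Finset.mem_Ioc] at hd
  rw [hf d ((Nat.floor_lt hD).1 hd.1), zero_mul]

theorem dyadicSum_mul {D : ℝ} (hD : 0 ≤ D) (φ : ℕ → ℂ) (f g : ArithmeticFunction ℂ) :
    dyadicSum D φ (f * g) = ∑ l ∈ Finset.Icc 1 ⌊2 * D⌋₊,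
      ∑ m ∈ Finset.Ioc ⌊D / l⌋₊ ⌊2 * D / l⌋₊, f m * g l * φ (m * l) := by
  have key : ∀ m l : ℕ, 0 < l → ((m * l ∈ Finset.Ioc ⌊D⌋₊ ⌊2 * D⌋₊) ↔ m ∈ Finset.Ioc ⌊D / l⌋₊ ⌊2 * D / l⌋₊) := by
    intro m l hl
    have hlr : (0 : ℝ) < l := by exact_mod_cast hl
    rw [Finset.mem_Ioc, Finset.mem_Ioc, Nat.floor_lt hD, Nat.floor_lt (by positivity),
      Nat.le_floor_iff (by positivity), Nat.le_floor_iff (by positivity), div_lt_iff₀ hlr, le_div_iff₀ hlr]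
    push_cast
    rfl
  rw [dyadicSum]
  simp_rw [ArithmeticFunction.mul_apply, Finset.sum_mul]
  rw [Finset.sum_sigma', Finset.sum_sigma']
  refine Finset.sum_bij' (fun z _ => ⟨z.2.2, z.2.1⟩) (fun z _ => ⟨z.2 * z.1, (z.2, z.1)⟩) ?_ ?_ ?_ ?_ ?_
  · rintro ⟨d, m, l⟩ hz
    simp only [Finset.mem_sigma, Nat.mem_divisorsAntidiagonal] at hz ⊢
    obtain ⟨h1, h2, h3⟩ := hz
    have hl : 0 < l := Nat.pos_of_ne_zero fun h => h3 (by rw [← h2, h, mul_zero])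
    have hm : 0 < m := Nat.pos_of_ne_zero fun h => h3 (by rw [← h2, h, zero_mul])
    rw [← h2] at h1
    refine ⟨Finset.mem_Icc.2 ⟨hl, ?_⟩, (key m l hl).1 h1⟩
    exact (Nat.le_mul_of_pos_left l hm).trans (Finset.mem_Ioc.1 h1).2
  · rintro ⟨l, m⟩ hz
    simp only [Finset.mem_sigma, Nat.mem_divisorsAntidiagonal] at hz ⊢
    have hl : 0 < l := (Finset.mem_Icc.1 hz.1).1
    have hm : 0 < m := lt_of_le_of_lt (Nat.zero_le _) (Finset.mem_Ioc.1 hz.2).1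
    exact ⟨(key m l hl).2 hz.2, trivial, (Nat.mul_pos hm hl).ne'⟩
  · rintro ⟨d, m, l⟩ hz
    simp only [Finset.mem_sigma, Nat.mem_divisorsAntidiagonal] at hz
    simp [hz.2.1]
  · rintro ⟨l, m⟩ _
    rfl
  · rintro ⟨d, m, l⟩ hz
    simp only [Finset.mem_sigma, Nat.mem_divisorsAntidiagonal] at hz
    simp [hz.2.1]

/-- `∑_{H ≤ h < 2 H} γ(h) e(h x / d ^ 2)`. -/
noncomputable def phaseSum (x : ℝ) (H : ℕ) (γ : ℕ → ℂ) (d : ℕ) : ℂ :=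
  ∑ h ∈ Finset.Ico H (2 * H), γ h * expTwoPi (h * x / (d : ℝ) ^ 2)

/-- The range of parameters: `x = u ^ 22`, `u ^ 7 ≤ D ≤ u ^ 8`, `H ≤ (D / u ^ 7) ^ 2` and
`U = ⌊D ^ (1 / 4)⌋`. -/
structure DyadicParams (u D : ℝ) (H U : ℕ) : Prop where
  one_le_u : 1 ≤ u
  pow_le : u ^ 7 ≤ D
  le_pow : D ≤ u ^ 8
  eight_le : 8 ≤ D
  H_pos : 0 < H
  H_le : (H : ℝ) * u ^ 14 ≤ D ^ 2
  U_pos : 0 < U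
  U_pow_le : (U : ℝ) ^ 4 ≤ D
  le_U_pow : D ≤ ((U : ℝ) + 1) ^ 4

theorem sum_Ico_dyadic (g : ℕ → ℂ) (A J : ℕ) :
    ∑ l ∈ Finset.Ico A (2 ^ J * A), g l = ∑ j ∈ Finset.range J, ∑ l ∈ Finset.Ico (2 ^ j * A) (2 * (2 ^ j * A)), g l := by
  induction J with
  | zero => simp
  | succ J ih =>
    rw [Finset.sum_range_succ, ← ih, show 2 ^ (J + 1) * A = 2 * (2 ^ J * A) by ring,
      Finset.sum_Ico_consecutive]
    · exact Nat.le_mul_of_pos_left _ (by positivity)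
    · omega

/-- The variable of β is cut into dyadic ranges starting at (U + 1) 2^j. The support condition makes
a range with N^2 > 2D contribute nothing, and N ≥ U + 1 gives N^4 ≥ D, so `exists_norm_typeII_le`
covers every other range. The number of ranges is O(log x), absorbed in x^ε. -/
theorem exists_norm_dyadicSum_mul_le_of_support {ε : ℝ} (hε : 0 < ε) : ∃ C : ℝ, 1 ≤ C ∧
    ∀ (u D : ℝ) (H U : ℕ), DyadicParams u D H U → ∀ (γ : ℕ → ℂ) (_ : ∀ h, ‖γ h‖ ≤ 1)
    (α β : ArithmeticFunction ℂ) (_ : ∀ n : ℕ, (n : ℝ) ≤ 2 * D → ‖α n‖ ≤ 1)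
    (_ : ∀ n : ℕ, (n : ℝ) ≤ 2 * D → ‖β n‖ ≤ 1) (_ : ∀ l : ℕ, β l ≠ 0 → U < l ∧ (l : ℝ) ^ 2 ≤ 2 * D),
    ‖dyadicSum D (phaseSum (u ^ 22) H γ) (α * β)‖ ≤ C * (u ^ 22) ^ ε * (H * u ^ 7) := by
  obtain ⟨C₁, hC₁, hII⟩ := exists_norm_typeII_le (half_pos hε)
  obtain ⟨C₀, hC₀, hlog⟩ := exists_two_add_log_le_rpow (half_pos hε)
  refine ⟨2 * C₀ * C₁, by nlinarith, ?_⟩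
  intro u D H U hp γ hγ α β hα hβ hβs
  have hu := hp.one_le_u
  have hu0 : 0 < u := by linarith
  have hD0 : 0 < D := by linarith [hp.eight_le]
  set x := u ^ 22 with hx
  have hx1 : 1 ≤ x := one_le_pow₀ hu
  have hDx : D ≤ x := hp.le_pow.trans (pow_le_pow_right₀ hu (by norm_num))
  set J : ℕ := 2 * ⌈Real.log (4 * x)⌉₊ with hJ
  have hlog0 : 0 ≤ Real.log (4 * x) := Real.log_nonneg (by linarith)
  have hJle : (J : ℝ) ≤ 2 * (C₀ * x ^ (ε / 2)) := by
    have h1 := (Nat.ceil_lt_add_one hlog0).le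
    have h2 := hlog x hx1
    rw [hJ]; push_cast
    linarith
  have h2J : 4 * x ≤ 2 ^ J := by
    calc 4 * x = Real.exp (Real.log (4 * x)) := (Real.exp_log (by positivity)).symm
      _ ≤ Real.exp ⌈Real.log (4 * x)⌉₊ := Real.exp_le_exp.2 (Nat.le_ceil _)
      _ = Real.exp 1 ^ ⌈Real.log (4 * x)⌉₊ := by rw [← Real.exp_nat_mul, mul_one]
      _ ≤ 4 ^ ⌈Real.log (4 * x)⌉₊ := by
        gcongr
        linarith [Real.exp_one_lt_three]
      _ = 2 ^ J := by rw [hJ, pow_mul]; norm_num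
  set g : ℕ → ℂ := fun l => ∑ m ∈ Finset.Ioc ⌊D / l⌋₊ ⌊2 * D / l⌋₊, α m * β l * phaseSum x H γ (m * l) with hg
  have hg0 : ∀ l, β l = 0 → g l = 0 := fun l hl => by
    rw [hg]; simp only
    exact Finset.sum_eq_zero fun m _ => by rw [hl, mul_zero, zero_mul]
  have hsum : dyadicSum D (phaseSum x H γ) (α * β) = ∑ l ∈ Finset.Ico (U + 1) (2 ^ J * (U + 1)), g l := by
    rw [dyadicSum_mul hD0.le]
    refine Finset.sum_congr_of_eq_on_inter ?_ ?_ (fun _ _ _ => rfl)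
    · intro l hl hl'
      refine hg0 l ?_
      by_contra hne
      have h1 := hβs l hne
      apply hl'
      rw [Finset.mem_Ico]
      refine ⟨h1.1, ?_⟩
      have h2 : (l : ℝ) ≤ 2 * D := (Nat.le_floor_iff (by positivity)).1 (Finset.mem_Icc.1 hl).2
      have h3 : (l : ℝ) < (2 ^ J * (U + 1) : ℕ) := by
        push_cast
        have hU : (0 : ℝ) ≤ U := Nat.cast_nonneg _
        nlinarith
      exact_mod_cast h3
    · intro l hl hl'
      refine hg0 l ?_
      by_contra hne
      have h1 := hβs l hne
      apply hl'
      rw [Finset.mem_Icc]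
      have hl1 : 1 ≤ l := by omega
      refine ⟨hl1, (Nat.le_floor_iff (by positivity)).2 ?_⟩
      have : (1 : ℝ) ≤ l := by exact_mod_cast hl1
      nlinarith
  rw [hsum, sum_Ico_dyadic]
  have hj : ∀ j ∈ Finset.range J, ‖∑ l ∈ Finset.Ico (2 ^ j * (U + 1)) (2 * (2 ^ j * (U + 1))), g l‖ ≤
      C₁ * x ^ (ε / 2) * (H * u ^ 7) := by
    intro j _
    set N := 2 ^ j * (U + 1) with hN
    have hN0 : 0 < N := by positivity
    rcases le_or_gt ((N : ℝ) ^ 2) (2 * D) with hND | hND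
    · have hUN : (U : ℝ) + 1 ≤ N := by
        have : U + 1 ≤ N := Nat.le_mul_of_pos_left _ (by positivity)
        exact_mod_cast this
      have h16 : D ≤ 16 * (N : ℝ) ^ 4 := by
        have h1 : ((U : ℝ) + 1) ^ 4 ≤ (N : ℝ) ^ 4 := by gcongr
        have h2 : 0 ≤ (N : ℝ) ^ 4 := by positivity
        linarith [hp.le_U_pow]
      have key := hII u D hu hp.pow_le hp.le_pow hp.eight_le H N hp.H_pos hN0 hp.H_le h16 hND
        (fun m => if (m : ℝ) ≤ 2 * D then α m else 0) (fun m => by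
          split_ifs with h
          · exact hα m h
          · simp)
        (fun p => γ p.1 * if (p.2 : ℝ) ≤ 2 * D then β p.2 else 0) (fun p => by
          rw [norm_mul]
          refine mul_le_one₀ (hγ _) (norm_nonneg _) ?_
          split_ifs with h
          · exact hβ _ h
          · simp)
      refine le_trans (le_of_eq ?_) key
      congr 1
      rw [Finset.sum_product_right]
      refine Finset.sum_congr rfl fun l hl => ?_
      rw [hg]
      simp only
      rw [Finset.sum_comm]
      refine Finset.sum_congr rfl fun m hm => ?_
      rw [phaseSum, Finset.mul_sum]
      refine Finset.sum_congr rfl fun h _ => ?_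
      have hl1 : 1 ≤ l := by rw [Finset.mem_Ico] at hl; omega
      have hl1r : (1 : ℝ) ≤ l := by exact_mod_cast hl1
      have hm2 : (m : ℝ) ≤ 2 * D := by
        have : (m : ℝ) ≤ 2 * D / l := (Nat.le_floor_iff (by positivity)).1 (Finset.mem_Ioc.1 hm).2
        refine this.trans (div_le_self (by positivity) hl1r)
      rw [if_pos hm2]
      push_cast
      by_cases hb : (l : ℝ) ≤ 2 * D
      · rw [if_pos hb]; ring
      · have : β l = 0 := by
          by_contra hne
          have := (hβs l hne).2
          apply hb
          nlinarith
        rw [if_neg hb, this]; ring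
    · rw [Finset.sum_eq_zero]
      · rw [norm_zero]; positivity
      · intro l hl
        refine hg0 l ?_
        by_contra hne
        have h1 := (hβs l hne).2
        have h2 : (N : ℝ) ≤ l := by exact_mod_cast (Finset.mem_Ico.1 hl).1
        have : (N : ℝ) ^ 2 ≤ l ^ 2 := by gcongr
        linarith
  calc ‖∑ j ∈ Finset.range J, ∑ l ∈ Finset.Ico (2 ^ j * (U + 1)) (2 * (2 ^ j * (U + 1))), g l‖
      ≤ ∑ j ∈ Finset.range J, C₁ * x ^ (ε / 2) * (H * u ^ 7) := (norm_sum_le _ _).trans (Finset.sum_le_sum hj)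
    _ = J * (C₁ * x ^ (ε / 2) * (H * u ^ 7)) := by rw [Finset.sum_const, Finset.card_range, nsmul_eq_mul]
    _ ≤ 2 * (C₀ * x ^ (ε / 2)) * (C₁ * x ^ (ε / 2) * (H * u ^ 7)) := by gcongr
    _ = 2 * C₀ * C₁ * (x ^ (ε / 2) * x ^ (ε / 2)) * (H * u ^ 7) := by ring
    _ = _ := by rw [← Real.rpow_add (by linarith), add_halves]

/-- Bilinear sums in which both variables exceed `U`. -/
theorem exists_norm_dyadicSum_mul_le {ε : ℝ} (hε : 0 < ε) : ∃ C : ℝ, 1 ≤ C ∧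
    ∀ (u D : ℝ) (H U : ℕ), DyadicParams u D H U → ∀ (γ : ℕ → ℂ) (_ : ∀ h, ‖γ h‖ ≤ 1)
    (α β : ArithmeticFunction ℂ) (B : ℝ) (_ : 0 < B) (_ : ∀ n : ℕ, (n : ℝ) ≤ 2 * D → ‖α n‖ ≤ B)
    (_ : ∀ n : ℕ, (n : ℝ) ≤ 2 * D → ‖β n‖ ≤ B) (_ : ∀ l : ℕ, l ≤ U → α l = 0) (_ : ∀ l : ℕ, l ≤ U → β l = 0),
    ‖dyadicSum D (phaseSum (u ^ 22) H γ) (α * β)‖ ≤ C * (u ^ 22) ^ ε * (B ^ 2 * (H * u ^ 7)) := by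
  obtain ⟨C, hC, h⟩ := exists_norm_dyadicSum_mul_le_of_support hε
  refine ⟨2 * C, by linarith, ?_⟩
  intro u D H U hp γ hγ α β B hB hα hβ hα0 hβ0
  have hD0 : 0 < D := by linarith [hp.eight_le]
  -- Division by B reduces to coefficients bounded by 1; the factor B^2 returns through `hscmul`.
  set sc : ArithmeticFunction ℂ → ArithmeticFunction ℂ := fun f => ⟨fun n => (B : ℂ)⁻¹ * f n, by simp⟩ with hsc
  have hsc_apply : ∀ f n, sc f n = (B : ℂ)⁻¹ * f n := fun f n => rfl
  have hBne : (B : ℂ) ≠ 0 := by exact_mod_cast hB.ne'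
  have hscn : ∀ f : ArithmeticFunction ℂ, (∀ n : ℕ, (n : ℝ) ≤ 2 * D → ‖f n‖ ≤ B) → ∀ n : ℕ, (n : ℝ) ≤ 2 * D → ‖sc f n‖ ≤ 1 := by
    intro f hf n hn
    rw [hsc_apply, norm_mul, norm_inv, Complex.norm_real, Real.norm_eq_abs, abs_of_pos hB, inv_mul_le_iff₀ hB, mul_one]
    exact hf n hn
  have hscmul : ∀ f g : ArithmeticFunction ℂ, ‖dyadicSum D (phaseSum (u ^ 22) H γ) (f * g)‖ =
      B ^ 2 * ‖dyadicSum D (phaseSum (u ^ 22) H γ) (sc f * sc g)‖ := by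
    intro f g
    have : dyadicSum D (phaseSum (u ^ 22) H γ) (f * g) = (B : ℂ) ^ 2 * dyadicSum D (phaseSum (u ^ 22) H γ) (sc f * sc g) := by
      rw [dyadicSum, dyadicSum, Finset.mul_sum]
      refine Finset.sum_congr rfl fun d _ => ?_
      rw [ArithmeticFunction.mul_apply, ArithmeticFunction.mul_apply, ← mul_assoc, Finset.mul_sum]
      congr 1
      refine Finset.sum_congr rfl fun p _ => ?_
      rw [hsc_apply, hsc_apply]
      field_simp
    rw [this, norm_mul, norm_pow, Complex.norm_real, Real.norm_eq_abs, abs_of_pos hB]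
  set β₁ := arithRestrict β (fun l => (l : ℝ) ^ 2 ≤ 2 * D) with hβ₁
  set β₂ := arithRestrict β (fun l => ¬ (l : ℝ) ^ 2 ≤ 2 * D) with hβ₂
  set α₁ := arithRestrict α (fun l => (l : ℝ) ^ 2 ≤ 2 * D) with hα₁
  have e1 : dyadicSum D (phaseSum (u ^ 22) H γ) (α * β) =
      dyadicSum D (phaseSum (u ^ 22) H γ) (α * β₁) + dyadicSum D (phaseSum (u ^ 22) H γ) (α * β₂) := by
    rw [← dyadicSum_add, ← mul_add, hβ₁, hβ₂, arithRestrict_add_not]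
  -- As m l ≤ 2D, the two variables cannot both exceed √(2D). When l does, m does not, and the roles
  -- are exchanged.
  have e2 : dyadicSum D (phaseSum (u ^ 22) H γ) (α * β₂) = dyadicSum D (phaseSum (u ^ 22) H γ) (β₂ * α₁) := by
    rw [mul_comm β₂ α₁, dyadicSum_mul hD0.le, dyadicSum_mul hD0.le]
    refine Finset.sum_congr rfl fun l hl => Finset.sum_congr rfl fun m hm => ?_
    have hl1 : (1 : ℝ) ≤ l := by exact_mod_cast (Finset.mem_Icc.1 hl).1
    have hm1 : (m : ℝ) ≤ 2 * D / l := (Nat.le_floor_iff (by positivity)).1 (Finset.mem_Ioc.1 hm).2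
    rw [le_div_iff₀ (by linarith)] at hm1
    rw [hα₁, hβ₂, arithRestrict_apply, arithRestrict_apply]
    by_cases h1 : (l : ℝ) ^ 2 ≤ 2 * D
    · simp [h1]
    · have h2 : (m : ℝ) ^ 2 ≤ 2 * D := by
        by_contra h3
        have h1' : 2 * D < (l : ℝ) ^ 2 := not_le.1 h1
        have h3' : 2 * D < (m : ℝ) ^ 2 := not_le.1 h3
        have h4 : ((m : ℝ) * l) ^ 2 ≤ (2 * D) ^ 2 := by gcongr
        have h5 : (2 * D) * (2 * D) < (m : ℝ) ^ 2 * (l : ℝ) ^ 2 := by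
          apply mul_lt_mul h3' h1'.le (by positivity) (by positivity)
        nlinarith
      simp [h2]
  have hsupp : ∀ f : ArithmeticFunction ℂ, (∀ l : ℕ, l ≤ U → f l = 0) →
      ∀ l : ℕ, sc (arithRestrict f (fun l => (l : ℝ) ^ 2 ≤ 2 * D)) l ≠ 0 → U < l ∧ (l : ℝ) ^ 2 ≤ 2 * D := by
    intro f hf l hl
    rw [hsc_apply, arithRestrict_apply] at hl
    split_ifs at hl with h1
    · refine ⟨?_, h1⟩
      by_contra h2
      exact hl (by rw [hf l (by omega), mul_zero])
    · simp at hl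
  have b1 : ‖dyadicSum D (phaseSum (u ^ 22) H γ) (α * β₁)‖ ≤ B ^ 2 * (C * (u ^ 22) ^ ε * (H * u ^ 7)) := by
    rw [hscmul]
    gcongr
    exact h u D H U hp γ hγ (sc α) (sc β₁) (hscn _ hα)
      (hscn _ fun n hn => (norm_arithRestrict_le _ _ _).trans (hβ n hn)) (hsupp β hβ0)
  have b2 : ‖dyadicSum D (phaseSum (u ^ 22) H γ) (β₂ * α₁)‖ ≤ B ^ 2 * (C * (u ^ 22) ^ ε * (H * u ^ 7)) := by
    rw [hscmul]
    gcongr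
    exact h u D H U hp γ hγ (sc β₂) (sc α₁) (hscn _ fun n hn => (norm_arithRestrict_le _ _ _).trans (hβ n hn))
      (hscn _ fun n hn => (norm_arithRestrict_le _ _ _).trans (hα n hn)) (hsupp α hα0)
  rw [e1, e2]
  refine (norm_add_le _ _).trans ?_
  linarith

/-- The constant function `1` on the positive integers, with complex values. -/
noncomputable def complexZeta : ArithmeticFunction ℂ :=
  ((ArithmeticFunction.zeta : ArithmeticFunction ℕ) : ArithmeticFunction ℂ)

theorem complexZeta_apply {n : ℕ} (hn : n ≠ 0) : complexZeta n = 1 := by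
  rw [complexZeta, ArithmeticFunction.natCoe_apply, ArithmeticFunction.zeta_apply_ne hn]; simp

/-- The Dirichlet inverse of the divisor function. -/
noncomputable def moebiusSq : ArithmeticFunction ℂ :=
  ((ArithmeticFunction.moebius * ArithmeticFunction.moebius : ArithmeticFunction ℤ) : ArithmeticFunction ℂ)

theorem complexZeta_sq_mul_moebiusSq : complexZeta * complexZeta * moebiusSq = 1 := by
  have h : complexZeta * ((ArithmeticFunction.moebius : ArithmeticFunction ℤ) : ArithmeticFunction ℂ) = 1 :=
    ArithmeticFunction.coe_zeta_mul_coe_moebius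
  rw [moebiusSq, ArithmeticFunction.intCoe_mul]
  calc _ = (complexZeta * ((ArithmeticFunction.moebius : ArithmeticFunction ℤ) : ArithmeticFunction ℂ)) *
    (complexZeta * ((ArithmeticFunction.moebius : ArithmeticFunction ℤ) : ArithmeticFunction ℂ)) := by ring
    _ = 1 := by rw [h, mul_one]

theorem dominatedBy_complexZeta : DominatedBy complexZeta (divisorK 1) := by
  intro n
  rcases eq_or_ne n 0 with rfl | hn
  · simp
  · rw [complexZeta_apply hn, divisorK_one_apply hn]; simp

theorem dominatedBy_moebiusSq : DominatedBy moebiusSq (divisorK 2) := by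
  have h : DominatedBy ((ArithmeticFunction.moebius : ArithmeticFunction ℤ) : ArithmeticFunction ℂ) (divisorK 1) := by
    intro n
    rcases eq_or_ne n 0 with rfl | hn
    · simp
    · rw [divisorK_one_apply hn, ArithmeticFunction.intCoe_apply, Complex.norm_intCast]
      exact_mod_cast ArithmeticFunction.abs_moebius_le_one
  rw [moebiusSq, ArithmeticFunction.intCoe_mul, show 2 = 1 + 1 by rfl, divisorK_add]
  exact h.mul h

theorem DominatedBy.restrict {f : ArithmeticFunction ℂ} {F : ArithmeticFunction ℝ} (hf : DominatedBy f F)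
    (p : ℕ → Prop) [DecidablePred p] : DominatedBy (arithRestrict f p) F := fun n =>
  (norm_arithRestrict_le f p n).trans (hf n)

theorem ArithmeticFunction.mul_apply_eq_zero_of_support {f g : ArithmeticFunction ℂ} {a b : ℝ}
    (hf : ∀ n : ℕ, a < n → f n = 0) (hg : ∀ n : ℕ, b < n → g n = 0) (n : ℕ) (hn : a * b < n) :
    (f * g) n = 0 := by
  rw [ArithmeticFunction.mul_apply]
  refine Finset.sum_eq_zero fun p hp => ?_
  have h := (Nat.mem_divisorsAntidiagonal.1 hp).1
  by_cases h1 : a < p.1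
  · rw [hf _ h1, zero_mul]
  · by_cases h2 : b < p.2
    · rw [hg _ h2, mul_zero]
    · exfalso
      rw [← h] at hn
      push_cast at hn
      have : (p.1 : ℝ) * p.2 ≤ a * b := mul_le_mul (not_lt.1 h1) (not_lt.1 h2) (Nat.cast_nonneg _)
        ((Nat.cast_nonneg _).trans (not_lt.1 h1))
      linarith

/-- Sums in which one variable is at most `U` and the other one is smooth. -/
theorem norm_dyadicSum_smooth_mul_le {u D : ℝ} {H U : ℕ} (hp : DyadicParams u D H U) {γ : ℕ → ℂ}
    (hγ : ∀ h, ‖γ h‖ ≤ 1) {α : ArithmeticFunction ℂ} {B : ℝ} (hB : 0 < B)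
    (hα : ∀ n : ℕ, (n : ℝ) ≤ 2 * D → ‖α n‖ ≤ B) (hαs : ∀ l : ℕ, U < l → α l = 0) :
    ‖dyadicSum D (phaseSum (u ^ 22) H γ) (arithRestrict complexZeta (fun l => ¬ l ≤ U) * α)‖ ≤
      10 ^ 14 * (B * (H * u ^ 7)) := by
  have hu0 : 0 < u := by linarith [hp.one_le_u]
  have hD0 : 0 < D := by linarith [hp.eight_le]
  have hUr : (1 : ℝ) ≤ U := by exact_mod_cast hp.U_pos
  -- There are at most u^2 values of the short variable, each contributing u^5 per frequency by
  -- `norm_sum_expTwoPi_smooth_le`: the product is u^7.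
  have hUu : (U : ℝ) ≤ u ^ 2 := by
    have : (U : ℝ) ^ 4 ≤ (u ^ 2) ^ 4 := by
      calc (U : ℝ) ^ 4 ≤ D := hp.U_pow_le
        _ ≤ u ^ 8 := hp.le_pow
        _ = _ := by ring
    exact (pow_le_pow_iff_left₀ (by positivity) (by positivity) (by norm_num)).1 this
  rw [dyadicSum_mul hD0.le]
  set g : ℕ → ℂ := fun l => ∑ m ∈ Finset.Ioc ⌊D / l⌋₊ ⌊2 * D / l⌋₊,
    arithRestrict complexZeta (fun l => ¬ l ≤ U) m * α l * phaseSum (u ^ 22) H γ (m * l) with hg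
  have hgl : ∀ l, 1 ≤ l → l ≤ U → ‖g l‖ ≤ B * (H * (10 ^ 14 * u ^ 5)) := by
    intro l hl1 hlU
    have hl1r : (1 : ℝ) ≤ l := by exact_mod_cast hl1
    have hlUr : (l : ℝ) ≤ U := by exact_mod_cast hlU
    have hl4 : (l : ℝ) ^ 4 ≤ D := le_trans (by gcongr) hp.U_pow_le
    have hlD : (l : ℝ) ≤ D := by
      calc (l : ℝ) = l ^ 1 := (pow_one _).symm
        _ ≤ l ^ 4 := pow_le_pow_right₀ hl1r (by norm_num)
        _ ≤ D := hl4
    have e : g l = α l * ∑ h ∈ Finset.Ico H (2 * H), γ h *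
        ∑ m ∈ Finset.Ioc ⌊D / l⌋₊ ⌊2 * D / l⌋₊, expTwoPi (h * u ^ 22 / (l * m : ℝ) ^ 2) := by
      simp_rw [Finset.mul_sum]
      rw [Finset.sum_comm, hg]
      refine Finset.sum_congr rfl fun m hm => ?_
      have hm1 : D / l < m := (Nat.floor_lt (by positivity)).1 (Finset.mem_Ioc.1 hm).1
      -- Since m l > D ≥ U^4 and l ≤ U, the smooth variable exceeds U automatically, and its
      -- truncation has no effect.
      have hm2 : U < m := by
        have : (U : ℝ) < m := by
          refine lt_of_le_of_lt ?_ hm1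
          rw [le_div_iff₀ (by linarith)]
          calc (U : ℝ) * l ≤ U * U := by gcongr
            _ = U ^ 2 := by ring
            _ ≤ U ^ 4 := pow_le_pow_right₀ hUr (by norm_num)
            _ ≤ D := hp.U_pow_le
        exact_mod_cast this
      rw [arithRestrict_apply, if_pos (by omega), complexZeta_apply (by omega), phaseSum, Finset.mul_sum]
      refine Finset.sum_congr rfl fun h _ => ?_
      push_cast
      rw [mul_comm (m : ℝ) l]
      ring
    rw [e, norm_mul]
    refine mul_le_mul (hα l (by linarith)) ?_ (norm_nonneg _) hB.le
    refine (norm_sum_le _ _).trans ?_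
    calc _ ≤ ∑ h ∈ Finset.Ico H (2 * H), (10 ^ 14 * u ^ 5 : ℝ) := by
          refine Finset.sum_le_sum fun h hh => ?_
          rw [Finset.mem_Ico] at hh
          rw [norm_mul]
          have hH := hp.H_pos
          have hb := norm_sum_expTwoPi_smooth_le hp.one_le_u hp.pow_le hp.le_pow (m := l) (h := h) hl1 hl4 (by omega) (by
            have h1 : (h : ℝ) ≤ 2 * H := by exact_mod_cast hh.2.le
            calc (h : ℝ) * u ^ 14 ≤ 2 * H * u ^ 14 := by gcongr
              _ = 2 * (H * u ^ 14) := by ring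
              _ ≤ 2 * D ^ 2 := by linarith [hp.H_le])
          calc _ ≤ 1 * (10 ^ 14 * u ^ 5) := mul_le_mul (hγ h) hb (norm_nonneg _) zero_le_one
            _ = _ := one_mul _
      _ = H * (10 ^ 14 * u ^ 5) := by
          rw [Finset.sum_const, Nat.card_Ico, nsmul_eq_mul]
          congr 2
          omega
  have hg0 : ∀ l, U < l → g l = 0 := fun l hl => by
    rw [hg]; simp only
    exact Finset.sum_eq_zero fun m _ => by rw [hαs l hl, mul_zero, zero_mul]
  calc ‖∑ l ∈ Finset.Icc 1 ⌊2 * D⌋₊, g l‖ = ‖∑ l ∈ (Finset.Icc 1 ⌊2 * D⌋₊).filter (· ≤ U), g l‖ := by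
        congr 1
        rw [Finset.sum_filter_of_ne]
        intro l _ hne
        by_contra h
        exact hne (hg0 l (by omega))
    _ ≤ ∑ l ∈ (Finset.Icc 1 ⌊2 * D⌋₊).filter (· ≤ U), B * (H * (10 ^ 14 * u ^ 5)) := by
        refine (norm_sum_le _ _).trans (Finset.sum_le_sum fun l hl => ?_)
        rw [Finset.mem_filter, Finset.mem_Icc] at hl
        exact hgl l hl.1.1 hl.2
    _ = ((Finset.Icc 1 ⌊2 * D⌋₊).filter (· ≤ U)).card * (B * (H * (10 ^ 14 * u ^ 5))) := by
        rw [Finset.sum_const, nsmul_eq_mul]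
    _ ≤ u ^ 2 * (B * (H * (10 ^ 14 * u ^ 5))) := by
        gcongr
        refine le_trans ?_ hUu
        have : ((Finset.Icc 1 ⌊2 * D⌋₊).filter (· ≤ U)) ⊆ Finset.Icc 1 U := fun l hl => by
          simp only [Finset.mem_filter, Finset.mem_Icc] at hl ⊢
          exact ⟨hl.1.1, hl.2⟩
        have := Finset.card_le_card this
        rw [Nat.card_Icc, Nat.add_sub_cancel] at this
        exact_mod_cast this
    _ = _ := by ring

/-- Sums over `m l` with `l > U` smooth and `m` arbitrary. -/
theorem exists_norm_dyadicSum_smooth_mul_le {ε : ℝ} (hε : 0 < ε) : ∃ C : ℝ, 1 ≤ C ∧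
    ∀ (u D : ℝ) (H U : ℕ), DyadicParams u D H U → ∀ (γ : ℕ → ℂ) (_ : ∀ h, ‖γ h‖ ≤ 1)
    (α : ArithmeticFunction ℂ) (B : ℝ) (_ : 1 ≤ B) (_ : ∀ n : ℕ, (n : ℝ) ≤ 2 * D → ‖α n‖ ≤ B),
    ‖dyadicSum D (phaseSum (u ^ 22) H γ) (arithRestrict complexZeta (fun l => ¬ l ≤ U) * α)‖ ≤
      C * (u ^ 22) ^ ε * (B ^ 2 * (H * u ^ 7)) := by
  obtain ⟨C, hC, h⟩ := exists_norm_dyadicSum_mul_le hε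
  refine ⟨10 ^ 14 + C, by linarith, ?_⟩
  intro u D H U hp γ hγ α B hB hα
  have hu0 : 0 < u := by linarith [hp.one_le_u]
  have e : dyadicSum D (phaseSum (u ^ 22) H γ) (arithRestrict complexZeta (fun l => ¬ l ≤ U) * α) =
      dyadicSum D (phaseSum (u ^ 22) H γ) (arithRestrict complexZeta (fun l => ¬ l ≤ U) * arithRestrict α (· ≤ U)) +
      dyadicSum D (phaseSum (u ^ 22) H γ) (arithRestrict complexZeta (fun l => ¬ l ≤ U) * arithRestrict α (fun l => ¬ l ≤ U)) := by
    rw [← dyadicSum_add, ← mul_add, arithRestrict_add_not]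
  rw [e]
  have b1 := norm_dyadicSum_smooth_mul_le hp hγ (α := arithRestrict α (· ≤ U)) (B := B) (by linarith)
    (fun n hn => (norm_arithRestrict_le _ _ _).trans (hα n hn))
    (fun l hl => by rw [arithRestrict_apply, if_neg (by omega)])
  have b2 := h u D H U hp γ hγ (arithRestrict complexZeta (fun l => ¬ l ≤ U)) (arithRestrict α (fun l => ¬ l ≤ U)) B
    (by linarith) (fun n _ => by
      refine (norm_arithRestrict_le _ _ _).trans ?_
      rcases eq_or_ne n 0 with rfl | hn
      · simp; linarith
      · rw [complexZeta_apply hn]; simpa using hB)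
    (fun n hn => (norm_arithRestrict_le _ _ _).trans (hα n hn))
    (fun l hl => by rw [arithRestrict_apply, if_neg (by omega)])
    (fun l hl => by rw [arithRestrict_apply, if_neg (by omega)])
  have hx1 : 1 ≤ (u ^ 22) ^ ε := Real.one_le_rpow (one_le_pow₀ hp.one_le_u) hε.le
  have hBB : B ≤ B ^ 2 := by nlinarith
  have b1' : 10 ^ 14 * (B * (H * u ^ 7)) ≤ 10 ^ 14 * (u ^ 22) ^ ε * (B ^ 2 * (H * u ^ 7)) := by
    calc 10 ^ 14 * (B * (H * u ^ 7)) ≤ 10 ^ 14 * (B ^ 2 * (H * u ^ 7)) := by gcongr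
      _ = 10 ^ 14 * 1 * (B ^ 2 * (H * u ^ 7)) := by ring
      _ ≤ _ := by gcongr
  refine (norm_add_le _ _).trans ?_
  have : (10 ^ 14 + C) * (u ^ 22) ^ ε * (B ^ 2 * (H * u ^ 7)) =
    10 ^ 14 * (u ^ 22) ^ ε * (B ^ 2 * (H * u ^ 7)) + C * (u ^ 22) ^ ε * (B ^ 2 * (H * u ^ 7)) := by ring
  linarith

/-- The exponential sum with coefficients `μ * μ`. -/
theorem exists_norm_dyadicSum_moebiusSq_le {ε : ℝ} (hε : 0 < ε) : ∃ C : ℝ, 1 ≤ C ∧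
    ∀ (u D : ℝ) (H U : ℕ), DyadicParams u D H U → ∀ (γ : ℕ → ℂ) (_ : ∀ h, ‖γ h‖ ≤ 1),
    ‖dyadicSum D (phaseSum (u ^ 22) H γ) moebiusSq‖ ≤ C * (u ^ 22) ^ ε * (H * u ^ 7) := by
  obtain ⟨C₁, hC₁, hS⟩ := exists_norm_dyadicSum_smooth_mul_le (half_pos hε)
  obtain ⟨C₂, hC₂, hII⟩ := exists_norm_dyadicSum_mul_le (half_pos hε)
  -- The longest coefficient met below is `G * G * complexZeta`, dominated by d_{2+2+1}.
  obtain ⟨C₃, hC₃, hK⟩ := isSubPoly_divisorK 5 (ε / 4) (by positivity)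
  set B₀ := 2 * C₃ * 2 ^ (ε / 4) with hB₀
  have h2 : (1 : ℝ) ≤ 2 ^ (ε / 4) := Real.one_le_rpow (by norm_num) (by positivity)
  have hB₀1 : 1 ≤ B₀ := by nlinarith
  refine ⟨(2 * C₁ + C₂) * B₀ ^ 2, by nlinarith [one_le_pow₀ (n := 2) hB₀1], ?_⟩
  intro u D H U hp γ hγ
  have hu0 : 0 < u := by linarith [hp.one_le_u]
  have hD0 : 0 < D := by linarith [hp.eight_le]
  have hUr : (1 : ℝ) ≤ U := by exact_mod_cast hp.U_pos
  set x := u ^ 22 with hx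
  have hx1 : 1 ≤ x := one_le_pow₀ hp.one_le_u
  have hDx : D ≤ x := hp.le_pow.trans (pow_le_pow_right₀ hp.one_le_u (by norm_num))
  set B := B₀ * x ^ (ε / 4) with hB
  have hB1 : 1 ≤ B := one_le_mul_of_one_le_of_one_le hB₀1 (Real.one_le_rpow hx1 (by positivity))
  have hBn : ∀ n : ℕ, (n : ℝ) ≤ 2 * D → 2 * divisorK 5 n ≤ B := by
    intro n hn
    have h1 := (le_abs_self _).trans (hK n)
    have h3 : (n : ℝ) ^ (ε / 4) ≤ (2 * x) ^ (ε / 4) := by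
      apply Real.rpow_le_rpow (Nat.cast_nonneg _) (by linarith) (by positivity)
    rw [Real.mul_rpow (by norm_num) (by linarith)] at h3
    calc 2 * divisorK 5 n ≤ 2 * (C₃ * (2 ^ (ε / 4) * x ^ (ε / 4))) := by nlinarith
      _ = B := by rw [hB, hB₀]; ring
  have hdom : ∀ (f : ArithmeticFunction ℂ) (k : ℕ), k ≤ 5 → DominatedBy f (divisorK k) →
      ∀ n : ℕ, (n : ℝ) ≤ 2 * D → ‖f n‖ ≤ B := by
    intro f k hk hf n hn
    have h1 := hf n
    have h3 := divisorK_mono hk n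
    have h4 := hBn n hn
    have h5 := divisorK_nonneg 5 n
    linarith
  set G := arithRestrict moebiusSq (· ≤ U) with hG
  set R := arithRestrict moebiusSq (fun l => ¬ l ≤ U) with hR
  set Zs := arithRestrict complexZeta (· ≤ U) with hZs
  set Zl := arithRestrict complexZeta (fun l => ¬ l ≤ U) with hZl
  have hGR : G + R = moebiusSq := arithRestrict_add_not _ _
  have hZZ : Zs + Zl = complexZeta := arithRestrict_add_not _ _
  have hGdom : DominatedBy G (divisorK 2) := dominatedBy_moebiusSq.restrict _
  have hRdom : DominatedBy R (divisorK 2) := dominatedBy_moebiusSq.restrict _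
  have hZsdom : DominatedBy Zs (divisorK 1) := dominatedBy_complexZeta.restrict _
  -- Formally, with m = μ*μ = G + R and ζ^2 m = 1, one has m = 2G - ζ^2 G^2 + R (1 - ζ^2 G). One
  -- factor ζ of ζ^2 G^2 is split at U. In the last product both factors vanish up to U: R by
  -- definition, and 1 - ζ^2 G because G agrees with m there.
  have hid : moebiusSq = G + G - (Zl * (G * G * complexZeta) + complexZeta * (G * G * Zs)) +
      R * (1 - complexZeta * complexZeta * G) := by
    have e1 : R = moebiusSq - G := by rw [← hGR]; ring
    have e2 : Zs = complexZeta - Zl := by rw [← hZZ]; ring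
    rw [e1, e2]
    linear_combination G * complexZeta_sq_mul_moebiusSq
  have hGs : ∀ n : ℕ, (U : ℝ) < n → G n = 0 := fun n hn => by
    have : U < n := by exact_mod_cast hn
    rw [hG, arithRestrict_apply, if_neg (by omega)]
  have hZss : ∀ n : ℕ, (U : ℝ) < n → Zs n = 0 := fun n hn => by
    have : U < n := by exact_mod_cast hn
    rw [hZs, arithRestrict_apply, if_neg (by omega)]
  have hU4 : (U : ℝ) * U * U * U ≤ D := by
    calc (U : ℝ) * U * U * U = U ^ 4 := by ring
      _ ≤ D := hp.U_pow_le
  -- the terms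
  have t0 : dyadicSum D (phaseSum x H γ) G = 0 := dyadicSum_eq_zero hD0.le _ fun n hn => hGs n (by
    have : (U : ℝ) ≤ U ^ 4 := le_self_pow₀ hUr (by norm_num)
    linarith [hp.U_pow_le])
  have t1 : ‖dyadicSum D (phaseSum x H γ) (Zl * (G * G * complexZeta))‖ ≤ C₁ * x ^ (ε / 2) * (B ^ 2 * (H * u ^ 7)) :=
    hS u D H U hp γ hγ _ B hB1 (hdom _ 5 le_rfl (by
      have := (hGdom.mul hGdom).mul dominatedBy_complexZeta
      rwa [← divisorK_add, ← divisorK_add] at this))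
  have t2 : ‖dyadicSum D (phaseSum x H γ) (complexZeta * (G * G * Zs))‖ ≤ C₁ * x ^ (ε / 2) * (B ^ 2 * (H * u ^ 7)) := by
    -- Replacing the remaining ζ by its part above U drops a product of four factors supported up to
    -- U, hence up to U^4 ≤ D, outside the block. This dictates U ≈ D^{1/4}.
    have e : dyadicSum D (phaseSum x H γ) (complexZeta * (G * G * Zs)) = dyadicSum D (phaseSum x H γ) (Zl * (G * G * Zs)) := by
      rw [← hZZ, add_mul, dyadicSum_add, dyadicSum_eq_zero hD0.le _ (f := Zs * (G * G * Zs)), zero_add]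
      intro n hn
      have hUU := ArithmeticFunction.mul_apply_eq_zero_of_support hGs hGs
      have hUUU := ArithmeticFunction.mul_apply_eq_zero_of_support hUU hZss
      refine ArithmeticFunction.mul_apply_eq_zero_of_support hZss hUUU n ?_
      linarith
    rw [e]
    exact hS u D H U hp γ hγ _ B hB1 (hdom _ 5 le_rfl (by
      have := (hGdom.mul hGdom).mul hZsdom
      rwa [← divisorK_add, ← divisorK_add] at this))
  have t3 : ‖dyadicSum D (phaseSum x H γ) (R * (1 - complexZeta * complexZeta * G))‖ ≤
      C₂ * x ^ (ε / 2) * (B ^ 2 * (H * u ^ 7)) := by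
    refine hII u D H U hp γ hγ _ _ B (by linarith) (hdom _ 2 (by norm_num) hRdom) ?_ ?_ ?_
    · intro n hn
      have h1 : (1 - complexZeta * complexZeta * G) n + (complexZeta * complexZeta * G) n = (1 : ArithmeticFunction ℂ) n := by
        rw [← ArithmeticFunction.add_apply, sub_add_cancel]
      have h3 : ‖(1 - complexZeta * complexZeta * G) n‖ ≤ ‖(1 : ArithmeticFunction ℂ) n‖ + ‖(complexZeta * complexZeta * G) n‖ := by
        rw [← h1]
        have := norm_sub_le ((1 - complexZeta * complexZeta * G) n + (complexZeta * complexZeta * G) n) ((complexZeta * complexZeta * G) n)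
        simpa using this
      have h4 := ((dominatedBy_complexZeta.mul dominatedBy_complexZeta).mul hGdom) n
      rw [← divisorK_add, ← divisorK_add] at h4
      have h5 := divisorK_mono (show 1 + 1 + 2 ≤ 5 by norm_num) n
      have h6 : ‖(1 : ArithmeticFunction ℂ) n‖ ≤ divisorK 5 n := by
        rcases eq_or_ne n 1 with rfl | hn
        · have := divisorK_mono (show 1 ≤ 5 by norm_num) 1
          rw [divisorK_one_apply one_ne_zero] at this
          simpa using this
        · rw [ArithmeticFunction.one_apply_ne hn, norm_zero]; exact divisorK_nonneg _ _
      linarith [hBn n hn]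
    · intro l hl
      rw [hR, arithRestrict_apply, if_neg (by omega)]
    · intro l hl
      have h1 : (1 - complexZeta * complexZeta * G) l + (complexZeta * complexZeta * G) l = (1 : ArithmeticFunction ℂ) l := by
        rw [← ArithmeticFunction.add_apply, sub_add_cancel]
      have h3 : (complexZeta * complexZeta * G) l = (1 : ArithmeticFunction ℂ) l := by
        rw [← complexZeta_sq_mul_moebiusSq, ArithmeticFunction.mul_apply, ArithmeticFunction.mul_apply]
        refine Finset.sum_congr rfl fun p hp' => ?_
        have hm := Nat.mem_divisorsAntidiagonal.1 hp'
        have h4 : p.2 ≤ U := (Nat.le_of_dvd (Nat.pos_of_ne_zero hm.2) (Dvd.intro_left _ hm.1)).trans hl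
        rw [hG, arithRestrict_apply, if_pos h4]
      rw [h3] at h1
      simpa using h1
  rw [hid, dyadicSum_add, dyadicSum_sub, dyadicSum_add, dyadicSum_add, t0, add_zero, zero_sub]
  refine (norm_add_le _ _).trans ?_
  rw [norm_neg]
  have h7 := norm_add_le (dyadicSum D (phaseSum x H γ) (Zl * (G * G * complexZeta))) (dyadicSum D (phaseSum x H γ) (complexZeta * (G * G * Zs)))
  have e : (2 * C₁ + C₂) * B₀ ^ 2 * x ^ ε * (H * u ^ 7) = C₁ * x ^ (ε / 2) * (B ^ 2 * (H * u ^ 7)) +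
      C₁ * x ^ (ε / 2) * (B ^ 2 * (H * u ^ 7)) + C₂ * x ^ (ε / 2) * (B ^ 2 * (H * u ^ 7)) := by
    have e1 : x ^ ε = x ^ (ε / 2) * (x ^ (ε / 4)) ^ 2 := by
      rw [← Real.rpow_natCast (x ^ (ε / 4)), ← Real.rpow_mul (by linarith), ← Real.rpow_add (by linarith)]
      congr 1
      push_cast
      ring
    rw [e1, hB]; ring
  rw [e]
  linarith

/-! ### The sawtooth function -/

/-- The primitive `({t} ^ 2 - {t} + 1 / 6) / 2` of the sawtooth function. -/
noncomputable def sawtoothPrim (t : ℝ) : ℝ := (Int.fract t ^ 2 - Int.fract t + 1 / 6) / 2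

/-- The periodic primitive never exceeds the quadratic polynomial with which it coincides on the
period containing t: a shift of the argument of that polynomial by k periods changes it by k (k + 1
- 2 (f + δ))/2, which is never positive. For the polynomial the expansion on the right is exact.
Taking δ of either sign bounds the sawtooth from both sides by its short averages. -/
theorem sawtoothPrim_add_sub_le (t δ : ℝ) :
    sawtoothPrim (t + δ) - sawtoothPrim t ≤ δ * (Int.fract t - 1 / 2) + δ ^ 2 / 2 := by
  set f := Int.fract t with hf
  set k := ⌊f + δ⌋ with hk
  have e : Int.fract (t + δ) = f + δ - k := by
    have : t + δ = (f + δ) + (⌊t⌋ : ℤ) := by rw [hf, Int.fract]; ring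
    rw [this, Int.fract_add_intCast, Int.fract]
  have h1 : (k : ℝ) ≤ f + δ := Int.floor_le _
  have h2 : f + δ < k + 1 := Int.lt_floor_add_one _
  have key : (k : ℝ) * (k + 1 - 2 * (f + δ)) ≤ 0 := by
    rcases lt_trichotomy k 0 with h | h | h
    · have h' : (k : ℝ) + 1 ≤ 0 := by exact_mod_cast h
      nlinarith
    · rw [h]; simp
    · have h' : (1 : ℝ) ≤ k := by exact_mod_cast h
      nlinarith
  rw [sawtoothPrim, sawtoothPrim, e, ← hf]
  nlinarith

/-- This is the Fourier series of the second Bernoulli polynomial. The primitive is expanded rather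
than the sawtooth itself because its series converges absolutely. -/
theorem hasSum_sawtoothPrim (t : ℝ) :
    HasSum (fun n : ℕ => 1 / (2 * Real.pi ^ 2 * (n : ℝ) ^ 2) * Real.cos (2 * Real.pi * n * t)) (sawtoothPrim t) := by
  have h := hasSum_one_div_nat_pow_mul_cos (k := 1) one_ne_zero (x := Int.fract t)
    ⟨Int.fract_nonneg t, (Int.fract_lt_one t).le⟩
  have h2 := h.mul_left (1 / (2 * Real.pi ^ 2))
  have hp := Real.pi_pos
  convert! h2 using 1
  · funext n
    have : Real.cos (2 * Real.pi * n * t) = Real.cos (2 * Real.pi * n * Int.fract t) := by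
      have e : 2 * Real.pi * n * t = 2 * Real.pi * n * Int.fract t + ((n * ⌊t⌋ : ℤ) : ℝ) * (2 * Real.pi) := by
        conv_lhs => rw [← Int.fract_add_floor t]
        push_cast; ring
      rw [e, Real.cos_add_int_mul_two_pi]
    rw [this]
    rcases eq_or_ne n 0 with rfl | hn
    · simp
    · have : (n : ℝ) ≠ 0 := by exact_mod_cast hn
      field_simp
      ring
  · rw [sawtoothPrim]
    have : ((Polynomial.map (algebraMap ℚ ℝ) (Polynomial.bernoulli (2 * 1))).eval (Int.fract t)) =
        Int.fract t ^ 2 - Int.fract t + 1 / 6 := by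
      have e : Polynomial.bernoulli 2 = Polynomial.X ^ 2 - Polynomial.X + Polynomial.C (1 / 6 : ℚ) := by
        rw [Polynomial.bernoulli]
        simp [Finset.sum_range_succ, bernoulli_eq_bernoulli'_of_ne_one, Polynomial.C_mul_X_pow_eq_monomial.symm]
        have hc : Polynomial.C (-1 / 2 : ℚ) * 2 = -1 := by
          rw [← map_ofNat Polynomial.C 2, ← Polynomial.C_mul]; norm_num
        linear_combination Polynomial.X * hc
      rw [mul_one, e]
      simp
    rw [this]
    simp [Nat.factorial]
    field_simp

theorem re_expTwoPi (t : ℝ) : (expTwoPi t).re = Real.cos (2 * Real.pi * t) := by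
  have : (2 * Real.pi * t * Complex.I : ℂ) = ((2 * Real.pi * t : ℝ) : ℂ) * Complex.I := by push_cast; ring
  rw [expTwoPi, this, Complex.exp_ofReal_mul_I_re]

theorem norm_expTwoPi_sub_one_le (t : ℝ) : ‖expTwoPi t - 1‖ ≤ 2 * Real.pi * |t| := by
  have : expTwoPi t = Complex.exp (Complex.I * ((2 * Real.pi * t : ℝ) : ℂ)) := by
    rw [expTwoPi]; congr 1; push_cast; ring
  rw [this]
  refine (Real.norm_exp_I_mul_ofReal_sub_one_le).trans (le_of_eq ?_)
  rw [Real.norm_eq_abs, abs_mul, abs_of_pos (by positivity : 0 < 2 * Real.pi)]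

/-- Fourier coefficients of the mean value of the sawtooth function over `[t, t + δ]`. -/
noncomputable def sawtoothCoeff (δ : ℝ) (n : ℕ) : ℂ :=
  (expTwoPi (n * δ) - 1) / ((2 * Real.pi ^ 2 * δ * (n : ℝ) ^ 2 : ℝ) : ℂ)

/-- The first bound uses |e(t) - 1| ≤ 2π |t|, the second |e(t) - 1| ≤ 2. The first serves in the
dyadic blocks of frequencies, the second makes the tail of the series small. -/
theorem norm_sawtoothCoeff_le {δ : ℝ} (hδ : δ ≠ 0) {n : ℕ} (hn : n ≠ 0) :
    ‖sawtoothCoeff δ n‖ ≤ 1 / n ∧ ‖sawtoothCoeff δ n‖ ≤ 1 / (|δ| * n ^ 2) := by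
  have hn0 : (0 : ℝ) < n := by exact_mod_cast Nat.pos_of_ne_zero hn
  have hp := Real.pi_gt_three
  have hδ0 : 0 < |δ| := abs_pos.2 hδ
  have hden : ‖((2 * Real.pi ^ 2 * δ * (n : ℝ) ^ 2 : ℝ) : ℂ)‖ = 2 * Real.pi ^ 2 * |δ| * n ^ 2 := by
    rw [Complex.norm_real, Real.norm_eq_abs, abs_mul, abs_mul, abs_of_pos (by positivity : 0 < 2 * Real.pi ^ 2),
      abs_of_pos (by positivity : 0 < (n : ℝ) ^ 2)]
  rw [sawtoothCoeff, norm_div, hden]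
  constructor
  · have h1 := norm_expTwoPi_sub_one_le (n * δ)
    rw [abs_mul, abs_of_pos hn0] at h1
    rw [div_le_div_iff₀ (by positivity) hn0, one_mul]
    calc ‖expTwoPi (n * δ) - 1‖ * n ≤ 2 * Real.pi * (n * |δ|) * n := by gcongr
      _ = (2 * |δ| * n ^ 2) * (Real.pi * 1) := by ring
      _ ≤ (2 * |δ| * n ^ 2) * (Real.pi * Real.pi) := by gcongr; linarith
      _ = _ := by ring
  · have h1 : ‖expTwoPi (n * δ) - 1‖ ≤ 2 := by
      refine (norm_sub_le _ _).trans ?_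
      rw [norm_expTwoPi, norm_one]; norm_num
    rw [div_le_div_iff₀ (by positivity) (by positivity), one_mul]
    have h2 : 2 ≤ 2 * Real.pi ^ 2 := by nlinarith
    calc ‖expTwoPi (n * δ) - 1‖ * (|δ| * n ^ 2) ≤ 2 * Real.pi ^ 2 * (|δ| * n ^ 2) := by
          gcongr; linarith
      _ = _ := by ring

theorem summable_sawtoothCoeff_mul {δ : ℝ} (hδ : δ ≠ 0) (t : ℝ) :
    Summable fun n : ℕ => sawtoothCoeff δ n * expTwoPi (n * t) := by
  refine Summable.of_norm_bounded (g := fun n : ℕ => 1 / |δ| * (1 / (n : ℝ) ^ 2))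
    ((Real.summable_one_div_nat_pow.2 one_lt_two).mul_left _) fun n => ?_
  rw [norm_mul, norm_expTwoPi, mul_one]
  rcases eq_or_ne n 0 with rfl | hn
  · simp [sawtoothCoeff]
  · refine ((norm_sawtoothCoeff_le hδ hn).2).trans (le_of_eq ?_)
    rw [div_mul_div_comm, one_mul]

theorem re_tsum_sawtoothCoeff {δ : ℝ} (hδ : δ ≠ 0) (t : ℝ) :
    (∑' n : ℕ, sawtoothCoeff δ n * expTwoPi (n * t)).re = (sawtoothPrim (t + δ) - sawtoothPrim t) / δ := by
  have h := ((hasSum_sawtoothPrim (t + δ)).sub (hasSum_sawtoothPrim t)).div_const δ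
  have h2 := Complex.hasSum_re (summable_sawtoothCoeff_mul hδ t).hasSum
  refine h2.unique ?_
  convert! h using 1
  funext n
  have e : sawtoothCoeff δ n * expTwoPi (n * t) = (expTwoPi (n * (t + δ)) - expTwoPi (n * t)) /
      ((2 * Real.pi ^ 2 * δ * (n : ℝ) ^ 2 : ℝ) : ℂ) := by
    rw [sawtoothCoeff, mul_add, expTwoPi_add]; ring
  rw [e, Complex.div_ofReal_re, Complex.sub_re, re_expTwoPi, re_expTwoPi]
  rcases eq_or_ne n 0 with rfl | hn
  · simp
  · have : (n : ℝ) ≠ 0 := by exact_mod_cast hn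
    have hp := Real.pi_pos
    rw [show 2 * Real.pi * (n * (t + δ)) = 2 * Real.pi * n * (t + δ) by ring,
      show 2 * Real.pi * (n * t) = 2 * Real.pi * n * t by ring]
    field_simp

theorem tsum_inv_sq_tail_le {K : ℕ} (hK : 0 < K) :
    Summable (fun n : ℕ => 1 / ((n + K : ℕ) : ℝ) ^ 2) ∧ ∑' n : ℕ, 1 / ((n + K : ℕ) : ℝ) ^ 2 ≤ 2 / (K : ℝ) := by
  have hKr : (1 : ℝ) ≤ K := by exact_mod_cast hK
  have hpart : ∀ m : ℕ, ∑ n ∈ Finset.range m, 1 / ((n + K : ℕ) : ℝ) ^ 2 ≤ 2 / (K : ℝ) - 2 / ((m : ℝ) + K) := by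
    intro m
    induction m with
    | zero => simp
    | succ m ih =>
      rw [Finset.sum_range_succ]
      have hm : (0 : ℝ) ≤ m := Nat.cast_nonneg m
      have : 1 / ((m + K : ℕ) : ℝ) ^ 2 ≤ 2 / ((m : ℝ) + K) - 2 / (((m + 1 : ℕ) : ℝ) + K) := by
        push_cast
        rw [div_sub_div _ _ (by positivity) (by positivity), div_le_div_iff₀ (by positivity) (by positivity)]
        nlinarith [mul_nonneg hm hm]
      linarith
  refine ⟨summable_of_sum_range_le (c := 2 / (K : ℝ)) (fun n => by positivity) fun m => (hpart m).trans ?_,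
    Real.tsum_le_of_sum_range_le (fun n => by positivity) fun m => (hpart m).trans ?_⟩ <;>
  · have : (0 : ℝ) ≤ 2 / ((m : ℝ) + K) := by positivity
    linarith

/-- From dyadic blocks of frequencies to the truncated Fourier series. -/
theorem norm_dyadicSum_tsum_le {u D : ℝ} {U : ℕ} (hp : DyadicParams u D 1 U) {f : ArithmeticFunction ℂ} {B T : ℝ}
    (hB : 0 ≤ B) (hT : 0 ≤ T)
    (hf : ∀ n : ℕ, (n : ℝ) ≤ 2 * D → ‖f n‖ ≤ B)
    (hbl : ∀ H : ℕ, DyadicParams u D H U → ∀ γ : ℕ → ℂ, (∀ h, ‖γ h‖ ≤ 1) →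
      ‖dyadicSum D (phaseSum (u ^ 22) H γ) f‖ ≤ T * H)
    {δ : ℝ} (hδ : |δ| = u ^ 7 / D) :
    ‖dyadicSum D (fun d => ∑' n : ℕ, sawtoothCoeff δ n * expTwoPi (n * (u ^ 22 / (d : ℝ) ^ 2))) f‖ ≤
      2 * (2 + Real.log (4 * u ^ 22)) * T + 4 * B * u ^ 7 := by
  have hu := hp.one_le_u
  have hu0 : 0 < u := by linarith
  have hD0 : 0 < D := by linarith [hp.eight_le]
  have hδ0 : 0 < |δ| := by rw [hδ]; positivity
  have hδne : δ ≠ 0 := abs_pos.1 hδ0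
  set x := u ^ 22 with hx
  have hx1 : 1 ≤ x := one_le_pow₀ hu
  -- Y = δ^{-2} is the largest H allowed by `DyadicParams`. Beyond it the coefficients sum to
  -- O(1/(|δ| Y)) = O(u^7/D), so that the tail, summed trivially over d, costs O(B u^7).
  set Y : ℝ := D ^ 2 / u ^ 14 with hY
  have hY1 : 1 ≤ Y := by
    rw [hY, le_div_iff₀ (by positivity), one_mul]
    calc u ^ 14 = (u ^ 7) ^ 2 := by ring
      _ ≤ D ^ 2 := by gcongr; exact hp.pow_le
  have hYx : Y ≤ x := by
    rw [hY, div_le_iff₀ (by positivity)]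
    calc D ^ 2 ≤ (u ^ 8) ^ 2 := by gcongr; exact hp.le_pow
      _ = u ^ 16 := by ring
      _ ≤ u ^ 36 := pow_le_pow_right₀ hu (by norm_num)
      _ = _ := by rw [hx]; ring
  have hex : ∃ J : ℕ, Y < 2 ^ J := pow_unbounded_of_one_lt Y one_lt_two
  set J := Nat.find hex with hJ
  have hJ1 : Y < 2 ^ J := Nat.find_spec hex
  have hJ2 : ∀ j < J, (2 : ℝ) ^ j ≤ Y := fun j hj => not_lt.1 (Nat.find_min hex hj)
  have hJ0 : 0 < J := by
    rcases Nat.eq_zero_or_pos J with h | h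
    · rw [h, pow_zero] at hJ1; linarith
    · exact h
  have hlog0 : 0 ≤ Real.log x := Real.log_nonneg hx1
  have hJlog : (J : ℝ) ≤ 2 * (2 + Real.log (4 * x)) := by
    have h1 := (hJ2 (J - 1) (by omega)).trans hYx
    have h2 := Real.log_le_log (by positivity) h1
    rw [Real.log_pow, Nat.cast_sub hJ0, Nat.cast_one] at h2
    have h3 := Real.log_two_gt_d9
    have h4 : Real.log (4 * x) = Real.log 4 + Real.log x := Real.log_mul (by norm_num) (by linarith)
    have h5 : 0 ≤ Real.log 4 := Real.log_nonneg (by norm_num)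
    have h6 : (1 : ℝ) ≤ J := by exact_mod_cast hJ0
    nlinarith
  set K : ℕ := 2 ^ J with hK
  have hK0 : 0 < K := by positivity
  have hsplit : ∀ d : ℕ, ∑' n : ℕ, sawtoothCoeff δ n * expTwoPi (n * (x / (d : ℝ) ^ 2)) =
      ∑ j ∈ Finset.range J, phaseSum x (2 ^ j) (sawtoothCoeff δ) d +
        ∑' n : ℕ, sawtoothCoeff δ (n + K) * expTwoPi ((n + K : ℕ) * (x / (d : ℝ) ^ 2)) := by
    intro d
    rw [← (summable_sawtoothCoeff_mul hδne _).sum_add_tsum_nat_add K]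
    congr 1
    have h1 : ∑ i ∈ Finset.range K, sawtoothCoeff δ i * expTwoPi (i * (x / (d : ℝ) ^ 2)) =
        ∑ i ∈ Finset.Ico 1 (2 ^ J * 1), sawtoothCoeff δ i * expTwoPi (i * (x / (d : ℝ) ^ 2)) := by
      rw [mul_one, ← hK, Finset.range_eq_Ico, Finset.sum_eq_sum_Ico_succ_bot hK0]
      simp [sawtoothCoeff]
    rw [h1, sum_Ico_dyadic]
    refine Finset.sum_congr rfl fun j _ => ?_
    rw [mul_one, phaseSum]
    refine Finset.sum_congr rfl fun h _ => ?_
    rw [mul_div_assoc]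
  have hE : dyadicSum D (fun d => ∑' n : ℕ, sawtoothCoeff δ n * expTwoPi (n * (x / (d : ℝ) ^ 2))) f =
      ∑ j ∈ Finset.range J, dyadicSum D (phaseSum x (2 ^ j) (sawtoothCoeff δ)) f +
      dyadicSum D (fun d => ∑' n : ℕ, sawtoothCoeff δ (n + K) * expTwoPi ((n + K : ℕ) * (x / (d : ℝ) ^ 2))) f := by
    simp only [dyadicSum]
    rw [Finset.sum_comm, ← Finset.sum_add_distrib]
    refine Finset.sum_congr rfl fun d _ => ?_
    rw [hsplit d, mul_add, Finset.mul_sum]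
  have hblock : ∀ j ∈ Finset.range J, ‖dyadicSum D (phaseSum x (2 ^ j) (sawtoothCoeff δ)) f‖ ≤ T := by
    intro j hj
    have h2j : (0 : ℝ) < 2 ^ j := by positivity
    have hp' : DyadicParams u D (2 ^ j) U := ⟨hp.one_le_u, hp.pow_le, hp.le_pow, hp.eight_le, by positivity, by
      have := hJ2 j (Finset.mem_range.1 hj)
      rw [hY, le_div_iff₀ (by positivity)] at this
      exact_mod_cast this, hp.U_pos, hp.U_pow_le, hp.le_U_pow⟩
    -- The coefficients in the block are O(2^{-j}), so they are rescaled by 2^j; they are set to 0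
    -- below the block because the bound by 1 is demanded for every index.
    have h := hbl (2 ^ j) hp' (fun n => if 2 ^ j ≤ n then (2 : ℂ) ^ j * sawtoothCoeff δ n else 0) (fun n => by
      split_ifs with hn
      · have hnr : (2 : ℝ) ^ j ≤ n := by exact_mod_cast hn
        rw [norm_mul, norm_pow, Complex.norm_ofNat]
        have := (norm_sawtoothCoeff_le hδne (n := n) (by
          have : 0 < 2 ^ j := by positivity
          omega)).1
        calc (2 : ℝ) ^ j * ‖sawtoothCoeff δ n‖ ≤ n * (1 / n) := by gcongr
          _ = 1 := by
            have : (n : ℝ) ≠ 0 := by linarith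
            field_simp
      · simp)
    have e : dyadicSum D (phaseSum x (2 ^ j) (fun n => if 2 ^ j ≤ n then (2 : ℂ) ^ j * sawtoothCoeff δ n else 0)) f =
        (2 : ℂ) ^ j * dyadicSum D (phaseSum x (2 ^ j) (sawtoothCoeff δ)) f := by
      simp only [dyadicSum, phaseSum, Finset.mul_sum]
      refine Finset.sum_congr rfl fun d _ => Finset.sum_congr rfl fun n hn => ?_
      rw [if_pos (Finset.mem_Ico.1 hn).1]
      ring
    rw [e, norm_mul, norm_pow, Complex.norm_ofNat] at h
    push_cast at h
    nlinarith
  have htail : ‖dyadicSum D (fun d => ∑' n : ℕ, sawtoothCoeff δ (n + K) * expTwoPi ((n + K : ℕ) * (x / (d : ℝ) ^ 2))) f‖ ≤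
      4 * B * u ^ 7 := by
    have hd : ∀ d : ℕ, ‖∑' n : ℕ, sawtoothCoeff δ (n + K) * expTwoPi ((n + K : ℕ) * (x / (d : ℝ) ^ 2))‖ ≤ 2 * u ^ 7 / D := by
      intro d
      obtain ⟨s1, s2⟩ := tsum_inv_sq_tail_le hK0
      have hb : ‖∑' n : ℕ, sawtoothCoeff δ (n + K) * expTwoPi ((n + K : ℕ) * (x / (d : ℝ) ^ 2))‖ ≤
          1 / |δ| * ∑' n : ℕ, 1 / ((n + K : ℕ) : ℝ) ^ 2 := by
        refine tsum_of_norm_bounded (s1.hasSum.mul_left _) fun n => ?_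
        rw [norm_mul, norm_expTwoPi, mul_one]
        refine ((norm_sawtoothCoeff_le hδne (by omega)).2).trans (le_of_eq ?_)
        rw [div_mul_div_comm, one_mul]
      refine hb.trans ?_
      have hKY : Y ≤ K := by rw [hK]; push_cast; exact hJ1.le
      calc 1 / |δ| * ∑' n : ℕ, 1 / ((n + K : ℕ) : ℝ) ^ 2 ≤ 1 / |δ| * (2 / K) := by gcongr
        _ ≤ 1 / |δ| * (2 / Y) := by gcongr
        _ = 2 * u ^ 7 / D := by rw [hδ, hY]; field_simp
    rw [dyadicSum]
    refine (norm_sum_le _ _).trans ?_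
    calc _ ≤ ∑ d ∈ Finset.Ioc ⌊D⌋₊ ⌊2 * D⌋₊, B * (2 * u ^ 7 / D) := by
          refine Finset.sum_le_sum fun d hd' => ?_
          rw [norm_mul]
          refine mul_le_mul (hf d ?_) (hd d) (norm_nonneg _) hB
          exact (Nat.le_floor_iff (by positivity)).1 (Finset.mem_Ioc.1 hd').2
      _ = (⌊2 * D⌋₊ - ⌊D⌋₊ : ℕ) * (B * (2 * u ^ 7 / D)) := by
          rw [Finset.sum_const, Nat.card_Ioc, nsmul_eq_mul]
      _ ≤ (2 * D) * (B * (2 * u ^ 7 / D)) := by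
          gcongr
          calc ((⌊2 * D⌋₊ - ⌊D⌋₊ : ℕ) : ℝ) ≤ (⌊2 * D⌋₊ : ℝ) := by exact_mod_cast Nat.sub_le _ _
            _ ≤ 2 * D := Nat.floor_le (by positivity)
      _ = _ := by field_simp; ring
  rw [hE]
  refine (norm_add_le _ _).trans (add_le_add ?_ htail)
  calc ‖∑ j ∈ Finset.range J, dyadicSum D (phaseSum x (2 ^ j) (sawtoothCoeff δ)) f‖ ≤ ∑ j ∈ Finset.range J, T :=
        (norm_sum_le _ _).trans (Finset.sum_le_sum hblock)
    _ = J * T := by rw [Finset.sum_const, Finset.card_range, nsmul_eq_mul]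
    _ ≤ _ := by gcongr

/-- The Dirichlet inverse of the divisor function, with real values. -/
noncomputable def realMoebiusSq : ArithmeticFunction ℝ :=
  ((ArithmeticFunction.moebius * ArithmeticFunction.moebius : ArithmeticFunction ℤ) : ArithmeticFunction ℝ)

theorem moebiusSq_eq_ofReal (n : ℕ) : moebiusSq n = (realMoebiusSq n : ℂ) := by
  simp only [moebiusSq, realMoebiusSq, ArithmeticFunction.intCoe_apply]
  norm_cast

theorem abs_realMoebiusSq (n : ℕ) : |realMoebiusSq n| = ‖moebiusSq n‖ := by
  rw [moebiusSq_eq_ofReal, Complex.norm_real, Real.norm_eq_abs]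

theorem exists_abs_realMoebiusSq_le {ε : ℝ} (hε : 0 < ε) :
    ∃ C : ℝ, 1 ≤ C ∧ ∀ n : ℕ, |realMoebiusSq n| ≤ C * (n : ℝ) ^ ε := by
  obtain ⟨C, hC, h⟩ := isSubPoly_divisorK 2 ε hε
  refine ⟨C, hC, fun n => ?_⟩
  rw [abs_realMoebiusSq]
  exact (dominatedBy_moebiusSq n).trans ((le_abs_self _).trans (h n))

/-- These unweighted sums enter because the error of the approximation to the sawtooth, taken in
absolute value, must itself be summed over d. -/
theorem norm_dyadicSum_phaseSum_complexZeta_le {u D : ℝ} {H U : ℕ} (hp : DyadicParams u D H U) {γ : ℕ → ℂ}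
    (hγ : ∀ h, ‖γ h‖ ≤ 1) :
    ‖dyadicSum D (phaseSum (u ^ 22) H γ) complexZeta‖ ≤ 10 ^ 14 * u ^ 5 * H := by
  have hH := hp.H_pos
  have e : dyadicSum D (phaseSum (u ^ 22) H γ) complexZeta =
      ∑ h ∈ Finset.Ico H (2 * H), γ h * ∑ d ∈ Finset.Ioc ⌊D⌋₊ ⌊2 * D⌋₊, expTwoPi (h * u ^ 22 / (d : ℝ) ^ 2) := by
    simp only [dyadicSum, phaseSum, Finset.mul_sum]
    rw [Finset.sum_comm]
    refine Finset.sum_congr rfl fun h _ => Finset.sum_congr rfl fun d hd => ?_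
    rw [complexZeta_apply (by have := (Finset.mem_Ioc.1 hd).1; omega), one_mul]
  rw [e]
  refine (norm_sum_le _ _).trans ?_
  calc _ ≤ ∑ h ∈ Finset.Ico H (2 * H), 10 ^ 14 * u ^ 5 := by
        refine Finset.sum_le_sum fun h hh => ?_
        obtain ⟨h1, h2⟩ := Finset.mem_Ico.1 hh
        have h3 := norm_sum_expTwoPi_smooth_le hp.one_le_u hp.pow_le hp.le_pow (m := 1) (h := h) one_pos (by
          have := hp.eight_le
          push_cast; linarith) (by omega) (by
          have h4 : (h : ℝ) ≤ 2 * H := by exact_mod_cast h2.le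
          have h5 := hp.H_le
          have h6 : 0 ≤ u ^ 14 := by have := hp.one_le_u; positivity
          nlinarith)
        simp only [Nat.cast_one, div_one, one_mul] at h3
        rw [norm_mul]
        calc _ ≤ 1 * (10 ^ 14 * u ^ 5) := mul_le_mul (hγ h) h3 (norm_nonneg _) zero_le_one
          _ = _ := one_mul _
    _ = _ := by
        rw [Finset.sum_const, Nat.card_Ico, nsmul_eq_mul, show 2 * H - H = H by omega]; ring

/-- Up to δ/2, the sawtooth lies between its averages over [t, t + δ] and [t - δ, t]. Since μ*μ
changes sign, one average is inserted throughout; the discrepancy is at most the difference of the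
two averages plus 3δ/2, and only an upper bound B of |μ*μ| is needed to sum it. -/
theorem abs_sum_sawtooth_le_of_coeff {D δ B : ℝ} (hD : 0 ≤ D) (hδ : 0 < δ) (hB : 0 ≤ B) (x : ℝ)
    (hBD : ∀ n : ℕ, (n : ℝ) ≤ 2 * D → |realMoebiusSq n| ≤ B) :
    |∑ d ∈ Finset.Ioc ⌊D⌋₊ ⌊2 * D⌋₊, realMoebiusSq d * (Int.fract (x / (d : ℝ) ^ 2) - 1 / 2)| ≤
      ‖dyadicSum D (fun d => ∑' n : ℕ, sawtoothCoeff δ n * expTwoPi (n * (x / (d : ℝ) ^ 2))) moebiusSq‖ +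
      B * (‖dyadicSum D (fun d => ∑' n : ℕ, sawtoothCoeff δ n * expTwoPi (n * (x / (d : ℝ) ^ 2))) complexZeta‖ +
        ‖dyadicSum D (fun d => ∑' n : ℕ, sawtoothCoeff (-δ) n * expTwoPi (n * (x / (d : ℝ) ^ 2))) complexZeta‖) +
      3 * B * (2 * D * δ) := by
  set I := Finset.Ioc ⌊D⌋₊ ⌊2 * D⌋₊ with hI
  set ψ : ℕ → ℝ := fun d => Int.fract (x / (d : ℝ) ^ 2) - 1 / 2 with hψ
  set S₁ : ℕ → ℂ := fun d => ∑' n : ℕ, sawtoothCoeff δ n * expTwoPi (n * (x / (d : ℝ) ^ 2)) with hS₁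
  set S₂ : ℕ → ℂ := fun d => ∑' n : ℕ, sawtoothCoeff (-δ) n * expTwoPi (n * (x / (d : ℝ) ^ 2)) with hS₂
  have hlow : ∀ d, (S₁ d).re - δ / 2 ≤ ψ d := by
    intro d
    have h := sawtoothPrim_add_sub_le (x / (d : ℝ) ^ 2) δ
    rw [hS₁]
    simp only
    rw [re_tsum_sawtoothCoeff hδ.ne']
    have h2 : (sawtoothPrim (x / (d : ℝ) ^ 2 + δ) - sawtoothPrim (x / (d : ℝ) ^ 2)) / δ ≤ ψ d + δ / 2 := by
      rw [div_le_iff₀ hδ]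
      simp only [hψ]
      linarith
    linarith
  have hupp : ∀ d, ψ d ≤ (S₂ d).re + δ / 2 := by
    intro d
    have h := sawtoothPrim_add_sub_le (x / (d : ℝ) ^ 2) (-δ)
    rw [hS₂]
    simp only
    rw [re_tsum_sawtoothCoeff (neg_ne_zero.2 hδ.ne'), div_neg]
    have h2 : (sawtoothPrim (x / (d : ℝ) ^ 2 + -δ) - sawtoothPrim (x / (d : ℝ) ^ 2)) / δ ≤ -ψ d + δ / 2 := by
      rw [div_le_iff₀ hδ]
      simp only [hψ]
      linarith
    linarith
  have hcard : (I.card : ℝ) ≤ 2 * D := by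
    rw [hI, Nat.card_Ioc]
    calc ((⌊2 * D⌋₊ - ⌊D⌋₊ : ℕ) : ℝ) ≤ (⌊2 * D⌋₊ : ℝ) := by exact_mod_cast Nat.sub_le _ _
      _ ≤ 2 * D := Nat.floor_le (by positivity)
  have hBI : ∀ d ∈ I, |realMoebiusSq d| ≤ B := fun d hd =>
    hBD d ((Nat.le_floor_iff (by positivity)).1 (Finset.mem_Ioc.1 hd).2)
  have hsplit : ∑ d ∈ I, realMoebiusSq d * ψ d = ∑ d ∈ I, realMoebiusSq d * (S₁ d).re +
      ∑ d ∈ I, realMoebiusSq d * (ψ d - (S₁ d).re) := by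
    rw [← Finset.sum_add_distrib]
    exact Finset.sum_congr rfl fun d _ => by ring
  have h1 : |∑ d ∈ I, realMoebiusSq d * (S₁ d).re| ≤ ‖dyadicSum D S₁ moebiusSq‖ := by
    have : ∑ d ∈ I, realMoebiusSq d * (S₁ d).re = (dyadicSum D S₁ moebiusSq).re := by
      rw [dyadicSum, Complex.re_sum]
      refine Finset.sum_congr rfl fun d _ => ?_
      rw [moebiusSq_eq_ofReal, Complex.re_ofReal_mul]
    rw [this]
    exact Complex.abs_re_le_norm _
  have hz : ∀ S : ℕ → ℂ, |∑ d ∈ I, (S d).re| ≤ ‖dyadicSum D S complexZeta‖ := by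
    intro S
    have : ∑ d ∈ I, (S d).re = (dyadicSum D S complexZeta).re := by
      rw [dyadicSum, Complex.re_sum]
      refine Finset.sum_congr rfl fun d hd => ?_
      rw [complexZeta_apply (by have := (Finset.mem_Ioc.1 hd).1; omega), one_mul]
    rw [this]
    exact Complex.abs_re_le_norm _
  have h2 : |∑ d ∈ I, realMoebiusSq d * (ψ d - (S₁ d).re)| ≤
      B * (‖dyadicSum D S₁ complexZeta‖ + ‖dyadicSum D S₂ complexZeta‖ + 3 * (2 * D * δ)) := by
    refine (Finset.abs_sum_le_sum_abs _ _).trans ?_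
    calc _ ≤ ∑ d ∈ I, B * ((S₂ d).re - (S₁ d).re + 3 / 2 * δ) := by
          refine Finset.sum_le_sum fun d hd => ?_
          rw [abs_mul]
          refine mul_le_mul (hBI d hd) ?_ (abs_nonneg _) hB
          have := hlow d
          have := hupp d
          rw [abs_le]
          constructor <;> linarith
      _ = B * (∑ d ∈ I, (S₂ d).re - ∑ d ∈ I, (S₁ d).re + I.card * (3 / 2 * δ)) := by
          rw [← Finset.mul_sum, Finset.sum_add_distrib, Finset.sum_sub_distrib, Finset.sum_const, nsmul_eq_mul]
      _ ≤ _ := by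
          refine mul_le_mul_of_nonneg_left ?_ hB
          have e1 := le_abs_self (∑ d ∈ I, (S₂ d).re)
          have e2 := neg_abs_le (∑ d ∈ I, (S₁ d).re)
          have e3 := hz S₁
          have e4 := hz S₂
          have e5 : (I.card : ℝ) * (3 / 2 * δ) ≤ 2 * D * (3 / 2 * δ) := by gcongr
          have e6 : 0 ≤ D * δ := by positivity
          linarith
  rw [hsplit]
  refine (abs_add_le _ _).trans ?_
  linarith

/-- The key exponential sum estimate, on a dyadic interval. -/
theorem exists_abs_sum_dyadic_sawtooth_le {ε : ℝ} (hε : 0 < ε) : ∃ C : ℝ, 1 ≤ C ∧ ∀ u D : ℝ,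
    1 ≤ u → u ^ 7 ≤ D → D ≤ u ^ 8 → 8 ≤ D →
    |∑ d ∈ Finset.Ioc ⌊D⌋₊ ⌊2 * D⌋₊, realMoebiusSq d * (Int.fract (u ^ 22 / (d : ℝ) ^ 2) - 1 / 2)| ≤
      C * (u ^ 22) ^ ε * u ^ 7 := by
  have hε2 := half_pos hε
  obtain ⟨C₁, hC₁, h₁⟩ := exists_norm_dyadicSum_moebiusSq_le hε2
  obtain ⟨C₂, hC₂, h₂⟩ := exists_two_add_log_le_rpow hε2
  obtain ⟨C₃, hC₃, h₃⟩ := exists_abs_realMoebiusSq_le hε2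
  refine ⟨2 * C₂ * C₁ + 4 * C₃ + C₃ * 2 * (2 * C₂ * 10 ^ 14 + 4) + 6 * C₃, by nlinarith, ?_⟩
  intro u D hu hD1 hD2 hD8
  have hu0 : 0 < u := by linarith
  have hD0 : 0 < D := by linarith
  set X := u ^ 22 with hX
  have hX1 : 1 ≤ X := one_le_pow₀ hu
  set L := X ^ (ε / 2) with hL
  have hL1 : 1 ≤ L := Real.one_le_rpow hX1 hε2.le
  have hLL : X ^ ε = L * L := by
    rw [hL, ← Real.rpow_add (by linarith)]; congr 1; ring
  have h2D : 2 * D ≤ X := by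
    have e1 : 8 ≤ u ^ 8 := hD8.trans hD2
    have e2 : u ^ 8 ≤ u ^ 14 := pow_le_pow_right₀ hu (by norm_num)
    calc 2 * D ≤ u ^ 14 * u ^ 8 := by nlinarith
      _ = X := by rw [hX]; ring
  set B := C₃ * L with hBdef
  have hB0 : 0 ≤ B := by positivity
  have hBr : ∀ n : ℕ, (n : ℝ) ≤ 2 * D → |realMoebiusSq n| ≤ B := by
    intro n hn
    refine (h₃ n).trans ?_
    rw [hBdef, hL]
    have : (n : ℝ) ≤ X := hn.trans h2D
    gcongr
  have hB1 : 1 ≤ B := by nlinarith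
  -- the parameter `U`
  have hex : ∃ U : ℕ, D < ((U : ℝ) + 1) ^ 4 := by
    obtain ⟨U, hU⟩ := exists_nat_gt D
    refine ⟨U, hU.trans_le ?_⟩
    have : (0 : ℝ) ≤ U := Nat.cast_nonneg U
    calc (U : ℝ) ≤ (U + 1) ^ 1 := by linarith
      _ ≤ _ := pow_le_pow_right₀ (by linarith) (by norm_num)
  set U := Nat.find hex with hU
  have hU1 : D < ((U : ℝ) + 1) ^ 4 := Nat.find_spec hex
  have hUpos : 0 < U := by
    rcases Nat.eq_zero_or_pos U with h | h
    · rw [h] at hU1; norm_num at hU1; linarith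
    · exact h
  have hU2 : (U : ℝ) ^ 4 ≤ D := by
    have := not_lt.1 (Nat.find_min hex (m := U - 1) (by omega))
    rwa [Nat.cast_sub (by omega : 1 ≤ U), Nat.cast_one, sub_add_cancel] at this
  have hp : DyadicParams u D 1 U := ⟨hu, hD1, hD2, hD8, one_pos, by
    push_cast
    rw [one_mul]
    calc u ^ 14 = (u ^ 7) ^ 2 := by ring
      _ ≤ D ^ 2 := by gcongr, hUpos, hU2, hU1.le⟩
  -- With this length the smoothing error, of order B D δ, is B u^7.
  set δ := u ^ 7 / D with hδ
  have hδ0 : 0 < δ := by positivity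
  have ha : |δ| = u ^ 7 / D := abs_of_pos hδ0
  have ha' : |-δ| = u ^ 7 / D := by rw [abs_neg, ha]
  have hmain := abs_sum_sawtooth_le_of_coeff hD0.le hδ0 hB0 X hBr
  have hlog := h₂ X hX1
  have hlog0 : 0 ≤ 2 + Real.log (4 * X) := by
    have := Real.log_nonneg (by linarith : 1 ≤ 4 * X)
    linarith
  have k1 : ‖dyadicSum D (fun d => ∑' n : ℕ, sawtoothCoeff δ n * expTwoPi (n * (X / (d : ℝ) ^ 2))) moebiusSq‖ ≤
      (2 * C₂ * C₁ + 4 * C₃) * (L * L * u ^ 7) := by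
    have h := norm_dyadicSum_tsum_le hp (T := C₁ * L * u ^ 7) hB0 (by positivity)
      (fun n hn => by rw [← abs_realMoebiusSq]; exact hBr n hn)
      (fun H hp' γ hγ => (h₁ u D H U hp' γ hγ).trans (le_of_eq (by ring))) ha
    refine h.trans ?_
    have e1 : 2 * (2 + Real.log (4 * X)) * (C₁ * L * u ^ 7) ≤ 2 * (C₂ * L) * (C₁ * L * u ^ 7) := by gcongr
    have e2 : 4 * B * u ^ 7 ≤ 4 * C₃ * (L * L * u ^ 7) := by
      rw [hBdef]
      calc 4 * (C₃ * L) * u ^ 7 = 4 * C₃ * (1 * L * u ^ 7) := by ring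
        _ ≤ _ := by gcongr
    calc _ ≤ 2 * (C₂ * L) * (C₁ * L * u ^ 7) + 4 * C₃ * (L * L * u ^ 7) := add_le_add e1 e2
      _ = _ := by ring
  have k2 : ∀ δ' : ℝ, |δ'| = u ^ 7 / D →
      ‖dyadicSum D (fun d => ∑' n : ℕ, sawtoothCoeff δ' n * expTwoPi (n * (X / (d : ℝ) ^ 2))) complexZeta‖ ≤
      (2 * C₂ * 10 ^ 14 + 4) * (L * u ^ 7) := by
    intro δ' hδ'
    have h := norm_dyadicSum_tsum_le hp (f := complexZeta) (B := 1) (T := 10 ^ 14 * u ^ 7) zero_le_one (by positivity)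
      (fun n _ => by
        rcases eq_or_ne n 0 with rfl | hn
        · simp
        · rw [complexZeta_apply hn, norm_one])
      (fun H hp' γ hγ => (norm_dyadicSum_phaseSum_complexZeta_le hp' hγ).trans (by
        have : u ^ 5 ≤ u ^ 7 := pow_le_pow_right₀ hu (by norm_num)
        gcongr)) hδ'
    refine h.trans ?_
    have e1 : 2 * (2 + Real.log (4 * X)) * (10 ^ 14 * u ^ 7) ≤ 2 * (C₂ * L) * (10 ^ 14 * u ^ 7) := by gcongr
    have e2 : 4 * 1 * u ^ 7 ≤ 4 * (L * u ^ 7) := by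
      calc 4 * 1 * u ^ 7 = 4 * (1 * u ^ 7) := by ring
        _ ≤ _ := by gcongr
    calc _ ≤ 2 * (C₂ * L) * (10 ^ 14 * u ^ 7) + 4 * (L * u ^ 7) := add_le_add e1 e2
      _ = _ := by ring
  refine hmain.trans ?_
  have k3 : 3 * B * (2 * D * δ) ≤ 6 * C₃ * (L * L * u ^ 7) := by
    have e : D * δ = u ^ 7 := by rw [hδ]; field_simp
    calc 3 * B * (2 * D * δ) = 6 * B * (D * δ) := by ring
      _ = 6 * C₃ * (1 * L * u ^ 7) := by rw [e, hBdef]; ring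
      _ ≤ _ := by gcongr
  calc _ ≤ (2 * C₂ * C₁ + 4 * C₃) * (L * L * u ^ 7) +
        B * ((2 * C₂ * 10 ^ 14 + 4) * (L * u ^ 7) + (2 * C₂ * 10 ^ 14 + 4) * (L * u ^ 7)) +
        6 * C₃ * (L * L * u ^ 7) := by
        refine add_le_add (add_le_add k1 ?_) k3
        exact mul_le_mul_of_nonneg_left (add_le_add (k2 δ ha) (k2 (-δ) ha')) hB0
    _ = _ := by rw [hLL, hBdef]; ring

/-- Halving z removes one dyadic block, of cost at most T; as log 2 > 1/2, the majorant T (1 + 2 log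
z) falls by at least T at each halving. Below 16 u^7 the trivial bound is enough. The hypothesis z ≤
2^n in `key` only serves to run the induction. -/
theorem exists_abs_sum_sawtooth_le {ε : ℝ} (hε : 0 < ε) : ∃ C : ℝ, 1 ≤ C ∧ ∀ x z : ℝ, 1 ≤ x →
    z ≤ 2 * x ^ (8 / 22 : ℝ) →
    |∑ d ∈ Finset.Ioc 0 ⌊z⌋₊, realMoebiusSq d * (Int.fract (x / (d : ℝ) ^ 2) - 1 / 2)| ≤
      C * x ^ (7 / 22 + ε) := by
  have hε2 := half_pos hε
  obtain ⟨C₁, hC₁, h₁⟩ := exists_abs_sum_dyadic_sawtooth_le hε2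
  obtain ⟨C₂, hC₂, h₂⟩ := exists_two_add_log_le_rpow hε2
  obtain ⟨C₃, hC₃, h₃⟩ := exists_abs_realMoebiusSq_le hε2
  refine ⟨(C₁ + C₃ * 2 ^ (ε / 2) * 16) * (1 + 2 * C₂), ?_, fun x z hx hz => ?_⟩
  · have : (1 : ℝ) ≤ 2 ^ (ε / 2) := Real.one_le_rpow (by norm_num) hε2.le
    have h0 : 0 ≤ C₃ * 2 ^ (ε / 2) * 16 := by positivity
    exact one_le_mul_of_one_le_of_one_le (by linarith) (by linarith)
  have hx0 : 0 < x := by linarith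
  set u := x ^ (1 / 22 : ℝ) with hu
  have hu1 : 1 ≤ u := Real.one_le_rpow hx (by norm_num)
  have hu0 : 0 < u := by linarith
  -- The parameter u turns the exponents 7/22, 8/22 and 1 into integers, so that the inequalities
  -- between parameters in the exponential sums become polynomial ones.
  have hpow : ∀ k : ℕ, u ^ k = x ^ (k / 22 : ℝ) := by
    intro k
    rw [hu, ← Real.rpow_natCast, ← Real.rpow_mul hx0.le]
    congr 1; ring
  have hu22 : u ^ 22 = x := by rw [hpow]; norm_num
  have hu8 : u ^ 8 = x ^ (8 / 22 : ℝ) := by rw [hpow]; norm_num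
  have hu7 : u ^ 7 = x ^ (7 / 22 : ℝ) := by rw [hpow]; norm_num
  set L := x ^ (ε / 2) with hL
  have hL1 : 1 ≤ L := Real.one_le_rpow hx hε2.le
  set T := (C₁ + C₃ * 2 ^ (ε / 2) * 16) * (L * u ^ 7) with hT
  have hT0 : 0 ≤ T := by positivity
  set S : ℝ → ℝ := fun z => ∑ d ∈ Finset.Ioc 0 ⌊z⌋₊, realMoebiusSq d * (Int.fract (x / (d : ℝ) ^ 2) - 1 / 2) with hS
  have key : ∀ n : ℕ, ∀ z : ℝ, 1 ≤ z → z ≤ 2 ^ n → z ≤ 2 * x ^ (8 / 22 : ℝ) → |S z| ≤ T * (1 + 2 * Real.log z) := by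
    have hsmall : ∀ z : ℝ, 1 ≤ z → z ≤ 16 * u ^ 7 → z ≤ 2 * x ^ (8 / 22 : ℝ) → |S z| ≤ T * (1 + 2 * Real.log z) := by
      intro z hz1 hz16 hz8
      have hlog := Real.log_nonneg hz1
      have h2x : z ≤ 2 * x := hz8.trans (by
        gcongr
        calc x ^ (8 / 22 : ℝ) ≤ x ^ (1 : ℝ) := Real.rpow_le_rpow_of_exponent_le hx (by norm_num)
          _ = x := Real.rpow_one x)
      have : |S z| ≤ C₃ * 2 ^ (ε / 2) * L * z := by
        refine (Finset.abs_sum_le_sum_abs _ _).trans ?_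
        calc _ ≤ ∑ d ∈ Finset.Ioc 0 ⌊z⌋₊, C₃ * 2 ^ (ε / 2) * L := by
              refine Finset.sum_le_sum fun d hd => ?_
              have hdz : (d : ℝ) ≤ z := (Nat.le_floor_iff (by linarith)).1 (Finset.mem_Ioc.1 hd).2
              rw [abs_mul]
              have e1 : |Int.fract (x / (d : ℝ) ^ 2) - 1 / 2| ≤ 1 := by
                have := Int.fract_nonneg (x / (d : ℝ) ^ 2)
                have := Int.fract_lt_one (x / (d : ℝ) ^ 2)
                rw [abs_le]; constructor <;> linarith
              calc _ ≤ C₃ * (d : ℝ) ^ (ε / 2) * 1 := mul_le_mul (h₃ d) e1 (abs_nonneg _) (by positivity)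
                _ ≤ C₃ * (2 * x) ^ (ε / 2) * 1 := by
                    have := hdz.trans h2x
                    gcongr
                _ = _ := by rw [Real.mul_rpow (by norm_num) hx0.le]; ring
          _ = (⌊z⌋₊ : ℝ) * (C₃ * 2 ^ (ε / 2) * L) := by
              rw [Finset.sum_const, Nat.card_Ioc, Nat.sub_zero, nsmul_eq_mul]
          _ ≤ z * (C₃ * 2 ^ (ε / 2) * L) := by
              have := Nat.floor_le (by linarith : 0 ≤ z)
              gcongr
          _ = _ := by ring
      calc |S z| ≤ C₃ * 2 ^ (ε / 2) * L * z := this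
        _ ≤ C₃ * 2 ^ (ε / 2) * L * (16 * u ^ 7) := by gcongr
        _ ≤ T * 1 := by
            rw [hT]
            have : 0 ≤ C₁ * (L * u ^ 7) := by positivity
            linarith
        _ ≤ _ := by gcongr; linarith
    intro n
    induction n with
    | zero =>
      intro z hz1 hz2 hz3
      refine hsmall z hz1 ?_ hz3
      have := one_le_pow₀ hu1 (n := 7)
      rw [pow_zero] at hz2
      linarith
    | succ n ih =>
      intro z hz1 hz2 hz3
      by_cases h16 : z ≤ 16 * u ^ 7
      · exact hsmall z hz1 h16 hz3
      · push Not at h16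
        have hu71 := one_le_pow₀ hu1 (n := 7)
        set D := z / 2 with hD
        have hzD : z = 2 * D := by rw [hD]; ring
        have e1 := ih D (by linarith) (by rw [pow_succ] at hz2; linarith) (by linarith)
        have e2 := h₁ u D hu1 (by linarith) (by rw [hu8]; linarith) (by linarith)
        have e3 : S z = S D + ∑ d ∈ Finset.Ioc ⌊D⌋₊ ⌊2 * D⌋₊, realMoebiusSq d *
            (Int.fract (u ^ 22 / (d : ℝ) ^ 2) - 1 / 2) := by
          rw [hu22, hS]
          simp only
          rw [hzD]
          exact (Finset.sum_Ioc_consecutive _ (Nat.zero_le _) (Nat.floor_mono (by linarith))).symm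
        have e4 : Real.log z = Real.log 2 + Real.log D := by
          rw [hzD, Real.log_mul (by norm_num) (by linarith)]
        have e5 := Real.log_two_gt_d9
        have e6 : C₁ * (u ^ 22) ^ (ε / 2) * u ^ 7 ≤ T := by
          rw [hu22, hT]
          have : 0 ≤ C₃ * 2 ^ (ε / 2) * 16 * (L * u ^ 7) := by positivity
          rw [← hL]
          linarith
        rw [e3, e4]
        refine (abs_add_le _ _).trans ?_
        nlinarith
  by_cases hz1 : 1 ≤ z
  · obtain ⟨n, hn⟩ := pow_unbounded_of_one_lt z one_lt_two
    refine (key n z hz1 hn.le hz).trans ?_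
    have e1 : Real.log z ≤ 2 + Real.log (4 * x) := by
      have : z ≤ 4 * x := hz.trans (by
        have : x ^ (8 / 22 : ℝ) ≤ x ^ (1 : ℝ) := Real.rpow_le_rpow_of_exponent_le hx (by norm_num)
        rw [Real.rpow_one] at this
        linarith)
      have := Real.log_le_log (by linarith) this
      linarith
    have e2 := e1.trans (h₂ x hx)
    rw [← hL] at e2
    calc T * (1 + 2 * Real.log z) ≤ T * (L + 2 * (C₂ * L)) := by gcongr
      _ = (C₁ + C₃ * 2 ^ (ε / 2) * 16) * (1 + 2 * C₂) * (u ^ 7 * (L * L)) := by rw [hT]; ring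
      _ = _ := by
          rw [hu7, hL, ← Real.rpow_add hx0, ← Real.rpow_add hx0]
          congr 2; ring
  · push Not at hz1
    rw [Nat.floor_eq_zero.2 hz1]
    simp
    positivity

/-! ### The zeta function: Mellin transforms and growth under the Riemann hypothesis -/

section
open MeasureTheory Set Complex

/-- `∫_0^u (⌊v⌋ - v) dv`. -/
noncomputable def floorPrim (u : ℝ) : ℝ := ∑ n ∈ Finset.Icc 1 ⌊u⌋₊, (u - n) - u ^ 2 / 2

theorem floorPrim_eq (u : ℝ) : floorPrim u = -((u - ⌊u⌋₊) ^ 2) / 2 - ⌊u⌋₊ / 2 := by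
  have h : ∀ N : ℕ, ∑ n ∈ Finset.Icc 1 N, (u - n) = N * u - N * (N + 1) / 2 := by
    intro N
    induction N with
    | zero => simp
    | succ N ih =>
      rw [Finset.sum_Icc_succ_top (by omega), ih]
      push_cast; ring
  rw [floorPrim, h]
  ring

theorem floorPrim_of_lt_one {u : ℝ} (hu : u < 1) : floorPrim u = -u ^ 2 / 2 := by
  rw [floorPrim_eq, Nat.floor_eq_zero.2 hu]
  simp

theorem abs_floorPrim_le {u : ℝ} (hu : 1 ≤ u) : |floorPrim u| ≤ u := by
  have h1 := Nat.floor_le (by linarith : 0 ≤ u)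
  have h2 := Nat.lt_floor_add_one u
  rw [floorPrim_eq, abs_le]
  constructor <;> nlinarith [Nat.cast_nonneg (α := ℝ) ⌊u⌋₊]

theorem sum_Icc_floor_sub_eq {u : ℝ} {M : ℕ} (hM : ⌊u⌋₊ ≤ M) :
    ∑ n ∈ Finset.Icc 1 ⌊u⌋₊, (u - n) = ∑ n ∈ Finset.Icc 1 M, max (u - n) 0 := by
  rw [← Finset.sum_subset (Finset.Icc_subset_Icc_right hM)]
  · refine Finset.sum_congr rfl fun n hn => ?_
    have h1 := Finset.mem_Icc.1 hn
    have := (Nat.le_floor_iff' (by omega)).1 h1.2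
    rw [max_eq_left (by linarith)]
  · intro n hn hn'
    rw [Finset.mem_Icc] at hn hn'
    have h3 : ⌊u⌋₊ < n := by omega
    have := (Nat.floor_lt' (by omega)).1 h3
    rw [max_eq_right (by linarith)]

/-- The terms are the positive parts of u - n, so the jumps of the number of terms are harmless;
near a point a fixed number of them suffices. -/
theorem continuous_floorPrim : Continuous floorPrim := by
  rw [continuous_iff_continuousAt]
  intro u₀
  obtain ⟨M, hM⟩ := exists_nat_gt (u₀ + 1)
  have : floorPrim =ᶠ[nhds u₀] fun u => ∑ n ∈ Finset.Icc 1 M, max (u - n) 0 - u ^ 2 / 2 := by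
    filter_upwards [Iio_mem_nhds (by linarith : u₀ < u₀ + 1)] with u hu
    rw [floorPrim, sum_Icc_floor_sub_eq]
    exact Nat.floor_le_of_le ((le_of_lt hu).trans hM.le)
  refine ContinuousAt.congr ?_ this.symm
  fun_prop

theorem integrableOn_max_sub_mul_cpow {a : ℝ} (ha : 0 < a) {s : ℂ} (hs : 0 < s.re) :
    IntegrableOn (fun u : ℝ => ((max (u - a) 0 : ℝ) : ℂ) * (u : ℂ) ^ (-s - 2)) (Ioi 0) ∧
    ∫ u in Ioi (0 : ℝ), ((max (u - a) 0 : ℝ) : ℂ) * (u : ℂ) ^ (-s - 2) = (a : ℂ) ^ (-s) / (s * (s + 1)) := by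
  have h1 := integrableOn_Ioi_cpow_of_lt (a := -s - 1) (by simp; linarith) ha
  have h2 := integrableOn_Ioi_cpow_of_lt (a := -s - 2) (by simp; linarith) ha
  have e1 := integral_Ioi_cpow_of_lt (a := -s - 1) (by simp; linarith) ha
  have e2 := integral_Ioi_cpow_of_lt (a := -s - 2) (by simp; linarith) ha
  have ha0 : (a : ℂ) ≠ 0 := by exact_mod_cast ha.ne'
  have hs0 : s ≠ 0 := by rintro rfl; simp at hs
  have hs1 : s + 1 ≠ 0 := by
    intro h
    have := congrArg Complex.re h
    simp at this
    linarith
  have hint := h1.sub (h2.const_mul (a : ℂ))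
  have hind : EqOn (fun u : ℝ => ((max (u - a) 0 : ℝ) : ℂ) * (u : ℂ) ^ (-s - 2))
      ((Ioi a).indicator fun u : ℝ => (u : ℂ) ^ (-s - 1) - a * (u : ℂ) ^ (-s - 2)) (Ioi 0) := by
    intro u hu
    have hu0 : (u : ℂ) ≠ 0 := by
      have : (0 : ℝ) < u := hu
      exact_mod_cast this.ne'
    by_cases h : a < u
    · rw [indicator_of_mem (mem_Ioi.2 h)]
      simp only
      rw [max_eq_left (by linarith), show -s - 1 = (-s - 2) + 1 by ring, Complex.cpow_add _ _ hu0, cpow_one]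
      push_cast; ring
    · rw [indicator_of_notMem (by simpa using h)]
      simp only
      rw [max_eq_right (by linarith)]
      simp
  have hsub : Ioi (0 : ℝ) ∩ Ioi a = Ioi a := by
    rw [inter_eq_right]
    exact Ioi_subset_Ioi ha.le
  constructor
  · rw [integrableOn_congr_fun hind measurableSet_Ioi]
    exact ((integrable_indicator_iff measurableSet_Ioi).2 hint).integrableOn
  · rw [setIntegral_congr_fun measurableSet_Ioi hind, setIntegral_indicator measurableSet_Ioi, hsub,
      integral_sub h1 (h2.const_mul _), integral_const_mul, e1, e2,
      show -s - 1 + 1 = -s by ring, show -s - 2 + 1 = -s - 1 by ring, Complex.cpow_sub _ _ ha0, cpow_one]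
    have h3 : -s - 1 ≠ 0 := by
      intro h
      apply hs1
      linear_combination -h
    field_simp
    ring

/-- Termwise integration of the Dirichlet series. Working with the primitive of ⌊u⌋ rather than ⌊u⌋
produces the denominator s (s + 1), which later makes the inverse Mellin integral absolutely
convergent. -/
theorem integral_sum_floor_mul_cpow {s : ℂ} (hs : 1 < s.re) :
    ∫ u in Ioi (0 : ℝ), ((∑ n ∈ Finset.Icc 1 ⌊u⌋₊, (u - n) : ℝ) : ℂ) * (u : ℂ) ^ (-s - 2) =
      riemannZeta s / (s * (s + 1)) := by
  have hs0 : 0 < s.re := by linarith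
  set F : ℕ → ℝ → ℂ := fun n u => ((max (u - (n + 1 : ℕ)) 0 : ℝ) : ℂ) * (u : ℂ) ^ (-s - 2) with hF
  have hFint : ∀ n, Integrable (F n) (volume.restrict (Ioi 0)) := fun n =>
    (integrableOn_max_sub_mul_cpow (by positivity) hs0).1
  have hpt : ∀ u : ℝ, HasSum (fun n => F n u)
      (((∑ n ∈ Finset.Icc 1 ⌊u⌋₊, (u - n) : ℝ) : ℂ) * (u : ℂ) ^ (-s - 2)) := by
    intro u
    have h0 : ∀ n ∉ Finset.range ⌊u⌋₊, F n u = 0 := by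
      intro n hn
      rw [Finset.mem_range, not_lt] at hn
      have := (Nat.floor_lt' (n := n + 1) (by omega)).1 (show ⌊u⌋₊ < n + 1 by omega)
      simp only [hF]
      rw [max_eq_right (by linarith)]
      simp
    have h : HasSum (fun n => F n u) (∑ n ∈ Finset.range ⌊u⌋₊, F n u) := hasSum_sum_of_ne_finset_zero h0
    have e : ∑ n ∈ Finset.range ⌊u⌋₊, F n u =
        ((∑ n ∈ Finset.Icc 1 ⌊u⌋₊, (u - n) : ℝ) : ℂ) * (u : ℂ) ^ (-s - 2) := by
      simp only [hF]
      rw [← Finset.sum_mul, sum_Icc_floor_sub_eq le_rfl, ← Finset.Ico_add_one_right_eq_Icc,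
        Finset.sum_Ico_eq_sum_range]
      push_cast
      simp [add_comm]
    rwa [e] at h
  have hnorm : ∀ n, ∫ u in Ioi (0 : ℝ), ‖F n u‖ = ((n + 1 : ℕ) : ℝ) ^ (-s.re) / (s.re * (s.re + 1)) := by
    intro n
    have h := (integrableOn_max_sub_mul_cpow (a := (n + 1 : ℕ)) (by positivity) (s := (s.re : ℂ)) (by simpa using hs0)).2
    have e : ∫ u in Ioi (0 : ℝ), ((max (u - (n + 1 : ℕ)) 0 : ℝ) : ℂ) * (u : ℂ) ^ (-(s.re : ℂ) - 2) =
        ∫ u in Ioi (0 : ℝ), ((‖F n u‖ : ℝ) : ℂ) := by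
      refine setIntegral_congr_fun measurableSet_Ioi fun u hu => ?_
      have hu0 : (0 : ℝ) < u := hu
      simp only [hF]
      rw [norm_mul, norm_real, Real.norm_eq_abs, abs_of_nonneg (le_max_right _ _),
        norm_cpow_eq_rpow_re_of_pos hu0]
      push_cast
      congr 1
      rw [ofReal_cpow hu0.le]
      congr 1
      simp
    rw [e, integral_complex_ofReal] at h
    have h2 : ((((n + 1 : ℕ) : ℝ) ^ (-s.re) / (s.re * (s.re + 1)) : ℝ) : ℂ) =
        (((n + 1 : ℕ) : ℝ) : ℂ) ^ (-(s.re : ℂ)) / (s.re * (s.re + 1)) := by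
      push_cast
      rw [ofReal_cpow (by positivity)]
      push_cast
      rfl
    rw [← h2] at h
    exact_mod_cast h
  have hsum : Summable fun n => ∫ u in Ioi (0 : ℝ), ‖F n u‖ := by
    simp_rw [hnorm]
    refine Summable.div_const ?_ _
    have := (Real.summable_nat_rpow (p := -s.re)).2 (by linarith)
    exact (summable_nat_add_iff 1).2 this
  have hmain := hasSum_integral_of_summable_integral_norm hFint hsum
  have htsum : ∀ u : ℝ, ∑' n, F n u =
      ((∑ n ∈ Finset.Icc 1 ⌊u⌋₊, (u - n) : ℝ) : ℂ) * (u : ℂ) ^ (-s - 2) := fun u => (hpt u).tsum_eq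
  simp_rw [htsum] at hmain
  refine hmain.unique ?_
  have hz := zeta_eq_tsum_one_div_nat_add_one_cpow hs
  have hzs : Summable fun n : ℕ => 1 / ((n : ℂ) + 1) ^ s := by
    have := (Complex.summable_one_div_nat_cpow (p := s)).2 hs
    have := (summable_nat_add_iff 1).2 this
    simpa using this
  have h3 := (hz ▸ hzs.hasSum).div_const (s * (s + 1))
  have e : ∀ n, ∫ u in Ioi (0 : ℝ), F n u = 1 / ((n : ℂ) + 1) ^ s / (s * (s + 1)) := by
    intro n
    have := (integrableOn_max_sub_mul_cpow (a := (n + 1 : ℕ)) (by positivity) hs0).2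
    rw [hF]
    simp only
    rw [this, cpow_neg]
    push_cast
    rw [one_div]
  simp_rw [e]
  exact h3

end

/-! ### Continuation of the zeta function to Re s > 0 by the Mellin transform of `floorPrim` -/

section
open MeasureTheory Set Complex

/-- `∫_1^∞ B(u) u^{-s-2} du` where `B` is the primitive of `⌊u⌋ - u`. -/
noncomputable def zetaTail (s : ℂ) : ℂ := ∫ u in Ioi (1 : ℝ), (floorPrim u : ℂ) * (u : ℂ) ^ (-s - 2)

theorem norm_floorPrim_mul_cpow_le {u : ℝ} (hu : 1 ≤ u) (s : ℂ) :
    ‖(floorPrim u : ℂ) * (u : ℂ) ^ (-s - 2)‖ ≤ u ^ (-s.re - 1) := by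
  have hu0 : 0 < u := by linarith
  rw [norm_mul, norm_real, Real.norm_eq_abs, norm_cpow_eq_rpow_re_of_pos hu0]
  have : u ^ (-s.re - 1) = u * u ^ (-s - 2).re := by
    conv_rhs => rw [← Real.rpow_one u, ← Real.rpow_mul hu0.le, one_mul, ← Real.rpow_add hu0]
    congr 1
    simp; ring
  rw [this]
  gcongr
  exact abs_floorPrim_le hu

theorem integrableOn_floorPrim_mul_cpow {s : ℂ} (hs : 0 < s.re) :
    IntegrableOn (fun u : ℝ => (floorPrim u : ℂ) * (u : ℂ) ^ (-s - 2)) (Ioi 1) := by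
  refine Integrable.mono' (g := fun u : ℝ => u ^ (-s.re - 1))
    (integrableOn_Ioi_rpow_of_lt (by linarith) one_pos) ?_ ?_
  · refine ContinuousOn.aestronglyMeasurable (fun u hu => ?_) measurableSet_Ioi
    have hu0 : (0 : ℝ) < u := lt_trans one_pos hu
    refine ContinuousAt.continuousWithinAt (ContinuousAt.mul ?_ ?_)
    · exact (continuous_ofReal.comp continuous_floorPrim).continuousAt
    · exact continuousAt_ofReal_cpow_const _ _ (Or.inr hu0.ne')
  · exact (ae_restrict_iff' measurableSet_Ioi).2 (ae_of_all _ fun u hu => norm_floorPrim_mul_cpow_le (le_of_lt hu) s)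

theorem norm_zetaTail_le {s : ℂ} (hs : 0 < s.re) : ‖zetaTail s‖ ≤ 1 / s.re := by
  have h : ∫ u in Ioi (1 : ℝ), u ^ (-s.re - 1) = 1 / s.re := by
    rw [integral_Ioi_rpow_of_lt (by linarith) one_pos, Real.one_rpow, show -s.re - 1 + 1 = -s.re by ring,
      neg_div_neg_eq]
  rw [← h]
  refine norm_integral_le_of_norm_le (integrableOn_Ioi_rpow_of_lt (by linarith) one_pos) ?_
  exact (ae_restrict_iff' measurableSet_Ioi).2 (ae_of_all _ fun u hu => norm_floorPrim_mul_cpow_le (le_of_lt hu) s)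

/-- Up to a change of variable this is the Mellin transform of a function vanishing on (0, 1] and
O(u) at infinity, hence holomorphic for Re s > 0. -/
theorem differentiableAt_zetaTail {s : ℂ} (hs : 0 < s.re) : DifferentiableAt ℂ zetaTail s := by
  set f : ℝ → ℂ := (Ioi (1 : ℝ)).indicator fun u => (floorPrim u : ℂ) with hf
  have hc : Continuous fun u : ℝ => (floorPrim u : ℂ) := continuous_ofReal.comp continuous_floorPrim
  have e : zetaTail = fun s => mellin f (-s - 1) := by
    funext s
    rw [zetaTail, mellin]
    have : ∀ u : ℝ, (u : ℂ) ^ (-s - 1 - 1) • f u =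
        (Ioi (1 : ℝ)).indicator (fun u : ℝ => (floorPrim u : ℂ) * (u : ℂ) ^ (-s - 2)) u := by
      intro u
      rw [hf]
      by_cases h : u ∈ Ioi (1 : ℝ)
      · rw [indicator_of_mem h, indicator_of_mem h, smul_eq_mul, mul_comm]
        congr 2; ring
      · rw [indicator_of_notMem h, indicator_of_notMem h, smul_zero]
    simp_rw [this]
    rw [setIntegral_indicator measurableSet_Ioi, inter_eq_right.2 (Ioi_subset_Ioi zero_le_one)]
  have hm : DifferentiableAt ℂ (mellin f) (-s - 1) := by
    refine mellin_differentiableAt_of_isBigO_rpow (a := -1) (b := -s.re - 2) ?_ ?_ (by simp; linarith) ?_ (by simp)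
    · exact (((hc.locallyIntegrable).indicator measurableSet_Ioi).locallyIntegrableOn _)
    · refine IsBigO.of_bound 1 ?_
      filter_upwards [eventually_gt_atTop 1] with u hu
      rw [hf, indicator_of_mem (mem_Ioi.2 hu), norm_real, Real.norm_eq_abs, one_mul, neg_neg, Real.rpow_one,
        Real.norm_eq_abs, abs_of_pos (by linarith : 0 < u)]
      exact abs_floorPrim_le hu.le
    · refine IsBigO.of_bound 1 ?_
      filter_upwards [mem_nhdsWithin_of_mem_nhds (Iio_mem_nhds (zero_lt_one : (0 : ℝ) < 1))] with u hu
      rw [hf, indicator_of_notMem (by simpa using (le_of_lt hu)), norm_zero]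
      positivity
  have hl : DifferentiableAt ℂ (fun s : ℂ => -s - 1) s := by fun_prop
  rw [e]
  exact DifferentiableAt.comp (g := mellin f) s hm hl

theorem riemannZeta_eq_zetaTail_of_one_lt {s : ℂ} (hs : 1 < s.re) :
    riemannZeta s / (s * (s + 1)) = zetaTail s + 1 / (2 * (s - 1)) := by
  rw [← integral_sum_floor_mul_cpow hs]
  have hs1 : s - 1 ≠ 0 := by
    intro h
    rw [sub_eq_zero.1 h] at hs
    simp at hs
  have h1 : ∫ u in Ioi (0 : ℝ), ((∑ n ∈ Finset.Icc 1 ⌊u⌋₊, (u - n) : ℝ) : ℂ) * (u : ℂ) ^ (-s - 2) =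
      ∫ u in Ioi (1 : ℝ), ((∑ n ∈ Finset.Icc 1 ⌊u⌋₊, (u - n) : ℝ) : ℂ) * (u : ℂ) ^ (-s - 2) := by
    refine setIntegral_eq_of_subset_of_forall_sdiff_eq_zero measurableSet_Ioi (Ioi_subset_Ioi zero_le_one) fun u hu => ?_
    have hu1 : u ≤ 1 := not_lt.1 hu.2
    rcases hu1.lt_or_eq with h | h
    · rw [Nat.floor_eq_zero.2 h]; simp
    · rw [h]; simp
  have h2 : ∫ u in Ioi (1 : ℝ), ((∑ n ∈ Finset.Icc 1 ⌊u⌋₊, (u - n) : ℝ) : ℂ) * (u : ℂ) ^ (-s - 2) =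
      ∫ u in Ioi (1 : ℝ), ((floorPrim u : ℂ) * (u : ℂ) ^ (-s - 2) + 1 / 2 * (u : ℂ) ^ (-s)) := by
    refine setIntegral_congr_fun measurableSet_Ioi fun u hu => ?_
    have hu0 : (u : ℂ) ≠ 0 := by
      have : (0 : ℝ) < u := lt_trans one_pos hu
      exact_mod_cast this.ne'
    have : (u : ℂ) ^ (-s) = (u : ℂ) ^ (-s - 2) * (u : ℂ) ^ 2 := by
      rw [← Complex.cpow_ofNat, ← Complex.cpow_add _ _ hu0]
      congr 1; ring
    rw [this, floorPrim]
    push_cast; ring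
  have hi : IntegrableOn (fun u : ℝ => (u : ℂ) ^ (-s)) (Ioi 1) :=
    integrableOn_Ioi_cpow_of_lt (by simpa using hs) one_pos
  rw [h1, h2, integral_add (integrableOn_floorPrim_mul_cpow (by linarith)) (hi.const_mul _), integral_const_mul,
    integral_Ioi_cpow_of_lt (by simpa using hs) one_pos, ofReal_one, one_cpow, zetaTail]
  congr 1
  have h3 : -s + 1 ≠ 0 := by
    intro h
    apply hs1
    linear_combination -h
  field_simp
  ring

/-- By the identity theorem the formula extends from Re s > 1. It is stated for the entire function
(s - 1) ζ(s), which has no pole to be avoided. -/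
theorem riemannZeta₁_eq_zetaTail {s : ℂ} (hs : 0 < s.re) :
    riemannZeta₁ s = s * (s + 1) * ((s - 1) * zetaTail s + 1 / 2) := by
  have hU : IsOpen {s : ℂ | 0 < s.re} := isOpen_lt continuous_const continuous_re
  have hpre : IsPreconnected {s : ℂ | 0 < s.re} := (convex_halfSpace_re_gt 0).isPreconnected
  have ha : AnalyticOnNhd ℂ riemannZeta₁ {s : ℂ | 0 < s.re} :=
    (differentiable_riemannZeta₁.differentiableOn).analyticOnNhd hU
  have hb : AnalyticOnNhd ℂ (fun s : ℂ => s * (s + 1) * ((s - 1) * zetaTail s + 1 / 2)) {s : ℂ | 0 < s.re} := by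
    refine DifferentiableOn.analyticOnNhd (fun s hs => ?_) hU
    have := differentiableAt_zetaTail hs
    refine DifferentiableAt.differentiableWithinAt ?_
    fun_prop
  have h2 : (2 : ℂ) ∈ {s : ℂ | 0 < s.re} := by simp
  refine ha.eqOn_of_preconnected_of_eventuallyEq hb hpre h2 ?_ hs
  have hV : {s : ℂ | 1 < s.re} ∈ nhds (2 : ℂ) :=
    (isOpen_lt continuous_const continuous_re).mem_nhds (by simp)
  filter_upwards [hV] with s hs
  have hs : 1 < s.re := hs
  have hs1 : s ≠ 1 := by
    intro h
    rw [h] at hs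
    simp at hs
  have hs0 : s ≠ 0 := by
    intro h
    rw [h] at hs
    simp at hs
    linarith
  have hs2 : s + 1 ≠ 0 := by
    intro h
    have := congrArg Complex.re h
    simp at this
    linarith
  have h := riemannZeta_eq_zetaTail_of_one_lt hs
  rw [riemannZeta_eq_inv_sub_mul hs1] at h
  have hs3 : s - 1 ≠ 0 := sub_ne_zero.2 hs1
  field_simp at h
  linear_combination (1 / 2 : ℂ) * h

/-- On (0, 1) the function is -u^2/2, and for Re s < 1 its Mellin integral converges to 1/(2(s -
1)), exactly the polar term of the continuation. In the strip 0 < Re s < 1 the integral over (0, ∞)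
therefore carries no extra term. -/
theorem mellin_floorPrim {s : ℂ} (h0 : 0 < s.re) (h1 : s.re < 1) :
    MellinConvergent (fun u => (floorPrim u : ℂ)) (-s - 1) ∧
    mellin (fun u => (floorPrim u : ℂ)) (-s - 1) = riemannZeta s / (s * (s + 1)) := by
  have hs1 : s ≠ 1 := by
    intro h
    rw [h] at h1
    simp at h1
  have hs0 : s ≠ 0 := by
    intro h
    rw [h] at h0
    simp at h0
  have hs2 : s + 1 ≠ 0 := by
    intro h
    have := congrArg Complex.re h
    simp at this
    linarith
  have hs3 : s - 1 ≠ 0 := sub_ne_zero.2 hs1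
  have hA : IntegrableOn (fun u : ℝ => (u : ℂ) ^ (-s - 1 - 1) • (floorPrim u : ℂ)) (Ioi 1) := by
    refine (integrableOn_floorPrim_mul_cpow h0).congr_fun (fun u _ => ?_) measurableSet_Ioi
    simp only
    rw [smul_eq_mul, mul_comm]
    congr 2; ring
  have hAe : ∫ u in Ioi (1 : ℝ), (u : ℂ) ^ (-s - 1 - 1) • (floorPrim u : ℂ) = zetaTail s := by
    rw [zetaTail]
    refine setIntegral_congr_fun measurableSet_Ioi fun u _ => ?_
    rw [smul_eq_mul, mul_comm]
    congr 2; ring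
  have hr : -1 < (-s).re := by simpa using h1
  have hbase : EqOn (fun u : ℝ => (u : ℂ) ^ (-s - 1 - 1) • (floorPrim u : ℂ)) (fun u : ℝ => (-1 / 2 : ℂ) * (u : ℂ) ^ (-s))
      (Ioo 0 1) := by
    intro u hu
    have hu0 : (u : ℂ) ≠ 0 := by exact_mod_cast hu.1.ne'
    have : (u : ℂ) ^ (-s) = (u : ℂ) ^ (-s - 1 - 1) * (u : ℂ) ^ 2 := by
      rw [← Complex.cpow_ofNat, ← Complex.cpow_add _ _ hu0]
      congr 1; ring
    simp only
    rw [this, floorPrim_of_lt_one hu.2, smul_eq_mul]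
    push_cast; ring
  have hI := (intervalIntegral.intervalIntegrable_cpow' (a := 0) (b := 1) hr).const_mul (-1 / 2 : ℂ)
  rw [intervalIntegrable_iff_integrableOn_Ioo_of_le zero_le_one] at hI
  have hB : IntegrableOn (fun u : ℝ => (u : ℂ) ^ (-s - 1 - 1) • (floorPrim u : ℂ)) (Ioc 0 1) := by
    rw [integrableOn_Ioc_iff_integrableOn_Ioo]
    exact hI.congr_fun hbase.symm measurableSet_Ioo
  have hBe : ∫ u in Ioc (0 : ℝ) 1, (u : ℂ) ^ (-s - 1 - 1) • (floorPrim u : ℂ) = 1 / (2 * (s - 1)) := by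
    rw [integral_Ioc_eq_integral_Ioo, setIntegral_congr_fun measurableSet_Ioo hbase, ← integral_Ioc_eq_integral_Ioo,
      ← intervalIntegral.integral_of_le zero_le_one, intervalIntegral.integral_const_mul, integral_cpow (Or.inl hr)]
    have h3 : -s + 1 ≠ 0 := by
      intro h
      apply hs3
      linear_combination -h
    rw [ofReal_one, one_cpow, ofReal_zero, zero_cpow h3]
    field_simp
    ring
  have hu : Ioc (0 : ℝ) 1 ∪ Ioi 1 = Ioi 0 := Ioc_union_Ioi_eq_Ioi zero_le_one
  constructor
  · rw [MellinConvergent, ← hu]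
    exact hB.union hA
  · rw [mellin, ← hu, setIntegral_union (Ioc_disjoint_Ioi le_rfl) measurableSet_Ioi hB hA, hAe, hBe,
      riemannZeta_eq_inv_sub_mul hs1, riemannZeta₁_eq_zetaTail h0]
    field_simp
    ring

end

/-! ### Logarithms, three circles and Borel-Carathéodory -/

section
open Set Complex Metric

/-- L is the primitive of f'/f vanishing at c; then f exp(-L) has zero derivative on the disc. -/
theorem exists_log_of_differentiableOn_ball {f : ℂ → ℂ} {c : ℂ} {R : ℝ} (hR : 0 < R)
    (hf : DifferentiableOn ℂ f (ball c R)) (h0 : ∀ z ∈ ball c R, f z ≠ 0) :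
    ∃ L : ℂ → ℂ, DifferentiableOn ℂ L (ball c R) ∧ L c = 0 ∧ ∀ z ∈ ball c R, f z = f c * Complex.exp (L z) := by
  have hd : DifferentiableOn ℂ (fun z => deriv f z / f z) (ball c R) :=
    (hf.deriv isOpen_ball).div hf h0
  obtain ⟨L, hL0, hL⟩ := (hd.isExactOn_ball).with_val_at c 0
  have hLd : DifferentiableOn ℂ L (ball c R) := fun z hz => (hL z hz).differentiableAt.differentiableWithinAt
  refine ⟨L, hLd, hL0, fun z hz => ?_⟩
  have hder : ∀ w ∈ ball c R, HasDerivAt (fun w => f w * Complex.exp (-L w)) 0 w := by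
    intro w hw
    have h1 := (hf.differentiableAt (isOpen_ball.mem_nhds hw)).hasDerivAt
    have h2 := h1.mul ((hL w hw).neg.cexp)
    have e : deriv f w * Complex.exp (-L w) + f w * (Complex.exp (-L w) * -(deriv f w / f w)) = 0 := by
      have := h0 w hw
      field_simp
      ring
    rw [← e]
    exact h2
  have hconst : f z * Complex.exp (-L z) = f c * Complex.exp (-L c) := by
    refine (convex_ball c R).is_const_of_fderivWithin_eq_zero (𝕜 := ℂ) (f := fun w => f w * Complex.exp (-L w)) ?_ ?_ hz
      (mem_ball_self hR)
    · exact fun w hw => (hder w hw).differentiableAt.differentiableWithinAt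
    · intro w hw
      rw [fderivWithin_of_isOpen isOpen_ball hw]
      have := (hder w hw).hasFDerivAt.fderiv
      rw [this]
      ext
      simp
  rw [hL0, neg_zero, Complex.exp_zero, mul_one] at hconst
  rw [← hconst, mul_assoc, ← Complex.exp_add, neg_add_cancel, Complex.exp_zero, mul_one]

/-- Hadamard's three circles theorem. -/
theorem norm_le_interp_of_mem_annulus {f : ℂ → ℂ} {r₁ r₂ R a b : ℝ} (h1 : 0 < r₁) (h12 : r₁ < r₂) (h2R : r₂ < R)
    (hf : DifferentiableOn ℂ f (ball 0 R)) (ha : ∀ z : ℂ, ‖z‖ = r₁ → ‖f z‖ ≤ a) (hb : ∀ z : ℂ, ‖z‖ = r₂ → ‖f z‖ ≤ b)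
    {z : ℂ} (hz1 : r₁ ≤ ‖z‖) (hz2 : ‖z‖ ≤ r₂) :
    ‖f z‖ ≤ a ^ (1 - (Real.log ‖z‖ - Real.log r₁) / (Real.log r₂ - Real.log r₁)) *
      b ^ ((Real.log ‖z‖ - Real.log r₁) / (Real.log r₂ - Real.log r₁)) := by
  have h2 : 0 < r₂ := h1.trans h12
  have hz0 : z ≠ 0 := by
    intro h
    rw [h, norm_zero] at hz1
    linarith
  have hzn : 0 < ‖z‖ := norm_pos_iff.2 hz0
  have hul : Real.log r₁ < Real.log r₂ := Real.log_lt_log h1 h12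
  have hre : ∀ w : ℂ, w.re ≤ Real.log r₂ → ‖exp w‖ ≤ r₂ := by
    intro w hw
    rw [norm_exp, ← Real.exp_log h2]
    exact Real.exp_le_exp.2 hw
  have hw : log z ∈ HadamardThreeLines.verticalClosedStrip (Real.log r₁) (Real.log r₂) := by
    change (log z).re ∈ Icc _ _
    rw [log_re]
    exact ⟨Real.log_le_log h1 hz1, Real.log_le_log hzn hz2⟩
  have hmaps : ∀ w : ℂ, w.re ≤ Real.log r₂ → exp w ∈ ball (0 : ℂ) R := fun w hw => by
    rw [mem_ball_zero_iff]
    exact (hre w hw).trans_lt h2R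
  have hdiff : ∀ w : ℂ, w.re ≤ Real.log r₂ → DifferentiableAt ℂ (fun w => f (exp w)) w := fun w hw =>
    (hf.differentiableAt (isOpen_ball.mem_nhds (hmaps w hw))).comp w differentiableAt_exp
  -- The exponential carries the strip log r₁ ≤ Re w ≤ log r₂ onto the annulus, so the three lines
  -- theorem applies to f(exp w).
  have h := HadamardThreeLines.norm_le_interp_of_mem_verticalClosedStrip' (f := fun w => f (exp w)) (a := a) (b := b) hul hw
    ⟨fun w hw => (hdiff w (le_of_lt hw.2)).differentiableWithinAt, fun w hw => by
      have hcl : closure (HadamardThreeLines.verticalStrip (Real.log r₁) (Real.log r₂)) ⊆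
          {w : ℂ | w.re ≤ Real.log r₂} := closure_minimal (fun w hw => le_of_lt hw.2)
            (isClosed_le continuous_re continuous_const)
      exact (hdiff w (hcl hw)).continuousAt.continuousWithinAt⟩ ?_ ?_ ?_
  · rw [exp_log hz0, log_re] at h
    exact h
  · have hcomp : IsCompact (closedBall (0 : ℂ) r₂) := isCompact_closedBall _ _
    obtain ⟨B, hB⟩ := hcomp.exists_bound_of_continuousOn (f := f)
      (hf.continuousOn.mono (closedBall_subset_ball h2R))
    refine ⟨B, ?_⟩
    rintro _ ⟨w, hw, rfl⟩
    exact hB _ (by rw [mem_closedBall_zero_iff]; exact hre w hw.2)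
  · intro w hw
    refine ha _ ?_
    have hw : w.re = Real.log r₁ := hw
    rw [norm_exp, hw, Real.exp_log h1]
  · intro w hw
    refine hb _ ?_
    have hw : w.re = Real.log r₂ := hw
    rw [norm_exp, hw, Real.exp_log h2]

/-- The Borel-Carathéodory inequality bounds |L| by O(M₀) for |z| ≤ 1/4 and by O(M/η) on |z| = 3/2 -
η; the three circles theorem interpolates. The gain is the exponent θ < 1, which depends on η alone:
if M is of order log |t| and M₀ is bounded, then L is o(log |t|). -/
theorem exists_norm_le_of_re_le {η : ℝ} (hη : 0 < η) (hη1 : η < 1 / 2) : ∃ θ : ℝ, 0 ≤ θ ∧ θ < 1 ∧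
    ∀ (M₀ M : ℝ) (L : ℂ → ℂ), 1 ≤ M₀ → 1 ≤ M → DifferentiableOn ℂ L (ball 0 (3 / 2)) → L 0 = 0 →
    (∀ z ∈ ball (0 : ℂ) (3 / 2), (L z).re ≤ M) → (∀ z ∈ ball (0 : ℂ) (1 / 2), (L z).re ≤ M₀) →
    ∀ z : ℂ, ‖z‖ ≤ 3 / 2 - 2 * η → ‖L z‖ ≤ 2 * M₀ * (3 * M / η) ^ θ := by
  have hpos : 0 < Real.log (3 / 2 - η) - Real.log (1 / 4) :=
    sub_pos.2 (Real.log_lt_log (by norm_num) (by linarith))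
  have hlt : Real.log (3 / 2 - 2 * η) - Real.log (1 / 4) < Real.log (3 / 2 - η) - Real.log (1 / 4) :=
    sub_lt_sub_right (Real.log_lt_log (by linarith) (by linarith)) _
  have hnn : 0 ≤ Real.log (3 / 2 - 2 * η) - Real.log (1 / 4) :=
    sub_nonneg.2 (Real.log_le_log (by norm_num) (by linarith))
  refine ⟨(Real.log (3 / 2 - 2 * η) - Real.log (1 / 4)) / (Real.log (3 / 2 - η) - Real.log (1 / 4)),
    div_nonneg hnn hpos.le, (div_lt_one hpos).2 hlt, ?_⟩
  intro M₀ M L hM₀ hM hL hL0 hre hre0 z hz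
  have hMη : 1 ≤ 3 * M / η := by
    rw [le_div_iff₀ hη]; linarith
  have hsmall : ∀ z : ℂ, ‖z‖ ≤ 1 / 4 → ‖L z‖ ≤ 2 * M₀ := by
    intro z hz
    have h := borelCaratheodory_zero (f := L) (R := 1 / 2) (M := M₀) (z := z) (by linarith)
      (hL.mono (ball_subset_ball (by norm_num))) hre0 (by norm_num) (by rw [mem_ball_zero_iff]; linarith) hL0
    refine h.trans ?_
    rw [div_le_iff₀ (by linarith)]
    nlinarith [norm_nonneg z]
  have hlarge : ∀ z : ℂ, ‖z‖ = 3 / 2 - η → ‖L z‖ ≤ 3 * M / η := by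
    intro z hz
    have h := borelCaratheodory_zero (f := L) (R := 3 / 2) (M := M) (z := z) (by linarith)
      hL hre (by norm_num) (by rw [mem_ball_zero_iff]; linarith) hL0
    refine h.trans ?_
    rw [hz, show (3 : ℝ) / 2 - (3 / 2 - η) = η by ring]
    refine div_le_div_of_nonneg_right ?_ hη.le
    nlinarith
  by_cases hz4 : ‖z‖ ≤ 1 / 4
  · refine (hsmall z hz4).trans ?_
    exact le_mul_of_one_le_right (by linarith) (Real.one_le_rpow hMη (div_nonneg hnn hpos.le))
  · push Not at hz4
    have h := norm_le_interp_of_mem_annulus (r₁ := 1 / 4) (r₂ := 3 / 2 - η) (by norm_num) (by linarith) (by linarith) hL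
      (fun z hz => hsmall z hz.le) hlarge hz4.le (by linarith)
    have hθ0 : 0 ≤ (Real.log ‖z‖ - Real.log (1 / 4)) / (Real.log (3 / 2 - η) - Real.log (1 / 4)) :=
      div_nonneg (sub_nonneg.2 (Real.log_le_log (by norm_num) hz4.le)) hpos.le
    refine h.trans (mul_le_mul ?_ ?_ (by positivity) (by linarith))
    · calc (2 * M₀) ^ (1 - (Real.log ‖z‖ - Real.log (1 / 4)) / (Real.log (3 / 2 - η) - Real.log (1 / 4))) ≤
          (2 * M₀) ^ (1 : ℝ) := Real.rpow_le_rpow_of_exponent_le (by linarith) (by linarith)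
        _ = 2 * M₀ := Real.rpow_one _
    · refine Real.rpow_le_rpow_of_exponent_le hMη ?_
      have := Real.log_le_log (by linarith) hz
      gcongr

theorem exists_mul_rpow_le {K θ ε : ℝ} (hK : 0 < K) (hθ0 : 0 ≤ θ) (hθ : θ < 1) (hε : 0 < ε) :
    ∃ C : ℝ, 0 ≤ C ∧ ∀ l : ℝ, 0 < l → K * l ^ θ ≤ ε * l + C := by
  set l₀ := (K / ε) ^ (1 / (1 - θ)) with hl₀
  have hl : 0 < l₀ := by positivity
  refine ⟨K * l₀ ^ θ, by positivity, fun l hl0 => ?_⟩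
  by_cases h : l ≤ l₀
  · have : K * l ^ θ ≤ K * l₀ ^ θ := by gcongr
    have : 0 ≤ ε * l := by positivity
    linarith
  · push Not at h
    have h1 : K / ε ≤ l ^ (1 - θ) := by
      calc K / ε = l₀ ^ (1 - θ) := by
            rw [hl₀, ← Real.rpow_mul (by positivity), one_div_mul_cancel (by linarith), Real.rpow_one]
        _ ≤ _ := Real.rpow_le_rpow hl.le h.le (by linarith)
    rw [div_le_iff₀ hε] at h1
    have h2 : l = l ^ (1 - θ) * l ^ θ := by
      rw [← Real.rpow_add hl0, sub_add_cancel, Real.rpow_one]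
    have h3 : K * l ^ θ ≤ ε * l := by
      calc K * l ^ θ ≤ l ^ (1 - θ) * ε * l ^ θ := by gcongr
        _ = ε * (l ^ (1 - θ) * l ^ θ) := by ring
        _ = ε * l := by rw [← h2]
    have : 0 ≤ K * l₀ ^ θ := by positivity
    linarith

end

/-! ### Growth of the zeta function and of its inverse under the Riemann hypothesis -/

section
open Set Complex Metric

/-- Both ζ and 1/ζ have Dirichlet series with coefficients bounded by 1, dominated by the series of
ζ at 3/2. -/
theorem exists_norm_riemannZeta_bounds : ∃ Z : ℝ, 1 ≤ Z ∧ ∀ s : ℂ, 3 / 2 ≤ s.re →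
    ‖riemannZeta s‖ ≤ Z ∧ 1 ≤ Z * ‖riemannZeta s‖ := by
  have h32 : (1 : ℝ) < ((3 / 2 : ℝ) : ℂ).re := by rw [ofReal_re]; norm_num
  have hs0 : Summable fun n => ‖LSeries.term 1 ((3 / 2 : ℝ) : ℂ) n‖ := (LSeriesSummable_one_iff.2 h32).norm
  set S := ∑' n, ‖LSeries.term 1 ((3 / 2 : ℝ) : ℂ) n‖ with hS
  have hS0 : 0 ≤ S := tsum_nonneg fun n => norm_nonneg _
  have key : ∀ f : ℕ → ℂ, (∀ n, ‖f n‖ ≤ 1) → ∀ s : ℂ, 3 / 2 ≤ s.re → ‖LSeries f s‖ ≤ S + 1 := by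
    intro f hf s hs
    have h : ‖LSeries f s‖ ≤ S := tsum_of_norm_bounded hs0.hasSum fun n =>
      (LSeries.norm_term_le s (g := 1) (by simpa using hf n)).trans
        (LSeries.norm_term_le_of_re_le_re 1 (by rw [ofReal_re]; exact hs) n)
    linarith
  refine ⟨S + 1, by linarith, fun s hs => ?_⟩
  have hs1 : 1 < s.re := by linarith
  have h1 := key 1 (by simp) s hs
  have h2 := key (fun n => ((ArithmeticFunction.moebius n : ℤ) : ℂ)) (fun n => by
    rw [norm_intCast]
    exact_mod_cast ArithmeticFunction.abs_moebius_le_one) s hs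
  have h3 := LSeries_one_mul_Lseries_moebius hs1
  rw [LSeries_one_eq_riemannZeta hs1] at h1 h3
  refine ⟨h1, ?_⟩
  have h4 := congrArg norm h3
  rw [norm_mul, norm_one] at h4
  calc 1 = ‖riemannZeta s‖ * _ := h4.symm
    _ ≤ ‖riemannZeta s‖ * (S + 1) := by gcongr
    _ = _ := mul_comm _ _

theorem riemannZeta₁_eq_mul (s : ℂ) (hs : s ≠ 1) : riemannZeta₁ s = (s - 1) * riemannZeta s := by
  have : s - 1 ≠ 0 := sub_ne_zero.2 hs
  rw [riemannZeta_eq_inv_sub_mul hs]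
  field_simp

theorem RiemannHypothesis.riemannZeta₁_ne_zero (hRH : RiemannHypothesis) {s : ℂ} (hs : 1 / 2 < s.re) :
    riemannZeta₁ s ≠ 0 := by
  by_cases h1 : s = 1
  · rw [h1, riemannZeta₁_one]; exact one_ne_zero
  · rw [riemannZeta₁_eq_mul s h1]
    refine mul_ne_zero (sub_ne_zero.2 h1) fun h => ?_
    have := hRH s h (by
      rintro ⟨n, hn⟩
      rw [hn] at hs
      have : (-2 * ((n : ℂ) + 1)).re = -2 * ((n : ℝ) + 1) := by simp
      rw [this] at hs
      have := Nat.cast_nonneg (α := ℝ) n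
      linarith) h1
    linarith

theorem norm_riemannZeta₁_le {s : ℂ} (hs : 1 / 2 < s.re) (hs' : s.re ≤ 4) :
    ‖riemannZeta₁ s‖ ≤ 20 * (|s.im| + 4) ^ 3 := by
  have h0 : 0 < s.re := by linarith
  have hn : ‖s‖ ≤ |s.im| + 4 := by
    have := norm_le_abs_re_add_abs_im s
    rw [abs_of_pos h0] at this
    linarith
  have h1 : ‖s + 1‖ ≤ 2 * (|s.im| + 4) := by
    have := norm_add_le s 1
    rw [norm_one] at this
    have := abs_nonneg s.im
    linarith
  have h2 : ‖s - 1‖ ≤ 2 * (|s.im| + 4) := by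
    have := norm_sub_le s 1
    rw [norm_one] at this
    have := abs_nonneg s.im
    linarith
  have h3 : ‖zetaTail s‖ ≤ 2 := (norm_zetaTail_le h0).trans (by
    rw [div_le_iff₀ h0]; linarith)
  have h4 : ‖(s - 1) * zetaTail s + 1 / 2‖ ≤ 5 * (|s.im| + 4) := by
    have := norm_add_le ((s - 1) * zetaTail s) (1 / 2)
    rw [norm_mul] at this
    have e : ‖(1 / 2 : ℂ)‖ = 1 / 2 := by norm_num
    rw [e] at this
    have h5 : ‖s - 1‖ * ‖zetaTail s‖ ≤ 2 * (|s.im| + 4) * 2 := by gcongr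
    have := abs_nonneg s.im
    linarith
  rw [riemannZeta₁_eq_zetaTail h0, norm_mul, norm_mul]
  calc ‖s‖ * ‖s + 1‖ * ‖(s - 1) * zetaTail s + 1 / 2‖ ≤
      (|s.im| + 4) * (2 * (|s.im| + 4)) * (5 * (|s.im| + 4)) := by gcongr
    _ = 10 * (|s.im| + 4) ^ 3 := by ring
    _ ≤ _ := by gcongr; norm_num

/-- The disc of radius 3/2 about 2 + it lies in Re s > 1/2, where (s - 1) ζ(s) has no zero. The
logarithm L of its ratio to the value at the centre has real part O(log(|t| + 4)) on the disc, and
O(1) on the concentric disc of radius 1/2, where the Dirichlet series converges. By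
`exists_norm_le_of_re_le`, L is O(log^θ), and `exists_mul_rpow_le` turns this into ε log + C. -/
theorem RiemannHypothesis.exists_norm_riemannZeta₁_ratio_le (hRH : RiemannHypothesis) {δ ε : ℝ} (hδ : 0 < δ) (hδ1 : δ < 1)
    (hε : 0 < ε) : ∃ C : ℝ, 1 ≤ C ∧ ∀ s : ℂ, 1 / 2 + δ ≤ s.re → s.re ≤ 2 →
    ‖riemannZeta₁ s‖ ≤ C * (|s.im| + 4) ^ ε * ‖riemannZeta₁ (2 + s.im * I)‖ ∧
    ‖riemannZeta₁ (2 + s.im * I)‖ ≤ C * (|s.im| + 4) ^ ε * ‖riemannZeta₁ s‖ := by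
  obtain ⟨Z, hZ, hζ⟩ := exists_norm_riemannZeta_bounds
  obtain ⟨θ, hθ0, hθ1, hL⟩ := exists_norm_le_of_re_le (η := δ / 2) (by linarith) (by linarith)
  have hlog2 := Real.log_two_gt_d9
  have hlog4 : 1 < Real.log 4 := by
    rw [show (4 : ℝ) = 2 ^ 2 by norm_num, Real.log_pow]; push_cast; linarith
  set M₀ := Real.log (4 * Z ^ 2) with hM₀
  have hM₀1 : 1 ≤ M₀ := hlog4.le.trans (Real.log_le_log (by norm_num) (by nlinarith))
  -- The cubic bound of `norm_riemannZeta₁_le` gives real part at most log(20·64·Z) + 3l, and this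
  -- is at most b l because l ≥ 1.
  set b := Real.log (20 * 64 * Z) + 3 with hb
  have hb0 : 0 ≤ Real.log (20 * 64 * Z) := Real.log_nonneg (by linarith)
  obtain ⟨C, hC0, hC⟩ := exists_mul_rpow_le (K := 2 * M₀ * (3 * b / (δ / 2)) ^ θ) (θ := θ) (ε := ε)
    (by positivity) hθ0 hθ1 hε
  refine ⟨Real.exp C, Real.one_le_exp hC0, fun s hs hs2 => ?_⟩
  set t := s.im with ht
  set c : ℂ := 2 + t * I with hc
  have hcre : c.re = 2 := by simp [hc]
  have hcim : c.im = t := by simp [hc]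
  set l := Real.log (|t| + 4) with hl
  have ht0 := abs_nonneg t
  have hl1 : 1 ≤ l := hlog4.le.trans (Real.log_le_log (by norm_num) (by linarith))
  have hc1 : c ≠ 1 := by
    intro h
    rw [h] at hcre
    norm_num at hcre
  have hcn : 1 ≤ ‖c - 1‖ := by
    have := abs_re_le_norm (c - 1)
    rw [sub_re, hcre, one_re] at this
    norm_num at this
    exact this
  have hfc : ‖riemannZeta₁ c‖ = ‖c - 1‖ * ‖riemannZeta c‖ := by rw [riemannZeta₁_eq_mul c hc1, norm_mul]
  have hζc := hζ c (by rw [hcre]; norm_num)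
  have hfc1 : 1 ≤ Z * ‖riemannZeta₁ c‖ := by
    rw [hfc]
    calc (1 : ℝ) ≤ Z * ‖riemannZeta c‖ := hζc.2
      _ ≤ Z * (‖c - 1‖ * ‖riemannZeta c‖) := by
          gcongr
          exact le_mul_of_one_le_left (norm_nonneg _) hcn
  have hfc0 : 0 < ‖riemannZeta₁ c‖ := by
    by_contra h
    have : ‖riemannZeta₁ c‖ = 0 := le_antisymm (not_lt.1 h) (norm_nonneg _)
    rw [this] at hfc1
    norm_num at hfc1
  have hreim : ∀ z ∈ ball (0 : ℂ) (3 / 2), 1 / 2 < (c + z).re ∧ (c + z).re ≤ 4 ∧ |(c + z).im| ≤ |t| + 2 := by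
    intro z hz
    rw [mem_ball_zero_iff] at hz
    have h1 := (abs_le.1 (abs_re_le_norm z))
    have h2 := abs_im_le_norm z
    rw [add_re, add_im, hcre, hcim]
    refine ⟨by linarith, by linarith, (abs_add_le _ _).trans (by linarith)⟩
  obtain ⟨L, hLd, hL0, hLe⟩ := exists_log_of_differentiableOn_ball (f := fun z => riemannZeta₁ (c + z)) (c := 0)
    (R := 3 / 2) (by norm_num) ((differentiable_riemannZeta₁.comp (by fun_prop)).differentiableOn)
    (fun z hz => hRH.riemannZeta₁_ne_zero (hreim z hz).1)
  simp only [add_zero] at hLe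
  have hexp : ∀ z ∈ ball (0 : ℂ) (3 / 2), ‖riemannZeta₁ (c + z)‖ = ‖riemannZeta₁ c‖ * Real.exp (L z).re := by
    intro z hz
    rw [hLe z hz, norm_mul, norm_exp]
  have hre : ∀ z ∈ ball (0 : ℂ) (3 / 2), ∀ K : ℝ, 0 < K → ‖riemannZeta₁ (c + z)‖ ≤ K * ‖riemannZeta₁ c‖ →
      (L z).re ≤ Real.log K := by
    intro z hz K hK h
    rw [hexp z hz, mul_comm] at h
    rw [Real.le_log_iff_exp_le hK]
    exact le_of_mul_le_mul_right h hfc0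
  have hmain := hL M₀ (b * l) L hM₀1 (by nlinarith) hLd hL0 (fun z hz => by
      have h := hre z hz (20 * 64 * Z * (|t| + 4) ^ 3) (by positivity) (by
        obtain ⟨h1, h2, h3⟩ := hreim z hz
        refine (norm_riemannZeta₁_le h1 h2).trans ?_
        calc 20 * (|(c + z).im| + 4) ^ 3 ≤ 20 * (4 * (|t| + 4)) ^ 3 := by gcongr; linarith
          _ = 20 * 64 * (|t| + 4) ^ 3 * 1 := by ring
          _ ≤ 20 * 64 * (|t| + 4) ^ 3 * (Z * ‖riemannZeta₁ c‖) := by gcongr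
          _ = _ := by ring)
      rw [Real.log_mul (by positivity) (by positivity), Real.log_pow, ← hl] at h
      push_cast at h
      nlinarith) (fun z hz => by
      have hz' : z ∈ ball (0 : ℂ) (3 / 2) := ball_subset_ball (by norm_num) hz
      refine hre z hz' (4 * Z ^ 2) (by positivity) ?_
      rw [mem_ball_zero_iff] at hz
      have h1 := (abs_le.1 (abs_re_le_norm z))
      have hz1 : c + z ≠ 1 := by
        intro h
        have := congrArg Complex.re h
        rw [add_re, hcre, one_re] at this
        linarith
      rw [riemannZeta₁_eq_mul _ hz1, norm_mul, hfc]
      have h2 := (hζ (c + z) (by rw [add_re, hcre]; linarith)).1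
      have h3 : ‖c + z - 1‖ ≤ 2 * ‖c - 1‖ := by
        calc ‖c + z - 1‖ = ‖(c - 1) + z‖ := by congr 1; ring
          _ ≤ ‖c - 1‖ + ‖z‖ := norm_add_le _ _
          _ ≤ _ := by linarith
      calc ‖c + z - 1‖ * ‖riemannZeta (c + z)‖ ≤ 2 * ‖c - 1‖ * Z := by gcongr
        _ ≤ 2 * ‖c - 1‖ * Z * (Z * ‖riemannZeta c‖) := le_mul_of_one_le_right (by positivity) hζc.2
        _ = 2 * (Z ^ 2 * (‖c - 1‖ * ‖riemannZeta c‖)) := by ring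
        _ ≤ 4 * (Z ^ 2 * (‖c - 1‖ * ‖riemannZeta c‖)) := by gcongr; norm_num
        _ = _ := by ring)
  set z : ℂ := ((s.re - 2 : ℝ) : ℂ) with hz
  have hcz : c + z = s := by
    apply Complex.ext <;> simp [hc, hz, ht]
  have hzn : ‖z‖ ≤ 3 / 2 - 2 * (δ / 2) := by
    rw [hz, norm_real, Real.norm_eq_abs, abs_le]
    constructor <;> linarith
  have hLz := hmain z hzn
  have hLz2 : ‖L z‖ ≤ ε * l + C := by
    refine hLz.trans (le_trans (le_of_eq ?_) (hC l (by linarith)))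
    rw [show 3 * (b * l) / (δ / 2) = 3 * b / (δ / 2) * l by ring, Real.mul_rpow (by positivity) (by linarith)]
    ring
  have hE := hexp z (by rw [mem_ball_zero_iff]; linarith)
  rw [hcz] at hE
  have hexpC : Real.exp (ε * l + C) = Real.exp C * (|t| + 4) ^ ε := by
    rw [Real.exp_add, Real.rpow_def_of_pos (by positivity), ← hl, mul_comm, mul_comm ε]
  have habs := abs_le.1 ((abs_re_le_norm (L z)).trans hLz2)
  constructor
  · rw [hE, ← hexpC, mul_comm]
    gcongr
    exact habs.2
  · rw [hE, ← hexpC, mul_left_comm, ← Real.exp_add]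
    refine le_mul_of_one_le_right (norm_nonneg _) (Real.one_le_exp ?_)
    linarith [habs.1]

/-- The function `1 / ζ`, extended by `0` to the point `1`. -/
noncomputable def zetaInv (s : ℂ) : ℂ := (s - 1) / riemannZeta₁ s

theorem RiemannHypothesis.differentiableAt_zetaInv (hRH : RiemannHypothesis) {s : ℂ} (hs : 1 / 2 < s.re) :
    DifferentiableAt ℂ zetaInv s :=
  DifferentiableAt.div (by fun_prop) differentiable_riemannZeta₁.differentiableAt (hRH.riemannZeta₁_ne_zero hs)

theorem zetaInv_eq {s : ℂ} (hs : s ≠ 1) : zetaInv s = (riemannZeta s)⁻¹ := by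
  have : s - 1 ≠ 0 := sub_ne_zero.2 hs
  rw [zetaInv, riemannZeta₁_eq_mul s hs, div_mul_cancel_left₀ this]

theorem RiemannHypothesis.exists_norm_zetaInv_le (hRH : RiemannHypothesis) {δ ε : ℝ} (hδ : 0 < δ) (hδ1 : δ < 1)
    (hε : 0 < ε) : ∃ C : ℝ, 1 ≤ C ∧ ∀ s : ℂ, 1 / 2 + δ ≤ s.re → ‖zetaInv s‖ ≤ C * (|s.im| + 4) ^ ε := by
  obtain ⟨Z, hZ, hζ⟩ := exists_norm_riemannZeta_bounds
  obtain ⟨C, hC, h⟩ := hRH.exists_norm_riemannZeta₁_ratio_le hδ hδ1 hε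
  refine ⟨2 * C * Z, by nlinarith, fun s hs => ?_⟩
  have h4 : 1 ≤ (|s.im| + 4) ^ ε := Real.one_le_rpow (by linarith [abs_nonneg s.im]) hε.le
  by_cases h2 : s.re ≤ 2
  · have h1 := (h s hs h2).2
    have h0 : 0 < ‖riemannZeta₁ s‖ := norm_pos_iff.2 (hRH.riemannZeta₁_ne_zero (by linarith))
    set c : ℂ := 2 + s.im * I with hc
    have hc1 : c ≠ 1 := by
      intro h
      have := congrArg Complex.re h
      simp [hc] at this
    have h3 := (hζ c (by simp [hc]; norm_num)).2
    have h5 : ‖s - 1‖ ≤ 2 * ‖c - 1‖ := by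
      have h7 : ‖s - 1‖ ≤ |s.re - 1| + |s.im| := by
        have := norm_le_abs_re_add_abs_im (s - 1)
        simpa using this
      have h8 := abs_re_le_norm (c - 1)
      have h9 := abs_im_le_norm (c - 1)
      have h10 : |s.re - 1| ≤ 1 := by rw [abs_le]; constructor <;> linarith
      simp [hc] at h8 h9
      norm_num at h8
      simp only [hc]
      linarith
    rw [zetaInv, norm_div, div_le_iff₀ h0]
    calc ‖s - 1‖ ≤ 2 * ‖c - 1‖ := h5
      _ ≤ 2 * ‖c - 1‖ * (Z * ‖riemannZeta c‖) := le_mul_of_one_le_right (by positivity) h3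
      _ = 2 * Z * ‖riemannZeta₁ c‖ := by rw [riemannZeta₁_eq_mul c hc1, norm_mul]; ring
      _ ≤ 2 * Z * (C * (|s.im| + 4) ^ ε * ‖riemannZeta₁ s‖) := by gcongr
      _ = _ := by ring
  · push Not at h2
    have hs1 : s ≠ 1 := by
      intro h
      rw [h] at h2
      norm_num at h2
    have h3 := (hζ s (by linarith)).2
    have h0 : 0 < ‖riemannZeta s‖ := by
      by_contra h
      have : ‖riemannZeta s‖ = 0 := le_antisymm (not_lt.1 h) (norm_nonneg _)
      rw [this] at h3
      norm_num at h3
    rw [zetaInv_eq hs1, norm_inv]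
    calc ‖riemannZeta s‖⁻¹ ≤ Z := by
          rw [inv_le_iff_one_le_mul₀ h0]; exact h3
      _ ≤ 2 * C * Z * 1 := by nlinarith
      _ ≤ _ := by gcongr

/-- The restriction Re s ≤ 3/4 keeps s away from the pole, so that |s - 1| is comparable with the
same quantity at 2 + it and cancels. -/
theorem RiemannHypothesis.exists_norm_riemannZeta_le (hRH : RiemannHypothesis) {δ ε : ℝ} (hδ : 0 < δ) (hδ1 : δ < 1)
    (hε : 0 < ε) : ∃ C : ℝ, 1 ≤ C ∧ ∀ s : ℂ, 1 / 2 + δ ≤ s.re → s.re ≤ 3 / 4 →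
    ‖riemannZeta s‖ ≤ C * (|s.im| + 4) ^ ε := by
  obtain ⟨Z, hZ, hζ⟩ := exists_norm_riemannZeta_bounds
  obtain ⟨C, hC, h⟩ := hRH.exists_norm_riemannZeta₁_ratio_le hδ hδ1 hε
  refine ⟨8 * C * Z, by nlinarith, fun s hs hs2 => ?_⟩
  have h1 := (h s hs (by linarith)).1
  set c : ℂ := 2 + s.im * I with hc
  have hc1 : c ≠ 1 := by
    intro h
    have := congrArg Complex.re h
    simp [hc] at this
  have hs1 : s ≠ 1 := by
    intro h
    rw [h] at hs2
    norm_num at hs2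
  have h3 := (hζ c (by simp [hc]; norm_num)).1
  have h0 : 0 < ‖s - 1‖ := norm_pos_iff.2 (sub_ne_zero.2 hs1)
  have h5 : ‖c - 1‖ ≤ 8 * ‖s - 1‖ := by
    have h7 := norm_le_abs_re_add_abs_im (c - 1)
    have h8 := abs_re_le_norm (s - 1)
    have h9 := abs_im_le_norm (s - 1)
    have h10 : 1 / 4 ≤ |s.re - 1| := by rw [le_abs]; right; linarith
    simp only [sub_re, one_re, sub_im, one_im, sub_zero] at h8 h9
    simp [hc] at h7
    norm_num at h7
    simp only [hc]
    linarith
  rw [riemannZeta₁_eq_mul s hs1, riemannZeta₁_eq_mul c hc1, norm_mul, norm_mul] at h1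
  refine le_of_mul_le_mul_left (h1.trans ?_) h0
  calc C * (|s.im| + 4) ^ ε * (‖c - 1‖ * ‖riemannZeta c‖) ≤ C * (|s.im| + 4) ^ ε * (8 * ‖s - 1‖ * Z) := by gcongr
    _ = _ := by ring

end

/-! ### Weighted sums of `μ * μ` by contour integration -/

section
open Set Complex MeasureTheory

/-- The piecewise linear function equal to `0` on `[0, 1]` and to `1` on `[2, ∞)`. -/
noncomputable def tailWeight (u : ℝ) : ℝ := min u 2 - min u 1

/-- `tailWeight` subtracted from `1`, supported on `[0, 2]`. -/
noncomputable def headWeight (u : ℝ) : ℝ := max (2 - u) 0 - max (1 - u) 0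

/-- The Mellin transform of `headWeight`. -/
noncomputable def smoothKernel (s : ℂ) : ℂ := (2 * ((1 / 2 : ℝ) : ℂ) ^ (-s) - 1) / (s * (s + 1))

theorem headWeight_add_tailWeight (u : ℝ) : headWeight u + tailWeight u = 1 := by
  rw [headWeight, tailWeight]
  rcases le_total u 1 with h | h <;> rcases le_total u 2 with h' | h' <;>
    simp [h, h'] <;> linarith

theorem tailWeight_mem {u : ℝ} : 0 ≤ tailWeight u ∧ tailWeight u ≤ 1 := by
  rw [tailWeight]
  rcases le_total u 1 with h | h <;> rcases le_total u 2 with h' | h' <;>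
    simp only [min_eq_left, min_eq_right, h, h'] <;> constructor <;> linarith

theorem hasMellin_max_one_sub {s : ℂ} (hs : 0 < s.re) :
    HasMellin (fun u : ℝ => ((max (1 - u) 0 : ℝ) : ℂ)) s (1 / (s * (s + 1))) := by
  have h1 := hasMellin_one_Ioc hs
  have h2 := hasMellin_cpow_Ioc 1 (s := s) (by simp; linarith)
  have h := hasMellin_sub h1.1 h2.1
  rw [h1.2, h2.2] at h
  have hs0 : s ≠ 0 := by rintro rfl; simp at hs
  have hs1 : s + 1 ≠ 0 := by
    intro h
    have := congrArg Complex.re h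
    simp at this
    linarith
  have e1 : 1 / s - 1 / (s + 1) = 1 / (s * (s + 1)) := by field_simp; ring
  rw [e1] at h
  have e2 : EqOn (fun t : ℝ => (t : ℂ) ^ (s - 1) • ((Ioc (0 : ℝ) 1).indicator (fun _ => (1 : ℂ)) t -
      (Ioc (0 : ℝ) 1).indicator (fun t : ℝ => (t : ℂ) ^ (1 : ℂ)) t))
      (fun t : ℝ => (t : ℂ) ^ (s - 1) • ((max (1 - t) 0 : ℝ) : ℂ)) (Ioi 0) := by
    intro u hu
    have hu0 : 0 < u := hu
    by_cases h : u ≤ 1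
    · simp [hu0, h]
    · simp [h, max_eq_right (by linarith : 1 - u ≤ 0)]
  refine ⟨?_, ?_⟩
  · exact (integrableOn_congr_fun e2 measurableSet_Ioi).1 h.1
  · rw [← h.2]
    exact (setIntegral_congr_fun measurableSet_Ioi e2).symm

theorem hasMellin_min_one {s : ℂ} (hs : s.re < 0) (hs' : -1 < s.re) :
    HasMellin (fun u : ℝ => ((min u 1 : ℝ) : ℂ)) s (-(1 / (s * (s + 1)))) := by
  have h2 := hasMellin_cpow_Ioc 1 (s := s) (by simp; linarith)
  have hs0 : s ≠ 0 := by rintro rfl; simp at hs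
  have hs1 : s + 1 ≠ 0 := by
    intro h
    have := congrArg Complex.re h
    simp at this
    linarith
  have hI : IntegrableOn (fun u : ℝ => (u : ℂ) ^ (s - 1)) (Ioi 1) :=
    integrableOn_Ioi_cpow_of_lt (by simp; linarith) one_pos
  have h1 : HasMellin ((Ioi (1 : ℝ)).indicator (fun _ => (1 : ℂ))) s (-(1 / s)) := by
    have e : ∀ t : ℝ, (t : ℂ) ^ (s - 1) • (Ioi (1 : ℝ)).indicator (fun _ => (1 : ℂ)) t =
        (Ioi (1 : ℝ)).indicator (fun t : ℝ => (t : ℂ) ^ (s - 1)) t := by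
      intro t
      by_cases h : t ∈ Ioi (1 : ℝ)
      · rw [indicator_of_mem h, indicator_of_mem h, smul_eq_mul, mul_one]
      · rw [indicator_of_notMem h, indicator_of_notMem h, smul_zero]
    constructor
    · rw [MellinConvergent]
      simp_rw [e]
      exact ((integrable_indicator_iff measurableSet_Ioi).2 hI).integrableOn
    · rw [mellin]
      simp_rw [e]
      rw [setIntegral_indicator measurableSet_Ioi, inter_eq_right.2 (Ioi_subset_Ioi zero_le_one),
        integral_Ioi_cpow_of_lt (by simp; linarith) one_pos, ofReal_one, one_cpow, sub_add_cancel]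
      ring
  have h := hasMellin_add h1.1 h2.1
  rw [h1.2, h2.2] at h
  have e1 : -(1 / s) + 1 / (s + 1) = -(1 / (s * (s + 1))) := by field_simp; ring
  rw [e1] at h
  have e2 : EqOn (fun t : ℝ => (t : ℂ) ^ (s - 1) • ((Ioi (1 : ℝ)).indicator (fun _ => (1 : ℂ)) t +
      (Ioc (0 : ℝ) 1).indicator (fun t : ℝ => (t : ℂ) ^ (1 : ℂ)) t))
      (fun t : ℝ => (t : ℂ) ^ (s - 1) • ((min t 1 : ℝ) : ℂ)) (Ioi 0) := by
    intro u hu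
    have hu0 : 0 < u := hu
    by_cases h : u ≤ 1
    · simp [hu0, h, not_lt.2 h]
    · simp [h, not_le.1 h, (not_le.1 h).le]
  refine ⟨?_, ?_⟩
  · exact (integrableOn_congr_fun e2 measurableSet_Ioi).1 h.1
  · rw [← h.2]
    exact (setIntegral_congr_fun measurableSet_Ioi e2).symm

/-- Both weights have the shape 2 f(u/2) - f(u): `headWeight` with f(u) = max(1 - u, 0),
`tailWeight` with f(u) = min(u, 1). -/
theorem HasMellin.scale_two_sub {f : ℝ → ℂ} {s m : ℂ} (h : HasMellin f s m) :
    HasMellin (fun u => 2 * f (1 / 2 * u) - f u) s ((2 * ((1 / 2 : ℝ) : ℂ) ^ (-s) - 1) * m) := by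
  have h1 : MellinConvergent (fun u => f (1 / 2 * u)) s := (MellinConvergent.comp_mul_left (by norm_num)).2 h.1
  have h2 := hasMellin_sub (h1.const_smul (2 : ℂ)) h.1
  rw [mellin_const_smul, mellin_comp_mul_left _ _ (by norm_num : (0 : ℝ) < 1 / 2), h.2, smul_eq_mul, smul_eq_mul] at h2
  have e : (2 * ((1 / 2 : ℝ) : ℂ) ^ (-s) - 1) * m = 2 * (((1 / 2 : ℝ) : ℂ) ^ (-s) * m) - m := by ring
  rw [e]
  exact h2

theorem hasMellin_headWeight {s : ℂ} (hs : 0 < s.re) :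
    HasMellin (fun u => (headWeight u : ℂ)) s (smoothKernel s) := by
  have h := (hasMellin_max_one_sub hs).scale_two_sub
  rw [mul_one_div] at h
  have e : (fun u : ℝ => (headWeight u : ℂ)) =
      fun u : ℝ => 2 * ((max (1 - 1 / 2 * u) 0 : ℝ) : ℂ) - ((max (1 - u) 0 : ℝ) : ℂ) := by
    funext u
    rw [headWeight]
    have : max (2 - u) 0 = 2 * max (1 - 1 / 2 * u) 0 := by
      rw [mul_max_of_nonneg _ _ (by norm_num : (0 : ℝ) ≤ 2)]
      congr 1 <;> ring
    rw [this]
    push_cast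
    ring
  rw [e]
  exact h

/-- The kernel is that of `headWeight` with the opposite sign, now left of its pole at 0, in
accordance with the fact that the two weights add up to 1. -/
theorem hasMellin_tailWeight {s : ℂ} (hs : s.re < 0) (hs' : -1 < s.re) :
    HasMellin (fun u => (tailWeight u : ℂ)) s (-smoothKernel s) := by
  have h := (hasMellin_min_one hs hs').scale_two_sub
  rw [mul_neg, mul_one_div] at h
  have e : (fun u : ℝ => (tailWeight u : ℂ)) =
      fun u : ℝ => 2 * ((min (1 / 2 * u) 1 : ℝ) : ℂ) - ((min u 1 : ℝ) : ℂ) := by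
    funext u
    rw [tailWeight]
    have : min u 2 = 2 * min (1 / 2 * u) 1 := by
      rw [mul_min_of_nonneg _ _ (by norm_num : (0 : ℝ) ≤ 2)]
      congr 1 <;> ring
    rw [this]
    push_cast
    ring
  rw [e]
  exact h

theorem norm_smoothKernel_le {η : ℝ} (hη : 0 < η) (hη1 : η ≤ 1) {s : ℂ} (h0 : η ≤ |s.re|) (h1 : η ≤ |s.re + 1|)
    (h2 : s.re ≤ 2) : ‖smoothKernel s‖ ≤ 9 / η ^ 2 * (1 + s.im ^ 2)⁻¹ := by
  have hlow : ∀ z : ℂ, η ≤ |z.re| → η ^ 2 * (1 + z.im ^ 2) ≤ ‖z‖ ^ 2 := by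
    intro z hz
    rw [← normSq_eq_norm_sq, normSq_apply]
    have : η ^ 2 ≤ z.re ^ 2 := by
      rw [← sq_abs z.re]
      gcongr
    have h5 : η ^ 2 ≤ 1 := pow_le_one₀ hη.le hη1
    nlinarith [mul_nonneg (sub_nonneg.2 h5) (sq_nonneg z.im)]
  have h3 := hlow s h0
  have h4 := hlow (s + 1) (by simpa using h1)
  rw [add_im, one_im, add_zero] at h4
  have hden : η ^ 2 * (1 + s.im ^ 2) ≤ ‖s * (s + 1)‖ := by
    rw [norm_mul]
    refine le_of_sq_le_sq ?_ (by positivity)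
    calc (η ^ 2 * (1 + s.im ^ 2)) ^ 2 = (η ^ 2 * (1 + s.im ^ 2)) * (η ^ 2 * (1 + s.im ^ 2)) := by ring
      _ ≤ ‖s‖ ^ 2 * ‖s + 1‖ ^ 2 := by gcongr
      _ = _ := by ring
  have hnum : ‖2 * ((1 / 2 : ℝ) : ℂ) ^ (-s) - 1‖ ≤ 9 := by
    refine (norm_sub_le _ _).trans ?_
    rw [norm_mul, norm_cpow_eq_rpow_re_of_pos (by norm_num), norm_one, Complex.norm_ofNat]
    have : (1 / 2 : ℝ) ^ (-s).re ≤ 4 := by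
      calc (1 / 2 : ℝ) ^ (-s).re ≤ (1 / 2 : ℝ) ^ (-2 : ℝ) :=
            Real.rpow_le_rpow_of_exponent_ge (by norm_num) (by norm_num) (by simpa using h2)
        _ = 4 := by
            rw [Real.rpow_neg (by norm_num)]
            norm_num
    linarith
  have hpos : 0 < η ^ 2 * (1 + s.im ^ 2) := by positivity
  rw [smoothKernel, norm_div]
  calc ‖2 * ((1 / 2 : ℝ) : ℂ) ^ (-s) - 1‖ / ‖s * (s + 1)‖ ≤ 9 / (η ^ 2 * (1 + s.im ^ 2)) := by gcongr
    _ = _ := by rw [← div_div, div_eq_mul_inv]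

theorem differentiableAt_smoothKernel {s : ℂ} (h0 : s ≠ 0) (h1 : s + 1 ≠ 0) : DifferentiableAt ℂ smoothKernel s := by
  refine DifferentiableAt.div ?_ (by fun_prop) (mul_ne_zero h0 h1)
  have : ((1 / 2 : ℝ) : ℂ) ≠ 0 := by norm_num
  refine DifferentiableAt.sub (DifferentiableAt.const_mul ?_ _) (by fun_prop)
  exact DifferentiableAt.const_cpow (by fun_prop) (Or.inl this)

theorem integrable_smoothKernel {c η : ℝ} (hη : 0 < η) (hη1 : η ≤ 1) (h0 : η ≤ |c|) (h1 : η ≤ |c + 1|) (h2 : c ≤ 2) :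
    Integrable (fun t : ℝ => smoothKernel (c + t * I)) := by
  refine Integrable.mono' (g := fun t : ℝ => 9 / η ^ 2 * (1 + t ^ 2)⁻¹) (integrable_inv_one_add_sq.const_mul _) ?_ ?_
  · refine Continuous.aestronglyMeasurable ?_
    rw [continuous_iff_continuousAt]
    intro t
    have hd : DifferentiableAt ℂ smoothKernel (c + t * I) := differentiableAt_smoothKernel (by
      intro h
      have := congrArg Complex.re h
      simp at this
      rw [this, abs_zero] at h0
      linarith) (by
      intro h
      have := congrArg Complex.re h
      simp at this
      rw [this, abs_zero] at h1
      linarith)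
    exact ContinuousAt.comp (f := fun t : ℝ => (c + t * I : ℂ)) hd.continuousAt (by fun_prop)
  · refine ae_of_all _ fun t => ?_
    have := norm_smoothKernel_le hη hη1 (s := c + t * I) (by simpa using h0) (by simpa using h1) (by simpa using h2)
    simpa using this

theorem headWeight_eq_integral {c u : ℝ} (hc : 0 < c) (hc2 : c ≤ 2) (hu : 0 < u) :
    (headWeight u : ℂ) = (1 / (2 * Real.pi) : ℝ) • ∫ t : ℝ, (u : ℂ) ^ (-((c : ℂ) + t * I)) • smoothKernel (c + t * I) := by
  have hm : ∀ t : ℝ, mellin (fun u => (headWeight u : ℂ)) (c + t * I) = smoothKernel (c + t * I) := fun t =>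
    (hasMellin_headWeight (by simpa using hc)).2
  have h := mellinInv_mellin_eq c (fun u => (headWeight u : ℂ)) hu (hasMellin_headWeight (by simpa using hc)).1 (by
    rw [VerticalIntegrable]
    simp_rw [hm]
    exact integrable_smoothKernel (η := min c 1) (lt_min hc one_pos) (min_le_right _ _)
      ((min_le_left _ _).trans (le_abs_self _)) ((min_le_right _ _).trans (by
        rw [abs_of_pos (by linarith)]; linarith)) hc2) (by
    refine (continuous_ofReal.comp ?_).continuousAt
    unfold headWeight
    fun_prop)
  rw [mellinInv] at h
  simp_rw [hm] at h
  exact h.symm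

theorem tailWeight_eq_integral {c u : ℝ} (hc : c < 0) (hc1 : -1 < c) (hu : 0 < u) :
    (tailWeight u : ℂ) = (1 / (2 * Real.pi) : ℝ) • ∫ t : ℝ, (u : ℂ) ^ (-((c : ℂ) + t * I)) • (-smoothKernel (c + t * I)) := by
  have hm : ∀ t : ℝ, mellin (fun u => (tailWeight u : ℂ)) (c + t * I) = -smoothKernel (c + t * I) := fun t =>
    (hasMellin_tailWeight (by simpa using hc) (by simpa using hc1)).2
  have h := mellinInv_mellin_eq c (fun u => (tailWeight u : ℂ)) hu
    (hasMellin_tailWeight (by simpa using hc) (by simpa using hc1)).1 (by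
    rw [VerticalIntegrable]
    simp_rw [hm]
    refine (integrable_smoothKernel (η := min (-c) (c + 1)) (lt_min (by linarith) (by linarith))
      ((min_le_left _ _).trans (by linarith))
      ((min_le_left _ _).trans (neg_le_abs _)) ((min_le_right _ _).trans (le_abs_self _)) (by linarith)).neg) (by
    refine (continuous_ofReal.comp ?_).continuousAt
    unfold tailWeight
    fun_prop)
  rw [mellinInv] at h
  simp_rw [hm] at h
  exact h.symm

end

/-! ### Moving vertical lines of integration -/

section
open Set Complex MeasureTheory

/-- The majorant `(1 + t ^ 2) ^ (-3 / 4)`. -/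
noncomputable def decayWeight (t : ℝ) : ℝ := (1 + t ^ 2) ^ (-3 / 4 : ℝ)

theorem decayWeight_nonneg (t : ℝ) : 0 ≤ decayWeight t := by unfold decayWeight; positivity

theorem integrable_decayWeight : Integrable decayWeight := by
  have h := integrable_rpow_neg_one_add_norm_sq (E := ℝ) (μ := volume) (r := 3 / 2) (by simp; norm_num)
  refine h.congr (ae_of_all _ fun t => ?_)
  simp only [decayWeight, Real.norm_eq_abs, sq_abs]
  norm_num

theorem tendsto_decayWeight : Tendsto decayWeight atTop (nhds 0) := by
  have h1 : Tendsto (fun t : ℝ => 1 + t ^ 2) atTop atTop :=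
    tendsto_atTop_add_const_left _ _ (tendsto_pow_atTop two_ne_zero)
  have h := (tendsto_rpow_neg_atTop (by norm_num : (0 : ℝ) < 3 / 4)).comp h1
  refine h.congr fun t => ?_
  simp only [decayWeight, Function.comp]
  norm_num

/-- Zeta factors growing like a power of |t| up to 1/2, against a kernel with quadratic decay, still
leave an integrable majorant of order |t|^{-3/2}. -/
theorem rpow_mul_inv_one_add_sq_le {ε : ℝ} (hε : ε ≤ 1 / 2) (t : ℝ) :
    (|t| + 4) ^ ε * (1 + t ^ 2)⁻¹ ≤ 4 * decayWeight t := by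
  have h0 := abs_nonneg t
  have h1 : (|t| + 4) ^ ε ≤ (|t| + 4) ^ (1 / 2 : ℝ) := Real.rpow_le_rpow_of_exponent_le (by linarith) hε
  have h2 : |t| + 4 ≤ 16 * (1 + t ^ 2) ^ (1 / 2 : ℝ) := by
    rw [← Real.sqrt_eq_rpow]
    have h3 : 1 ≤ √(1 + t ^ 2) := Real.one_le_sqrt.2 (by nlinarith)
    have h4 : |t| ≤ √(1 + t ^ 2) := Real.abs_le_sqrt (by linarith)
    linarith
  have h5 : (|t| + 4) ^ (1 / 2 : ℝ) ≤ 4 * (1 + t ^ 2) ^ (1 / 4 : ℝ) := by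
    calc (|t| + 4) ^ (1 / 2 : ℝ) ≤ (16 * (1 + t ^ 2) ^ (1 / 2 : ℝ)) ^ (1 / 2 : ℝ) := by gcongr
      _ = 4 * (1 + t ^ 2) ^ (1 / 4 : ℝ) := by
          rw [Real.mul_rpow (by norm_num) (by positivity), ← Real.rpow_mul (by positivity)]
          congr 1
          · rw [show (16 : ℝ) = 4 ^ (2 : ℝ) by norm_num, ← Real.rpow_mul (by norm_num)]
            norm_num
          · norm_num
  calc (|t| + 4) ^ ε * (1 + t ^ 2)⁻¹ ≤ 4 * (1 + t ^ 2) ^ (1 / 4 : ℝ) * (1 + t ^ 2)⁻¹ := by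
        gcongr
        exact h1.trans h5
    _ = 4 * decayWeight t := by
        rw [decayWeight, ← Real.rpow_neg_one, mul_assoc, ← Real.rpow_add (by positivity)]
        norm_num

theorem continuous_vertical {F : ℂ → ℂ} {c : ℝ} (hd : ∀ s : ℂ, s.re = c → DifferentiableAt ℂ F s) :
    Continuous fun t : ℝ => F (c + t * I) := by
  rw [continuous_iff_continuousAt]
  intro t
  exact ContinuousAt.comp (f := fun t : ℝ => (c + t * I : ℂ)) (hd _ (by simp)).continuousAt (by fun_prop)

theorem integrable_vertical {F : ℂ → ℂ} {c C : ℝ} (hd : ∀ s : ℂ, s.re = c → DifferentiableAt ℂ F s)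
    (hF : ∀ s : ℂ, s.re = c → ‖F s‖ ≤ C * decayWeight s.im) : Integrable fun t : ℝ => F (c + t * I) :=
  Integrable.mono' (integrable_decayWeight.const_mul C) (continuous_vertical hd).aestronglyMeasurable
    (ae_of_all _ fun t => by simpa using hF (c + t * I) (by simp))

/-- Moving the line of integration. -/
theorem integral_vertical_eq {F : ℂ → ℂ} {a b C : ℝ} (hab : a ≤ b)
    (hd : ∀ s : ℂ, a ≤ s.re → s.re ≤ b → DifferentiableAt ℂ F s)
    (hF : ∀ s : ℂ, a ≤ s.re → s.re ≤ b → ‖F s‖ ≤ C * decayWeight s.im) :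
    ∫ t : ℝ, F (a + t * I) = ∫ t : ℝ, F (b + t * I) := by
  have hia := integrable_vertical (c := a) (fun s hs => hd s hs.ge (hs.le.trans hab)) (fun s hs => hF s hs.ge (hs.le.trans hab))
  have hib := integrable_vertical (c := b) (fun s hs => hd s (hab.trans hs.ge) hs.le) (fun s hs => hF s (hab.trans hs.ge) hs.le)
  have hta := intervalIntegral_tendsto_integral hia tendsto_neg_atTop_atBot tendsto_id
  have htb := intervalIntegral_tendsto_integral hib tendsto_neg_atTop_atBot tendsto_id
  have hrect : ∀ T : ℝ, (∫ x : ℝ in a..b, F (x + (-T : ℝ) * I)) - (∫ x : ℝ in a..b, F (x + T * I)) +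
      I • (∫ y : ℝ in (-T)..T, F (b + y * I)) - I • (∫ y : ℝ in (-T)..T, F (a + y * I)) = 0 := by
    intro T
    have h := integral_boundary_rect_eq_zero_of_differentiableOn F (a + (-T : ℝ) * I) (b + T * I) (by
      intro s hs
      rw [mem_reProdIm] at hs
      have h1 := hs.1
      simp only [add_re, ofReal_re, mul_re, I_re, mul_zero, ofReal_im, I_im, mul_one, sub_self, add_zero] at h1
      rw [uIcc_of_le hab] at h1
      exact (hd s h1.1 h1.2).differentiableWithinAt)
    simpa using h
  have hside : ∀ T : ℝ, ‖∫ x : ℝ in a..b, F (x + T * I)‖ ≤ C * decayWeight T * |b - a| := by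
    intro T
    refine intervalIntegral.norm_integral_le_of_norm_le_const fun x hx => ?_
    rw [uIoc_of_le hab] at hx
    have := hF (x + T * I) (by simpa using hx.1.le) (by simpa using hx.2)
    simpa using this
  have hdec : ∀ T, decayWeight (-T) = decayWeight T := fun T => by simp [decayWeight]
  have hz : Tendsto (fun T : ℝ => C * decayWeight T * |b - a|) atTop (nhds 0) := by
    have := (tendsto_decayWeight.const_mul C).mul_const |b - a|
    simpa using this
  have hs1 : Tendsto (fun T : ℝ => ∫ x : ℝ in a..b, F (x + T * I)) atTop (nhds 0) :=
    squeeze_zero_norm (fun T => hside T) hz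
  have hs2 : Tendsto (fun T : ℝ => ∫ x : ℝ in a..b, F (x + (-T : ℝ) * I)) atTop (nhds 0) :=
    squeeze_zero_norm (fun T => by have := hside (-T); rwa [hdec] at this) hz
  have hlim := ((hs2.sub hs1).add (htb.const_smul I)).sub (hta.const_smul I)
  have h0 : (0 : ℂ) - 0 + I • (∫ t : ℝ, F (b + t * I)) - I • ∫ t : ℝ, F (a + t * I) = 0 := by
    refine tendsto_nhds_unique hlim (tendsto_const_nhds.congr fun T => ?_)
    exact (hrect T).symm
  simp only [smul_eq_mul] at h0
  have : I * ((∫ t : ℝ, F (b + t * I)) - ∫ t : ℝ, F (a + t * I)) = 0 := by linear_combination h0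
  rcases mul_eq_zero.1 this with h | h
  · exact absurd h I_ne_zero
  · exact (sub_eq_zero.1 h).symm

theorem summable_norm_moebiusSq_mul_rpow {σ : ℝ} (hσ : 1 < σ) :
    Summable fun d : ℕ => ‖moebiusSq d‖ * (d : ℝ) ^ (-σ) := by
  obtain ⟨C, hC, h⟩ := exists_abs_realMoebiusSq_le (ε := (σ - 1) / 2) (by linarith)
  refine Summable.of_nonneg_of_le (fun d => by positivity) (fun d => ?_)
    ((Real.summable_nat_rpow (p := -σ + (σ - 1) / 2)).2 (by linarith) |>.mul_left C)
  rcases eq_or_ne d 0 with rfl | hd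
  · simp
    positivity
  · have hd0 : (0 : ℝ) < d := by exact_mod_cast Nat.pos_of_ne_zero hd
    rw [← abs_realMoebiusSq, Real.rpow_add hd0]
    calc |realMoebiusSq d| * (d : ℝ) ^ (-σ) ≤ C * (d : ℝ) ^ ((σ - 1) / 2) * (d : ℝ) ^ (-σ) := by
          gcongr
          exact h d
      _ = _ := by ring

theorem hasSum_moebiusSq_mul_cpow {s : ℂ} (hs : 1 < s.re) :
    HasSum (fun d : ℕ => moebiusSq d * (d : ℂ) ^ (-s)) (zetaInv s ^ 2) := by
  have hμ : LSeriesSummable (fun n => ((ArithmeticFunction.moebius : ArithmeticFunction ℤ) : ArithmeticFunction ℂ) n) s := by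
    simpa using ArithmeticFunction.LSeriesSummable_moebius_iff.2 hs
  have hs1 : s ≠ 1 := by
    intro h
    rw [h] at hs
    simp at hs
  have hs0 : s ≠ 0 := by
    intro h
    rw [h] at hs
    norm_num at hs
  have hLμ : LSeries (fun n => ((ArithmeticFunction.moebius : ArithmeticFunction ℤ) : ArithmeticFunction ℂ) n) s = zetaInv s := by
    rw [zetaInv_eq hs1]
    have h := LSeries_one_mul_Lseries_moebius hs
    rw [LSeries_one_eq_riemannZeta hs] at h
    refine (eq_inv_of_mul_eq_one_right ?_)
    simpa using h
  have h1 := ArithmeticFunction.LSeriesSummable_mul hμ hμ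
  have h2 := ArithmeticFunction.LSeries_mul' hμ hμ
  rw [← ArithmeticFunction.intCoe_mul] at h1 h2
  change LSeriesSummable (fun n => moebiusSq n) s at h1
  change LSeries (fun n => moebiusSq n) s = _ at h2
  rw [hLμ, ← sq] at h2
  have h3 : HasSum (LSeries.term (fun n => moebiusSq n) s) (zetaInv s ^ 2) := h2 ▸ h1.hasSum
  refine h3.congr_fun fun d => ?_
  rw [LSeries.term_of_ne_zero' hs0, cpow_neg, div_eq_mul_inv]

end

/-! ### Weighted sums of `μ * μ` under the Riemann hypothesis -/

section
open Set Complex MeasureTheory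

/-- Mellin inversion on Re s = c, where the Dirichlet series converges absolutely, writes the sum as
the integral of ζ(z + s)^{-2} y^s k(s). The hypotheses make this holomorphic between c' and c, with
ζ^{-2} of size |t|^ε; on the line c' the integral is of order y^{c'}. -/
theorem RiemannHypothesis.exists_norm_tsum_weight_le (hRH : RiemannHypothesis) {W : ℝ → ℝ} {k : ℂ → ℂ}
    {c c' A δ ε : ℝ} (hc : c' ≤ c) (hA : 0 ≤ A) (hδ : 0 < δ) (hδ1 : δ < 1) (hε : 0 < ε) (hε1 : ε ≤ 1 / 2)
    (hW : ∀ u : ℝ, 0 < u → (W u : ℂ) =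
      (1 / (2 * Real.pi) : ℝ) • ∫ t : ℝ, (u : ℂ) ^ (-((c : ℂ) + t * I)) • k (c + t * I))
    (hk : ∀ s : ℂ, c' ≤ s.re → s.re ≤ c → DifferentiableAt ℂ k s)
    (hkb : ∀ s : ℂ, c' ≤ s.re → s.re ≤ c → ‖k s‖ ≤ A * (1 + s.im ^ 2)⁻¹) :
    ∃ C : ℝ, 1 ≤ C ∧ ∀ y : ℝ, 0 < y → ∀ z : ℂ, 1 < z.re + c → 1 / 2 + δ ≤ z.re + c' →
      ‖∑' d : ℕ, moebiusSq d * (W (d / y) : ℂ) * (d : ℂ) ^ (-z)‖ ≤ C * y ^ c' * (|z.im| + 4) ^ ε := by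
  obtain ⟨C₁, hC₁, hzi⟩ := hRH.exists_norm_zetaInv_le hδ hδ1 (half_pos hε)
  set J := ∫ t, decayWeight t with hJ
  have hJ0 : 0 ≤ J := integral_nonneg decayWeight_nonneg
  refine ⟨C₁ ^ 2 * A * 4 * J + 1, le_add_of_nonneg_left (by positivity), fun y hy z hz hz' => ?_⟩
  have hy0 : (y : ℂ) ≠ 0 := by exact_mod_cast hy.ne'
  set F : ℂ → ℂ := fun s => zetaInv (z + s) ^ 2 * ((y : ℂ) ^ s * k s) with hF
  have hFd : ∀ s : ℂ, c' ≤ s.re → s.re ≤ c → DifferentiableAt ℂ F s := by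
    intro s hs hs'
    have h1 : DifferentiableAt ℂ zetaInv (z + s) := hRH.differentiableAt_zetaInv (by rw [add_re]; linarith)
    have h2 : DifferentiableAt ℂ (fun s => zetaInv (z + s)) s := h1.comp s (by fun_prop)
    have h3 : DifferentiableAt ℂ (fun s : ℂ => (y : ℂ) ^ s) s :=
      DifferentiableAt.const_cpow (by fun_prop) (Or.inl hy0)
    exact (h2.pow 2).mul (h3.mul (hk s hs hs'))
  have hFb : ∀ s : ℂ, c' ≤ s.re → s.re ≤ c →
      ‖F s‖ ≤ (C₁ ^ 2 * A * 4 * (|z.im| + 4) ^ ε) * y ^ s.re * decayWeight s.im := by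
    intro s hs hs'
    have h1 := hzi (z + s) (by rw [add_re]; linarith)
    have h2 : (|(z + s).im| + 4) ≤ (|z.im| + 4) * (|s.im| + 4) := by
      have := abs_add_le z.im s.im
      rw [add_im]
      nlinarith [abs_nonneg z.im, abs_nonneg s.im]
    have h3 : ‖zetaInv (z + s)‖ ^ 2 ≤ C₁ ^ 2 * ((|z.im| + 4) ^ ε * (|s.im| + 4) ^ ε) := by
      calc ‖zetaInv (z + s)‖ ^ 2 ≤ (C₁ * (|(z + s).im| + 4) ^ (ε / 2)) ^ 2 := by gcongr
        _ = C₁ ^ 2 * (|(z + s).im| + 4) ^ ε := by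
            rw [mul_pow, ← Real.rpow_natCast (_ ^ (ε / 2)), ← Real.rpow_mul (by positivity)]
            congr 2
            push_cast; ring
        _ ≤ C₁ ^ 2 * ((|z.im| + 4) * (|s.im| + 4)) ^ ε := by gcongr
        _ = _ := by rw [Real.mul_rpow (by positivity) (by positivity)]
    have h4 := rpow_mul_inv_one_add_sq_le hε1 s.im
    rw [hF]
    simp only
    rw [norm_mul, norm_mul, norm_pow, norm_cpow_eq_rpow_re_of_pos hy]
    calc ‖zetaInv (z + s)‖ ^ 2 * (y ^ s.re * ‖k s‖) ≤
        C₁ ^ 2 * ((|z.im| + 4) ^ ε * (|s.im| + 4) ^ ε) * (y ^ s.re * (A * (1 + s.im ^ 2)⁻¹)) := by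
          gcongr
          exact hkb s hs hs'
      _ = C₁ ^ 2 * A * (|z.im| + 4) ^ ε * y ^ s.re * ((|s.im| + 4) ^ ε * (1 + s.im ^ 2)⁻¹) := by ring
      _ ≤ C₁ ^ 2 * A * (|z.im| + 4) ^ ε * y ^ s.re * (4 * decayWeight s.im) := by gcongr
      _ = _ := by ring
  have hshift : ∫ t : ℝ, F (c' + t * I) = ∫ t : ℝ, F (c + t * I) := by
    refine integral_vertical_eq (C := (C₁ ^ 2 * A * 4 * (|z.im| + 4) ^ ε) * (y ^ c' + y ^ c)) hc hFd fun s hs hs' => ?_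
    refine (hFb s hs hs').trans ?_
    -- The sum covers both y ≥ 1 and y ≤ 1; it is only used to justify the shift and does not enter
    -- the final bound.
    have : y ^ s.re ≤ y ^ c' + y ^ c := by
      rcases le_total 1 y with h | h
      · have := Real.rpow_le_rpow_of_exponent_le h hs'
        have := Real.rpow_nonneg hy.le c'
        linarith
      · have := Real.rpow_le_rpow_of_exponent_ge hy h hs
        have := Real.rpow_nonneg hy.le c
        linarith
    have := decayWeight_nonneg s.im
    gcongr
  -- termwise integration on the line of real part `c`
  have hkint : Integrable fun t : ℝ => k (c + t * I) := by
    refine Integrable.mono' (integrable_inv_one_add_sq.const_mul A)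
      (continuous_vertical (fun s hs => hk s (by rw [hs]; exact hc) hs.le)).aestronglyMeasurable
      (ae_of_all _ fun t => ?_)
    have := hkb (c + t * I) (by simpa using hc) (by simp)
    simpa using this
  set f : ℕ → ℝ → ℂ := fun d t => moebiusSq d * (d : ℂ) ^ (-(z + (c + t * I))) * ((y : ℂ) ^ ((c : ℂ) + t * I) * k (c + t * I)) with hf
  have hfn : ∀ d t, ‖f d t‖ = ‖moebiusSq d‖ * (d : ℝ) ^ (-(z.re + c)) * (y ^ c * ‖k (c + t * I)‖) := by
    intro d t
    rw [hf]
    simp only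
    rw [norm_mul, norm_mul, norm_mul, norm_cpow_eq_rpow_re_of_pos hy]
    rcases Nat.eq_zero_or_pos d with rfl | hd
    · simp
    · rw [norm_natCast_cpow_of_pos hd]
      simp
  have hfi : ∀ d, Integrable (f d) := by
    intro d
    refine Integrable.mono' (hkint.norm.const_mul (‖moebiusSq d‖ * (d : ℝ) ^ (-(z.re + c)) * y ^ c)) ?_
      (ae_of_all _ fun t => (hfn d t).le.trans (le_of_eq (by ring)))
    have hkc := continuous_vertical (fun s hs => hk s (by rw [hs]; exact hc) hs.le)
    refine Continuous.aestronglyMeasurable ?_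
    rcases Nat.eq_zero_or_pos d with rfl | hd
    · have : f 0 = fun _ => 0 := by
        funext t
        simp [hf]
      rw [this]
      exact continuous_const
    · have hd0 : (d : ℂ) ≠ 0 := by exact_mod_cast hd.ne'
      have h1 : Continuous fun t : ℝ => (d : ℂ) ^ (-(z + (c + t * I))) :=
        Continuous.const_cpow (by fun_prop) (Or.inl hd0)
      have h2 : Continuous fun t : ℝ => (y : ℂ) ^ ((c : ℂ) + t * I) :=
        Continuous.const_cpow (by fun_prop) (Or.inl hy0)
      exact (h1.const_mul _).mul (h2.mul hkc)
  have hsum : Summable fun d => ∫ t, ‖f d t‖ := by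
    simp_rw [hfn, integral_const_mul]
    exact (summable_norm_moebiusSq_mul_rpow hz).mul_right _
  have hmain := hasSum_integral_of_summable_integral_norm hfi hsum
  have htsum : ∀ t : ℝ, ∑' d, f d t = F (c + t * I) := by
    intro t
    have h := hasSum_moebiusSq_mul_cpow (s := z + (c + t * I)) (by simpa using hz)
    exact (h.mul_right _).tsum_eq
  simp_rw [htsum] at hmain
  have hterm : ∀ d : ℕ, (1 / (2 * Real.pi) : ℝ) • ∫ t, f d t = moebiusSq d * (W (d / y) : ℂ) * (d : ℂ) ^ (-z) := by
    intro d
    rcases Nat.eq_zero_or_pos d with rfl | hd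
    · simp [hf]
    · have hdr : (0 : ℝ) < d := by exact_mod_cast hd
      have hd0 : (d : ℂ) ≠ 0 := by exact_mod_cast hd.ne'
      rw [hW (d / y) (by positivity)]
      have e : ∀ t : ℝ, f d t = moebiusSq d * (d : ℂ) ^ (-z) *
          (((d / y : ℝ) : ℂ) ^ (-((c : ℂ) + t * I)) • k (c + t * I)) := by
        intro t
        have e1 : ((d / y : ℝ) : ℂ) ^ (-((c : ℂ) + t * I)) = (d : ℂ) ^ (-((c : ℂ) + t * I)) * (y : ℂ) ^ ((c : ℂ) + t * I) := by
          rw [div_eq_mul_inv, ofReal_mul, mul_cpow_ofReal_nonneg hdr.le (by positivity), ofReal_natCast]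
          congr 1
          rw [ofReal_inv, inv_cpow _ _ (by rw [arg_ofReal_of_nonneg hy.le]; exact Real.pi_pos.ne), cpow_neg, inv_inv]
        rw [hf, e1, smul_eq_mul]
        simp only
        rw [neg_add, cpow_add _ _ hd0]
        ring
      simp_rw [e]
      rw [integral_const_mul, real_smul, real_smul]
      ring
  have hfin : ∑' d : ℕ, moebiusSq d * (W (d / y) : ℂ) * (d : ℂ) ^ (-z) =
      (1 / (2 * Real.pi) : ℝ) • ∫ t : ℝ, F (c' + t * I) := by
    rw [hshift, ← (hmain.const_smul (1 / (2 * Real.pi) : ℝ)).tsum_eq]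
    exact tsum_congr fun d => (hterm d).symm
  rw [hfin, norm_smul, Real.norm_eq_abs, abs_of_pos (by positivity)]
  have hb : ‖∫ t : ℝ, F (c' + t * I)‖ ≤ (C₁ ^ 2 * A * 4 * (|z.im| + 4) ^ ε) * y ^ c' * J := by
    rw [hJ, ← integral_const_mul]
    refine norm_integral_le_of_norm_le (integrable_decayWeight.const_mul _) (ae_of_all _ fun t => ?_)
    have := hFb (c' + t * I) (by simp) (by simpa using hc)
    simpa using this
  have hpi : 1 / (2 * Real.pi) ≤ 1 := by
    rw [div_le_one (by positivity)]
    linarith [Real.pi_gt_three]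
  calc 1 / (2 * Real.pi) * ‖∫ t : ℝ, F (c' + t * I)‖ ≤ 1 * ((C₁ ^ 2 * A * 4 * (|z.im| + 4) ^ ε) * y ^ c' * J) := by gcongr
    _ ≤ (C₁ ^ 2 * A * 4 * (|z.im| + 4) ^ ε) * y ^ c' * J + y ^ c' * (|z.im| + 4) ^ ε := by
        rw [one_mul]
        exact le_add_of_nonneg_right (by positivity)
    _ = _ := by ring

/-- The line moves from -η to -1/2 + η, inside the strip -1 < Re s < 0, so the poles of the kernel
are not met. With Re z = 1 + 2η the argument of ζ starts at real part 1 + η and stops at 1/2 + 3η.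
-/
theorem RiemannHypothesis.exists_norm_tsum_tailWeight_le (hRH : RiemannHypothesis) {η ε : ℝ} (hη : 0 < η) (hη1 : η < 1 / 4)
    (hε : 0 < ε) (hε1 : ε ≤ 1 / 2) : ∃ C : ℝ, 1 ≤ C ∧ ∀ y : ℝ, 0 < y → ∀ z : ℂ, z.re = 1 + 2 * η →
      ‖∑' d : ℕ, moebiusSq d * (tailWeight (d / y) : ℂ) * (d : ℂ) ^ (-z)‖ ≤ C * y ^ (-1 / 2 + η) * (|z.im| + 4) ^ ε := by
  have hne : ∀ s : ℂ, -1 / 2 + η ≤ s.re → s.re ≤ -η → η ≤ |s.re| ∧ η ≤ |s.re + 1| := fun s h1 h2 =>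
    ⟨by rw [abs_of_neg (by linarith)]; linarith, by rw [abs_of_pos (by linarith)]; linarith⟩
  obtain ⟨C, hC, h⟩ := hRH.exists_norm_tsum_weight_le (W := tailWeight) (k := fun s => -smoothKernel s) (c := -η)
    (c' := -1 / 2 + η) (A := 9 / η ^ 2) (δ := η) (ε := ε) (by linarith) (by positivity) hη (by linarith) hε hε1
    (fun u hu => tailWeight_eq_integral (by linarith) (by linarith) hu)
    (fun s h1 h2 => (differentiableAt_smoothKernel (fun h => by
      have := (hne s h1 h2).1
      rw [h, zero_re, abs_zero] at this
      linarith) (fun h => by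
      have := (hne s h1 h2).2
      have h' := congrArg Complex.re h
      rw [add_re, one_re, zero_re] at h'
      rw [h', abs_zero] at this
      linarith)).neg)
    (fun s h1 h2 => by
      rw [norm_neg]
      exact norm_smoothKernel_le hη (by linarith) (hne s h1 h2).1 (hne s h1 h2).2 (by linarith))
  exact ⟨C, hC, fun y hy z hz => h y hy z (by linarith) (by linarith)⟩

/-- Here z = 0, and the line moves from 2 to 1/2 + η, to the right of all poles of the kernel. -/
theorem RiemannHypothesis.exists_abs_tsum_headWeight_le (hRH : RiemannHypothesis) {η : ℝ} (hη : 0 < η) (hη1 : η < 1 / 4) :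
    ∃ C : ℝ, 1 ≤ C ∧ ∀ y : ℝ, 0 < y →
      |∑' d : ℕ, realMoebiusSq d * headWeight (d / y)| ≤ C * y ^ (1 / 2 + η) := by
  have hne : ∀ s : ℂ, 1 / 2 + η ≤ s.re → s.re ≤ 2 → η ≤ |s.re| ∧ η ≤ |s.re + 1| := fun s h1 h2 =>
    ⟨by rw [abs_of_pos (by linarith)]; linarith, by rw [abs_of_pos (by linarith)]; linarith⟩
  obtain ⟨C, hC, h⟩ := hRH.exists_norm_tsum_weight_le (W := headWeight) (k := smoothKernel) (c := 2)
    (c' := 1 / 2 + η) (A := 9 / η ^ 2) (δ := η) (ε := 1 / 2) (by linarith) (by positivity) hη (by linarith)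
    (by norm_num) le_rfl
    (fun u hu => headWeight_eq_integral (by norm_num) le_rfl hu)
    (fun s h1 h2 => differentiableAt_smoothKernel (fun h => by
      have := (hne s h1 h2).1
      rw [h, zero_re, abs_zero] at this
      linarith) (fun h => by
      have := (hne s h1 h2).2
      have h' := congrArg Complex.re h
      rw [add_re, one_re, zero_re] at h'
      rw [h', abs_zero] at this
      linarith))
    (fun s h1 h2 => norm_smoothKernel_le hη (by linarith) (hne s h1 h2).1 (hne s h1 h2).2 h2)
  refine ⟨C * 4 ^ (1 / 2 : ℝ), ?_, fun y hy => ?_⟩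
  · exact one_le_mul_of_one_le_of_one_le hC (Real.one_le_rpow (by norm_num) (by norm_num))
  · have h1 := h y hy 0 (by norm_num) (by simp)
    have e : ∑' d : ℕ, moebiusSq d * (headWeight (d / y) : ℂ) * (d : ℂ) ^ (-(0 : ℂ)) =
        ((∑' d : ℕ, realMoebiusSq d * headWeight (d / y) : ℝ) : ℂ) := by
      rw [ofReal_tsum]
      refine tsum_congr fun d => ?_
      rw [neg_zero, cpow_zero, mul_one, moebiusSq_eq_ofReal]
      push_cast
      rfl
    rw [e, norm_real, Real.norm_eq_abs, zero_im, abs_zero, zero_add] at h1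
    linarith

end

/-! ### `floorPrim` as an inverse Mellin integral, and short averages of powers -/

section
open Set Complex MeasureTheory

theorem one_add_im_sq_le_norm_sq {a : ℝ} (ha : 0 < a) (ha1 : a ≤ 1) {z : ℂ} (hz : a ≤ z.re) :
    a * (1 + z.im ^ 2) ^ (1 / 2 : ℝ) ≤ ‖z‖ := by
  rw [← Real.sqrt_eq_rpow]
  refine le_of_sq_le_sq ?_ (norm_nonneg z)
  rw [mul_pow, Real.sq_sqrt (by positivity), ← normSq_eq_norm_sq, normSq_apply]
  have h1 : a ^ 2 ≤ z.re ^ 2 := by gcongr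
  have h2 : a ^ 2 ≤ 1 := pow_le_one₀ ha.le ha1
  nlinarith [mul_nonneg (sub_nonneg.2 h2) (sq_nonneg z.im)]

theorem abs_add_four_le (t : ℝ) : |t| + 4 ≤ 16 * (1 + t ^ 2) ^ (1 / 2 : ℝ) := by
  rw [← Real.sqrt_eq_rpow]
  have h3 : 1 ≤ √(1 + t ^ 2) := Real.one_le_sqrt.2 (by nlinarith)
  have h4 : |t| ≤ √(1 + t ^ 2) := Real.abs_le_sqrt (by linarith)
  linarith

/-- Inversion of `mellin_floorPrim`. The denominator s (s + 1), against ζ(s) = O(|t|^{1/2}), makes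
the integral absolutely convergent. -/
theorem RiemannHypothesis.floorPrim_eq_integral (hRH : RiemannHypothesis) {σ : ℝ} (h1 : 1 / 2 < σ) (h2 : σ ≤ 3 / 4)
    {u : ℝ} (hu : 0 < u) :
    Integrable (fun t : ℝ =>
      (u : ℂ) ^ ((σ : ℂ) + t * I + 1) * (riemannZeta (σ + t * I) / ((σ + t * I) * (σ + t * I + 1)))) ∧
    (floorPrim u : ℂ) = (1 / (2 * Real.pi) : ℝ) •
      ∫ t : ℝ, (u : ℂ) ^ ((σ : ℂ) + t * I + 1) * (riemannZeta (σ + t * I) / ((σ + t * I) * (σ + t * I + 1))) := by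
  obtain ⟨C, hC, hζ⟩ := hRH.exists_norm_riemannZeta_le (δ := σ - 1 / 2) (ε := 1 / 2) (by linarith) (by linarith) (by norm_num)
  set G : ℂ → ℂ := fun s => riemannZeta s / (s * (s + 1)) with hG
  have hGd : ∀ s : ℂ, s.re = σ → DifferentiableAt ℂ G s := by
    intro s hs
    have hs1 : s ≠ 1 := by
      intro h
      rw [h, one_re] at hs
      linarith
    have hs0 : s ≠ 0 := by
      intro h
      rw [h, zero_re] at hs
      linarith
    have hs2 : s + 1 ≠ 0 := by
      intro h
      have := congrArg Complex.re h
      rw [add_re, one_re, zero_re] at this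
      linarith
    exact (differentiableAt_riemannZeta hs1).div (by fun_prop) (mul_ne_zero hs0 hs2)
  have hGb : ∀ s : ℂ, s.re = σ → ‖G s‖ ≤ 8 * C * decayWeight s.im := by
    intro s hs
    have e1 := one_add_im_sq_le_norm_sq (a := 1 / 2) (z := s) (by norm_num) (by norm_num) (by linarith)
    have e2 := one_add_im_sq_le_norm_sq (a := 1) (z := s + 1) (by norm_num) (by norm_num) (by rw [add_re, one_re]; linarith)
    rw [add_im, one_im, add_zero, one_mul] at e2
    have e3 := hζ s (by linarith) (by linarith)
    have e4 := rpow_mul_inv_one_add_sq_le le_rfl s.im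
    have e5 : 1 / 2 * (1 + s.im ^ 2) ≤ ‖s * (s + 1)‖ := by
      rw [norm_mul]
      calc 1 / 2 * (1 + s.im ^ 2) = 1 / 2 * (1 + s.im ^ 2) ^ (1 / 2 : ℝ) * (1 + s.im ^ 2) ^ (1 / 2 : ℝ) := by
            rw [mul_assoc, ← Real.rpow_add (by positivity)]
            norm_num
        _ ≤ _ := by gcongr
    rw [hG]
    simp only
    rw [norm_div]
    calc ‖riemannZeta s‖ / ‖s * (s + 1)‖ ≤ C * (|s.im| + 4) ^ (1 / 2 : ℝ) / (1 / 2 * (1 + s.im ^ 2)) := by gcongr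
      _ = 2 * C * ((|s.im| + 4) ^ (1 / 2 : ℝ) * (1 + s.im ^ 2)⁻¹) := by field_simp
      _ ≤ 2 * C * (4 * decayWeight s.im) := by gcongr
      _ = _ := by ring
  have hm : ∀ t : ℝ, mellin (fun u => (floorPrim u : ℂ)) ((-σ - 1 : ℝ) + t * I) = G (σ + (-t : ℝ) * I) := by
    intro t
    have h := (mellin_floorPrim (s := σ + (-t : ℝ) * I) (by simp; linarith) (by simp; linarith)).2
    rw [hG]
    simp only
    rw [← h]
    congr 1
    push_cast; ring
  have hint : Integrable fun t : ℝ => G (σ + (-t : ℝ) * I) :=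
    (integrable_vertical (F := G) hGd hGb).comp_neg
  constructor
  · refine integrable_vertical (F := fun s => (u : ℂ) ^ (s + 1) * G s) (C := u ^ (σ + 1) * (8 * C)) (fun s hs => ?_)
      fun s hs => ?_
    · exact DifferentiableAt.mul (DifferentiableAt.const_cpow (by fun_prop)
        (Or.inl (by exact_mod_cast hu.ne'))) (hGd s hs)
    · rw [norm_mul, norm_cpow_eq_rpow_re_of_pos hu, add_re, one_re, hs, mul_assoc]
      gcongr
      exact hGb s hs
  have h := mellinInv_mellin_eq (-σ - 1) (fun u => (floorPrim u : ℂ)) hu (by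
    have := (mellin_floorPrim (s := (σ : ℂ)) (by simp; linarith) (by simp; linarith)).1
    push_cast
    exact this) (by
    rw [VerticalIntegrable]
    simp_rw [hm]
    exact hint) (continuous_ofReal.comp continuous_floorPrim).continuousAt
  rw [mellinInv] at h
  simp_rw [hm] at h
  rw [← h]
  congr 1
  -- The Mellin variable is -s - 1, so its imaginary part is opposite to that of s.
  rw [← integral_neg_eq_self (fun t : ℝ => (u : ℂ) ^ ((σ : ℂ) + t * I + 1) * (riemannZeta (σ + t * I) / ((σ + t * I) * (σ + t * I + 1))))]
  refine integral_congr_ae (ae_of_all _ fun t => ?_)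
  simp only [hG, smul_eq_mul]
  congr 2
  push_cast; ring

/-- The quantity is the mean of v^s over [x, x + h]. The mean value inequality bounds it by (x +
h)^{Re s}; estimating the two powers separately gains a factor of order (x + h)/(h |s + 1|).
Interpolation with weight κ keeps a small power of |t| in the denominator at the price of a small
power of (x + h)/h. -/
theorem norm_cpow_average_le {x h κ : ℝ} (hx : 0 < x) (hh : 0 < h) (hκ : 0 ≤ κ) (hκ1 : κ ≤ 1) {s : ℂ} (hs : 0 ≤ s.re) :
    ‖(((x + h : ℝ) : ℂ) ^ (s + 1) / (s + 1) - (x : ℂ) ^ (s + 1) / (s + 1)) / h‖ ≤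
      (x + h) ^ s.re * (2 * (x + h) / h) ^ κ * (1 + s.im ^ 2) ^ (-κ / 2) := by
  have hX : 0 < x + h := by linarith
  have hs1 : s ≠ -1 := by
    intro h
    rw [h] at hs
    norm_num at hs
  have hs2 : s + 1 ≠ 0 := fun h => hs1 (by linear_combination h)
  have hn : 0 < ‖s + 1‖ := norm_pos_iff.2 hs2
  have hl := one_add_im_sq_le_norm_sq (a := 1) (z := s + 1) (by norm_num) (by norm_num) (by rw [add_re, one_re]; linarith)
  rw [add_im, one_im, add_zero, one_mul] at hl
  have hhn : ‖(h : ℂ)‖ = h := by rw [norm_real, Real.norm_eq_abs, abs_of_pos hh]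
  set A := ((x + h : ℝ) : ℂ) ^ (s + 1) / (s + 1) - (x : ℂ) ^ (s + 1) / (s + 1) with hA
  have h1 : ‖A / h‖ ≤ (x + h) ^ s.re := by
    rw [norm_div, hhn, div_le_iff₀ hh]
    have := Convex.norm_image_sub_le_of_norm_hasDerivWithin_le (f := fun v : ℝ => (v : ℂ) ^ (s + 1) / (s + 1))
      (f' := fun v : ℝ => (v : ℂ) ^ s) (s := Icc x (x + h)) (C := (x + h) ^ s.re) (x := x) (y := x + h)
      (fun v hv => by
        have hv0 : v ≠ 0 := (hx.trans_le hv.1).ne'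
        exact (hasDerivAt_ofReal_cpow_const' hv0 hs1).hasDerivWithinAt)
      (fun v hv => by
        have hv0 : 0 < v := hx.trans_le hv.1
        rw [norm_cpow_eq_rpow_re_of_pos hv0]
        exact Real.rpow_le_rpow hv0.le hv.2 hs) (convex_Icc _ _) (by constructor <;> linarith) (by constructor <;> linarith)
    rw [add_sub_cancel_left, Real.norm_eq_abs, abs_of_pos hh] at this
    exact this
  have h2 : ‖A / h‖ ≤ (x + h) ^ s.re * (2 * (x + h) / (h * ‖s + 1‖)) := by
    have e1 : ‖A‖ ≤ 2 * (x + h) ^ (s.re + 1) / ‖s + 1‖ := by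
      rw [hA, ← sub_div, norm_div]
      gcongr
      refine (norm_sub_le _ _).trans ?_
      rw [norm_cpow_eq_rpow_re_of_pos hX, norm_cpow_eq_rpow_re_of_pos hx, add_re, one_re, two_mul]
      gcongr
      linarith
    rw [norm_div, hhn, div_le_iff₀ hh]
    refine e1.trans (le_of_eq ?_)
    rw [Real.rpow_add hX, Real.rpow_one]
    field_simp
  set B := 2 * (x + h) / (h * ‖s + 1‖) with hB
  have hB0 : 0 < B := by positivity
  have h3 : ‖A / h‖ ≤ (x + h) ^ s.re * B ^ κ := by
    rcases le_total 1 B with hB1 | hB1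
    · exact h1.trans (le_mul_of_one_le_right (by positivity) (Real.one_le_rpow hB1 hκ))
    · refine h2.trans ?_
      gcongr
      calc B = B ^ (1 : ℝ) := (Real.rpow_one B).symm
        _ ≤ B ^ κ := Real.rpow_le_rpow_of_exponent_ge hB0 hB1 hκ1
  refine h3.trans ?_
  rw [mul_assoc]
  gcongr
  have e : B = 2 * (x + h) / h * ‖s + 1‖⁻¹ := by rw [hB]; field_simp
  rw [e, Real.mul_rpow (by positivity) (by positivity)]
  gcongr
  rw [Real.inv_rpow hn.le, neg_div, Real.rpow_neg (by positivity)]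
  gcongr
  calc (1 + s.im ^ 2) ^ (κ / 2) = ((1 + s.im ^ 2) ^ (1 / 2 : ℝ)) ^ κ := by
        rw [← Real.rpow_mul (by positivity)]; congr 1; ring
    _ ≤ _ := by gcongr

end

/-! ### The large `d`, averaged over a short interval -/

section
open Set Complex MeasureTheory

/-- The factor multiplying the weight is the mean of ⌊v/d^2⌋ - v/d^2 over [x, x + h]. Inserting the
Mellin integral on Re s = 1/2 + η and summing over d first produces the weighted tail of ∑ (μ*μ)(d)
d^{-2s}, of order y^{-1/2+η}. Without the average one would have ζ(s)/s, which these bounds do not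
make absolutely integrable. -/
theorem RiemannHypothesis.exists_abs_tsum_average_le (hRH : RiemannHypothesis) {η ε : ℝ} (hη : 0 < η) (hη1 : η < 1 / 4)
    (hε : 0 < ε) (hε1 : ε ≤ 1 / 8) : ∃ C : ℝ, 1 ≤ C ∧ ∀ x h y : ℝ, 0 < x → 0 < h → 0 < y →
      |∑' d : ℕ, realMoebiusSq d * tailWeight (d / y) *
        ((d : ℝ) ^ 2 / h * (floorPrim ((x + h) / (d : ℝ) ^ 2) - floorPrim (x / (d : ℝ) ^ 2)))| ≤
      C * (x + h) ^ (1 / 2 + η) * (2 * (x + h) / h) ^ (4 * ε) * y ^ (-1 / 2 + η) := by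
  obtain ⟨C₁, hC₁, hζ⟩ := hRH.exists_norm_riemannZeta_le hη (by linarith) hε
  obtain ⟨C₂, hC₂, hS⟩ := hRH.exists_norm_tsum_tailWeight_le hη hη1 hε (by linarith)
  set j : ℝ → ℝ := fun t => (1 + t ^ 2) ^ (-(1 + 2 * ε) / 2) with hj
  have hjint : Integrable j := by
    have h := integrable_rpow_neg_one_add_norm_sq (E := ℝ) (μ := volume) (r := 1 + 2 * ε) (by simp; linarith)
    refine h.congr (ae_of_all _ fun t => ?_)
    simp only [hj, Real.norm_eq_abs, sq_abs]
  have hj0 : ∀ t, 0 ≤ j t := fun t => by simp only [hj]; positivity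
  set J := ∫ t, j t with hJ
  have hJ0 : 0 ≤ J := integral_nonneg hj0
  refine ⟨2 * C₁ * 16 ^ (2 * ε) * (C₂ * 2 ^ ε) * J + 1, le_add_of_nonneg_left (by positivity), ?_⟩
  intro x h y hx hh hy
  have hX : 0 < x + h := by linarith
  set σ : ℝ := 1 / 2 + η with hσ
  set P : ℝ := (x + h) ^ σ * (2 * (x + h) / h) ^ (4 * ε) with hP
  have hP0 : 0 ≤ P := by positivity
  set g : ℂ → ℂ := fun s => (((x + h : ℝ) : ℂ) ^ (s + 1) / (s + 1) - (x : ℂ) ^ (s + 1) / (s + 1)) / h * (riemannZeta s / s) with hg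
  have hgb : ∀ s : ℂ, s.re = σ → ‖g s‖ * (|s.im| + 4) ^ ε ≤ 2 * C₁ * 16 ^ (2 * ε) * P * j s.im := by
    intro s hs
    -- ζ and the sum over d each grow like |t|^ε; the saving |t|^{-4ε} outweighs them and leaves
    -- |t|^{-1-2ε}, the decay of `j`.
    have h1 := norm_cpow_average_le hx hh (κ := 4 * ε) (by linarith) (by linarith) (s := s) (by linarith)
    have h2 := hζ s (by linarith) (by linarith)
    have h3 := one_add_im_sq_le_norm_sq (a := 1 / 2) (z := s) (by norm_num) (by norm_num) (by linarith)
    have h4 := abs_add_four_le s.im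
    rw [hs, ← hP] at h1
    have h5 : ‖riemannZeta s / s‖ ≤ C₁ * (|s.im| + 4) ^ ε / (1 / 2 * (1 + s.im ^ 2) ^ (1 / 2 : ℝ)) := by
      rw [norm_div]
      gcongr
    have h6 : (|s.im| + 4) ^ (2 * ε) ≤ 16 ^ (2 * ε) * (1 + s.im ^ 2) ^ ε := by
      calc (|s.im| + 4) ^ (2 * ε) ≤ (16 * (1 + s.im ^ 2) ^ (1 / 2 : ℝ)) ^ (2 * ε) := by gcongr
        _ = _ := by
            rw [Real.mul_rpow (by norm_num) (by positivity), ← Real.rpow_mul (by positivity)]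
            congr 2; ring
    have h7 : j s.im = (1 + s.im ^ 2) ^ (-(4 * ε) / 2) * (1 + s.im ^ 2) ^ ε * ((1 + s.im ^ 2) ^ (1 / 2 : ℝ))⁻¹ := by
      rw [hj, ← Real.rpow_neg (by positivity), ← Real.rpow_add (by positivity), ← Real.rpow_add (by positivity)]
      simp only
      congr 1; ring
    have h8 : (|s.im| + 4) ^ (2 * ε) = (|s.im| + 4) ^ ε * (|s.im| + 4) ^ ε := by
      rw [← Real.rpow_add (by positivity)]; congr 1; ring
    rw [hg]
    simp only
    rw [norm_mul]
    calc _ ≤ P * (1 + s.im ^ 2) ^ (-(4 * ε) / 2) * (C₁ * (|s.im| + 4) ^ ε / (1 / 2 * (1 + s.im ^ 2) ^ (1 / 2 : ℝ))) *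
          (|s.im| + 4) ^ ε := by gcongr
      _ = 2 * C₁ * P * ((1 + s.im ^ 2) ^ (-(4 * ε) / 2) * ((1 + s.im ^ 2) ^ (1 / 2 : ℝ))⁻¹) * (|s.im| + 4) ^ (2 * ε) := by
          rw [h8]; field_simp
      _ ≤ 2 * C₁ * P * ((1 + s.im ^ 2) ^ (-(4 * ε) / 2) * ((1 + s.im ^ 2) ^ (1 / 2 : ℝ))⁻¹) *
          (16 ^ (2 * ε) * (1 + s.im ^ 2) ^ ε) := by gcongr
      _ = _ := by rw [h7]; ring
  have hgd : ∀ s : ℂ, s.re = σ → DifferentiableAt ℂ g s := by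
    intro s hs
    have hs1 : s ≠ 1 := by
      intro h
      rw [h, one_re] at hs
      linarith
    have hs0 : s ≠ 0 := by
      intro h
      rw [h, zero_re] at hs
      linarith
    have hs2 : s + 1 ≠ 0 := by
      intro h
      have := congrArg Complex.re h
      rw [add_re, one_re, zero_re] at this
      linarith
    have hp : ∀ v : ℝ, 0 < v → DifferentiableAt ℂ (fun s : ℂ => (v : ℂ) ^ (s + 1) / (s + 1)) s := fun v hv =>
      DifferentiableAt.div (DifferentiableAt.const_cpow (by fun_prop) (Or.inl (by exact_mod_cast hv.ne')))
        (by fun_prop) hs2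
    exact (((hp _ hX).sub (hp _ hx)).div_const _).mul ((differentiableAt_riemannZeta hs1).div (by fun_prop) hs0)
  have hgc : Continuous fun t : ℝ => g (σ + t * I) := continuous_vertical hgd
  have hgi : Integrable fun t : ℝ => g (σ + t * I) := by
    refine Integrable.mono' (hjint.const_mul (2 * C₁ * 16 ^ (2 * ε) * P)) hgc.aestronglyMeasurable (ae_of_all _ fun t => ?_)
    have h1 := hgb (σ + t * I) (by simp)
    have h2 : (σ + t * I : ℂ).im = t := by simp
    rw [h2] at h1
    refine le_trans (le_mul_of_one_le_right (norm_nonneg _) (Real.one_le_rpow ?_ hε.le)) h1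
    linarith [abs_nonneg t]
  set f : ℕ → ℝ → ℂ := fun d t => moebiusSq d * (tailWeight (d / y) : ℂ) * (d : ℂ) ^ (-(2 * (σ + t * I) : ℂ)) * g (σ + t * I) with hf
  have hfn : ∀ d t, ‖f d t‖ ≤ ‖moebiusSq d‖ * (d : ℝ) ^ (-(2 * σ)) * ‖g (σ + t * I)‖ := by
    intro d t
    simp only [hf]
    rw [norm_mul, norm_mul, norm_mul, norm_real, Real.norm_eq_abs, abs_of_nonneg tailWeight_mem.1]
    rcases Nat.eq_zero_or_pos d with rfl | hd
    · simp
    · rw [norm_natCast_cpow_of_pos hd]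
      have : (-(2 * (σ + t * I) : ℂ)).re = -(2 * σ) := by simp
      rw [this]
      calc _ ≤ ‖moebiusSq d‖ * 1 * (d : ℝ) ^ (-(2 * σ)) * ‖g (σ + t * I)‖ := by
            gcongr
            exact tailWeight_mem.2
        _ = _ := by rw [mul_one]
  have hfi : ∀ d, Integrable (f d) := by
    intro d
    refine Integrable.mono' (hgi.norm.const_mul (‖moebiusSq d‖ * (d : ℝ) ^ (-(2 * σ)))) ?_ (ae_of_all _ fun t => hfn d t)
    refine Continuous.aestronglyMeasurable ?_
    rcases Nat.eq_zero_or_pos d with rfl | hd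
    · have : f 0 = fun _ => 0 := by
        funext t
        simp [hf]
      rw [this]
      exact continuous_const
    · have hd0 : (d : ℂ) ≠ 0 := by exact_mod_cast hd.ne'
      have h1 : Continuous fun t : ℝ => (d : ℂ) ^ (-(2 * (σ + t * I) : ℂ)) :=
        Continuous.const_cpow (by fun_prop) (Or.inl hd0)
      exact (h1.const_mul _).mul hgc
  have hsum : Summable fun d => ∫ t, ‖f d t‖ := by
    refine Summable.of_nonneg_of_le (fun d => integral_nonneg fun t => norm_nonneg _) (fun d => ?_)
      ((summable_norm_moebiusSq_mul_rpow (σ := 2 * σ) (by linarith)).mul_right (∫ t : ℝ, ‖g (σ + t * I)‖))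
    rw [← integral_const_mul]
    exact integral_mono (hfi d).norm (hgi.norm.const_mul _) (hfn d)
  have hmain := hasSum_integral_of_summable_integral_norm hfi hsum
  have hterm : ∀ d : ℕ, (1 / (2 * Real.pi) : ℝ) • ∫ t, f d t = ((realMoebiusSq d * tailWeight (d / y) *
        ((d : ℝ) ^ 2 / h * (floorPrim ((x + h) / (d : ℝ) ^ 2) - floorPrim (x / (d : ℝ) ^ 2))) : ℝ) : ℂ) := by
    intro d
    rcases Nat.eq_zero_or_pos d with rfl | hd
    · simp [hf]
    · have hdr : (0 : ℝ) < d := by exact_mod_cast hd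
      have hd0 : (d : ℂ) ≠ 0 := by exact_mod_cast hd.ne'
      obtain ⟨i1, e1⟩ := hRH.floorPrim_eq_integral (σ := σ) (by linarith) (by linarith) (u := (x + h) / (d : ℝ) ^ 2) (by positivity)
      obtain ⟨i2, e2⟩ := hRH.floorPrim_eq_integral (σ := σ) (by linarith) (by linarith) (u := x / (d : ℝ) ^ 2) (by positivity)
      have hpow : ∀ v : ℝ, 0 < v → ∀ s : ℂ, ((v / (d : ℝ) ^ 2 : ℝ) : ℂ) ^ (s + 1) =
          (v : ℂ) ^ (s + 1) * ((d : ℂ) ^ (-(2 * s)) * ((d : ℂ) ^ 2)⁻¹) := by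
        intro v hv s
        rw [div_eq_mul_inv, ofReal_mul, mul_cpow_ofReal_nonneg hv.le (by positivity)]
        congr 1
        rw [ofReal_inv, inv_cpow _ _ (by rw [arg_ofReal_of_nonneg (by positivity)]; exact Real.pi_pos.ne), sq, ofReal_mul,
          mul_cpow_ofReal_nonneg hdr.le hdr.le, ofReal_natCast, cpow_add _ _ hd0, cpow_one, cpow_neg,
          two_mul, cpow_add _ _ hd0, mul_inv, mul_inv, mul_inv]
        ring
      have e3 : ∀ t : ℝ, f d t = moebiusSq d * (tailWeight (d / y) : ℂ) * ((d : ℂ) ^ 2 / h) *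
          ((((x + h) / (d : ℝ) ^ 2 : ℝ) : ℂ) ^ ((σ : ℂ) + t * I + 1) * (riemannZeta (σ + t * I) / ((σ + t * I) * (σ + t * I + 1))) -
          ((x / (d : ℝ) ^ 2 : ℝ) : ℂ) ^ ((σ : ℂ) + t * I + 1) * (riemannZeta (σ + t * I) / ((σ + t * I) * (σ + t * I + 1)))) := by
        intro t
        rw [hpow _ hX, hpow _ hx]
        simp only [hf, hg]
        field_simp
      simp_rw [e3]
      rw [integral_const_mul, integral_sub i1 i2]
      have e4 : (((d : ℝ) ^ 2 / h : ℝ) : ℂ) = (d : ℂ) ^ 2 / h := by push_cast; rfl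
      rw [ofReal_mul, ofReal_mul, ofReal_mul, ofReal_sub, e1, e2, e4, ← moebiusSq_eq_ofReal]
      simp only [real_smul]
      ring
  have htsum : ∀ t : ℝ, ‖∑' d, f d t‖ ≤ (C₂ * 2 ^ ε) * y ^ (-1 / 2 + η) * (‖g (σ + t * I)‖ * (|t| + 4) ^ ε) := by
    intro t
    have h1 := hS y hy (2 * (σ + t * I)) (by simp [hσ]; ring)
    have him : (2 * (σ + t * I) : ℂ).im = 2 * t := by simp
    rw [him] at h1
    have h2 : (|2 * t| + 4) ^ ε ≤ 2 ^ ε * (|t| + 4) ^ ε := by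
      rw [← Real.mul_rpow (by norm_num) (by positivity), abs_mul, abs_two]
      gcongr
      linarith
    simp only [hf]
    rw [tsum_mul_right, norm_mul]
    calc _ ≤ C₂ * y ^ (-1 / 2 + η) * (2 ^ ε * (|t| + 4) ^ ε) * ‖g (σ + t * I)‖ := by
          gcongr
          exact h1.trans (by gcongr)
      _ = _ := by ring
  have hfin : ((∑' d : ℕ, realMoebiusSq d * tailWeight (d / y) *
        ((d : ℝ) ^ 2 / h * (floorPrim ((x + h) / (d : ℝ) ^ 2) - floorPrim (x / (d : ℝ) ^ 2))) : ℝ) : ℂ) =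
      (1 / (2 * Real.pi) : ℝ) • ∫ t : ℝ, ∑' d, f d t := by
    rw [ofReal_tsum, ← (hmain.const_smul (1 / (2 * Real.pi) : ℝ)).tsum_eq]
    exact tsum_congr fun d => (hterm d).symm
  rw [← Real.norm_eq_abs, ← norm_real, hfin, norm_smul, Real.norm_eq_abs, abs_of_pos (by positivity)]
  have hb : ‖∫ t : ℝ, ∑' d, f d t‖ ≤ (2 * C₁ * 16 ^ (2 * ε) * (C₂ * 2 ^ ε)) * P * y ^ (-1 / 2 + η) * J := by
    rw [hJ, ← integral_const_mul]
    refine norm_integral_le_of_norm_le (hjint.const_mul _) (ae_of_all _ fun t => ?_)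
    have h1 := hgb (σ + t * I) (by simp)
    have h2 : (σ + t * I : ℂ).im = t := by simp
    rw [h2] at h1
    calc _ ≤ _ := htsum t
      _ ≤ (C₂ * 2 ^ ε) * y ^ (-1 / 2 + η) * (2 * C₁ * 16 ^ (2 * ε) * P * j t) := by gcongr
      _ = _ := by ring
  have hpi : 1 / (2 * Real.pi) ≤ 1 := by
    rw [div_le_one (by positivity)]
    linarith [Real.pi_gt_three]
  calc 1 / (2 * Real.pi) * ‖∫ t : ℝ, ∑' d, f d t‖ ≤
        1 * ((2 * C₁ * 16 ^ (2 * ε) * (C₂ * 2 ^ ε)) * P * y ^ (-1 / 2 + η) * J) := by gcongr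
    _ ≤ (2 * C₁ * 16 ^ (2 * ε) * (C₂ * 2 ^ ε)) * P * y ^ (-1 / 2 + η) * J + P * y ^ (-1 / 2 + η) := by
        rw [one_mul]
        exact le_add_of_nonneg_right (by positivity)
    _ = _ := by rw [hP]; ring

end

/-! ### The mean value of `∑_{d ^ 2 ∣ n} (μ * μ)(d)` -/

/-- The primitive departs from its linear part because of the integers in (u, u + k], each
contributing at most k, and of the term k^2/2. This serves to undo the average over [x, x + h]. -/
theorem abs_floorPrim_add_sub_le {u k : ℝ} (hu : 0 ≤ u) (hk : 0 ≤ k) :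
    |floorPrim (u + k) - floorPrim u - k * ((⌊u⌋₊ : ℝ) - u)| ≤ k * (((⌊u + k⌋₊ - ⌊u⌋₊ : ℕ) : ℝ) + k / 2) := by
  have hle : ⌊u⌋₊ ≤ ⌊u + k⌋₊ := Nat.floor_mono (by linarith)
  have hI : ∀ N : ℕ, Finset.Icc 1 N = Finset.Ioc 0 N := fun N => rfl
  have e : floorPrim (u + k) - floorPrim u - k * ((⌊u⌋₊ : ℝ) - u) =
      ∑ n ∈ Finset.Ioc ⌊u⌋₊ ⌊u + k⌋₊, (u + k - n) - k ^ 2 / 2 := by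
    rw [floorPrim, floorPrim, hI, hI, ← Finset.sum_Ioc_consecutive _ (Nat.zero_le _) hle]
    have : ∑ n ∈ Finset.Ioc 0 ⌊u⌋₊, (u + k - n) = ∑ n ∈ Finset.Ioc 0 ⌊u⌋₊, (u - n) + ⌊u⌋₊ * k := by
      have : (⌊u⌋₊ : ℝ) * k = ∑ n ∈ Finset.Ioc 0 ⌊u⌋₊, k := by simp
      rw [this, ← Finset.sum_add_distrib]
      exact Finset.sum_congr rfl fun n _ => by ring
    rw [this]
    ring
  have h1 : 0 ≤ ∑ n ∈ Finset.Ioc ⌊u⌋₊ ⌊u + k⌋₊, (u + k - n) := Finset.sum_nonneg fun n hn => by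
    have := (Nat.le_floor_iff (by linarith)).1 (Finset.mem_Ioc.1 hn).2
    linarith
  have h2 : ∑ n ∈ Finset.Ioc ⌊u⌋₊ ⌊u + k⌋₊, (u + k - n) ≤ ((⌊u + k⌋₊ - ⌊u⌋₊ : ℕ) : ℝ) * k := by
    calc ∑ n ∈ Finset.Ioc ⌊u⌋₊ ⌊u + k⌋₊, (u + k - n) ≤ ∑ n ∈ Finset.Ioc ⌊u⌋₊ ⌊u + k⌋₊, k :=
          Finset.sum_le_sum fun n hn => by
            have := (Nat.floor_lt hu).1 (Finset.mem_Ioc.1 hn).1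
            linarith
      _ = _ := by rw [Finset.sum_const, Nat.card_Ioc, nsmul_eq_mul]
  rw [e, abs_le]
  constructor <;> nlinarith [Nat.cast_nonneg (α := ℝ) (⌊u + k⌋₊ - ⌊u⌋₊)]

/-- Abel summation against a nonnegative and nonincreasing weight. -/
theorem abs_sum_mul_le_of_antitone {a g : ℕ → ℝ} {T : ℝ} (hg : Antitone g) (hg0 : ∀ i, 0 ≤ g i) {n : ℕ}
    (h : ∀ k ≤ n, |∑ i ∈ Finset.range k, a i| ≤ T) : |∑ i ∈ Finset.range n, a i * g i| ≤ T * g 0 := by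
  have key : ∀ m : ℕ, ∑ i ∈ Finset.range m, a i * g i = g m * ∑ i ∈ Finset.range m, a i +
      ∑ i ∈ Finset.range m, (g i - g (i + 1)) * ∑ j ∈ Finset.range (i + 1), a j := by
    intro m
    induction m with
    | zero => simp
    | succ m ih =>
      rw [Finset.sum_range_succ, ih, Finset.sum_range_succ (fun i => (g i - g (i + 1)) * _), Finset.sum_range_succ a]
      ring
  have htel : ∑ i ∈ Finset.range n, (g i - g (i + 1)) = g 0 - g n := Finset.sum_range_sub' g n
  rw [key]
  refine (abs_add_le _ _).trans ?_
  calc _ ≤ g n * T + ∑ i ∈ Finset.range n, (g i - g (i + 1)) * T := by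
        refine add_le_add ?_ ((Finset.abs_sum_le_sum_abs _ _).trans (Finset.sum_le_sum fun i hi => ?_))
        · rw [abs_mul, abs_of_nonneg (hg0 n)]
          exact mul_le_mul_of_nonneg_left (h n le_rfl) (hg0 n)
        · have h0 : 0 ≤ g i - g (i + 1) := sub_nonneg.2 (hg (Nat.le_succ i))
          rw [abs_mul, abs_of_nonneg h0]
          exact mul_le_mul_of_nonneg_left (h _ (Finset.mem_range.1 hi)) h0
    _ = T * g 0 := by rw [← Finset.sum_mul, htel]; ring

theorem headWeight_antitone : Antitone headWeight := by
  intro a b hab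
  simp only [headWeight]
  rcases le_total a 1 with h1 | h1 <;> rcases le_total a 2 with h2 | h2 <;> rcases le_total b 1 with h3 | h3 <;>
    rcases le_total b 2 with h4 | h4 <;> simp only [max_def] <;> split_ifs <;> linarith

theorem headWeight_mem (u : ℝ) : 0 ≤ headWeight u ∧ headWeight u ≤ 1 := by
  have := headWeight_add_tailWeight u
  have := tailWeight_mem (u := u)
  constructor <;> linarith

theorem headWeight_eq_zero {u : ℝ} (hu : 2 ≤ u) : headWeight u = 0 := by
  rw [headWeight, max_eq_right (by linarith), max_eq_right (by linarith), sub_zero]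

theorem natFloor_sub_eq {u : ℝ} (hu : 0 ≤ u) : (⌊u⌋₊ : ℝ) - u = -(Int.fract u - 1 / 2) - 1 / 2 := by
  have : (⌊u⌋₊ : ℝ) = ((⌊u⌋ : ℤ) : ℝ) := by exact_mod_cast natCast_floor_eq_intCast_floor hu
  rw [this, Int.fract]
  ring

theorem summable_realMoebiusSq_div_sq : Summable fun d : ℕ => |realMoebiusSq d| / (d : ℝ) ^ 2 := by
  refine (summable_norm_moebiusSq_mul_rpow (σ := 2) (by norm_num)).congr fun d => ?_
  rw [abs_realMoebiusSq, Real.rpow_neg (Nat.cast_nonneg d), div_eq_mul_inv]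
  norm_num

theorem sum_Ioc_eq_range (f : ℕ → ℝ) (k : ℕ) : ∑ d ∈ Finset.Ioc 0 k, f d = ∑ i ∈ Finset.range k, f (i + 1) := by
  rw [show Finset.Ioc 0 k = Finset.Ico 1 (k + 1) from rfl, Finset.sum_Ico_eq_sum_range]
  simp [add_comm]

/-- The contribution of the small `d`. -/
theorem RiemannHypothesis.exists_abs_tsum_head_le (hRH : RiemannHypothesis) {ε : ℝ} (hε : 0 < ε) :
    ∃ C : ℝ, 1 ≤ C ∧ ∀ x : ℝ, 1 ≤ x →
      |∑' d : ℕ, realMoebiusSq d * headWeight (d / x ^ (8 / 22 : ℝ)) * ((⌊x / (d : ℝ) ^ 2⌋₊ : ℝ) - x / (d : ℝ) ^ 2)| ≤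
        C * x ^ (7 / 22 + ε) := by
  obtain ⟨C₁, hC₁, h₁⟩ := exists_abs_sum_sawtooth_le hε
  obtain ⟨C₂, hC₂, h₂⟩ := hRH.exists_abs_tsum_headWeight_le (η := 1 / 8) (by norm_num) (by norm_num)
  refine ⟨C₁ + C₂, by linarith, fun x hx => ?_⟩
  have hx0 : 0 < x := by linarith
  set y := x ^ (8 / 22 : ℝ) with hy
  have hy0 : 0 < y := by positivity
  have hsupp : ∀ (φ : ℕ → ℝ), ∑' d : ℕ, realMoebiusSq d * headWeight (d / y) * φ d =
      ∑ d ∈ Finset.Ioc 0 ⌊2 * y⌋₊, realMoebiusSq d * headWeight (d / y) * φ d := by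
    intro φ
    refine tsum_eq_sum fun d hd => ?_
    rcases Nat.eq_zero_or_pos d with rfl | hd0
    · simp
    · rw [Finset.mem_Ioc, not_and, not_le] at hd
      have h3 := (Nat.floor_lt (by positivity)).1 (hd hd0)
      rw [headWeight_eq_zero, mul_zero, zero_mul]
      rw [le_div_iff₀ hy0]
      exact h3.le
  -- The sawtooth part goes to the exponential sums, the weight being removed by Abel summation; the
  -- constant -1/2 leaves a weighted sum of μ*μ, controlled by the Riemann hypothesis.
  have hsplit : ∑' d : ℕ, realMoebiusSq d * headWeight (d / y) * ((⌊x / (d : ℝ) ^ 2⌋₊ : ℝ) - x / (d : ℝ) ^ 2) =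
      -(∑ d ∈ Finset.Ioc 0 ⌊2 * y⌋₊, realMoebiusSq d * (Int.fract (x / (d : ℝ) ^ 2) - 1 / 2) * headWeight (d / y)) -
        1 / 2 * ∑' d : ℕ, realMoebiusSq d * headWeight (d / y) := by
    have h3 := hsupp fun _ => 1
    simp only [mul_one] at h3
    rw [hsupp, h3, Finset.mul_sum, ← Finset.sum_neg_distrib, ← Finset.sum_sub_distrib]
    refine Finset.sum_congr rfl fun d _ => ?_
    rw [natFloor_sub_eq (by positivity)]
    ring
  have hA : |∑ d ∈ Finset.Ioc 0 ⌊2 * y⌋₊, realMoebiusSq d * (Int.fract (x / (d : ℝ) ^ 2) - 1 / 2) * headWeight (d / y)| ≤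
      C₁ * x ^ (7 / 22 + ε) := by
    rw [sum_Ioc_eq_range]
    have h3 := abs_sum_mul_le_of_antitone (n := ⌊2 * y⌋₊) (T := C₁ * x ^ (7 / 22 + ε))
      (a := fun i => realMoebiusSq (i + 1) * (Int.fract (x / ((i + 1 : ℕ) : ℝ) ^ 2) - 1 / 2))
      (g := fun i => headWeight ((i + 1 : ℕ) / y))
      (fun i j hij => headWeight_antitone (by gcongr)) (fun i => (headWeight_mem _).1) (fun k hk => by
        rw [← sum_Ioc_eq_range (fun d => realMoebiusSq d * (Int.fract (x / (d : ℝ) ^ 2) - 1 / 2))]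
        have h4 := h₁ x k hx ((Nat.le_floor_iff (by positivity)).1 hk)
        rwa [Nat.floor_natCast] at h4)
    refine h3.trans ?_
    exact mul_le_of_le_one_right (by positivity) (headWeight_mem _).2
  -- With η = 1/8 this is y^{5/8} = x^{5/22}, with room to spare.
  have hB : |∑' d : ℕ, realMoebiusSq d * headWeight (d / y)| ≤ C₂ * x ^ (7 / 22 + ε) := by
    refine (h₂ y hy0).trans ?_
    rw [hy, ← Real.rpow_mul hx0.le]
    gcongr
    linarith
  rw [hsplit]
  refine (abs_sub _ _).trans ?_
  rw [abs_neg, abs_mul, abs_of_pos (by norm_num : (0 : ℝ) < 1 / 2)]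
  have : 0 ≤ |∑' d : ℕ, realMoebiusSq d * headWeight (d / y)| := abs_nonneg _
  linarith

/-- Divisibility by squares in short intervals. -/
theorem exists_sum_abs_realMoebiusSq_mul_floor_sub_le {ε : ℝ} (hε : 0 < ε) : ∃ C : ℝ, 1 ≤ C ∧ ∀ x h : ℝ,
    1 ≤ x → 1 ≤ h → h ≤ x →
    Summable (fun d : ℕ => |realMoebiusSq d| * ((⌊(x + h) / (d : ℝ) ^ 2⌋₊ - ⌊x / (d : ℝ) ^ 2⌋₊ : ℕ) : ℝ)) ∧
    ∑' d : ℕ, |realMoebiusSq d| * ((⌊(x + h) / (d : ℝ) ^ 2⌋₊ - ⌊x / (d : ℝ) ^ 2⌋₊ : ℕ) : ℝ) ≤ C * (h * x ^ ε) := by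
  obtain ⟨C₁, hC₁, h₁⟩ := exists_abs_realMoebiusSq_le (half_pos hε)
  obtain ⟨C₂, hC₂, h₂⟩ := exists_card_divisors_le_rpow (half_pos hε)
  refine ⟨C₁ * C₂ * 2 * 2 ^ ε, ?_, fun x h hx hh hhx => ?_⟩
  · have : (1 : ℝ) ≤ 2 ^ ε := Real.one_le_rpow (by norm_num) hε.le
    have h3 : (1 : ℝ) ≤ C₁ * C₂ := one_le_mul_of_one_le_of_one_le hC₁ hC₂
    nlinarith
  set X := x + h with hX
  have hX0 : 0 < X := by linarith
  set M := ⌊X⌋₊ with hM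
  -- The difference of integer parts counts the multiples of d^2 in (x, x + h]. After exchanging the
  -- sums, each of the O(h) integers n there has at most as many admissible d as divisors.
  have hdiff : ∀ d : ℕ, 0 < d → ⌊X / (d : ℝ) ^ 2⌋₊ - ⌊x / (d : ℝ) ^ 2⌋₊ =
      ((Finset.Ioc ⌊x⌋₊ ⌊X⌋₊).filter fun n => d ^ 2 ∣ n).card := by
    intro d hd
    have e : ∀ v : ℝ, ⌊v / (d : ℝ) ^ 2⌋₊ = ⌊v⌋₊ / d ^ 2 := by
      intro v
      rw [← Nat.floor_div_natCast]
      push_cast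
      rfl
    rw [e, e, ← Nat.Ioc_filter_dvd_card_eq_div, ← Nat.Ioc_filter_dvd_card_eq_div]
    have hd : Disjoint ((Finset.Ioc 0 ⌊x⌋₊).filter fun n => d ^ 2 ∣ n) ((Finset.Ioc ⌊x⌋₊ ⌊X⌋₊).filter fun n => d ^ 2 ∣ n) := by
      rw [Finset.disjoint_left]
      intro n h1 h2
      rw [Finset.mem_filter, Finset.mem_Ioc] at h1 h2
      omega
    have hun : (Finset.Ioc 0 ⌊X⌋₊).filter (fun n => d ^ 2 ∣ n) =
        ((Finset.Ioc 0 ⌊x⌋₊).filter fun n => d ^ 2 ∣ n) ∪ ((Finset.Ioc ⌊x⌋₊ ⌊X⌋₊).filter fun n => d ^ 2 ∣ n) := by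
      rw [← Finset.filter_union, Finset.Ioc_union_Ioc_eq_Ioc (Nat.zero_le _) (Nat.floor_mono (by linarith))]
    rw [hun, Finset.card_union_of_disjoint hd]
    omega
  have hzero : ∀ d ∉ Finset.Ioc 0 M, |realMoebiusSq d| * ((⌊X / (d : ℝ) ^ 2⌋₊ - ⌊x / (d : ℝ) ^ 2⌋₊ : ℕ) : ℝ) = 0 := by
    intro d hd
    rcases Nat.eq_zero_or_pos d with rfl | hd0
    · simp
    · rw [Finset.mem_Ioc, not_and, not_le] at hd
      have h3 := (Nat.floor_lt hX0.le).1 (hd hd0)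
      have hd1 : (1 : ℝ) ≤ d := by exact_mod_cast hd0
      have : ⌊X / (d : ℝ) ^ 2⌋₊ = 0 := by
        rw [Nat.floor_eq_zero, div_lt_one (by positivity)]
        nlinarith
      rw [this]
      simp
  refine ⟨summable_of_ne_finset_zero hzero, ?_⟩
  rw [tsum_eq_sum hzero]
  have hX2 : X ≤ 2 * x := by linarith
  have hMX : (M : ℝ) ≤ X := Nat.floor_le hX0.le
  calc ∑ d ∈ Finset.Ioc 0 M, |realMoebiusSq d| * ((⌊X / (d : ℝ) ^ 2⌋₊ - ⌊x / (d : ℝ) ^ 2⌋₊ : ℕ) : ℝ)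
      ≤ ∑ d ∈ Finset.Ioc 0 M, ∑ n ∈ Finset.Ioc ⌊x⌋₊ M, C₁ * X ^ (ε / 2) * (if d ^ 2 ∣ n then 1 else 0) := by
        refine Finset.sum_le_sum fun d hd => ?_
        rw [Finset.mem_Ioc] at hd
        rw [hdiff d hd.1, ← Finset.mul_sum, Finset.sum_boole]
        gcongr
        have : (d : ℝ) ≤ X := le_trans (by exact_mod_cast hd.2) hMX
        exact (h₁ d).trans (by gcongr)
    _ = ∑ n ∈ Finset.Ioc ⌊x⌋₊ M, ∑ d ∈ Finset.Ioc 0 M, C₁ * X ^ (ε / 2) * (if d ^ 2 ∣ n then 1 else 0) := Finset.sum_comm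
    _ ≤ ∑ n ∈ Finset.Ioc ⌊x⌋₊ M, C₁ * X ^ (ε / 2) * (C₂ * X ^ (ε / 2)) := by
        refine Finset.sum_le_sum fun n hn => ?_
        rw [Finset.mem_Ioc] at hn
        rw [← Finset.mul_sum, Finset.sum_boole]
        gcongr
        have hcard : ((Finset.Ioc 0 M).filter fun d => d ^ 2 ∣ n).card ≤ n.divisors.card := by
          refine Finset.card_le_card fun d hd => ?_
          rw [Finset.mem_filter] at hd
          rw [Nat.mem_divisors]
          exact ⟨(dvd_pow_self d two_ne_zero).trans hd.2, by omega⟩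
        have hnX : (n : ℝ) ≤ X := le_trans (by exact_mod_cast hn.2) hMX
        calc _ ≤ (n.divisors.card : ℝ) := by exact_mod_cast hcard
          _ ≤ C₂ * (n : ℝ) ^ (ε / 2) := h₂ n
          _ ≤ _ := by gcongr
    _ = ((M - ⌊x⌋₊ : ℕ) : ℝ) * (C₁ * C₂ * X ^ ε) := by
        rw [Finset.sum_const, Nat.card_Ioc, nsmul_eq_mul]
        have : X ^ ε = X ^ (ε / 2) * X ^ (ε / 2) := by rw [← Real.rpow_add hX0]; congr 1; ring
        rw [this]
        ring
    _ ≤ (2 * h) * (C₁ * C₂ * (2 * x) ^ ε) := by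
        gcongr
        rw [Nat.cast_sub (Nat.floor_mono (by linarith))]
        have := Nat.lt_floor_add_one x
        linarith
    _ = _ := by rw [Real.mul_rpow (by norm_num) (by linarith)]; ring

/-- The contribution of the large `d`. -/
theorem RiemannHypothesis.exists_abs_tsum_tail_le (hRH : RiemannHypothesis) {ε : ℝ} (hε : 0 < ε) (hε1 : ε ≤ 1) :
    ∃ C : ℝ, 1 ≤ C ∧ ∀ x : ℝ, 1 ≤ x →
      |∑' d : ℕ, realMoebiusSq d * tailWeight (d / x ^ (8 / 22 : ℝ)) * ((⌊x / (d : ℝ) ^ 2⌋₊ : ℝ) - x / (d : ℝ) ^ 2)| ≤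
        C * x ^ (7 / 22 + ε) := by
  obtain ⟨C₁, hC₁, h₁⟩ := hRH.exists_abs_tsum_average_le (η := ε / 8) (ε := ε / 8) (by linarith) (by linarith)
    (by linarith) (by linarith)
  obtain ⟨C₂, hC₂, h₂⟩ := exists_sum_abs_realMoebiusSq_mul_floor_sub_le hε
  set A := ∑' d : ℕ, |realMoebiusSq d| / (d : ℝ) ^ 2 with hA
  have hA0 : 0 ≤ A := tsum_nonneg fun d => by positivity
  refine ⟨8 * C₁ + C₂ + A, by linarith, fun x hx => ?_⟩
  have hx0 : 0 < x := by linarith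
  set y := x ^ (8 / 22 : ℝ) with hy
  have hy0 : 0 < y := by positivity
  -- Undoing the average costs O(h x^ε), so h may be as large as the error aimed at; the average
  -- itself depends on h only through a small power of x/h.
  set h := x ^ (7 / 22 : ℝ) with hh
  have hh1 : 1 ≤ h := Real.one_le_rpow hx (by norm_num)
  have hhx : h ≤ x := by
    calc h ≤ x ^ (1 : ℝ) := Real.rpow_le_rpow_of_exponent_le hx (by norm_num)
      _ = x := Real.rpow_one x
  have hh0 : 0 < h := by linarith
  obtain ⟨hN1, hN2⟩ := h₂ x h hx hh1 hhx
  set N : ℕ → ℝ := fun d => ((⌊(x + h) / (d : ℝ) ^ 2⌋₊ - ⌊x / (d : ℝ) ^ 2⌋₊ : ℕ) : ℝ) with hN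
  set Ψ : ℕ → ℝ := fun d => (⌊x / (d : ℝ) ^ 2⌋₊ : ℝ) - x / (d : ℝ) ^ 2 with hΨ
  set V : ℕ → ℝ := fun d => (d : ℝ) ^ 2 / h * (floorPrim ((x + h) / (d : ℝ) ^ 2) - floorPrim (x / (d : ℝ) ^ 2)) with hV
  have hdiff : ∀ d : ℕ, 0 < d → |V d - Ψ d| ≤ N d + h / (d : ℝ) ^ 2 := by
    intro d hd
    have hd0 : (0 : ℝ) < d := by exact_mod_cast hd
    have h3 := abs_floorPrim_add_sub_le (u := x / (d : ℝ) ^ 2) (k := h / (d : ℝ) ^ 2) (by positivity) (by positivity)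
    rw [← add_div] at h3
    have e : V d - Ψ d = (d : ℝ) ^ 2 / h * (floorPrim ((x + h) / (d : ℝ) ^ 2) - floorPrim (x / (d : ℝ) ^ 2) -
        h / (d : ℝ) ^ 2 * ((⌊x / (d : ℝ) ^ 2⌋₊ : ℝ) - x / (d : ℝ) ^ 2)) := by
      simp only [hV, hΨ]
      field_simp
    rw [e, abs_mul, abs_of_pos (by positivity)]
    calc _ ≤ (d : ℝ) ^ 2 / h * (h / (d : ℝ) ^ 2 * (N d + h / (d : ℝ) ^ 2 / 2)) := by gcongr
      _ = N d + h / (d : ℝ) ^ 2 / 2 := by field_simp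
      _ ≤ _ := by
          have : 0 ≤ h / (d : ℝ) ^ 2 := by positivity
          linarith
  have hterm : ∀ d : ℕ, |realMoebiusSq d * tailWeight (d / y) * (V d - Ψ d)| ≤
      |realMoebiusSq d| * N d + h * (|realMoebiusSq d| / (d : ℝ) ^ 2) := by
    intro d
    rcases Nat.eq_zero_or_pos d with rfl | hd
    · simp
    · rw [abs_mul, abs_mul, abs_of_nonneg tailWeight_mem.1]
      calc _ ≤ |realMoebiusSq d| * 1 * (N d + h / (d : ℝ) ^ 2) := by
            gcongr
            · exact tailWeight_mem.2
            · exact hdiff d hd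
        _ = _ := by ring
  have hsum1 : Summable fun d : ℕ => |realMoebiusSq d| * N d + h * (|realMoebiusSq d| / (d : ℝ) ^ 2) :=
    hN1.add (summable_realMoebiusSq_div_sq.mul_left h)
  have hsD : Summable fun d : ℕ => realMoebiusSq d * tailWeight (d / y) * (V d - Ψ d) :=
    Summable.of_norm_bounded hsum1 hterm
  have hsΨ : Summable fun d : ℕ => realMoebiusSq d * tailWeight (d / y) * Ψ d := by
    refine Summable.of_norm_bounded (summable_realMoebiusSq_div_sq.mul_left x) fun d => ?_
    rw [Real.norm_eq_abs, abs_mul, abs_mul, abs_of_nonneg tailWeight_mem.1]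
    have h3 : |Ψ d| ≤ x / (d : ℝ) ^ 2 := by
      have h4 := Nat.floor_le (a := x / (d : ℝ) ^ 2) (by positivity)
      rw [abs_le]
      simp only [hΨ]
      constructor
      · linarith [Nat.cast_nonneg (α := ℝ) ⌊x / (d : ℝ) ^ 2⌋₊]
      · have : 0 ≤ x / (d : ℝ) ^ 2 := by positivity
        linarith
    calc _ ≤ |realMoebiusSq d| * 1 * (x / (d : ℝ) ^ 2) := by
          gcongr
          exact tailWeight_mem.2
      _ = _ := by ring
  have hsV : Summable fun d : ℕ => realMoebiusSq d * tailWeight (d / y) * V d :=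
    (hsD.add hsΨ).congr fun d => by ring
  have hE : ∑' d : ℕ, realMoebiusSq d * tailWeight (d / y) * Ψ d =
      ∑' d : ℕ, realMoebiusSq d * tailWeight (d / y) * V d - ∑' d : ℕ, realMoebiusSq d * tailWeight (d / y) * (V d - Ψ d) := by
    rw [← hsV.tsum_sub hsD]
    exact tsum_congr fun d => by ring
  have hb1 : |∑' d : ℕ, realMoebiusSq d * tailWeight (d / y) * (V d - Ψ d)| ≤ (C₂ + A) * x ^ (7 / 22 + ε) := by
    have h3 : |∑' d : ℕ, realMoebiusSq d * tailWeight (d / y) * (V d - Ψ d)| ≤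
        ∑' d : ℕ, (|realMoebiusSq d| * N d + h * (|realMoebiusSq d| / (d : ℝ) ^ 2)) := by
      rw [← Real.norm_eq_abs]
      exact tsum_of_norm_bounded hsum1.hasSum hterm
    rw [hN1.tsum_add (summable_realMoebiusSq_div_sq.mul_left h), tsum_mul_left, ← hA] at h3
    have hxε : 1 ≤ x ^ ε := Real.one_le_rpow hx hε.le
    have e : x ^ (7 / 22 + ε) = h * x ^ ε := Real.rpow_add hx0 _ _
    rw [e]
    have h4 : h * A ≤ A * (h * x ^ ε) := by
      calc h * A = A * (h * 1) := by ring
        _ ≤ _ := by gcongr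
    linarith
  -- The exponent is 1/2 - (1/2)(8/22) = 7/22 up to ε: this fixes the cut y = x^{8/22}, the largest
  -- range that the exponential sums reach.
  have hb2 : |∑' d : ℕ, realMoebiusSq d * tailWeight (d / y) * V d| ≤ 8 * C₁ * x ^ (7 / 22 + ε) := by
    refine (h₁ x h y hx0 hh0 hy0).trans ?_
    have e1 : (x + h) ^ (1 / 2 + ε / 8) ≤ 2 * x ^ (1 / 2 + ε / 8) := by
      calc (x + h) ^ (1 / 2 + ε / 8) ≤ (2 * x) ^ (1 / 2 + ε / 8) := by gcongr; linarith
        _ = 2 ^ (1 / 2 + ε / 8) * x ^ (1 / 2 + ε / 8) := Real.mul_rpow (by norm_num) hx0.le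
        _ ≤ 2 ^ (1 : ℝ) * x ^ (1 / 2 + ε / 8) := by gcongr <;> linarith
        _ = _ := by rw [Real.rpow_one]
    have e2 : (2 * (x + h) / h) ^ (4 * (ε / 8)) ≤ 4 * x ^ (4 * (ε / 8)) := by
      have h5 : 2 * (x + h) / h ≤ 4 * x := by
        rw [div_le_iff₀ hh0]
        nlinarith
      calc (2 * (x + h) / h) ^ (4 * (ε / 8)) ≤ (4 * x) ^ (4 * (ε / 8)) := by gcongr
        _ = 4 ^ (4 * (ε / 8)) * x ^ (4 * (ε / 8)) := Real.mul_rpow (by norm_num) hx0.le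
        _ ≤ 4 ^ (1 : ℝ) * x ^ (4 * (ε / 8)) := by gcongr <;> linarith
        _ = _ := by rw [Real.rpow_one]
    calc _ ≤ C₁ * (2 * x ^ (1 / 2 + ε / 8)) * (4 * x ^ (4 * (ε / 8))) * y ^ (-1 / 2 + ε / 8) := by gcongr
      _ = 8 * C₁ * x ^ (1 / 2 + ε / 8 + 4 * (ε / 8) + 8 / 22 * (-1 / 2 + ε / 8)) := by
          rw [hy, ← Real.rpow_mul hx0.le, Real.rpow_add hx0 (1 / 2 + ε / 8 + 4 * (ε / 8)),
            Real.rpow_add hx0 (1 / 2 + ε / 8)]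
          ring
      _ ≤ _ := by
          refine mul_le_mul_of_nonneg_left (Real.rpow_le_rpow_of_exponent_le hx ?_) (by linarith)
          linarith
  rw [hE]
  refine (abs_sub _ _).trans ?_
  linarith

/-- The mean value of the function `n ↦ ∑_{d ^ 2 ∣ n} (μ * μ)(d)`, with an error term for all `x > 0`. -/
theorem RiemannHypothesis.exists_abs_sum_floor_sub_le (hRH : RiemannHypothesis) {ε : ℝ} (hε : 0 < ε) (hε1 : ε ≤ 1 / 2) :
    ∃ C : ℝ, 1 ≤ C ∧ ∀ x : ℝ, 0 < x →
      |∑' d : ℕ, realMoebiusSq d * (⌊x / (d : ℝ) ^ 2⌋₊ : ℝ) - (∑' d : ℕ, realMoebiusSq d / (d : ℝ) ^ 2) * x| ≤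
        C * x ^ (7 / 22 + ε) := by
  obtain ⟨C₁, hC₁, h₁⟩ := hRH.exists_abs_tsum_head_le hε
  obtain ⟨C₂, hC₂, h₂⟩ := hRH.exists_abs_tsum_tail_le hε (by linarith)
  set A := ∑' d : ℕ, realMoebiusSq d / (d : ℝ) ^ 2 with hA
  have hsA : Summable fun d : ℕ => realMoebiusSq d / (d : ℝ) ^ 2 :=
    Summable.of_norm_bounded summable_realMoebiusSq_div_sq fun d => by
      rw [norm_div, norm_pow, Real.norm_natCast, Real.norm_eq_abs]
  refine ⟨C₁ + C₂ + |A|, by linarith [abs_nonneg A], fun x hx0 => ?_⟩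
  have hbound : ∀ d : ℕ, |realMoebiusSq d * (⌊x / (d : ℝ) ^ 2⌋₊ : ℝ)| ≤ x * (|realMoebiusSq d| / (d : ℝ) ^ 2) := by
    intro d
    rw [abs_mul, Nat.abs_cast]
    calc _ ≤ |realMoebiusSq d| * (x / (d : ℝ) ^ 2) := by
          gcongr
          exact Nat.floor_le (by positivity)
      _ = _ := by ring
  have hsF : Summable fun d : ℕ => realMoebiusSq d * (⌊x / (d : ℝ) ^ 2⌋₊ : ℝ) :=
    Summable.of_norm_bounded (summable_realMoebiusSq_div_sq.mul_left x) hbound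
  have hs : Summable fun d : ℕ => realMoebiusSq d * ((⌊x / (d : ℝ) ^ 2⌋₊ : ℝ) - x / (d : ℝ) ^ 2) :=
    (hsF.sub (hsA.mul_right x)).congr fun d => by ring
  have hE : ∑' d : ℕ, realMoebiusSq d * (⌊x / (d : ℝ) ^ 2⌋₊ : ℝ) - A * x =
      ∑' d : ℕ, realMoebiusSq d * ((⌊x / (d : ℝ) ^ 2⌋₊ : ℝ) - x / (d : ℝ) ^ 2) := by
    rw [hA, ← tsum_mul_right, ← hsF.tsum_sub (hsA.mul_right x)]
    exact tsum_congr fun d => by ring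
  by_cases hx : 1 ≤ x
  · have hw : ∀ w : ℝ → ℝ, (∀ u, 0 ≤ w u ∧ w u ≤ 1) → Summable fun d : ℕ =>
        realMoebiusSq d * w (d / x ^ (8 / 22 : ℝ)) * ((⌊x / (d : ℝ) ^ 2⌋₊ : ℝ) - x / (d : ℝ) ^ 2) := by
      intro w hw
      refine Summable.of_norm_bounded hs.norm fun d => ?_
      rw [mul_right_comm, norm_mul, Real.norm_eq_abs (w _), abs_of_nonneg (hw _).1]
      exact mul_le_of_le_one_right (norm_nonneg _) (hw _).2
    have hsplit : ∑' d : ℕ, realMoebiusSq d * ((⌊x / (d : ℝ) ^ 2⌋₊ : ℝ) - x / (d : ℝ) ^ 2) =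
        ∑' d : ℕ, realMoebiusSq d * headWeight (d / x ^ (8 / 22 : ℝ)) * ((⌊x / (d : ℝ) ^ 2⌋₊ : ℝ) - x / (d : ℝ) ^ 2) +
        ∑' d : ℕ, realMoebiusSq d * tailWeight (d / x ^ (8 / 22 : ℝ)) * ((⌊x / (d : ℝ) ^ 2⌋₊ : ℝ) - x / (d : ℝ) ^ 2) := by
      rw [← (hw headWeight headWeight_mem).tsum_add (hw tailWeight fun u => tailWeight_mem)]
      refine tsum_congr fun d => ?_
      rw [← add_mul, ← mul_add, headWeight_add_tailWeight, mul_one]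
    rw [hE, hsplit]
    have := abs_add_le (∑' d : ℕ, realMoebiusSq d * headWeight (d / x ^ (8 / 22 : ℝ)) * ((⌊x / (d : ℝ) ^ 2⌋₊ : ℝ) - x / (d : ℝ) ^ 2))
      (∑' d : ℕ, realMoebiusSq d * tailWeight (d / x ^ (8 / 22 : ℝ)) * ((⌊x / (d : ℝ) ^ 2⌋₊ : ℝ) - x / (d : ℝ) ^ 2))
    have h3 := h₁ x hx
    have h4 := h₂ x hx
    have h5 : 0 ≤ |A| * x ^ (7 / 22 + ε) := by positivity
    linarith
  -- For x < 1 the sum is empty, and x ≤ x^{7/22+ε} since ε ≤ 1/2 keeps the exponent below 1. Small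
  -- x is included because the bound will be summed over x/m for all m.
  · push Not at hx
    have hz : ∑' d : ℕ, realMoebiusSq d * (⌊x / (d : ℝ) ^ 2⌋₊ : ℝ) = 0 := by
      rw [← tsum_zero]
      refine tsum_congr fun d => ?_
      rcases Nat.eq_zero_or_pos d with rfl | hd
      · simp
      · have hd1 : (1 : ℝ) ≤ d := by exact_mod_cast hd
        rw [Nat.floor_eq_zero.2, Nat.cast_zero, mul_zero]
        rw [div_lt_one (by positivity)]
        nlinarith
    rw [hz, zero_sub, abs_neg, abs_mul, abs_of_pos hx0]
    have h3 : x ≤ x ^ (7 / 22 + ε) := by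
      calc x = x ^ (1 : ℝ) := (Real.rpow_one x).symm
        _ ≤ _ := Real.rpow_le_rpow_of_exponent_ge hx0 hx.le (by linarith)
    calc |A| * x ≤ |A| * x ^ (7 / 22 + ε) := by gcongr
      _ ≤ _ := by
          gcongr
          linarith

/-! ### Multiplicative functions depending only on the exponents -/

/-- The multiplicative arithmetic function whose value at every `p ^ k` with `k > 0` is the coefficient of index `k`
of a given power series. -/
noncomputable def ofEulerFactor (f : PowerSeries ℝ) : ArithmeticFunction ℝ :=
  ⟨fun n => if n = 0 then 0 else n.factorization.prod fun _ k => f.coeff k, if_pos rfl⟩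

theorem ofEulerFactor_apply (f : PowerSeries ℝ) {n : ℕ} (hn : n ≠ 0) :
    ofEulerFactor f n = n.factorization.prod fun _ k => f.coeff k :=
  if_neg hn

theorem isMultiplicative_ofEulerFactor (f : PowerSeries ℝ) : (ofEulerFactor f).IsMultiplicative := by
  rw [ArithmeticFunction.IsMultiplicative.iff_ne_zero]
  refine ⟨by simp [ofEulerFactor_apply f one_ne_zero], fun {m n} hm hn hmn => ?_⟩
  rw [ofEulerFactor_apply f hm, ofEulerFactor_apply f hn, ofEulerFactor_apply f (mul_ne_zero hm hn),
    Nat.factorization_mul_of_coprime hmn, Finsupp.prod_add_index_of_disjoint]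
  exact hmn.disjoint_primeFactors

theorem ofEulerFactor_prime_pow {f : PowerSeries ℝ} (hf : f.coeff 0 = 1) {p : ℕ} (hp : p.Prime) (k : ℕ) :
    ofEulerFactor f (p ^ k) = f.coeff k := by
  rw [ofEulerFactor_apply f (pow_ne_zero _ hp.ne_zero), hp.factorization_pow, Finsupp.prod_single_index hf]

/-- On powers of a prime, Dirichlet convolution is the Cauchy product. Factorizations of Dirichlet
series thus become identities between power series. -/
theorem ofEulerFactor_mul {f g : PowerSeries ℝ} (hf : f.coeff 0 = 1) (hg : g.coeff 0 = 1) :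
    ofEulerFactor (f * g) = ofEulerFactor f * ofEulerFactor g := by
  have hfg : (f * g).coeff 0 = 1 := by
    simp only [PowerSeries.coeff_mul, Finset.Nat.antidiagonal_zero, Finset.sum_singleton, hf, hg, one_mul]
  rw [ArithmeticFunction.IsMultiplicative.eq_iff_eq_on_prime_powers _ (isMultiplicative_ofEulerFactor _) _
    ((isMultiplicative_ofEulerFactor f).mul (isMultiplicative_ofEulerFactor g))]
  intro p k hp
  rw [ofEulerFactor_prime_pow hfg hp, PowerSeries.coeff_mul, Finset.Nat.sum_antidiagonal_eq_sum_range_succ_mk,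
    ArithmeticFunction.mul_apply,
    Nat.sum_divisorsAntidiagonal (fun a b => ofEulerFactor f a * ofEulerFactor g b), Nat.sum_divisors_prime_pow hp]
  refine Finset.sum_congr rfl fun i hi => ?_
  have hik : i ≤ k := Nat.lt_succ_iff.1 (Finset.mem_range.1 hi)
  rw [Nat.pow_div hik hp.pos, ofEulerFactor_prime_pow hf hp, ofEulerFactor_prime_pow hg hp]

theorem ofEulerFactor_eq_of_prime_pow {f : PowerSeries ℝ} (hf : f.coeff 0 = 1) {F : ArithmeticFunction ℝ}
    (hF : F.IsMultiplicative) (h : ∀ p k : ℕ, p.Prime → F (p ^ k) = f.coeff k) : ofEulerFactor f = F := by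
  rw [ArithmeticFunction.IsMultiplicative.eq_iff_eq_on_prime_powers _ (isMultiplicative_ofEulerFactor _) _ hF]
  intro p k hp
  rw [ofEulerFactor_prime_pow hf hp, h p k hp]

theorem summable_abs_coeff_mul_pow {f : PowerSeries ℝ} {K : ℝ} (hK : ∀ k : ℕ, |f.coeff k| ≤ K * ((k : ℝ) + 1) ^ 2)
    {q : ℝ} (hq0 : 0 ≤ q) (hq1 : q < 1) : Summable fun k : ℕ => |f.coeff k| * q ^ k := by
  have h1 : Summable fun k : ℕ => K * (((k : ℝ) + 1) ^ 2 * q ^ k) := by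
    have hq : ‖q‖ < 1 := by rwa [Real.norm_of_nonneg hq0]
    have h2 := summable_pow_mul_geometric_of_norm_lt_one 2 hq
    have h3 := summable_pow_mul_geometric_of_norm_lt_one 1 hq
    have h4 := summable_pow_mul_geometric_of_norm_lt_one 0 hq
    refine (((h2.add (h3.mul_left 2)).add h4).mul_left K).congr fun k => ?_
    ring
  refine Summable.of_nonneg_of_le (fun k => by positivity) (fun k => ?_) h1
  rw [← mul_assoc]
  gcongr
  exact hK k

/-- After the constant term the series starts at q^r, which is factored out; W is the value of the
remaining series at the largest q allowed. -/
theorem exists_tsum_abs_coeff_mul_pow_le {f : PowerSeries ℝ} (hf : f.coeff 0 = 1) {r : ℕ} (hr : 1 ≤ r)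
    (hfr : ∀ k, 0 < k → k < r → f.coeff k = 0) {K : ℝ} (hK : ∀ k : ℕ, |f.coeff k| ≤ K * ((k : ℝ) + 1) ^ 2)
    {ρ : ℝ} (hρ0 : 0 < ρ) (hρ1 : ρ < 1) :
    ∃ W : ℝ, 0 ≤ W ∧ ∀ q : ℝ, 0 ≤ q → q ≤ ρ → ∑' k : ℕ, |f.coeff k| * q ^ k ≤ 1 + W * q ^ r := by
  have hWs : Summable fun k : ℕ => |f.coeff (k + r)| * ρ ^ k := by
    refine (((summable_nat_add_iff r).2 (summable_abs_coeff_mul_pow hK hρ0.le hρ1)).mul_right ((ρ ^ r)⁻¹)).congr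
      fun k => ?_
    rw [pow_add]
    field_simp
  refine ⟨∑' k : ℕ, |f.coeff (k + r)| * ρ ^ k, tsum_nonneg fun k => by positivity, fun q hq0 hqρ => ?_⟩
  have hs := summable_abs_coeff_mul_pow hK hq0 (hqρ.trans_lt hρ1)
  have hhead : ∑ k ∈ Finset.range r, |f.coeff k| * q ^ k = 1 := by
    rw [Finset.sum_eq_single 0]
    · rw [hf]
      simp
    · intro k hk hk0
      rw [hfr k (Nat.pos_of_ne_zero hk0) (Finset.mem_range.1 hk)]
      simp
    · intro h
      exact absurd (Finset.mem_range.2 hr) h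
  rw [← hs.sum_add_tsum_nat_add r, hhead, ← tsum_mul_right]
  refine add_le_add le_rfl (Summable.tsum_le_tsum (fun k => ?_) ((summable_nat_add_iff r).2 hs) (hWs.mul_right _))
  rw [pow_add, ← mul_assoc]
  gcongr

/-- A nonnegative function, multiplicative on coprime arguments, is summable if its Euler factors are close to `1`. -/
theorem summable_of_tsum_prime_pow_le {u : ℕ → ℝ} (hu0 : ∀ n, 0 ≤ u n) (hz : u 0 = 0) (hu1 : u 1 = 1)
    (humul : ∀ {m n : ℕ}, Nat.Coprime m n → u (m * n) = u m * u n)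
    (hs : ∀ {p : ℕ}, p.Prime → Summable fun k : ℕ => u (p ^ k)) {w : ℕ → ℝ} (hw0 : ∀ n, 0 ≤ w n) (hw : Summable w)
    (h : ∀ {p : ℕ}, p.Prime → ∑' k : ℕ, u (p ^ k) ≤ 1 + w p) : Summable u := by
  refine summable_of_sum_range_le (c := Real.exp (∑' n : ℕ, w n)) hu0 fun N => ?_
  -- Every positive n < N has only prime factors below N, so partial sums are at most finite Euler
  -- products, hence at most ∏ (1 + w p) ≤ exp(∑ w).
  obtain ⟨-, hh⟩ := EulerProduct.summable_and_hasSum_smoothNumbers_prod_primesBelow_tsum hu1 humul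
    (fun {p} hp => (hs hp).norm) N
  calc ∑ n ∈ Finset.range N, u n = ∑ n ∈ Finset.range N, (Nat.smoothNumbers N).indicator u n := by
        refine Finset.sum_congr rfl fun n hn => ?_
        rcases Nat.eq_zero_or_pos n with rfl | hn0
        · rw [Set.indicator_apply, hz, ite_self]
        · rw [Set.indicator_of_mem (Nat.mem_smoothNumbers_of_lt hn0 (Finset.mem_range.1 hn))]
    _ ≤ ∑' n : ℕ, (Nat.smoothNumbers N).indicator u n :=
        (summable_subtype_iff_indicator.1 hh.summable).sum_le_tsum _ fun n _ => Set.indicator_nonneg (fun n _ => hu0 n) n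
    _ = ∏ p ∈ N.primesBelow, ∑' k : ℕ, u (p ^ k) := by
        rw [← tsum_subtype]
        exact hh.tsum_eq
    _ ≤ ∏ p ∈ N.primesBelow, Real.exp (w p) := by
        refine Finset.prod_le_prod (fun p _ => tsum_nonneg fun k => hu0 _) fun p hp => ?_
        linarith [h (Nat.prime_of_mem_primesBelow hp), Real.add_one_le_exp (w p)]
    _ ≤ _ := by
        rw [← Real.exp_sum]
        exact Real.exp_le_exp.2 (hw.sum_le_tsum _ fun n _ => hw0 n)

/-- The Euler factor at p is 1 + O(p^{-rσ}), uniformly in p because p^{-σ} ≤ 2^{-σ} < 1. -/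
theorem summable_abs_ofEulerFactor_mul_rpow {f : PowerSeries ℝ} (hf : f.coeff 0 = 1) {r : ℕ} (hr : 1 ≤ r)
    (hfr : ∀ k, 0 < k → k < r → f.coeff k = 0) {K : ℝ} (hK : ∀ k : ℕ, |f.coeff k| ≤ K * ((k : ℝ) + 1) ^ 2)
    {σ : ℝ} (hσ : 0 < σ) (hrσ : 1 < r * σ) :
    Summable fun n : ℕ => |ofEulerFactor f n| * (n : ℝ) ^ (-σ) := by
  have hρ1 : (2 : ℝ) ^ (-σ) < 1 := Real.rpow_lt_one_of_one_lt_of_neg (by norm_num) (by linarith)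
  obtain ⟨W, hW0, hW⟩ := exists_tsum_abs_coeff_mul_pow_le hf hr hfr hK (ρ := (2 : ℝ) ^ (-σ)) (by positivity) hρ1
  have hupow : ∀ {p : ℕ}, p.Prime → ∀ k : ℕ, |ofEulerFactor f (p ^ k)| * ((p ^ k : ℕ) : ℝ) ^ (-σ) =
      |f.coeff k| * ((p : ℝ) ^ (-σ)) ^ k := by
    intro p hp k
    rw [ofEulerFactor_prime_pow hf hp, Nat.cast_pow, ← Real.rpow_natCast, ← Real.rpow_mul (Nat.cast_nonneg _),
      ← Real.rpow_natCast, ← Real.rpow_mul (Nat.cast_nonneg _), mul_comm (k : ℝ)]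
  have hprime : ∀ {p : ℕ}, p.Prime → (p : ℝ) ^ (-σ) ≤ (2 : ℝ) ^ (-σ) := fun {p} hp =>
    Real.rpow_le_rpow_of_nonpos (by norm_num) (by exact_mod_cast hp.two_le) (by linarith)
  refine summable_of_tsum_prime_pow_le (w := fun n => W * (n : ℝ) ^ (-(r * σ))) (fun n => by positivity) (by simp)
    (by simp [(isMultiplicative_ofEulerFactor f).map_one]) (fun {m n} hmn => ?_) (fun {p} hp => ?_)
    (fun n => by positivity) ((Real.summable_nat_rpow.2 (by linarith)).mul_left W) fun {p} hp => ?_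
  · rw [(isMultiplicative_ofEulerFactor f).map_mul_of_coprime hmn, abs_mul, Nat.cast_mul,
      Real.mul_rpow (Nat.cast_nonneg _) (Nat.cast_nonneg _)]
    ring
  · simp only [hupow hp]
    exact summable_abs_coeff_mul_pow hK (by positivity) ((hprime hp).trans_lt hρ1)
  · rw [tsum_congr (hupow hp)]
    have e : ((p : ℝ) ^ (-σ)) ^ r = (p : ℝ) ^ (-(r * σ)) := by
      rw [← Real.rpow_natCast, ← Real.rpow_mul (Nat.cast_nonneg _)]
      congr 1
      ring
    rw [← e]
    exact hW _ (by positivity) (hprime hp)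

/-! ### Euler factors in `X ^ 2`, and the convolution of `μ * μ` on squares with `1` -/

section

open PowerSeries

theorem exists_sq_eq_of_even_factorization {n : ℕ} (hn : n ≠ 0) (h : ∀ p, Even (n.factorization p)) : ∃ d, d ^ 2 = n := by
  refine ⟨n.factorization.prod fun p k => p ^ (k / 2), ?_⟩
  conv_rhs => rw [← Nat.prod_factorization_pow_eq_self hn]
  rw [Finsupp.prod, Finsupp.prod, ← Finset.prod_pow]
  refine Finset.prod_congr rfl fun p _ => ?_
  rw [← pow_mul, Nat.div_mul_cancel (h p).two_dvd]

theorem ofEulerFactor_sq {f g : ℝ⟦X⟧} (h : ∀ k, f.coeff (2 * k) = g.coeff k) (d : ℕ) :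
    ofEulerFactor f (d ^ 2) = ofEulerFactor g d := by
  rcases eq_or_ne d 0 with rfl | hd
  · simp
  · rw [ofEulerFactor_apply f (pow_ne_zero 2 hd), ofEulerFactor_apply g hd, Finsupp.prod, Finsupp.prod,
      Nat.support_factorization, Nat.support_factorization, Nat.primeFactors_pow d two_ne_zero]
    refine Finset.prod_congr rfl fun p _ => ?_
    rw [Nat.factorization_pow, Finsupp.smul_apply, smul_eq_mul, h]

theorem ofEulerFactor_eq_zero_of_not_sq {f : ℝ⟦X⟧} (h : ∀ k, Odd k → f.coeff k = 0) {n : ℕ} (hn : ∀ d, d ^ 2 ≠ n) :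
    ofEulerFactor f n = 0 := by
  rcases eq_or_ne n 0 with rfl | hn0
  · simp
  · by_contra hne
    rw [ofEulerFactor_apply f hn0, Finsupp.prod, ← ne_eq, Finset.prod_ne_zero_iff] at hne
    obtain ⟨d, hd⟩ := exists_sq_eq_of_even_factorization hn0 fun p => by
      by_contra hp
      have hp1 : Odd (n.factorization p) := Nat.not_even_iff_odd.1 hp
      refine hne p (Finsupp.mem_support_iff.2 fun h0 => ?_) (h _ hp1)
      rw [h0] at hp
      exact hp (by simp)
    exact hn d hd

/-- The hypotheses say f(X) = g(X^2): the function attached to f lives on the squares, where it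
copies that of g. -/
theorem tsum_ofEulerFactor_mul {f g : ℝ⟦X⟧} (h : ∀ k, f.coeff (2 * k) = g.coeff k) (h' : ∀ k, Odd k → f.coeff k = 0)
    (w : ℕ → ℝ) : ∑' n : ℕ, ofEulerFactor f n * w n = ∑' d : ℕ, ofEulerFactor g d * w (d ^ 2) := by
  rw [← Function.Injective.tsum_eq (Nat.pow_left_injective two_ne_zero) (f := fun n => ofEulerFactor f n * w n)]
  · exact tsum_congr fun d => by rw [ofEulerFactor_sq h]
  · intro n hn
    by_contra hr
    refine hn ?_
    simp only
    rw [ofEulerFactor_eq_zero_of_not_sq h' fun d hd => hr ⟨d, hd⟩, zero_mul]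

theorem realMoebiusSq_eq_ofEulerFactor : realMoebiusSq = ofEulerFactor ((1 - X) * (1 - X)) := by
  have h0 : (1 - X : ℝ⟦X⟧).coeff 0 = 1 := by simp
  have h : ofEulerFactor (1 - X) = ((ArithmeticFunction.moebius : ArithmeticFunction ℤ) : ArithmeticFunction ℝ) := by
    refine ofEulerFactor_eq_of_prime_pow h0 ArithmeticFunction.isMultiplicative_moebius.intCast fun p k hp => ?_
    rw [ArithmeticFunction.intCoe_apply, map_sub, coeff_one, coeff_X]
    rcases eq_or_ne k 0 with rfl | hk
    · simp
    · rw [ArithmeticFunction.moebius_apply_prime_pow hp hk, if_neg hk]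
      split_ifs <;> simp
  rw [ofEulerFactor_mul h0 h0, h, realMoebiusSq, ArithmeticFunction.intCoe_mul]

theorem ofEulerFactor_mk_one : ofEulerFactor (mk 1) = ((ArithmeticFunction.zeta : ArithmeticFunction ℕ) : ArithmeticFunction ℝ) := by
  refine ofEulerFactor_eq_of_prime_pow (by simp) ArithmeticFunction.isMultiplicative_zeta.natCast fun p k hp => ?_
  rw [ArithmeticFunction.natCoe_apply, ArithmeticFunction.zeta_apply_ne (pow_ne_zero _ hp.ne_zero)]
  simp

theorem coeff_one_sub_X_sq_sq (k : ℕ) : ((1 - X ^ 2) * (1 - X ^ 2) : ℝ⟦X⟧).coeff k =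
    (if k = 0 then 1 else 0) - 2 * (if k = 2 then 1 else 0) + if k = 4 then 1 else 0 := by
  have e : ((1 - X ^ 2) * (1 - X ^ 2) : ℝ⟦X⟧) = 1 - (X ^ 2 + X ^ 2) + X ^ 4 := by ring
  rw [e, map_add, map_sub, map_add, coeff_one, coeff_X_pow, coeff_X_pow]
  ring

theorem coeff_one_sub_X_sq (k : ℕ) : ((1 - X) * (1 - X) : ℝ⟦X⟧).coeff k =
    (if k = 0 then 1 else 0) - 2 * (if k = 1 then 1 else 0) + if k = 2 then 1 else 0 := by
  have e : ((1 - X) * (1 - X) : ℝ⟦X⟧) = 1 - (X ^ 1 + X ^ 1) + X ^ 2 := by ring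
  rw [e, map_add, map_sub, map_add, coeff_one, coeff_X_pow, coeff_X_pow]
  ring

theorem tsum_ofEulerFactor_one_sub_X_sq_mul (w : ℕ → ℝ) :
    ∑' n : ℕ, ofEulerFactor ((1 - X ^ 2) * (1 - X ^ 2)) n * w n = ∑' d : ℕ, realMoebiusSq d * w (d ^ 2) := by
  rw [realMoebiusSq_eq_ofEulerFactor]
  refine tsum_ofEulerFactor_mul (fun k => ?_) (fun k hk => ?_) w
  · rw [coeff_one_sub_X_sq_sq, coeff_one_sub_X_sq]
    simp only [show 2 * k = 0 ↔ k = 0 by omega, show 2 * k = 2 ↔ k = 1 by omega, show 2 * k = 4 ↔ k = 2 by omega]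
  · rw [coeff_one_sub_X_sq_sq, if_neg, if_neg, if_neg]
    · simp
    all_goals
      rintro rfl
      revert hk
      decide

theorem sum_Ioc_ofEulerFactor_mul_zeta (u : ℝ) :
    ∑ n ∈ Finset.Ioc 0 ⌊u⌋₊, (ofEulerFactor ((1 - X ^ 2) * (1 - X ^ 2)) *
      ((ArithmeticFunction.zeta : ArithmeticFunction ℕ) : ArithmeticFunction ℝ)) n =
    ∑' d : ℕ, realMoebiusSq d * (⌊u / (d : ℝ) ^ 2⌋₊ : ℝ) := by
  have e := tsum_ofEulerFactor_one_sub_X_sq_mul fun n => (⌊u / (n : ℝ)⌋₊ : ℝ)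
  simp only [Nat.cast_pow] at e
  rw [ArithmeticFunction.sum_Ioc_mul_zeta_eq_sum, ← e, tsum_eq_sum (s := Finset.Ioc 0 ⌊u⌋₊)]
  · exact Finset.sum_congr rfl fun n _ => by rw [Nat.floor_div_natCast]
  · intro n hn
    rcases Nat.eq_zero_or_pos n with rfl | hn0
    · simp
    · have h : ⌊u⌋₊ < n := by
        by_contra h
        exact hn (Finset.mem_Ioc.2 ⟨hn0, by omega⟩)
      rw [Nat.floor_div_natCast, Nat.div_eq_of_lt h, Nat.cast_zero, mul_zero]

/-- This is the multiplicativity of Dirichlet series at s = 1, obtained from the complex L-series.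
-/
theorem tsum_mul_div_eq {f g : ArithmeticFunction ℝ} (hf : Summable fun n : ℕ => f n / n)
    (hg : Summable fun n : ℕ => g n / n) :
    ∑' n : ℕ, (f * g) n / (n : ℝ) = (∑' n : ℕ, f n / (n : ℝ)) * ∑' n : ℕ, g n / (n : ℝ) := by
  have hterm : ∀ (F : ArithmeticFunction ℝ) (n : ℕ), LSeries.term (fun n => (F n : ℂ)) 1 n = ((F n / n : ℝ) : ℂ) := by
    intro F n
    rcases eq_or_ne n 0 with rfl | hn
    · simp
    · rw [LSeries.term_of_ne_zero hn, Complex.cpow_one]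
      push_cast
      rfl
  have hsum : ∀ F : ArithmeticFunction ℝ, (Summable fun n : ℕ => F n / (n : ℝ)) →
      LSeriesHasSum (fun n => (F n : ℂ)) 1 ((∑' n : ℕ, F n / (n : ℝ) : ℝ) : ℂ) := by
    intro F hF
    rw [LSeriesHasSum, funext (hterm F)]
    exact Complex.hasSum_ofReal.2 hF.hasSum
  have h := (hsum f hf).convolution (hsum g hg)
  have e : LSeries.convolution (fun n => (f n : ℂ)) (fun n => (g n : ℂ)) = fun n => ((f * g) n : ℂ) := by
    rw [LSeries.convolution_def]
    funext n
    rw [ArithmeticFunction.mul_apply]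
    push_cast
    rfl
  rw [e, LSeriesHasSum, funext (hterm (f * g)), ← Complex.ofReal_mul, Complex.hasSum_ofReal] at h
  exact h.tsum_eq

theorem abs_coeff_mul_le {f g : ℝ⟦X⟧} {K : ℝ} {i : ℕ} (hf : ∀ k : ℕ, |f.coeff k| ≤ K * ((k : ℝ) + 1) ^ i)
    (hg : ∀ k, |g.coeff k| ≤ 1) (k : ℕ) : |(f * g).coeff k| ≤ K * ((k : ℝ) + 1) ^ (i + 1) := by
  have hK : 0 ≤ K := by
    have := (abs_nonneg _).trans (hf 0)
    simpa using this
  rw [coeff_mul, Finset.Nat.sum_antidiagonal_eq_sum_range_succ_mk]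
  refine (Finset.abs_sum_le_sum_abs _ _).trans ?_
  calc _ ≤ ∑ j ∈ Finset.range k.succ, K * ((k : ℝ) + 1) ^ i := by
        refine Finset.sum_le_sum fun j hj => ?_
        have hjk : (j : ℝ) ≤ k := by exact_mod_cast Nat.lt_succ_iff.1 (Finset.mem_range.1 hj)
        rw [abs_mul]
        calc _ ≤ K * ((j : ℝ) + 1) ^ i * 1 := by
              gcongr
              · exact hf j
              · exact hg _
          _ ≤ _ := by
              rw [mul_one]
              gcongr
    _ = _ := by
        rw [Finset.sum_const, Finset.card_range, nsmul_eq_mul]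
        push_cast
        ring

/-- The series `1 + X ^ 2 + X ^ 4 + ⋯`. -/
noncomputable def evenSeries : ℝ⟦X⟧ := mk fun k => if Even k then 1 else 0

theorem one_sub_X_sq_mul_evenSeries : (1 - X ^ 2) * evenSeries = 1 := by
  ext k
  rw [sub_mul, one_mul, map_sub, coeff_X_pow_mul', coeff_one, evenSeries, coeff_mk, coeff_mk]
  rcases k with _ | _ | k
  · simp
  · simp
  · simp [Nat.even_add]

theorem abs_coeff_evenSeries_le (k : ℕ) : |evenSeries.coeff k| ≤ 1 := by
  rw [evenSeries, coeff_mk]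
  split_ifs <;> simp

end

/-! ### Extraction of `(1 - X ^ 2) ^ 2` and the Euler product of the mean value -/

section

open PowerSeries

theorem coeff_mul_one_sub_X (φ : ℝ⟦X⟧) (k : ℕ) :
    (φ * (1 - X)).coeff (k + 1) = φ.coeff (k + 1) - φ.coeff k := by
  rw [mul_sub, mul_one, map_sub, coeff_succ_mul_X]

theorem coeff_zero_mul_one_sub_X (φ : ℝ⟦X⟧) : (φ * (1 - X)).coeff 0 = φ.coeff 0 := by
  rw [mul_sub, mul_one, map_sub, coeff_zero_mul_X, sub_zero]

theorem abs_coeff_mul_one_sub_X_le {φ : ℝ⟦X⟧} (hφ : ∀ k, |φ.coeff k| ≤ 1) (k : ℕ) : |(φ * (1 - X)).coeff k| ≤ 2 := by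
  rcases k with _ | k
  · rw [coeff_zero_mul_one_sub_X]
    linarith [hφ 0]
  · rw [coeff_mul_one_sub_X]
    exact (abs_sub _ _).trans (by linarith [hφ (k + 1), hφ k])

/-- If `φ = 1 + X - X ^ 2 - X ^ 3 + ⋯`, then `φ * (1 - X) = (1 - X ^ 2) ^ 2 * γ` with `γ = 1 + O(X ^ 4)`. -/
theorem exists_eq_one_sub_X_sq_mul {φ : ℝ⟦X⟧} (h0 : φ.coeff 0 = 1) (h1 : φ.coeff 1 = 1) (h2 : φ.coeff 2 = -1)
    (h3 : φ.coeff 3 = -1) (hφ : ∀ k, |φ.coeff k| ≤ 1) :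
    ∃ γ : ℝ⟦X⟧, φ * (1 - X) = γ * ((1 - X ^ 2) * (1 - X ^ 2)) ∧ γ.coeff 0 = 1 ∧
      (∀ k, 0 < k → k < 4 → γ.coeff k = 0) ∧ ∀ k : ℕ, |γ.coeff k| ≤ 2 * ((k : ℝ) + 1) ^ 2 := by
  set η := φ * (1 - X) with hη
  have e : η = η * evenSeries * evenSeries * ((1 - X ^ 2) * (1 - X ^ 2)) := by
    calc η = η * ((1 - X ^ 2) * evenSeries) * ((1 - X ^ 2) * evenSeries) := by
          rw [one_sub_X_sq_mul_evenSeries, mul_one, mul_one]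
      _ = _ := by ring
  refine ⟨η * evenSeries * evenSeries, e, ?_⟩
  -- Division by (1 - X^2)^2 is multiplication, twice, by a series with coefficients 0 and 1; each
  -- time the growth of the coefficients rises by one power of k + 1.
  have hb := abs_coeff_mul_le (abs_coeff_mul_le (K := 2) (i := 0)
    (fun k => by simpa using abs_coeff_mul_one_sub_X_le hφ k) abs_coeff_evenSeries_le) abs_coeff_evenSeries_le
  set γ := η * evenSeries * evenSeries
  have hrec : γ = η + (X ^ 2 * γ + X ^ 2 * γ) - X ^ 4 * γ := by
    conv_rhs => rw [e]
    ring
  -- Below degree 4 the recursion reads γ_k = η_k + 2 γ_{k-2}, and η = 1 - 2 X^2 + O(X^4) makes γ_1,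
  -- γ_2, γ_3 vanish.
  have hcoeff : ∀ k, k < 4 → γ.coeff k = η.coeff k + 2 * if 2 ≤ k then γ.coeff (k - 2) else 0 := by
    intro k hk
    conv_lhs => rw [hrec]
    rw [map_sub, map_add, map_add, coeff_X_pow_mul', coeff_X_pow_mul', if_neg (show ¬4 ≤ k by omega)]
    ring
  have hη0 : η.coeff 0 = 1 := by rw [hη, coeff_zero_mul_one_sub_X, h0]
  have hη1 : η.coeff 1 = 0 := by rw [hη, coeff_mul_one_sub_X, h0, h1, sub_self]
  have hη2 : η.coeff 2 = -2 := by
    rw [hη, coeff_mul_one_sub_X, h1, h2]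
    norm_num
  have hη3 : η.coeff 3 = 0 := by
    rw [hη, coeff_mul_one_sub_X, h2, h3, sub_self]
  have hγ0 : γ.coeff 0 = 1 := by
    rw [hcoeff 0 (by norm_num), hη0]
    norm_num
  have hγ1 : γ.coeff 1 = 0 := by
    rw [hcoeff 1 (by norm_num), hη1]
    norm_num
  refine ⟨hγ0, fun k hk hk4 => ?_, hb⟩
  interval_cases k
  · exact hγ1
  · rw [hcoeff 2 (by norm_num), hη2, if_pos le_rfl, Nat.sub_self, hγ0]
    norm_num
  · rw [hcoeff 3 (by norm_num), hη3, if_pos (by norm_num), hγ1]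
    norm_num

theorem ofEulerFactor_eq_mul {φ γ : ℝ⟦X⟧} (h0 : γ.coeff 0 = 1)
    (h : φ * (1 - X) = γ * ((1 - X ^ 2) * (1 - X ^ 2))) :
    ofEulerFactor φ = ofEulerFactor γ * (ofEulerFactor ((1 - X ^ 2) * (1 - X ^ 2)) *
      ((ArithmeticFunction.zeta : ArithmeticFunction ℕ) : ArithmeticFunction ℝ)) := by
  have hM : ((1 - X ^ 2) * (1 - X ^ 2) : ℝ⟦X⟧).coeff 0 = 1 := by
    rw [coeff_one_sub_X_sq_sq]
    norm_num
  have hZ : (mk 1 : ℝ⟦X⟧).coeff 0 = 1 := by simp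
  have hMZ : ((1 - X ^ 2) * (1 - X ^ 2) * mk 1 : ℝ⟦X⟧).coeff 0 = 1 := by
    rw [coeff_zero_eq_constantCoeff_apply] at hM hZ ⊢
    rw [map_mul, hM, hZ, one_mul]
  rw [← ofEulerFactor_mk_one, ← ofEulerFactor_mul hM hZ, ← ofEulerFactor_mul h0 hMZ, ← mul_assoc, ← h, mul_assoc,
    mul_comm (1 - X), mk_one_mul_one_sub_eq_one, mul_one]

theorem summable_coeff_sub_div_pow {φ : ℝ⟦X⟧} (hφ : ∀ k, |φ.coeff k| ≤ 1) {p : ℕ} (hp : p.Prime) :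
    Summable fun n : ℕ => (φ.coeff (n + 2) - φ.coeff (n + 1)) / (p : ℝ) ^ (n + 2) := by
  have hp2 : (2 : ℝ) ≤ p := by exact_mod_cast hp.two_le
  have hg : Summable fun n : ℕ => 2 * ((p : ℝ)⁻¹) ^ (n + 2) :=
    ((summable_nat_add_iff 2).2 (summable_geometric_of_lt_one (by positivity)
      (inv_lt_one_of_one_lt₀ (by linarith)))).mul_left 2
  refine Summable.of_norm_bounded hg fun n => ?_
  rw [← coeff_mul_one_sub_X, norm_div, norm_pow, Real.norm_natCast, inv_pow, ← div_eq_mul_inv, Real.norm_eq_abs]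
  gcongr
  exact abs_coeff_mul_one_sub_X_le hφ _

/-- Multiplying by 1 - X removes the term in X, since φ starts with 1 + X; the Dirichlet series of
the product therefore converges absolutely at s = 1 and equals its Euler product. -/
theorem hasProd_one_add_tsum_coeff_sub {φ : ℝ⟦X⟧} (h0 : φ.coeff 0 = 1) (h1 : φ.coeff 1 = 1)
    (hφ : ∀ k, |φ.coeff k| ≤ 1) :
    HasProd (fun p : Nat.Primes => 1 + ∑' n : ℕ, (φ.coeff (n + 2) - φ.coeff (n + 1)) / (p : ℝ) ^ (n + 2))
      (∑' n : ℕ, ofEulerFactor (φ * (1 - X)) n / (n : ℝ)) := by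
  have hη0 : (φ * (1 - X)).coeff 0 = 1 := by rw [coeff_zero_mul_one_sub_X, h0]
  have hη1 : (φ * (1 - X)).coeff 1 = 0 := by rw [coeff_mul_one_sub_X, h0, h1, sub_self]
  have hs := summable_abs_ofEulerFactor_mul_rpow hη0 (r := 2) (K := 2) (σ := 1) (by norm_num)
    (fun k hk hk2 => by
      obtain rfl : k = 1 := by omega
      exact hη1)
    (fun k => (abs_coeff_mul_one_sub_X_le hφ k).trans (by nlinarith [Nat.cast_nonneg (α := ℝ) k]))
    (by norm_num) (by norm_num)
  have hmul := isMultiplicative_ofEulerFactor (φ * (1 - X))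
  have h := EulerProduct.eulerProduct_hasProd (f := fun n : ℕ => ofEulerFactor (φ * (1 - X)) n / (n : ℝ))
    (by simp [hmul.map_one])
    (fun {m n} hmn => by
      rw [hmul.map_mul_of_coprime hmn, Nat.cast_mul, mul_div_mul_comm])
    (hs.congr fun n => by
      rw [Real.rpow_neg_one, norm_div, Real.norm_natCast, div_eq_mul_inv, Real.norm_eq_abs])
    (by simp)
  refine h.congr_fun fun p => ?_
  have e : ∀ k : ℕ, ofEulerFactor (φ * (1 - X)) ((p : ℕ) ^ k) / (((p : ℕ) ^ k : ℕ) : ℝ) =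
      (φ * (1 - X)).coeff k / (p : ℝ) ^ k := fun k => by
    rw [ofEulerFactor_prime_pow hη0 p.2, Nat.cast_pow]
  have hsp : Summable fun k : ℕ => (φ * (1 - X)).coeff k / (p : ℝ) ^ k := by
    rw [← summable_nat_add_iff 2]
    refine (summable_coeff_sub_div_pow hφ p.2).congr fun n => ?_
    rw [coeff_mul_one_sub_X]
  rw [tsum_congr e, ← hsp.sum_add_tsum_nat_add 2, Finset.sum_range_succ, Finset.sum_range_one, hη0, hη1, pow_zero,
    zero_div, add_zero, div_one]
  simp only [coeff_mul_one_sub_X]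

end

/-! ### Assembly -/

section

open PowerSeries

/-- The summatory function is ∑ g(m) S(x/m), where S(u) = A u + O(u^{7/22+ε}) for all u > 0. The
errors add up because ∑ |g(m)| m^{-(7/22+ε)} converges: γ = 1 + O(X^4) and 4·7/22 > 1. Extending the
sum to all m is free, as S(u) = 0 for u < 1. -/
theorem RiemannHypothesis.exists_abs_sum_ofEulerFactor_sub_le (hRH : RiemannHypothesis) {φ : ℝ⟦X⟧}
    (h0 : φ.coeff 0 = 1) (h1 : φ.coeff 1 = 1) (h2 : φ.coeff 2 = -1) (h3 : φ.coeff 3 = -1) (hφ : ∀ k, |φ.coeff k| ≤ 1)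
    {ε : ℝ} (hε : 0 < ε) (hε1 : ε ≤ 1 / 2) :
    ∃ C : ℝ, ∀ x : ℝ, 0 < x →
      |∑ n ∈ Finset.Ioc 0 ⌊x⌋₊, ofEulerFactor φ n -
        (∏' p : Nat.Primes, (1 + ∑' n : ℕ, (φ.coeff (n + 2) - φ.coeff (n + 1)) / (p : ℝ) ^ (n + 2))) * x| ≤
        C * x ^ (7 / 22 + ε) := by
  obtain ⟨γ, hγ, hγ0, hγ4, hγb⟩ := exists_eq_one_sub_X_sq_mul h0 h1 h2 h3 hφ
  obtain ⟨C, hC, hS⟩ := hRH.exists_abs_sum_floor_sub_le hε hε1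
  set A := ∑' d : ℕ, realMoebiusSq d / (d : ℝ) ^ 2 with hA
  set S : ℝ → ℝ := fun u => ∑' d : ℕ, realMoebiusSq d * (⌊u / (d : ℝ) ^ 2⌋₊ : ℝ) with hSdef
  set M := ofEulerFactor ((1 - X ^ 2) * (1 - X ^ 2)) with hM
  set g := ofEulerFactor γ with hg
  have hM0 : ((1 - X ^ 2) * (1 - X ^ 2) : ℝ⟦X⟧).coeff 0 = 1 := by
    rw [coeff_one_sub_X_sq_sq]
    norm_num
  have hgθ : Summable fun m : ℕ => |g m| * (m : ℝ) ^ (-(7 / 22 + ε)) :=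
    summable_abs_ofEulerFactor_mul_rpow hγ0 (r := 4) (by norm_num) hγ4 hγb (by linarith)
      (by push_cast; linarith)
  have hg1 : Summable fun m : ℕ => g m / (m : ℝ) := by
    refine Summable.of_norm_bounded (summable_abs_ofEulerFactor_mul_rpow hγ0 (r := 4) (σ := 1) (by norm_num) hγ4 hγb
      (by norm_num) (by norm_num)) fun m => ?_
    rw [Real.rpow_neg_one, norm_div, Real.norm_natCast, div_eq_mul_inv, Real.norm_eq_abs]
  have hMA : ∑' n : ℕ, M n / (n : ℝ) = A := by
    have := tsum_ofEulerFactor_one_sub_X_sq_mul fun n => ((n : ℝ))⁻¹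
    simpa only [Nat.cast_pow, ← div_eq_mul_inv] using this
  have hM1 : Summable fun n : ℕ => M n / (n : ℝ) := by
    refine Summable.of_norm_bounded (summable_abs_ofEulerFactor_mul_rpow hM0 (r := 2) (K := 2) (σ := 1) (by norm_num)
      (fun k hk hk2 => ?_) (fun k => ?_) (by norm_num) (by norm_num)) fun m => ?_
    · obtain rfl : k = 1 := by omega
      rw [coeff_one_sub_X_sq_sq]
      norm_num
    · have hk : |((1 - X ^ 2) * (1 - X ^ 2) : ℝ⟦X⟧).coeff k| ≤ 2 := by
        rw [coeff_one_sub_X_sq_sq]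
        split_ifs <;> first | omega | norm_num
      exact hk.trans (by nlinarith [Nat.cast_nonneg (α := ℝ) k])
    · rw [Real.rpow_neg_one, norm_div, Real.norm_natCast, div_eq_mul_inv, Real.norm_eq_abs]
  have hmean : ∏' p : Nat.Primes, (1 + ∑' n : ℕ, (φ.coeff (n + 2) - φ.coeff (n + 1)) / (p : ℝ) ^ (n + 2)) =
      (∑' m : ℕ, g m / (m : ℝ)) * A := by
    rw [(hasProd_one_add_tsum_coeff_sub h0 h1 hφ).tprod_eq, hγ, ofEulerFactor_mul hγ0 hM0, tsum_mul_div_eq hg1 hM1,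
      hMA]
  refine ⟨C * ∑' m : ℕ, |g m| * (m : ℝ) ^ (-(7 / 22 + ε)), fun x hx => ?_⟩
  have hsum : ∑ n ∈ Finset.Ioc 0 ⌊x⌋₊, ofEulerFactor φ n = ∑ m ∈ Finset.Ioc 0 ⌊x⌋₊, g m * S (x / m) := by
    rw [ofEulerFactor_eq_mul hγ0 hγ, ArithmeticFunction.sum_Ioc_mul_eq_sum_sum]
    refine Finset.sum_congr rfl fun m _ => ?_
    rw [← Nat.floor_div_natCast, sum_Ioc_ofEulerFactor_mul_zeta]
  have hzero : ∀ m ∉ Finset.Ioc 0 ⌊x⌋₊, g m * S (x / m) = 0 := by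
    intro m hm
    rcases Nat.eq_zero_or_pos m with rfl | hm0
    · simp
    · have h : ⌊x⌋₊ < m := by
        by_contra h
        exact hm (Finset.mem_Ioc.2 ⟨hm0, by omega⟩)
      rw [hSdef]
      simp only
      rw [← sum_Ioc_ofEulerFactor_mul_zeta, Nat.floor_div_natCast, Nat.div_eq_of_lt h, Finset.Ioc_self,
        Finset.sum_empty, mul_zero]
  have hsS : Summable fun m : ℕ => g m * S (x / m) := summable_of_ne_finset_zero hzero
  have hsA : Summable fun m : ℕ => g m / (m : ℝ) * (A * x) := hg1.mul_right _
  rw [hsum, hmean, ← tsum_eq_sum (L := .unconditional ℕ) hzero, mul_assoc, ← tsum_mul_right, ← hsS.tsum_sub hsA, ← Real.norm_eq_abs]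
  have e : C * (∑' m : ℕ, |g m| * (m : ℝ) ^ (-(7 / 22 + ε))) * x ^ (7 / 22 + ε) =
      ∑' m : ℕ, |g m| * (m : ℝ) ^ (-(7 / 22 + ε)) * (C * x ^ (7 / 22 + ε)) := by
    rw [tsum_mul_right]
    ring
  rw [e]
  refine tsum_of_norm_bounded (hgθ.mul_right _).hasSum fun m => ?_
  rcases Nat.eq_zero_or_pos m with rfl | hm
  · simp
  · have hm0 : (0 : ℝ) < m := by exact_mod_cast hm
    have e2 : g m * S (x / m) - g m / m * (A * x) = g m * (S (x / m) - A * (x / m)) := by ring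
    rw [e2, norm_mul, Real.norm_eq_abs, Real.norm_eq_abs]
    calc _ ≤ |g m| * (C * (x / m) ^ (7 / 22 + ε)) := by
          gcongr
          exact hS _ (by positivity)
      _ = _ := by
          rw [Real.div_rpow hx.le hm0.le, Real.rpow_neg hm0.le]
          ring

/-- The mean value, under the Riemann hypothesis, of the multiplicative function with value `v k` at every `p ^ k`,
when `v` is bounded by `1` and starts with `1, -1, -1`. -/
theorem RiemannHypothesis.isBigO_sum_prod_factorization_sub (hRH : RiemannHypothesis) {v : ℕ → ℤ} (h1 : v 1 = 1)
    (h2 : v 2 = -1) (h3 : v 3 = -1) (hv : ∀ k, |v k| ≤ 1) :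
    (∀ p : Nat.Primes, Summable fun n : ℕ => ((v (n + 2) : ℝ) - v (n + 1)) / (p : ℝ) ^ (n + 2)) ∧
      Multipliable (fun p : Nat.Primes => 1 + ∑' n : ℕ, ((v (n + 2) : ℝ) - v (n + 1)) / (p : ℝ) ^ (n + 2)) ∧
      ∀ ε : ℝ, 0 < ε →
        (fun x : ℝ => ∑ n ∈ Finset.Icc 1 ⌊x⌋₊, ((∏ p ∈ n.primeFactors, v (n.factorization p) : ℤ) : ℝ) -
          (∏' p : Nat.Primes, (1 + ∑' n : ℕ, ((v (n + 2) : ℝ) - v (n + 1)) / (p : ℝ) ^ (n + 2))) * x)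
          =O[atTop] fun x : ℝ => x ^ (7 / 22 + ε : ℝ) := by
  -- The constant term has to be 1 for multiplicativity, whatever v 0 is; for the Möbius function, v
  -- 0 = 0.
  set φ : ℝ⟦X⟧ := mk fun k => if k = 0 then 1 else (v k : ℝ) with hφ
  have hcoeff : ∀ k, φ.coeff (k + 1) = v (k + 1) := fun k => by
    rw [hφ, coeff_mk, if_neg k.succ_ne_zero]
  have h0' : φ.coeff 0 = 1 := by rw [hφ, coeff_mk, if_pos rfl]
  have h1' : φ.coeff 1 = 1 := by rw [hcoeff, h1, Int.cast_one]
  have h2' : φ.coeff 2 = -1 := by rw [hcoeff, h2, Int.cast_neg, Int.cast_one]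
  have h3' : φ.coeff 3 = -1 := by rw [hcoeff, h3, Int.cast_neg, Int.cast_one]
  have hb : ∀ k, |φ.coeff k| ≤ 1 := by
    rintro (_ | k)
    · rw [h0', abs_one]
    · rw [hcoeff]
      exact_mod_cast hv (k + 1)
  simp only [← hcoeff]
  refine ⟨fun p => summable_coeff_sub_div_pow hb p.2, (hasProd_one_add_tsum_coeff_sub h0' h1' hb).multipliable,
    fun ε hε => ?_⟩
  -- Larger ε follow from ε = 1/2 by monotonicity of x^ε for x ≥ 1.
  obtain ⟨C, hC⟩ := hRH.exists_abs_sum_ofEulerFactor_sub_le h0' h1' h2' h3' hb (ε := min ε (1 / 2))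
    (by positivity) (min_le_right _ _)
  refine (IsBigO.of_bound C ?_).trans (g := fun x : ℝ => x ^ (7 / 22 + min ε (1 / 2))) ?_
  · filter_upwards [eventually_gt_atTop 0] with x hx
    have e : ∑ n ∈ Finset.Icc 1 ⌊x⌋₊, ((∏ p ∈ n.primeFactors, v (n.factorization p) : ℤ) : ℝ) =
        ∑ n ∈ Finset.Ioc 0 ⌊x⌋₊, ofEulerFactor φ n := by
      refine Finset.sum_congr rfl fun n hn => ?_
      have hn0 : n ≠ 0 := by
        have := (Finset.mem_Icc.1 hn).1
        omega
      rw [ofEulerFactor_apply φ hn0, Finsupp.prod, Nat.support_factorization, Int.cast_prod]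
      refine Finset.prod_congr rfl fun p hp => ?_
      rw [← Nat.support_factorization, Finsupp.mem_support_iff] at hp
      rw [hφ, coeff_mk, if_neg hp]
    rw [e, Real.norm_eq_abs, Real.norm_of_nonneg (by positivity)]
    exact hC x hx
  · refine IsBigO.of_bound 1 ?_
    filter_upwards [eventually_ge_atTop 1] with x hx
    rw [Real.norm_of_nonneg (by positivity), Real.norm_of_nonneg (by positivity), one_mul]
    exact Real.rpow_le_rpow_of_exponent_le hx (by linarith [min_le_left ε (1 / 2)])

end

theorem theorem6 (hRH : RiemannHypothesis) :
    ((∀ p : Nat.Primes, Summable (fun n : ℕ => expMoebiusTerm p n)) ∧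
      Multipliable (fun p : Nat.Primes => 1 + ∑' n : ℕ, expMoebiusTerm p n) ∧
      ∀ ε : ℝ, 0 < ε →
        expMoebiusError =O[atTop] (fun x : ℝ => x ^ (7 / 22 + ε : ℝ))) ∧
    ((∀ p : Nat.Primes, Summable (fun n : ℕ => eUnitaryMoebiusTerm p n)) ∧
      Multipliable (fun p : Nat.Primes => 1 + ∑' n : ℕ, eUnitaryMoebiusTerm p n) ∧
      ∀ ε : ℝ, 0 < ε →
        eUnitaryMoebiusError =O[atTop] (fun x : ℝ => x ^ (7 / 22 + ε : ℝ))) := by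
  constructor
  · exact hRH.isBigO_sum_prod_factorization_sub (v := fun k => ArithmeticFunction.moebius k) (by simp)
      (ArithmeticFunction.moebius_apply_prime Nat.prime_two) (ArithmeticFunction.moebius_apply_prime Nat.prime_three)
      fun k => ArithmeticFunction.abs_moebius_le_one
  · have h := hRH.isBigO_sum_prod_factorization_sub
      (v := fun k => (-1 : ℤ) ^ ArithmeticFunction.cardDistinctFactors k) (by simp)
      (by rw [ArithmeticFunction.cardDistinctFactors_apply_prime Nat.prime_two, pow_one])
      (by rw [ArithmeticFunction.cardDistinctFactors_apply_prime Nat.prime_three, pow_one])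
      fun k => by rw [abs_pow, abs_neg, abs_one, one_pow]
    push_cast at h
    unfold eUnitaryMoebiusError eUnitaryMoebiusMean eUnitaryMoebiusTerm eUnitaryMoebius
    push_cast
    exact h
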